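/- **Conventions.** Indices $A,B\in\{1,2\}$, $x\in\{1,2,3\}$, and $\alpha=(I,\dot I)$ with $I,\dot I=1,\dots,m$; $\epsilon_{12}=1=-\epsilon_{21}$, $\mathbb C_{I\dot J}=\delta_{IJ}=-\mathbb C_{\dot J I}$ (other components zero), $\mathbb C^{\alpha\beta}\mathbb C_{\beta\gamma}=-\delta^\alpha_\gamma$, $(\sigma_x)_A{}^B$ are the Pauli matrices, $(\sigma_x)^A{}_B=\epsilon^{AC}(\sigma_x)_C{}^D\epsilon_{DB}$ with $\epsilon^{12}=1$, and $(\sigma_x)_{AB}=\epsilon_{BC}(\sigma_x)_A{}^C$. A quaternionic structure on an open subset $D$ of a real vector space of dimension $4m$ consists of smooth 1-forms: complex $\mathcal U^{A\alpha}$ without common zero vector, with $(\mathcal U^{A\alpha})^*=\epsilon_{AB}\mathbb C_{\alpha\beta}\mathcal U^{B\beta}$ and metric $h=\mathcal U^{A\alpha}\mathcal U^{B\beta}\epsilon_{AB}\mathbb C_{\alpha\beta}$; an $SU(2)$-connection given by real $\omega^x$; and a connection $\Delta^\alpha{}_\beta$ with values in the compact $\mathfrak{sp}(2m)$; such that, with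 $\lambda=-1$ and a completely symmetric tensor $\Omega_{\alpha\beta\gamma\delta}$, $$d\mathcal U^{A\alpha}+\tfrac i2\omega^x(\sigma_x)^A{}_B\wedge\mathcal U^{B\alpha}+\Delta^\alpha{}_\beta\wedge\mathcal U^{A\beta}=0,\qquad d\omega^x+\tfrac12\epsilon^{xyz}\omega^y\wedge\omega^z=i\lambda\,\mathbb C_{\alpha\beta}(\sigma_x)_{AB}\,\mathcal U^{A\alpha}\wedge\mathcal U^{B\beta},$$ $$d\Delta^\alpha{}_\beta+\Delta^\alpha{}_\gamma\wedge\Delta^\gamma{}_\beta=\lambda\,\epsilon_{AB}\,\mathcal U^{A\alpha}\wedge\mathbb C_{\beta\gamma}\mathcal U^{B\gamma}+\epsilon_{AB}\,\mathcal U^{A\gamma}\wedge\mathcal U^{B\delta}\,\mathbb C^{\alpha\rho}\Omega_{\rho\beta\gamma\delta}.$$ ($\mathcal U$ determines $\omega$, $\Delta$ and $\Omega$.) An embedded submanifold $N\subset D$ of half the dimension, $\dim_{\mathbb R}N=2m$, is called a *consistent Kähler–Hodge reduction* if $\mathcal U^{2I}=\omega^1=\omega^2=\Delta^I{}_{\dot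 J}=0$ on $N$; the metric $g$ induced by $h$ is Kähler for the complex structure $J$ on $N$ for which the forms $\mathcal U^{2\dot I}|_N$ are of type $(1,0)$; and the curvature of the remaining $U(1)$-connection is $d(\omega^3|_N)=-2\,g(J\cdot,\cdot)$. **c-map manifolds.** Let $M\subset\mathbb C^n$ ($n\ge0$) be a coordinate patch of a special Kähler manifold: $M$ is open, $V=(X^\Lambda,F_\Lambda)_{\Lambda=0,\dots,n}$ is holomorphic on $M$, $\langle A,B\rangle=A^\Lambda B_\Lambda-A_\Lambda B^\Lambda$, $\langle V,\partial_iV\rangle=0$, $i(\bar X^\Lambda F_\Lambda-\bar F_\Lambda X^\Lambda)>0$, and, with $\mathcal K=-\log[i(\bar X^\Lambda F_\Lambda-\bar F_\Lambda X^\Lambda)]$, the metric $g_{i\bar\jmath}=\partial_i\partial_{\bar\jmath}\mathcal K$ is positive definite. Put $D_iV=\partial_iV+(\partial_i\mathcal K)V$ and let $e^a=P^a_i\,dz^i$ be any smooth unitary coframe, $g_{i\bar\jmath}=\sum_aP^a_i\overline{P^a_j}$. On $D=M\times\mathbb R_\phi\times\mathbb R_a\times\mathbb R^{2n+2}_\zeta$,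 $\zeta=(\zeta^\Lambda,\tilde\zeta_\Lambda)$, define $$v=-d\phi-\tfrac i2e^{2\phi}(da+\tilde\zeta_\Lambda d\zeta^\Lambda-\zeta^\Lambda d\tilde\zeta_\Lambda),\qquad u=i\,e^{\mathcal K/2+\phi}\langle V,d\zeta\rangle,\qquad \bar E^a=i\,e^{\mathcal K/2+\phi}(P^{-1})^i{}_a\langle D_iV,d\zeta\rangle ,$$ and let the vielbein of the c-map manifold ($m=n+1$) be $\mathcal U^{1I}=\tfrac1{\sqrt2}(-v,\bar e^a)$, $\mathcal U^{2I}=\tfrac1{\sqrt2}(u,\bar E^a)$, $\mathcal U^{1\dot I}=-\overline{\mathcal U^{2I}}$, $\mathcal U^{2\dot I}=\overline{\mathcal U^{1I}}$. Then its metric $h$ is the (frame independent) Ferrara–Sabharwal metric $$d\phi^2+\tfrac14e^{4\phi}(da+\tilde\zeta_\Lambda d\zeta^\Lambda-\zeta^\Lambda d\tilde\zeta_\Lambda)^2+g_{i\bar\jmath}dz^id\bar z^{\bar\jmath}+e^{\mathcal K+2\phi}\big(|\langle V,d\zeta\rangle|^2+g^{i\bar\jmath}\langle D_iV,d\zeta\rangle\overline{\langle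 D_jV,d\zeta\rangle}\big),$$ there are $\omega,\Delta,\Omega$ which with $\mathcal U$ form a quaternionic structure on $D$, and $$\Omega_{\dot I\dot JK\dot L}=0\quad\text{on all of } D .$$ Moreover, for every $\zeta_0$ the submanifold $\{\zeta=\zeta_0\}\subset D$ is a consistent Kähler–Hodge reduction; in particular one passes through each point of $D$. No symmetry of $M$ or $D$ is assumed. **Symmetric examples.** Let $n=n_1+n_2$ with $n_1,n_2\ge0$. Describe $SO(p,q)/SO(p)\times SO(q)$ by the global coordinates $x\in\mathbb R^{q\times p}$, with coset representative $L(x)=\exp\begin{pmatrix}0&x^T\\x&0\end{pmatrix}$, coset vielbein $p_{ia}$ (the lower left block of $L^{-1}dL$) and invariant metric $\tfrac12\sum_{i,a}p_{ia}^2$. On $SO(4,n)/SO(4)\times SO(n)$ put $Z_{1,i}=\tfrac12(p_{i1}+ip_{i2})$, $Z_{2,i}=\tfrac12(p_{i3}+ip_{i4})$, and ($m=n$) $(\mathcal U^{1I},\mathcal U^{2I})=(Z_{1,I},Z_{2,I})$ for $I\le n_1$ and $(-\bar Z_{2,I},\bar Z_{1,I})$ for $I>n_1$, with dotted components as above. Then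 $h$ is the invariant metric, there are $\omega,\Delta,\Omega$ which with $\mathcal U$ form a quaternionic structure, $\Omega_{\dot I\dot JK\dot L}=0$ everywhere, and the submanifold $$\frac{SO(2,n_1)}{SO(2)\times SO(n_1)}\times\frac{SO(2,n_2)}{SO(2)\times SO(n_2)}\ \subset\ \frac{SO(4,n)}{SO(4)\times SO(n)}$$ of block-diagonal matrices $x$ is a consistent Kähler–Hodge reduction, whose induced metric is the product of the invariant metrics of the two factors. -/

import Mathlib

open scoped ContDiff ComplexOrder

noncomputable section

namespace CMap

/-! ## Differential forms on a real vector space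

A `G`-valued 1-form on (an open subset of) a real normed space `E` is a map `E → E →L[ℝ] G`. -/

section Forms

variable {E F G : Type*} [NormedAddCommGroup E] [NormedSpace ℝ E]
  [NormedAddCommGroup F] [NormedSpace ℝ F] [NormedAddCommGroup G] [NormedSpace ℝ G]

/-- Exterior derivative of a 1-form: `(dθ)_q(X, Y) = (D_X θ)(Y) - (D_Y θ)(X)`. -/
def extD (θ : E → E →L[ℝ] G) (q : E) (X Y : E) : G :=
  fderiv ℝ θ q X Y - fderiv ℝ θ q Y X

/-- Wedge product of two complex covectors: `(a ∧ b)(X, Y) = a(X) b(Y) - a(Y) b(X)`. -/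
def wedge (a b : E → ℂ) (X Y : E) : ℂ := a X * b Y - a Y * b X

/-- Complex conjugate of a complex-valued 1-form. -/
def conjForm (θ : E → E →L[ℝ] ℂ) (q : E) : E →L[ℝ] ℂ :=
  (Complex.conjCLE : ℂ →L[ℝ] ℂ).comp (θ q)

/-- Pull-back of a 1-form along a map `j`. -/
def pull (θ : E → E →L[ℝ] G) (j : F → E) (y : F) : F →L[ℝ] G :=
  (θ (j y)).comp (fderiv ℝ j y)

end Forms

/-! ## Invariant tensors

`SU(2)` indices `A, B` run over `Fin 2`; the usual values `1, 2` become `0, 1`.  The `Sp(2m)` index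
`α` is split as `α → (I, İ)` and runs over `ι ⊕ ι`, `ι` a finite type with `m` elements:
`Sum.inl I` is the undotted index `I`, `Sum.inr I` is the dotted index `İ`.  The index `x` of the
adjoint representation of `SU(2)` runs over `Fin 3`. -/

/-- `ε_{AB}`, with `ε_{12} = 1`. -/
def eps : Matrix (Fin 2) (Fin 2) ℂ := !![0, 1; -1, 0]

/-- The standard Pauli matrices `(σ_x)_A^B` (row `A`, column `B`). -/
def pauli : Fin 3 → Matrix (Fin 2) (Fin 2) ℂ
  | 0 => !![0, 1; 1, 0]
  | 1 => !![0, -Complex.I; Complex.I, 0]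
  | 2 => !![1, 0; 0, -1]

/-- `(σ_x)^A_B = ε^{AC} (σ_x)_C^D ε_{DB}`, where `ε^{12} = ε_{12} = 1`. -/
def pauliUp (x : Fin 3) (A B : Fin 2) : ℂ := ∑ C, ∑ D, eps A C * pauli x C D * eps D B

/-- `(σ_x)_{AB} = ε_{BC} (σ_x)_A^C`. -/
def pauliLow (x : Fin 3) (A B : Fin 2) : ℂ := ∑ C, eps B C * pauli x A C

/-- The totally antisymmetric symbol `ε^{xyz}`, with `ε^{123} = 1`. -/
def levi (x y z : Fin 3) : ℂ :=
  ((x.val : ℂ) - y.val) * ((y.val : ℂ) - z.val) * ((z.val : ℂ) - x.val) / 2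

/-- The flat symplectic metric `C_{αβ}`: `C_{I J̇} = δ_{IJ} = - C_{J̇ I}`, other components zero.
The tensor `C^{αβ}` defined by `C^{αβ} C_{βγ} = - δ^α_γ` has the same components. -/
def symC {ι : Type*} [DecidableEq ι] : ι ⊕ ι → ι ⊕ ι → ℂ
  | Sum.inl I, Sum.inr J => if I = J then 1 else 0
  | Sum.inr I, Sum.inl J => if I = J then -1 else 0
  | _, _ => 0

/-- The scale `Ω^x = lam * K^x` of the quaternionic geometry, fixed by supersymmetry. -/
def lam : ℂ := -1

/-! ## Quaternionic geometry in a moving frame -/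

section Quaternionic

variable {E F ι : Type*} [NormedAddCommGroup E] [NormedSpace ℝ E]
  [NormedAddCommGroup F] [NormedSpace ℝ F] [Fintype ι] [DecidableEq ι]

/-- The metric `h_{uv} = U^{Aα}_u U^{Bβ}_v C_{αβ} ε_{AB}` (its value is real by the reality
condition on `U`). -/
def hypMetric (U : Fin 2 → ι ⊕ ι → E → E →L[ℝ] ℂ) (q X Y : E) : ℝ :=
  (∑ A, ∑ B, ∑ α, ∑ β, eps A B * symC α β * U A α q X * U B β q Y).re

/-- `D` is a coordinate domain of a quaternionic (Kähler) manifold of real dimension `4 m`,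
`m = card ι`, with vielbein `U^{Aα}`, `SU(2)`-connection `ω^x` (`om x`), `Sp(2m)`-connection `Δ^α_β`
(in the compact form `USp(2m)`), and completely symmetric tensor `Ω_{αβγδ}` in the
`Sp(2m)`-curvature.  The vielbein determines `ω` and `Δ` (no torsion), and these determine `Ω`. -/
structure IsQuaternionic (D : Set E) (U : Fin 2 → ι ⊕ ι → E → E →L[ℝ] ℂ)
    (om : Fin 3 → E → E →L[ℝ] ℝ) (Δ : ι ⊕ ι → ι ⊕ ι → E → E →L[ℝ] ℂ)
    (Ω : E → ι ⊕ ι → ι ⊕ ι → ι ⊕ ι → ι ⊕ ι → ℂ) : Prop where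
  isOpen : IsOpen D
  finrank_eq : Module.finrank ℝ E = 4 * Fintype.card ι
  smooth_U : ∀ A α, ContDiffOn ℝ ∞ (U A α) D
  smooth_om : ∀ x, ContDiffOn ℝ ∞ (om x) D
  smooth_Δ : ∀ α β, ContDiffOn ℝ ∞ (Δ α β) D
  /-- the vielbein is a coframe -/
  coframe : ∀ q ∈ D, ∀ X, (∀ A α, U A α q X = 0) → X = 0
  /-- `(U^{Aα})^* = ε_{AB} C_{αβ} U^{Bβ}` -/
  reality : ∀ q ∈ D, ∀ A α X,
    (starRingEnd ℂ) (U A α q X) = ∑ B, ∑ β, eps A B * symC α β * U B β q X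
  /-- `Δ` takes values in the symplectic Lie algebra -/
  symplectic : ∀ q ∈ D, ∀ α β X,
    ∑ γ, symC α γ * Δ γ β q X = ∑ γ, symC β γ * Δ γ α q X
  /-- `Δ` is antihermitian -/
  antihermitian : ∀ q ∈ D, ∀ α β X, (starRingEnd ℂ) (Δ α β q X) = -Δ β α q X
  /-- `dU^{Aα} + (i/2) ω^x (σ_x)^A_B ∧ U^{Bα} + Δ^α_β ∧ U^{Aβ} = 0` -/
  torsion : ∀ q ∈ D, ∀ A α X Y,
    extD (U A α) q X Y
      + ∑ x, ∑ B, Complex.I / 2 * pauliUp x A B *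
          wedge (fun Z => (om x q Z : ℂ)) (U B α q) X Y
      + ∑ β, wedge (Δ α β q) (U A β q) X Y = 0
  /-- `dω^x + (1/2) ε^{xyz} ω^y ∧ ω^z = i λ C_{αβ} (σ^x)_{AB} U^{Aα} ∧ U^{Bβ}` -/
  su2_curvature : ∀ q ∈ D, ∀ x X Y,
    ((extD (om x) q X Y : ℝ) : ℂ)
      + 1 / 2 * ∑ y, ∑ z, levi x y z *
          wedge (fun Z => (om y q Z : ℂ)) (fun Z => (om z q Z : ℂ)) X Y
      = Complex.I * lam * ∑ α, ∑ β, ∑ A, ∑ B,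
          symC α β * pauliLow x A B * wedge (U A α q) (U B β q) X Y
  /-- `dΔ^α_β + Δ^α_γ ∧ Δ^γ_β
  = λ ε_{AB} U^{Aα} ∧ U^B_β + U^{Aγ} ∧ U^{Bδ} ε_{AB} C^{αρ} Ω_{ρβγδ}`,
  with `U^B_β = C_{βγ} U^{Bγ}` -/
  sp_curvature : ∀ q ∈ D, ∀ α β X Y,
    extD (Δ α β) q X Y + ∑ γ, wedge (Δ α γ q) (Δ γ β q) X Y
      = lam * ∑ A, ∑ B, ∑ γ, eps A B * symC β γ * wedge (U A α q) (U B γ q) X Y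
        + ∑ A, ∑ B, ∑ γ, ∑ δ, ∑ ρ,
            eps A B * symC α ρ * Ω q ρ β γ δ * wedge (U A γ q) (U B δ q) X Y
  /-- complete symmetry of `Ω` -/
  symm₁₂ : ∀ q ∈ D, ∀ α β γ δ, Ω q α β γ δ = Ω q β α γ δ
  symm₂₃ : ∀ q ∈ D, ∀ α β γ δ, Ω q α β γ δ = Ω q α γ β δ
  symm₃₄ : ∀ q ∈ D, ∀ α β γ δ, Ω q α β γ δ = Ω q α β δ γ

/-- `(N, g, J)` is a Kähler manifold (in a coordinate domain `N`): `g` is a Riemannian metric,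
`J` an almost complex structure with `g(JX, JY) = g(X, Y)`, the Nijenhuis tensor of `J` vanishes,
and the fundamental 2-form `g(JX, Y)` is closed. -/
structure IsKahler (N : Set F) (g : F → F → F → ℝ) (J : F → F →L[ℝ] F) : Prop where
  smooth_g : ∀ X Y, ContDiffOn ℝ ∞ (fun y => g y X Y) N
  smooth_J : ContDiffOn ℝ ∞ J N
  linear : ∀ y ∈ N, ∀ Y, IsLinearMap ℝ (fun X => g y X Y)
  symm : ∀ y ∈ N, ∀ X Y, g y X Y = g y Y X
  posDef : ∀ y ∈ N, ∀ X, X ≠ 0 → 0 < g y X X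
  sq : ∀ y ∈ N, ∀ X, J y (J y X) = -X
  hermitian : ∀ y ∈ N, ∀ X Y, g y (J y X) (J y Y) = g y X Y
  nijenhuis : ∀ y ∈ N, ∀ X Y,
    fderiv ℝ J y (J y X) Y - fderiv ℝ J y (J y Y) X
      + J y (fderiv ℝ J y Y X) - J y (fderiv ℝ J y X Y) = 0
  closed : ∀ y ∈ N, ∀ X Y Z,
    fderiv ℝ (fun y => g y (J y Y) Z) y X + fderiv ℝ (fun y => g y (J y Z) X) y Y
      + fderiv ℝ (fun y => g y (J y X) Y) y Z = 0

/-- Metric induced on the source of `j` by the quaternionic metric. -/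
def inducedMetric (U : Fin 2 → ι ⊕ ι → E → E →L[ℝ] ℂ) (j : F → E) (y X Y : F) : ℝ :=
  hypMetric U (j y) (fderiv ℝ j y X) (fderiv ℝ j y Y)

/-- The embedded submanifold `j : N → D`, of half the dimension, is a consistent reduction of the
quaternionic geometry `(D, U, ω, Δ)` to a Kähler-Hodge manifold: on it
`U^{2I} = ω¹ = ω² = Δ^I_{J̇} = 0`; with the complex structure for which the remaining vielbein
`U^{2İ} = (U^{1I})^*` is of type `(1,0)`, the induced metric is Kähler; and the `SU(2)`-bundle
reduces to the `U(1)` Hodge bundle: the curvature `dω³` of its connection is, up to the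
normalization constant, the Kähler form (`Ω³ = λ K³`, where `K³` is twice `g(J·, ·)`). -/
structure IsKahlerHodgeReduction (D : Set E) (U : Fin 2 → ι ⊕ ι → E → E →L[ℝ] ℂ)
    (om : Fin 3 → E → E →L[ℝ] ℝ) (Δ : ι ⊕ ι → ι ⊕ ι → E → E →L[ℝ] ℂ)
    (N : Set F) (j : F → E) : Prop where
  isOpen : IsOpen N
  half_dim : 2 * Module.finrank ℝ F = Module.finrank ℝ E
  smooth : ContDiffOn ℝ ∞ j N
  mapsTo : Set.MapsTo j N D
  embedding : Topology.IsEmbedding (N.domRestrict j)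
  immersion : ∀ y ∈ N, Function.Injective (fderiv ℝ j y)
  U_eq_zero : ∀ y ∈ N, ∀ I, pull (U 1 (Sum.inl I)) j y = 0
  om₁_eq_zero : ∀ y ∈ N, pull (om 0) j y = 0
  om₂_eq_zero : ∀ y ∈ N, pull (om 1) j y = 0
  Δ_eq_zero : ∀ y ∈ N, ∀ I J, pull (Δ (Sum.inl I) (Sum.inr J)) j y = 0
  kahlerHodge : ∃ J : F → F →L[ℝ] F,
    (∀ y ∈ N, ∀ I X, pull (U 1 (Sum.inr I)) j y (J y X)
      = Complex.I * pull (U 1 (Sum.inr I)) j y X) ∧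
    IsKahler N (inducedMetric U j) J ∧
    ∀ y ∈ N, ∀ X Y, extD (pull (om 2) j) y X Y = -2 * inducedMetric U j y (J y X) Y

/-- The vielbein `U^{Aα}` with given components `U^{1I} = θ₁`, `U^{2I} = θ₂`; the dotted components
are then given by the reality condition: `U^{2İ} = (U^{1I})^*`, `U^{1İ} = -(U^{2I})^*`. -/
def vielbeinOf (θ₁ θ₂ : ι → E → E →L[ℝ] ℂ) : Fin 2 → ι ⊕ ι → E → E →L[ℝ] ℂ
  | 0, Sum.inl I => θ₁ I
  | 1, Sum.inl I => θ₂ I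
  | 0, Sum.inr I => -conjForm (θ₂ I)
  | 1, Sum.inr I => conjForm (θ₁ I)

end Quaternionic

/-! ## Special Kähler geometry -/

section SpecialKahler

variable {n : ℕ}

/-- Symplectic vectors `(X^Λ, F_Λ)`, `Λ = 0, …, n`; `Sum.inl Λ` is an upper, `Sum.inr Λ` a lower
index. -/
abbrev SympVec (n : ℕ) : Type := Fin (n + 1) ⊕ Fin (n + 1) → ℂ

/-- Symplectic product `⟨A, B⟩ = A^Λ B_Λ - A_Λ B^Λ`. -/
def sympl (A B : SympVec n) : ℂ :=
  ∑ Λ, (A (Sum.inl Λ) * B (Sum.inr Λ) - A (Sum.inr Λ) * B (Sum.inl Λ))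

/-- `exp(-K) = i (X̄^Λ F_Λ - F̄_Λ X^Λ)` for a section `V = (X^Λ, F_Λ)`. -/
def expNegK (V : (Fin n → ℂ) → SympVec n) (z : Fin n → ℂ) : ℝ :=
  (Complex.I * sympl (fun s => (starRingEnd ℂ) (V z s)) (V z)).re

/-- The Kähler potential `K = - log [i (X̄^Λ F_Λ - F̄_Λ X^Λ)]`. -/
def kahlerPot (V : (Fin n → ℂ) → SympVec n) (z : Fin n → ℂ) : ℝ := -Real.log (expNegK V z)

/-- `∂_i = (∂_{x^i} - i ∂_{y^i}) / 2`. -/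
def dHol (i : Fin n) (f : (Fin n → ℂ) → ℂ) (z : Fin n → ℂ) : ℂ :=
  (fderiv ℝ f z (Pi.single i 1) - Complex.I * fderiv ℝ f z (Pi.single i Complex.I)) / 2

/-- `∂_{ī} = (∂_{x^i} + i ∂_{y^i}) / 2`. -/
def dBar (i : Fin n) (f : (Fin n → ℂ) → ℂ) (z : Fin n → ℂ) : ℂ :=
  (fderiv ℝ f z (Pi.single i 1) + Complex.I * fderiv ℝ f z (Pi.single i Complex.I)) / 2

/-- The Kähler metric `g_{i j̄} = ∂_i ∂_{j̄} K`. -/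
def kahlerMetric (V : (Fin n → ℂ) → SympVec n) (z : Fin n → ℂ) : Matrix (Fin n) (Fin n) ℂ :=
  fun i j => dHol i (dBar j (fun w => (kahlerPot V w : ℂ))) z

/-- `∂_i V` for a holomorphic section `V`. -/
def dSection (V : (Fin n → ℂ) → SympVec n) (i : Fin n) (z : Fin n → ℂ) : SympVec n :=
  fderiv ℂ V z (Pi.single i 1)

/-- `D_i V = ∂_i V + (∂_i K) V`. -/
def covSection (V : (Fin n → ℂ) → SympVec n) (i : Fin n) (z : Fin n → ℂ) : SympVec n :=
  dSection V i z + dHol i (fun w => (kahlerPot V w : ℂ)) z • V z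

/-- `V = (X^Λ, F_Λ)` is the holomorphic symplectic section of a special Kähler manifold of complex
dimension `n`, in a coordinate patch `M ⊆ ℂⁿ`: `i (X̄^Λ F_Λ - F̄_Λ X^Λ) > 0`, `⟨V, ∂_i V⟩ = 0`, and
`g_{i j̄} = ∂_i ∂_{j̄} K` is positive definite.  (The existence of a prepotential is not required; for
`F_Λ = ∂F/∂X^Λ` with `F` homogeneous of degree two the second condition holds.) -/
structure IsSpecialKahler (M : Set (Fin n → ℂ)) (V : (Fin n → ℂ) → SympVec n) : Prop where
  isOpen : IsOpen M
  holomorphic : DifferentiableOn ℂ V M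
  pos : ∀ z ∈ M, 0 < expNegK V z
  sympl_dSection : ∀ z ∈ M, ∀ i, sympl (V z) (dSection V i z) = 0
  metric_pos : ∀ z ∈ M, (kahlerMetric V z).PosDef

/-- `P^a = P^a_i dz^i` (`P z a i = P^a_i`) is a unitary coframe: `g_{i j̄} = ∑_a P^a_i (P^a_j)^*`. -/
structure IsUnitaryFrame (M : Set (Fin n → ℂ)) (V : (Fin n → ℂ) → SympVec n)
    (P : (Fin n → ℂ) → Matrix (Fin n) (Fin n) ℂ) : Prop where
  smooth : ∀ a i, ContDiffOn ℝ ∞ (fun z => P z a i) M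
  metric_eq : ∀ z ∈ M, ∀ i j,
    kahlerMetric V z i j = ∑ a, P z a i * (starRingEnd ℂ) (P z a j)

/-! ## The c-map

The quaternionic manifold of real dimension `4 (n + 1)` has coordinates `q = (z, φ, a, ζ)`: the
special Kähler coordinates `z`, the dilaton `φ`, the axion `a`, and a real symplectic vector
`ζ = (ζ^Λ, ζ̃_Λ)`.  Its (Ferrara-Sabharwal) metric is
`|v|² + |u|² + ∑_a |e^a|² + ∑_a |E^a|²` with the complex 1-forms `v, u, e^a, E^a` below. -/

/-- Coordinates `(z, φ, a, ζ)`. -/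
abbrev CMapSpace (n : ℕ) : Type :=
  (Fin n → ℂ) × ℝ × ℝ × (Fin (n + 1) ⊕ Fin (n + 1) → ℝ)

/-- The coordinate domain of the c-map of the special Kähler patch `M`. -/
def cmapDomain (M : Set (Fin n → ℂ)) : Set (CMapSpace n) := {q | q.1 ∈ M}

def dz (i : Fin n) : CMapSpace n →L[ℝ] ℂ :=
  (ContinuousLinearMap.proj (R := ℝ) (φ := fun _ : Fin n => ℂ) i).comp
    (ContinuousLinearMap.fst ℝ _ _)

def dφ : CMapSpace n →L[ℝ] ℂ :=
  Complex.ofRealCLM.comp ((ContinuousLinearMap.fst ℝ _ _).comp (ContinuousLinearMap.snd ℝ _ _))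

def da : CMapSpace n →L[ℝ] ℂ :=
  Complex.ofRealCLM.comp ((ContinuousLinearMap.fst ℝ _ _).comp
    ((ContinuousLinearMap.snd ℝ _ _).comp (ContinuousLinearMap.snd ℝ _ _)))

def dζ (s : Fin (n + 1) ⊕ Fin (n + 1)) : CMapSpace n →L[ℝ] ℂ :=
  Complex.ofRealCLM.comp
    ((ContinuousLinearMap.proj (R := ℝ) (φ := fun _ : Fin (n + 1) ⊕ Fin (n + 1) => ℝ) s).comp
      ((ContinuousLinearMap.snd ℝ _ _).comp
        ((ContinuousLinearMap.snd ℝ _ _).comp (ContinuousLinearMap.snd ℝ _ _))))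

/-- `⟨A, dζ⟩ = A^Λ dζ̃_Λ - A_Λ dζ^Λ`. -/
def symplDζ (A : SympVec n) : CMapSpace n →L[ℝ] ℂ :=
  ∑ Λ, (A (Sum.inl Λ) • dζ (Sum.inr Λ) - A (Sum.inr Λ) • dζ (Sum.inl Λ))

/-- `da + ζ̃_Λ dζ^Λ - ζ^Λ dζ̃_Λ`. -/
def contactForm (q : CMapSpace n) : CMapSpace n →L[ℝ] ℂ :=
  da + ∑ Λ, ((q.2.2.2 (Sum.inr Λ) : ℂ) • dζ (Sum.inl Λ)
    - (q.2.2.2 (Sum.inl Λ) : ℂ) • dζ (Sum.inr Λ))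

/-- `v = - dφ - (i/2) exp(2φ) (da + ζ̃_Λ dζ^Λ - ζ^Λ dζ̃_Λ)`. -/
def vForm (q : CMapSpace n) : CMapSpace n →L[ℝ] ℂ :=
  -dφ - (Complex.I / 2 * Real.exp (2 * q.2.1)) • contactForm q

/-- `u = i exp(K/2 + φ) ⟨V, dζ⟩ = i exp(K/2 + φ) (X^Λ dζ̃_Λ - F_Λ dζ^Λ)`. -/
def uForm (V : (Fin n → ℂ) → SympVec n) (q : CMapSpace n) : CMapSpace n →L[ℝ] ℂ :=
  (Complex.I * Real.exp (kahlerPot V q.1 / 2 + q.2.1)) • symplDζ (V q.1)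

/-- `e^a = P^a_i dz^i`. -/
def eForm (P : (Fin n → ℂ) → Matrix (Fin n) (Fin n) ℂ) (a : Fin n) (q : CMapSpace n) :
    CMapSpace n →L[ℝ] ℂ :=
  ∑ i, P q.1 a i • dz i

/-- The complex conjugate of `E^a`: `Ē^a = i exp(K/2 + φ) (P⁻¹)^i_a ⟨D_i V, dζ⟩`. -/
def EbarForm (V : (Fin n → ℂ) → SympVec n) (P : (Fin n → ℂ) → Matrix (Fin n) (Fin n) ℂ)
    (a : Fin n) (q : CMapSpace n) : CMapSpace n →L[ℝ] ℂ :=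
  (Complex.I * Real.exp (kahlerPot V q.1 / 2 + q.2.1)) •
    symplDζ (∑ i, (P q.1)⁻¹ i a • covSection V i q.1)

/-- The Ferrara-Sabharwal metric on the c-map domain, written without a choice of unitary frame:
`dφ² + (1/4) exp(4φ) (da + ζ̃_Λ dζ^Λ - ζ^Λ dζ̃_Λ)² + g_{i j̄} dz^i dz̄^j
+ exp(K + 2φ) (|⟨V, dζ⟩|² + g^{j̄ i} ⟨D_i V, dζ⟩ ⟨D_j V, dζ⟩^*)`. -/
def cmapMetric (V : (Fin n → ℂ) → SympVec n) (q X Y : CMapSpace n) : ℝ :=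
  (dφ X * dφ Y
    + 1 / 4 * Real.exp (4 * q.2.1) * contactForm q X * contactForm q Y
    + ∑ i, ∑ j, kahlerMetric V q.1 i j * dz i X * (starRingEnd ℂ) (dz j Y)
    + Real.exp (kahlerPot V q.1 + 2 * q.2.1) *
      (symplDζ (V q.1) X * (starRingEnd ℂ) (symplDζ (V q.1) Y)
        + ∑ i, ∑ j, (kahlerMetric V q.1)⁻¹ j i * symplDζ (covSection V i q.1) X *
            (starRingEnd ℂ) (symplDζ (covSection V j q.1) Y))).re

/-- `U^{1I} = (-v, ē^a) / √2`, with `I = none` or `I = some a`, `a = 1, …, n`. -/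
def cmapTheta₁ (P : (Fin n → ℂ) → Matrix (Fin n) (Fin n) ℂ) :
    Option (Fin n) → CMapSpace n → CMapSpace n →L[ℝ] ℂ
  | none => fun q => (-(1 / Real.sqrt 2 : ℝ)) • vForm q
  | some a => fun q => (1 / Real.sqrt 2 : ℝ) • conjForm (eForm P a) q

/-- `U^{2I} = (u, Ē^a) / √2`. -/
def cmapTheta₂ (V : (Fin n → ℂ) → SympVec n) (P : (Fin n → ℂ) → Matrix (Fin n) (Fin n) ℂ) :
    Option (Fin n) → CMapSpace n → CMapSpace n →L[ℝ] ℂ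
  | none => fun q => (1 / Real.sqrt 2 : ℝ) • uForm V q
  | some a => fun q => (1 / Real.sqrt 2 : ℝ) • EbarForm V P a q

/-- The quaternionic vielbein of the c-map. -/
def cmapVielbein (V : (Fin n → ℂ) → SympVec n) (P : (Fin n → ℂ) → Matrix (Fin n) (Fin n) ℂ) :
    Fin 2 → Option (Fin n) ⊕ Option (Fin n) → CMapSpace n → CMapSpace n →L[ℝ] ℂ :=
  vielbeinOf (cmapTheta₁ P) (cmapTheta₂ V P)

/-- The submanifold `ζ = ζ₀`, with coordinates `(z, φ, a)`. -/
def cmapSlice (ζ₀ : Fin (n + 1) ⊕ Fin (n + 1) → ℝ) (y : (Fin n → ℂ) × ℝ × ℝ) : CMapSpace n :=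
  (y.1, y.2.1, y.2.2, ζ₀)

end SpecialKahler

/-! ## The symmetric spaces `SO(p, q) / SO(p) × SO(q)`

`p` and `q` are the cardinalities of the finite index types `π` and `κ`.  The tangent space at the
base point consists of the real `q × p` matrices `x`; by the Cartan decomposition the space is
covered by the single chart `x ↦ L(x) H`, with the coset representative
`L(x) = exp [[0, xᵀ], [x, 0]]`. -/

section Coset

variable (π κ : Type*) [Fintype π] [DecidableEq π] [Fintype κ] [DecidableEq κ]

variable {π κ} in
/-- The coset representative `L(x) ∈ SO(p, q)`. -/
def cosetRep (x : κ → π → ℝ) : Matrix (π ⊕ κ) (π ⊕ κ) ℝ :=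
  NormedSpace.exp (Matrix.fromBlocks 0 (Matrix.transpose (Matrix.of x)) (Matrix.of x) 0)

variable {π κ} in
/-- The coset vielbein: the off-diagonal block of the left-invariant form `L⁻¹ dL`. -/
def cosetForm (i : κ) (a : π) (x : κ → π → ℝ) : (κ → π → ℝ) →L[ℝ] ℝ :=
  ∑ s, (cosetRep x)⁻¹ (Sum.inr i) s • fderiv ℝ (fun y => cosetRep y s (Sum.inl a)) x

/-- The invariant metric of the symmetric space, normalized as `(1/2) ∑ p_{ia} p_{ia}`, where `p` is
the coset vielbein. -/
def cosetMetric (x X Y : κ → π → ℝ) : ℝ :=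
  1 / 2 * ∑ i, ∑ a, cosetForm i a x X * cosetForm i a x Y

variable (n₁ n₂ : ℕ)

/-- Coordinates on `SO(4, n) / SO(4) × SO(n)`, `n = n₁ + n₂`; the index `1, …, 4` is written as
`Fin 2 ⊕ Fin 2` and the index `1, …, n` as `Fin n₁ ⊕ Fin n₂`. -/
abbrev GrSpace : Type := Fin n₁ ⊕ Fin n₂ → Fin 2 ⊕ Fin 2 → ℝ

variable {n₁ n₂}

/-- The complex 1-forms `(p_{i1} + i p_{i2}) / 2`. -/
def grZ₁ (i : Fin n₁ ⊕ Fin n₂) (x : GrSpace n₁ n₂) : GrSpace n₁ n₂ →L[ℝ] ℂ :=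
  (1 / 2 : ℂ) • (Complex.ofRealCLM.comp (cosetForm i (Sum.inl 0) x)
    + Complex.I • Complex.ofRealCLM.comp (cosetForm i (Sum.inl 1) x))

/-- The complex 1-forms `(p_{i3} + i p_{i4}) / 2`. -/
def grZ₂ (i : Fin n₁ ⊕ Fin n₂) (x : GrSpace n₁ n₂) : GrSpace n₁ n₂ →L[ℝ] ℂ :=
  (1 / 2 : ℂ) • (Complex.ofRealCLM.comp (cosetForm i (Sum.inr 0) x)
    + Complex.I • Complex.ofRealCLM.comp (cosetForm i (Sum.inr 1) x))

/-- `U^{1I}`: equal to `Z₁` for `I ≤ n₁` and to `- Z̄₂` for `I > n₁`. -/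
def grTheta₁ : Fin n₁ ⊕ Fin n₂ → GrSpace n₁ n₂ → GrSpace n₁ n₂ →L[ℝ] ℂ
  | Sum.inl i => grZ₁ (Sum.inl i)
  | Sum.inr i => -conjForm (grZ₂ (Sum.inr i))

/-- `U^{2I}`: equal to `Z₂` for `I ≤ n₁` and to `Z̄₁` for `I > n₁`. -/
def grTheta₂ : Fin n₁ ⊕ Fin n₂ → GrSpace n₁ n₂ → GrSpace n₁ n₂ →L[ℝ] ℂ
  | Sum.inl i => grZ₂ (Sum.inl i)
  | Sum.inr i => conjForm (grZ₁ (Sum.inr i))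

variable (n₁ n₂)

/-- The quaternionic vielbein of `SO(4, n) / SO(4) × SO(n)`, adapted to the splitting
`n = n₁ + n₂`. -/
def grVielbein : Fin 2 → (Fin n₁ ⊕ Fin n₂) ⊕ (Fin n₁ ⊕ Fin n₂) →
    GrSpace n₁ n₂ → GrSpace n₁ n₂ →L[ℝ] ℂ :=
  vielbeinOf grTheta₁ grTheta₂

variable {n₁ n₂}

/-- The block-diagonal embedding
`SO(2, n₁) / SO(2) × SO(n₁) × SO(2, n₂) / SO(2) × SO(n₂) → SO(4, n) / SO(4) × SO(n)`. -/
def grSub (y : (Fin n₁ → Fin 2 → ℝ) × (Fin n₂ → Fin 2 → ℝ)) : GrSpace n₁ n₂ :=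
  Matrix.fromBlocks (Matrix.of y.1) 0 0 (Matrix.of y.2)

end Coset

end CMap

end

/-! Everything is an identity in Cartan's moving-frame calculus. The proof consists of a universal
part and of two families of structure equations.

Universal part. Suppose that a coframe U and connections ω, Δ satisfy the reality condition, the
symmetry conditions on Δ, the torsion equation and the SU(2)-curvature equation (`IsTorsionFree`).
Then the required form of the Sp(2m)-curvature is automatic. Differentiating the torsion equation
gives the first Bianchi identity of the connection on the tensor product bundle. The prescribed
SU(2)-curvature cancels there against the λ-term of the Sp(2m)-curvature, so the remaining part W
satisfies a Bianchi identity of its own, separately for each value of the SU(2)-index. Evaluated in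
a dual frame, this identity and the symmetry of the sp-valued W force W to be ε times a completely
symmetric tensor Ω (`exists_weylTensor`). By reality only the undotted torsion equations have to be
checked (`isTorsionFree_of_blocks`).

Two general consequences serve both families. On a submanifold of half the dimension where U^{2I},
ω¹ and ω² pull back to zero, the torsion equation says that dη lies in the ideal generated by η for
the (1,0)-coframe η, which is integrability of J. The third SU(2)-curvature equation becomes dω³ =
-2 g(J·,·), so the fundamental form is exact and therefore closed
(`isKahlerHodgeReduction_of_pull_eq_zero`). On the plane U^{2I} = 0 the curvature component R^I_{J̇}
involves only Ω_{İJ̇KL̇}, so these components vanish as soon as R^I_{J̇} vanishes on that plane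
(`weylTensor_eq_zero`).

The c-map. The section V, its covariant derivatives along a unitary frame, and their complex
conjugates form a basis of ℂ^{2n+2} adapted to the symplectic product. Differentiating the constant
or known pairings gives the structure equations of this basis, with a symmetric cubic form as second
fundamental form; d² V = 0 gives the structure equations of the coframe and of ∂K. Since u and Ē are
contractions of the basis with dζ, and dv contains ⟨dζ, dζ⟩, all exterior derivatives follow and the
connections can be read off. The forms u, Ē, hence ω¹, ω² and the blocks Δ^I_{J̇}, vanish along the
slices ζ = ζ₀. The kernel of the U^{2I} at a point is the tangent space of the slice through that
point, so R^I_{J̇} vanishes on it by naturality of d.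

The symmetric examples. The structure equations are the Maurer-Cartan equations of L⁻¹dL. Under
so(4) = su(2) ⊕ su(2) one summand is ω, and the other joins so(n) to form Δ. For I > n₁ dotted and
undotted components are interchanged, so that Δ^I_{J̇} consists of the mixed SO(n)-rotations and of
the mixed SO(4)-components of the second su(2). These vanish on block-diagonal matrices, and their
curvature contains only products of vielbein components that vanish when U^{2I} = 0. That the coset
vielbein is a coframe follows from L² = exp(2·) and the injectivity of the differential of exp at
symmetric matrices (`eq_zero_of_hasDerivAt_exp`). -/

noncomputable section

namespace CMap

/-! ### Exterior calculus of one-forms and the first Bianchi identity. -/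

section FormCalculus

variable {E G : Type*} [NormedAddCommGroup E] [NormedSpace ℝ E]
  [NormedAddCommGroup G] [NormedSpace ℝ G]

theorem extD_swap (θ : E → E →L[ℝ] G) (q X Y : E) : extD θ q Y X = -extD θ q X Y := by
  simp [extD]

theorem wedge_swap {T : Type*} (a b : T → ℂ) (X Y : T) : wedge a b Y X = -wedge a b X Y := by
  simp only [wedge]; ring

theorem hasFDerivAt_apply_const {θ : E → E →L[ℝ] G} {q : E} (h : DifferentiableAt ℝ θ q) (X : E) :
    HasFDerivAt (fun p => θ p X) ((fderiv ℝ θ q).flip X) q :=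
  (h.hasFDerivAt.clm_apply (hasFDerivAt_const X q)).congr_fderiv (by ext; simp)

theorem fderiv_apply_const {θ : E → E →L[ℝ] G} {q : E} (h : DifferentiableAt ℝ θ q) (X Z : E) :
    fderiv ℝ (fun p => θ p X) q Z = fderiv ℝ θ q Z X := by
  rw [(hasFDerivAt_apply_const h X).fderiv, ContinuousLinearMap.flip_apply]

theorem fderiv_extD {θ : E → E →L[ℝ] G} {q : E} (h : ContDiffAt ℝ ∞ θ q) (X Y Z : E) :
    fderiv ℝ (fun p => extD θ p X Y) q Z
      = fderiv ℝ (fderiv ℝ θ) q Z X Y - fderiv ℝ (fderiv ℝ θ) q Z Y X := by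
  have h1 : DifferentiableAt ℝ (fderiv ℝ θ) q :=
    (h.fderiv_right (m := ∞) (by simp)).differentiableAt (by simp)
  have h2 : ∀ X Y : E, HasFDerivAt (fun p => fderiv ℝ θ p X Y)
      (((fderiv ℝ (fderiv ℝ θ) q).flip X).flip Y) q := fun X Y =>
    ((hasFDerivAt_apply_const h1 X).clm_apply (hasFDerivAt_const Y q)).congr_fderiv (by ext; simp)
  simp only [extD]
  rw [((h2 X Y).fun_sub (h2 Y X)).fderiv]
  simp

/-- This is d² = 0. On constant vector fields the differential of a two-form is the cyclic sum of
directional derivatives, and the six second derivatives cancel in pairs by symmetry. -/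
theorem extD_extD {θ : E → E →L[ℝ] G} {q : E} (h : ContDiffAt ℝ ∞ θ q) (X Y Z : E) :
    fderiv ℝ (fun p => extD θ p X Y) q Z + fderiv ℝ (fun p => extD θ p Y Z) q X
      + fderiv ℝ (fun p => extD θ p Z X) q Y = 0 := by
  have hs : IsSymmSndFDerivAt ℝ θ q := h.isSymmSndFDerivAt (by simpa using WithTop.coe_le_coe.2 (le_top : (2 : ℕ∞) ≤ ⊤))
  simp only [fderiv_extD h]
  rw [hs.eq X Z, hs.eq Z Y, hs.eq Y X]
  abel

theorem fderiv_wedge {a b : E → E →L[ℝ] ℂ} {q : E} (ha : DifferentiableAt ℝ a q)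
    (hb : DifferentiableAt ℝ b q) (X Y Z : E) :
    fderiv ℝ (fun p => wedge (a p) (b p) X Y) q Z
      = wedge (fderiv ℝ a q Z) (b q) X Y + wedge (a q) (fderiv ℝ b q Z) X Y := by
  have e := fun X => hasFDerivAt_apply_const ha X
  have e' := fun X => hasFDerivAt_apply_const hb X
  simp only [wedge]
  rw [(((e X).fun_mul (e' Y)).fun_sub ((e Y).fun_mul (e' X))).fderiv]
  simp
  ring

theorem differentiableAt_wedge {a b : E → E →L[ℝ] ℂ} {q : E} (ha : DifferentiableAt ℝ a q)
    (hb : DifferentiableAt ℝ b q) (X Y : E) :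
    DifferentiableAt ℝ (fun p => wedge (a p) (b p) X Y) q := by
  unfold wedge
  fun_prop

/-- The Leibniz rule d(a ∧ b) = da ∧ b - a ∧ db, with three-forms written as cyclic sums over
constant vector fields. -/
theorem extD_wedge {a b : E → E →L[ℝ] ℂ} {q : E} (ha : DifferentiableAt ℝ a q)
    (hb : DifferentiableAt ℝ b q) (X Y Z : E) :
    fderiv ℝ (fun p => wedge (a p) (b p) X Y) q Z + fderiv ℝ (fun p => wedge (a p) (b p) Y Z) q X
        + fderiv ℝ (fun p => wedge (a p) (b p) Z X) q Y
      = (extD a q X Y * b q Z + extD a q Y Z * b q X + extD a q Z X * b q Y)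
        - (a q Z * extD b q X Y + a q X * extD b q Y Z + a q Y * extD b q Z X) := by
  rw [fderiv_wedge ha hb, fderiv_wedge ha hb, fderiv_wedge ha hb]
  simp only [wedge, extD]
  ring

/-- First Bianchi identity for a torsion-free connection in a moving frame. -/
theorem bianchi {k : Type*} [Fintype k] {D : Set E} (hD : IsOpen D) {U : k → E → E →L[ℝ] ℂ}
    {Γ : k → k → E → E →L[ℝ] ℂ} (hU : ∀ a, ContDiffOn ℝ ∞ (U a) D)
    (hΓ : ∀ a b, ContDiffOn ℝ ∞ (Γ a b) D)
    (htor : ∀ q ∈ D, ∀ a X Y, extD (U a) q X Y + ∑ b, wedge (Γ a b q) (U b q) X Y = 0)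
    {q : E} (hq : q ∈ D) (a : k) (X Y Z : E) :
    ∑ b, ((extD (Γ a b) q X Y + ∑ c, wedge (Γ a c q) (Γ c b q) X Y) * U b q Z
      + (extD (Γ a b) q Y Z + ∑ c, wedge (Γ a c q) (Γ c b q) Y Z) * U b q X
      + (extD (Γ a b) q Z X + ∑ c, wedge (Γ a c q) (Γ c b q) Z X) * U b q Y) = 0 := by
  have hUq := fun a => (hU a).contDiffAt (hD.mem_nhds hq)
  have hΓq := fun a b => (hΓ a b).contDiffAt (hD.mem_nhds hq)
  have dU := fun a => (hUq a).differentiableAt (by simp)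
  have dΓ := fun a b => (hΓq a b).differentiableAt (by simp)
  -- The torsion equation holds on an open set, hence near q, and may therefore be differentiated at
  -- q.
  have key : ∀ X Y Z, fderiv ℝ (fun p => extD (U a) p X Y) q Z
      = -∑ b, fderiv ℝ (fun p => wedge (Γ a b p) (U b p) X Y) q Z := by
    intro X Y Z
    have : (fun p => extD (U a) p X Y) =ᶠ[nhds q] fun p => -∑ b, wedge (Γ a b p) (U b p) X Y := by
      filter_upwards [hD.mem_nhds hq] with p hp
      exact eq_neg_of_add_eq_zero_left (htor p hp a X Y)
    rw [this.fderiv_eq, fderiv_fun_neg,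
      fderiv_fun_sum fun b _ => differentiableAt_wedge (dΓ a b) (dU b) X Y]
    simp
  have h0 := extD_extD (hUq a) X Y Z
  rw [key, key, key] at h0
  have h1 : ∑ b, ((extD (Γ a b) q X Y * U b q Z + extD (Γ a b) q Y Z * U b q X
      + extD (Γ a b) q Z X * U b q Y)
        - (Γ a b q Z * extD (U b) q X Y + Γ a b q X * extD (U b) q Y Z
          + Γ a b q Y * extD (U b) q Z X)) = 0 := by
    simp only [← extD_wedge (dΓ a _) (dU _), Finset.sum_add_distrib]
    linear_combination -h0
  -- Substituting dU = -Γ ∧ U turns -Γ ∧ dU into Γ ∧ Γ ∧ U. After renaming two summation indices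
  -- this is the quadratic part of the curvature.
  have h2 : ∀ b X Y, extD (U b) q X Y = -∑ c, wedge (Γ b c q) (U c q) X Y := fun b X Y =>
    eq_neg_of_add_eq_zero_left (htor q hq b X Y)
  simp only [h2] at h1
  have h3 : ∑ b, ∑ c, (wedge (Γ a c q) (Γ c b q) X Y * U b q Z
        + wedge (Γ a c q) (Γ c b q) Y Z * U b q X + wedge (Γ a c q) (Γ c b q) Z X * U b q Y)
      = ∑ b, ∑ c, (Γ a b q Z * wedge (Γ b c q) (U c q) X Y
        + Γ a b q X * wedge (Γ b c q) (U c q) Y Z + Γ a b q Y * wedge (Γ b c q) (U c q) Z X) := by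
    rw [Finset.sum_comm]
    refine Finset.sum_congr rfl fun b _ => Finset.sum_congr rfl fun c _ => ?_
    simp only [wedge]; ring
  rw [← h1, ← sub_eq_zero, ← Finset.sum_sub_distrib]
  rw [← sub_eq_zero] at h3
  rw [← h3, ← Finset.sum_sub_distrib]
  refine Finset.sum_congr rfl fun b _ => ?_
  simp only [Finset.sum_add_distrib, Finset.mul_sum, Finset.sum_mul, add_mul, mul_neg]
  ring

end FormCalculus

/-! ### Dual frames in the complexified tangent space. -/

section Coframe

variable {E k : Type*} [NormedAddCommGroup E] [NormedSpace ℝ E] [Fintype k] [DecidableEq k]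

/-- A family of complex covectors without common zero, closed under complex conjugation and of the
right cardinality, has a dual basis in the complexified tangent space. -/
theorem exists_dual_frame [FiniteDimensional ℝ E] (hdim : Module.finrank ℝ E = Fintype.card k)
    (U : k → E →L[ℝ] ℂ) (hU : ∀ X, (∀ a, U a X = 0) → X = 0)
    (hconj : ∀ X Y : E, (∀ a, U a X + Complex.I * U a Y = 0) →
      ∀ a, (starRingEnd ℂ) (U a X) + Complex.I * (starRingEnd ℂ) (U a Y) = 0) :
    ∃ x y : k → E, (∀ a b, U b (x a) + Complex.I * U b (y a) = if b = a then 1 else 0) ∧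
      ∀ (f : E →ₗ[ℝ] ℂ) (X : E), f X = ∑ a, U a X * (f (x a) + Complex.I * f (y a)) := by
  let Φ : E × E →ₗ[ℝ] (k → ℂ) :=
    { toFun := fun p a => U a p.1 + Complex.I * U a p.2
      map_add' := by intro p p'; ext a; simp; ring
      map_smul' := by intro c p; ext a; simp; ring }
  have hinj : Function.Injective Φ := by
    rw [← LinearMap.ker_eq_bot, LinearMap.ker_eq_bot']
    rintro ⟨X, Y⟩ h
    have h0 : ∀ a, U a X + Complex.I * U a Y = 0 := fun a => congrFun h a
    -- The pair (X, Y) stands for X + iY. Closure of the coframe under conjugation shows that X - iY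
    -- is killed as well, hence so are X and Y.
    have h1 : ∀ a, U a X - Complex.I * U a Y = 0 := fun a => by
      have := congrArg (starRingEnd ℂ) (hconj X Y h0 a)
      simpa [sub_eq_add_neg] using this
    have hX : X = 0 := hU X fun a => by linear_combination (h0 a + h1 a) / 2
    have hY : Y = 0 := hU Y fun a => by
      have : Complex.I * U a Y = 0 := by linear_combination (h0 a - h1 a) / 2
      simpa using this
    simp [hX, hY]
  have hfin : Module.finrank ℝ (E × E) = Module.finrank ℝ (k → ℂ) := by
    rw [Module.finrank_prod, Module.finrank_pi_fintype]
    simp [hdim, Complex.finrank_real_complex]; ring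
  have hsurj : Function.Surjective Φ :=
    (LinearMap.injective_iff_surjective_of_finrank_eq_finrank hfin).1 hinj
  choose e he using fun a : k => hsurj (Pi.single a 1)
  have he' : ∀ a b, U b (e a).1 + Complex.I * U b (e a).2 = if b = a then 1 else 0 := fun a b => by
    have := congrFun (he a) b
    rw [Pi.single_apply] at this
    exact this
  refine ⟨fun a => (e a).1, fun a => (e a).2, he', fun f X => ?_⟩
  -- On E × E, the complexification of E, multiplication by i is (x, y) ↦ (-y, x); the coefficients
  -- `U a X` act through their real and imaginary parts.
  have hexp : (X, (0 : E)) = ∑ a, ((U a X).re • e a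
      + (U a X).im • ((-(e a).2, (e a).1) : E × E)) := by
    apply hinj
    ext b
    rw [map_sum, Finset.sum_apply]
    have : ∀ a, Φ ((U a X).re • e a + (U a X).im • ((-(e a).2, (e a).1) : E × E)) b
        = U a X * if b = a then 1 else 0 := fun a => by
      rw [← he' a b]
      conv_rhs => rw [← Complex.re_add_im (U a X)]
      rw [map_add, map_smul, map_smul, Pi.add_apply, Pi.smul_apply, Pi.smul_apply]
      simp only [Φ, LinearMap.coe_mk, AddHom.coe_mk, map_neg, Complex.real_smul]
      linear_combination -(U b (e a).2) * (U a X).im * Complex.I_mul_I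
    simp only [this]
    simp [Φ]
  have h1 := congrArg Prod.fst hexp
  have h2 := congrArg Prod.snd hexp
  simp only [Prod.fst_sum, Prod.snd_sum, Prod.fst_add, Prod.snd_add, Prod.smul_fst,
    Prod.smul_snd] at h1 h2
  have h3 := congrArg f h1
  have h4 := congrArg f h2
  rw [map_zero] at h4
  rw [map_sum] at h3 h4
  simp only [map_add, map_smul, map_neg, Complex.real_smul] at h3 h4
  -- The second component of `hexp` is an expansion of 0. Adding i times it to the first recombines
  -- real and imaginary parts into the complex coefficients `U a X`.
  have h5 : f X = f X + Complex.I * 0 := by simp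
  rw [h5, h4, h3, Finset.mul_sum, ← Finset.sum_add_distrib]
  refine Finset.sum_congr rfl fun a _ => ?_
  conv_rhs => rw [← Complex.re_add_im (U a X)]
  linear_combination -(f (e a).2) * (U a X).im * Complex.I_mul_I

end Coframe

/-! ### Linearity of the exterior derivative. -/

section ExtDLinear

variable {E G G' : Type*} [NormedAddCommGroup E] [NormedSpace ℝ E]
  [NormedAddCommGroup G] [NormedSpace ℝ G] [NormedAddCommGroup G'] [NormedSpace ℝ G']

theorem extD_add {θ η : E → E →L[ℝ] G} {q : E} (h : DifferentiableAt ℝ θ q)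
    (h' : DifferentiableAt ℝ η q) (X Y : E) :
    extD (fun p => θ p + η p) q X Y = extD θ q X Y + extD η q X Y := by
  simp only [extD]
  rw [fderiv_fun_add h h']
  simp only [add_apply]
  abel

theorem extD_neg (θ : E → E →L[ℝ] G) (q X Y : E) :
    extD (fun p => -θ p) q X Y = -extD θ q X Y := by
  simp only [extD, fderiv_fun_neg, neg_apply]
  abel

theorem extD_sum {κ : Type*} (s : Finset κ) {θ : κ → E → E →L[ℝ] G} {q : E}
    (h : ∀ i ∈ s, DifferentiableAt ℝ (θ i) q) (X Y : E) :
    extD (fun p => ∑ i ∈ s, θ i p) q X Y = ∑ i ∈ s, extD (θ i) q X Y := by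
  simp only [extD]
  rw [fderiv_fun_sum h]
  simp [Finset.sum_sub_distrib]

theorem extD_clm_comp (L : G →L[ℝ] G') {θ : E → E →L[ℝ] G} {q : E} (h : DifferentiableAt ℝ θ q)
    (X Y : E) : extD (fun p => L.comp (θ p)) q X Y = L (extD θ q X Y) := by
  have : HasFDerivAt (fun p => L.comp (θ p))
      ((ContinuousLinearMap.compL ℝ E G G' L).comp (fderiv ℝ θ q)) q :=
    (ContinuousLinearMap.compL ℝ E G G' L).hasFDerivAt.comp q h.hasFDerivAt
  simp only [extD]
  rw [this.fderiv]
  simp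

theorem extD_const_smul (c : ℂ) {θ : E → E →L[ℝ] ℂ} {q : E} (h : DifferentiableAt ℝ θ q)
    (X Y : E) : extD (fun p => c • θ p) q X Y = c * extD θ q X Y := by
  exact extD_clm_comp (ContinuousLinearMap.mul ℝ ℂ c) h X Y

theorem extD_congr {θ η : E → E →L[ℝ] G} {q : E} (h : θ =ᶠ[nhds q] η) (X Y : E) :
    extD θ q X Y = extD η q X Y := by
  simp only [extD, h.fderiv_eq]

theorem extD_const (θ : E →L[ℝ] G) (q X Y : E) : extD (fun _ => θ) q X Y = 0 := by
  simp [extD]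

theorem extD_add_left (θ : E → E →L[ℝ] G) (q X X' Y : E) :
    extD θ q (X + X') Y = extD θ q X Y + extD θ q X' Y := by
  simp only [extD, map_add, add_apply]; abel

theorem extD_smul_left (θ : E → E →L[ℝ] G) (q : E) (c : ℝ) (X Y : E) :
    extD θ q (c • X) Y = c • extD θ q X Y := by
  simp only [extD, map_smul, smul_apply, smul_sub]

end ExtDLinear

/-! ### Torsion-free quaternionic frames and their SU(2)-curvature. -/

section SymC

variable {ι : Type*} [DecidableEq ι]

theorem symC_swap (α β : ι ⊕ ι) : symC α β = -symC β α := by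
  rcases α with i | i <;> rcases β with j | j <;> simp [symC, eq_comm, apply_ite]

theorem symC_mul_symC [Fintype ι] (α β : ι ⊕ ι) :
    ∑ γ, symC α γ * symC γ β = -(if α = β then 1 else 0) := by
  rcases α with i | i <;> rcases β with j | j <;> simp [symC, Fintype.sum_sum_type]
  split_ifs <;> simp

end SymC

section Quaternionic

variable {E ι : Type*} [NormedAddCommGroup E] [NormedSpace ℝ E] [Fintype ι] [DecidableEq ι]

/-- The part of the quaternionic structure equations that involves the vielbein and the
connections, but not the `Sp(2m)`-curvature. -/
structure IsTorsionFree (D : Set E) (U : Fin 2 → ι ⊕ ι → E → E →L[ℝ] ℂ)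
    (om : Fin 3 → E → E →L[ℝ] ℝ) (Δ : ι ⊕ ι → ι ⊕ ι → E → E →L[ℝ] ℂ) : Prop where
  isOpen : IsOpen D
  finrank_eq : Module.finrank ℝ E = 4 * Fintype.card ι
  smooth_U : ∀ A α, ContDiffOn ℝ ∞ (U A α) D
  smooth_om : ∀ x, ContDiffOn ℝ ∞ (om x) D
  smooth_Δ : ∀ α β, ContDiffOn ℝ ∞ (Δ α β) D
  coframe : ∀ q ∈ D, ∀ X, (∀ A α, U A α q X = 0) → X = 0
  reality : ∀ q ∈ D, ∀ A α X,
    (starRingEnd ℂ) (U A α q X) = ∑ B, ∑ β, eps A B * symC α β * U B β q X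
  symplectic : ∀ q ∈ D, ∀ α β X,
    ∑ γ, symC α γ * Δ γ β q X = ∑ γ, symC β γ * Δ γ α q X
  antihermitian : ∀ q ∈ D, ∀ α β X, (starRingEnd ℂ) (Δ α β q X) = -Δ β α q X
  torsion : ∀ q ∈ D, ∀ A α X Y,
    extD (U A α) q X Y
      + ∑ x, ∑ B, Complex.I / 2 * pauliUp x A B *
          wedge (fun Z => (om x q Z : ℂ)) (U B α q) X Y
      + ∑ β, wedge (Δ α β q) (U A β q) X Y = 0
  su2_curvature : ∀ q ∈ D, ∀ x X Y,
    ((extD (om x) q X Y : ℝ) : ℂ)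
      + 1 / 2 * ∑ y, ∑ z, levi x y z *
          wedge (fun Z => (om y q Z : ℂ)) (fun Z => (om z q Z : ℂ)) X Y
      = Complex.I * lam * ∑ α, ∑ β, ∑ A, ∑ B,
          symC α β * pauliLow x A B * wedge (U A α q) (U B β q) X Y

variable {D : Set E} {U : Fin 2 → ι ⊕ ι → E → E →L[ℝ] ℂ} {om : Fin 3 → E → E →L[ℝ] ℝ}
  {Δ : ι ⊕ ι → ι ⊕ ι → E → E →L[ℝ] ℂ}

/-- The `SU(2)`-connection in the fundamental representation. -/
def suConn (om : Fin 3 → E → E →L[ℝ] ℝ) (A B : Fin 2) (q : E) : E →L[ℝ] ℂ :=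
  ∑ x, (Complex.I / 2 * pauliUp x A B) • Complex.ofRealCLM.comp (om x q)

/-- The total connection on the tensor product of the two bundles. -/
def totalConn (om : Fin 3 → E → E →L[ℝ] ℝ) (Δ : ι ⊕ ι → ι ⊕ ι → E → E →L[ℝ] ℂ)
    (a b : Fin 2 × (ι ⊕ ι)) (q : E) : E →L[ℝ] ℂ :=
  (if a.2 = b.2 then (1 : ℂ) else 0) • suConn om a.1 b.1 q
    + (if a.1 = b.1 then (1 : ℂ) else 0) • Δ a.2 b.2 q

/-- `k_{AB}(X, Y) = C_{γδ} U^{Aγ}(X) U^{Bδ}(Y)`. -/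
def symPair (U : Fin 2 → ι ⊕ ι → E → E →L[ℝ] ℂ) (A B : Fin 2) (q X Y : E) : ℂ :=
  ∑ γ, ∑ δ, symC γ δ * U A γ q X * U B δ q Y

theorem symPair_swap (A B : Fin 2) (q X Y : E) :
    symPair U A B q X Y = -symPair U B A q Y X := by
  simp only [symPair]
  rw [Finset.sum_comm, ← Finset.sum_neg_distrib]
  refine Finset.sum_congr rfl fun γ _ => ?_
  rw [← Finset.sum_neg_distrib]
  refine Finset.sum_congr rfl fun δ _ => ?_
  rw [symC_swap]; ring

/-- The curvature of the `SU(2)`-connection in the fundamental representation. -/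
def suCurv (om : Fin 3 → E → E →L[ℝ] ℝ) (A B : Fin 2) (q X Y : E) : ℂ :=
  extD (suConn om A B) q X Y + ∑ C, wedge (suConn om A C q) (suConn om C B q) X Y

/-- The curvature of the `Sp(2m)`-connection. -/
def spCurv (Δ : ι ⊕ ι → ι ⊕ ι → E → E →L[ℝ] ℂ) (α β : ι ⊕ ι) (q X Y : E) : ℂ :=
  extD (Δ α β) q X Y + ∑ γ, wedge (Δ α γ q) (Δ γ β q) X Y

/-- The two summands of the total connection act on different tensor factors and so commute. Their
cross terms are symmetric in the two vectors and drop out of the wedge product. -/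
theorem sum_wedge_totalConn (a b : Fin 2 × (ι ⊕ ι)) (q X Y : E) :
    ∑ c, wedge (totalConn om Δ a c q) (totalConn om Δ c b q) X Y
      = (if a.2 = b.2 then (1 : ℂ) else 0) *
          ∑ C, wedge (suConn om a.1 C q) (suConn om C b.1 q) X Y
        + (if a.1 = b.1 then (1 : ℂ) else 0) * ∑ γ, wedge (Δ a.2 γ q) (Δ γ b.2 q) X Y := by
  obtain ⟨A, α⟩ := a
  obtain ⟨B, β⟩ := b
  rw [Fintype.sum_prod_type]
  simp only [totalConn, wedge, add_apply, smul_apply,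
    smul_eq_mul]
  have h1 : ∀ (p r : E), ∑ C, ∑ γ, (((if α = γ then (1 : ℂ) else 0) * suConn om A C q p
      + (if A = C then (1 : ℂ) else 0) * Δ α γ q p) *
        ((if γ = β then (1 : ℂ) else 0) * suConn om C B q r
          + (if C = B then (1 : ℂ) else 0) * Δ γ β q r))
      = (if α = β then (1 : ℂ) else 0) * ∑ C, suConn om A C q p * suConn om C B q r
        + suConn om A B q p * Δ α β q r + Δ α β q p * suConn om A B q r
        + (if A = B then (1 : ℂ) else 0) * ∑ γ, Δ α γ q p * Δ γ β q r := by
    intro p r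
    have : ∀ C γ, (((if α = γ then (1 : ℂ) else 0) * suConn om A C q p
      + (if A = C then (1 : ℂ) else 0) * Δ α γ q p) *
        ((if γ = β then (1 : ℂ) else 0) * suConn om C B q r
          + (if C = B then (1 : ℂ) else 0) * Δ γ β q r))
        = (if α = γ then (if γ = β then suConn om A C q p * suConn om C B q r else 0) else 0)
          + (if α = γ then (if C = B then suConn om A C q p * Δ γ β q r else 0) else 0)
          + (if γ = β then (if A = C then Δ α γ q p * suConn om C B q r else 0) else 0)
          + (if A = C then (if C = B then Δ α γ q p * Δ γ β q r else 0) else 0) := by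
      intro C γ
      split_ifs <;> ring
    simp only [this, Finset.sum_add_distrib]
    rw [Finset.sum_comm (f := fun C γ => if A = C then (if C = B then Δ α γ q p * Δ γ β q r else 0) else 0)]
    simp only [Finset.sum_ite_eq, Finset.sum_ite_eq', Finset.mem_univ, if_true]
    congr 1
    · congr 1
      congr 1
      split_ifs <;> simp
    · split_ifs <;> simp
  simp only [Finset.sum_sub_distrib, h1]
  ring

theorem contDiffOn_suConn (h : ∀ x, ContDiffOn ℝ ∞ (om x) D) (A B : Fin 2) :
    ContDiffOn ℝ ∞ (suConn om A B) D := by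
  unfold suConn
  refine ContDiffOn.sum fun x _ => ContDiffOn.const_smul _ ?_
  exact contDiffOn_const.clm_comp (h x)

/-- The Pauli matrices convert the curvature equation in the adjoint representation into one for 2 ×
2 matrices. Written through the pairings k_{AB}, with k_{10} eliminated by antisymmetry, it can be
compared directly with the λ-term of the Sp(2m)-curvature. -/
theorem suCurv_eq (h : IsTorsionFree D U om Δ) {q : E} (hq : q ∈ D) (X Y : E) :
    (suCurv om 0 0 q X Y = lam * (symPair U 0 1 q X Y - symPair U 0 1 q Y X)) ∧
    (suCurv om 0 1 q X Y = -lam * (symPair U 0 0 q X Y - symPair U 0 0 q Y X)) ∧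
    (suCurv om 1 0 q X Y = lam * (symPair U 1 1 q X Y - symPair U 1 1 q Y X)) ∧
    (suCurv om 1 1 q X Y = -lam * (symPair U 0 1 q X Y - symPair U 0 1 q Y X)) := by
  have hom : ∀ x, DifferentiableAt ℝ (om x) q := fun x =>
    ((h.smooth_om x).contDiffAt (h.isOpen.mem_nhds hq)).differentiableAt (by simp)
  have hext : ∀ A B, extD (suConn om A B) q X Y
      = ∑ x, Complex.I / 2 * pauliUp x A B * ((extD (om x) q X Y : ℝ) : ℂ) := by
    intro A B
    unfold suConn
    rw [extD_sum _ fun x _ => by fun_prop]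
    refine Finset.sum_congr rfl fun x _ => ?_
    rw [extD_const_smul _ (by fun_prop), extD_clm_comp _ (hom x)]
    simp
  have hR : ∀ x, ∑ α, ∑ β, ∑ A, ∑ B, symC α β * pauliLow x A B * wedge (U A α q) (U B β q) X Y
      = ∑ A, ∑ B, pauliLow x A B * (symPair U A B q X Y - symPair U A B q Y X) := by
    intro x
    simp only [symPair, ← Finset.sum_sub_distrib, Finset.mul_sum, Fin.sum_univ_two,
      ← Finset.sum_add_distrib, wedge]
    refine Finset.sum_congr rfl fun α _ => Finset.sum_congr rfl fun β _ => ?_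
    ring
  have e : ∀ x, ((extD (om x) q X Y : ℝ) : ℂ) = Complex.I * lam *
      ∑ A, ∑ B, pauliLow x A B * (symPair U A B q X Y - symPair U A B q Y X)
      - 1 / 2 * ∑ y, ∑ z, levi x y z *
          wedge (fun Z => (om y q Z : ℂ)) (fun Z => (om z q Z : ℂ)) X Y := fun x => by
    rw [← hR, ← h.su2_curvature q hq]; ring
  have s10 := symPair_swap (U := U) 1 0 q X Y
  have s10' := symPair_swap (U := U) 1 0 q Y X
  have hI : (Complex.I) ^ 2 = -1 := Complex.I_sq
  have hI3 : (Complex.I) ^ 3 = -Complex.I := by rw [pow_succ, hI]; ring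
  have hI4 : (Complex.I) ^ 4 = 1 := by rw [pow_succ, hI3]; simp
  refine ⟨?_, ?_, ?_, ?_⟩ <;>
  · simp only [suCurv, hext, e]
    simp [Fin.sum_univ_three, Fin.sum_univ_two, suConn, wedge, pauliUp, pauliLow, pauli, eps, levi,
      s10, s10']
    ring_nf
    simp only [hI, hI3, hI4]
    ring

end Quaternionic

/-! ### The Sp(2m)-curvature and its Bianchi identity. -/

section SpCurvature

variable {E ι : Type*} [NormedAddCommGroup E] [NormedSpace ℝ E] [Fintype ι] [DecidableEq ι]
  {D : Set E} {U : Fin 2 → ι ⊕ ι → E → E →L[ℝ] ℂ} {om : Fin 3 → E → E →L[ℝ] ℝ}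
  {Δ : ι ⊕ ι → ι ⊕ ι → E → E →L[ℝ] ℂ}

/-- The part of the `Sp(2m)`-curvature that is not fixed by the scalar curvature. -/
def weylPart (U : Fin 2 → ι ⊕ ι → E → E →L[ℝ] ℂ) (Δ : ι ⊕ ι → ι ⊕ ι → E → E →L[ℝ] ℂ)
    (α β : ι ⊕ ι) (q X Y : E) : ℂ :=
  spCurv Δ α β q X Y
    - lam * ∑ A, ∑ B, ∑ γ, eps A B * symC β γ * wedge (U A α q) (U B γ q) X Y

/-- `weylPart` with its first index lowered. -/
def weylLow (U : Fin 2 → ι ⊕ ι → E → E →L[ℝ] ℂ) (Δ : ι ⊕ ι → ι ⊕ ι → E → E →L[ℝ] ℂ)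
    (σ β : ι ⊕ ι) (q X Y : E) : ℂ :=
  ∑ α, symC σ α * weylPart U Δ α β q X Y

/-- The curvature of a tensor product connection is the sum of the two curvatures, each acting on
its own factor, so the first Bianchi identity splits accordingly. -/
theorem bianchi_curv (h : IsTorsionFree D U om Δ) {q : E} (hq : q ∈ D) (A : Fin 2) (α : ι ⊕ ι)
    (X Y Z : E) :
    ∑ B, (suCurv om A B q X Y * U B α q Z + suCurv om A B q Y Z * U B α q X
        + suCurv om A B q Z X * U B α q Y)
      + ∑ β, (spCurv Δ α β q X Y * U A β q Z + spCurv Δ α β q Y Z * U A β q X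
        + spCurv Δ α β q Z X * U A β q Y) = 0 := by
  have htor : ∀ q ∈ D, ∀ (a : Fin 2 × (ι ⊕ ι)) X Y,
      extD (U a.1 a.2) q X Y + ∑ b, wedge (totalConn om Δ a b q) (U b.1 b.2 q) X Y = 0 := by
    intro q hq a X Y
    have ht := h.torsion q hq a.1 a.2 X Y
    rw [← ht, add_assoc]
    congr 1
    rw [Fintype.sum_prod_type, Finset.sum_comm (γ := Fin 3)]
    have : ∀ B β, wedge (totalConn om Δ a (B, β) q) (U B β q) X Y
        = (if a.2 = β then wedge (suConn om a.1 B q) (U B β q) X Y else 0)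
          + (if a.1 = B then wedge (Δ a.2 β q) (U B β q) X Y else 0) := by
      intro B β
      simp only [wedge, totalConn, add_apply, smul_apply, smul_eq_mul]
      split_ifs <;> ring
    simp only [this, Finset.sum_add_distrib]
    rw [Finset.sum_comm (f := fun B β => if a.1 = B then wedge (Δ a.2 β q) (U B β q) X Y else 0)]
    simp only [Finset.sum_ite_eq, Finset.mem_univ, if_true]
    congr 1
    refine Finset.sum_congr rfl fun B _ => ?_
    simp only [wedge, suConn, sum_apply, smul_apply, smul_eq_mul, Finset.sum_mul,
      ContinuousLinearMap.comp_apply, Complex.ofRealCLM_apply, ← Finset.sum_sub_distrib]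
    refine Finset.sum_congr rfl fun x _ => ?_
    ring
  have hsΓ : ∀ a b, ContDiffOn ℝ ∞ (totalConn om Δ a b) D := fun a b =>
    (ContDiffOn.const_smul _ (contDiffOn_suConn h.smooth_om _ _)).add
      (ContDiffOn.const_smul _ (h.smooth_Δ _ _))
  have hd1 : ∀ A B, DifferentiableAt ℝ (suConn om A B) q := fun A B =>
    ((contDiffOn_suConn h.smooth_om A B).contDiffAt (h.isOpen.mem_nhds hq)).differentiableAt
      (by simp)
  have hd2 : ∀ α β, DifferentiableAt ℝ (Δ α β) q := fun α β =>
    ((h.smooth_Δ α β).contDiffAt (h.isOpen.mem_nhds hq)).differentiableAt (by simp)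
  have hb := bianchi h.isOpen (U := fun a : Fin 2 × (ι ⊕ ι) => U a.1 a.2)
    (Γ := totalConn om Δ) (fun a => h.smooth_U _ _) hsΓ htor hq (A, α) X Y Z
  have hcurv : ∀ b X Y, extD (totalConn om Δ (A, α) b) q X Y
      + ∑ c, wedge (totalConn om Δ (A, α) c q) (totalConn om Δ c b q) X Y
      = (if α = b.2 then suCurv om A b.1 q X Y else 0)
        + (if A = b.1 then spCurv Δ α b.2 q X Y else 0) := by
    intro b X Y
    rw [sum_wedge_totalConn]
    unfold totalConn
    rw [extD_add ((hd1 _ _).fun_const_smul _) ((hd2 _ _).fun_const_smul _), extD_const_smul _ (hd1 _ _),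
      extD_const_smul _ (hd2 _ _)]
    simp only [suCurv, spCurv]
    split_ifs <;> ring
  simp only [hcurv] at hb
  rw [Fintype.sum_prod_type] at hb
  have hsplit : ∀ B β, ((if α = β then suCurv om A B q X Y else 0)
        + (if A = B then spCurv Δ α β q X Y else 0)) * U B β q Z
      + ((if α = β then suCurv om A B q Y Z else 0)
        + (if A = B then spCurv Δ α β q Y Z else 0)) * U B β q X
      + ((if α = β then suCurv om A B q Z X else 0)
        + (if A = B then spCurv Δ α β q Z X else 0)) * U B β q Y
      = (if α = β then (suCurv om A B q X Y * U B β q Z + suCurv om A B q Y Z * U B β q X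
        + suCurv om A B q Z X * U B β q Y) else 0)
        + (if A = B then (spCurv Δ α β q X Y * U B β q Z + spCurv Δ α β q Y Z * U B β q X
        + spCurv Δ α β q Z X * U B β q Y) else 0) := by
    intro B β
    split_ifs <;> ring
  simp only [hsplit, Finset.sum_add_distrib] at hb
  rw [Finset.sum_comm (f := fun B β => if A = B then _ else _)] at hb
  simp only [Finset.sum_ite_eq, Finset.mem_univ, if_true] at hb
  simpa only [Finset.sum_add_distrib] using hb

/-- The cyclic sum of the SU(2)-curvature cancels that of the λ-term; this is where the relative
normalization of the two curvature equations matters. There is no sum over A, so there are two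
independent identities, and the algebra of `exists_weylTensor` uses both. -/
theorem bianchi_weylPart (h : IsTorsionFree D U om Δ) {q : E} (hq : q ∈ D) (A : Fin 2)
    (α : ι ⊕ ι) (X Y Z : E) :
    ∑ β, (weylPart U Δ α β q X Y * U A β q Z + weylPart U Δ α β q Y Z * U A β q X
      + weylPart U Δ α β q Z X * U A β q Y) = 0 := by
  -- Contracting the λ-term with U^{Aβ} pairs C with two vielbeins, which is exactly the quantity
  -- k_{AB} that appears in `suCurv_eq`.
  have hk : ∀ X Y Z, ∑ β, (∑ C, ∑ B, ∑ γ, eps C B * symC β γ * wedge (U C α q) (U B γ q) X Y)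
      * U A β q Z = ∑ C, ∑ B, eps C B *
        (U C α q X * symPair U A B q Z Y - U C α q Y * symPair U A B q Z X) := by
    intro X Y Z
    simp only [Fin.sum_univ_two, symPair, Finset.mul_sum, Finset.sum_mul, add_mul,
      ← Finset.sum_add_distrib, ← Finset.sum_sub_distrib, wedge]
    refine Finset.sum_congr rfl fun β _ => Finset.sum_congr rfl fun γ _ => ?_
    ring
  have hb := bianchi_curv h hq A α X Y Z
  have e : ∑ β, (weylPart U Δ α β q X Y * U A β q Z + weylPart U Δ α β q Y Z * U A β q X
      + weylPart U Δ α β q Z X * U A β q Y)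
      = ∑ β, (spCurv Δ α β q X Y * U A β q Z + spCurv Δ α β q Y Z * U A β q X
        + spCurv Δ α β q Z X * U A β q Y)
        - lam * (∑ C, ∑ B, eps C B *
            (U C α q X * symPair U A B q Z Y - U C α q Y * symPair U A B q Z X)
          + ∑ C, ∑ B, eps C B *
            (U C α q Y * symPair U A B q X Z - U C α q Z * symPair U A B q X Y)
          + ∑ C, ∑ B, eps C B *
            (U C α q Z * symPair U A B q Y X - U C α q X * symPair U A B q Y Z)) := by
    simp only [← hk]
    rw [← Finset.sum_add_distrib, ← Finset.sum_add_distrib, Finset.mul_sum,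
      ← Finset.sum_sub_distrib]
    refine Finset.sum_congr rfl fun β _ => ?_
    simp only [weylPart]; ring
  rw [e]
  rw [add_comm] at hb
  rw [eq_neg_of_add_eq_zero_left hb]
  obtain ⟨a1, a2, a3, a4⟩ := suCurv_eq h hq X Y
  obtain ⟨b1, b2, b3, b4⟩ := suCurv_eq h hq Y Z
  obtain ⟨c1, c2, c3, c4⟩ := suCurv_eq h hq Z X
  have s : ∀ X Y, symPair U 1 0 q X Y = -symPair U 0 1 q Y X := fun X Y => symPair_swap 1 0 q X Y
  have s0 : ∀ X Y, symPair U 0 0 q X Y = -symPair U 0 0 q Y X := fun X Y => symPair_swap 0 0 q X Y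
  have s1 : ∀ X Y, symPair U 1 1 q X Y = -symPair U 1 1 q Y X := fun X Y => symPair_swap 1 1 q X Y
  fin_cases A
  · simp [Fin.sum_univ_two, eps, a1, a2, b1, b2, c1, c2]
    rw [s0 Y X, s0 Z Y, s0 X Z]
    ring
  · simp [Fin.sum_univ_two, eps, a3, a4, b3, b4, c3, c4, s]
    rw [s1 Y X, s1 Z Y, s1 X Z]
    ring

theorem bianchi_weylLow (h : IsTorsionFree D U om Δ) {q : E} (hq : q ∈ D) (A : Fin 2)
    (σ : ι ⊕ ι) (X Y Z : E) :
    ∑ β, (weylLow U Δ σ β q X Y * U A β q Z + weylLow U Δ σ β q Y Z * U A β q X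
      + weylLow U Δ σ β q Z X * U A β q Y) = 0 := by
  have : ∑ α, symC σ α * ∑ β, (weylPart U Δ α β q X Y * U A β q Z
      + weylPart U Δ α β q Y Z * U A β q X + weylPart U Δ α β q Z X * U A β q Y) = 0 := by
    simp [bianchi_weylPart h hq]
  rw [← this]
  simp only [weylLow, Finset.sum_mul, Finset.mul_sum, ← Finset.sum_add_distrib]
  rw [Finset.sum_comm]
  refine Finset.sum_congr rfl fun β _ => Finset.sum_congr rfl fun γ _ => ?_
  ring

/-- Since Δ takes values in sp, the matrices C·Δ are symmetric. So are C·dΔ and C·[Δ, Δ], while the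
λ-term is symmetric because ε and the wedge product are both antisymmetric. -/
theorem weylLow_symm (h : IsTorsionFree D U om Δ) {q : E} (hq : q ∈ D) (σ β : ι ⊕ ι) (X Y : E) :
    weylLow U Δ σ β q X Y = weylLow U Δ β σ q X Y := by
  have hd : ∀ α β, DifferentiableAt ℝ (Δ α β) q := fun α β =>
    ((h.smooth_Δ α β).contDiffAt (h.isOpen.mem_nhds hq)).differentiableAt (by simp)
  have h1 : ∑ γ, symC σ γ * extD (Δ γ β) q X Y = ∑ γ, symC β γ * extD (Δ γ σ) q X Y := by
    have e : ∀ σ β, ∑ γ, symC σ γ * extD (Δ γ β) q X Y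
        = extD (fun p => ∑ γ, symC σ γ • Δ γ β p) q X Y := by
      intro σ β
      rw [extD_sum _ fun γ _ => (hd _ _).fun_const_smul _]
      exact Finset.sum_congr rfl fun γ _ => (extD_const_smul _ (hd _ _) X Y).symm
    rw [e, e]
    apply extD_congr
    filter_upwards [h.isOpen.mem_nhds hq] with p hp
    ext Z
    simpa using h.symplectic p hp σ β Z
  have h2 : ∑ α, symC σ α * ∑ γ, wedge (Δ α γ q) (Δ γ β q) X Y
      = ∑ α, symC β α * ∑ γ, wedge (Δ α γ q) (Δ γ σ q) X Y := by
    let C : Matrix (ι ⊕ ι) (ι ⊕ ι) ℂ := Matrix.of fun α β => symC α β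
    let M : E → Matrix (ι ⊕ ι) (ι ⊕ ι) ℂ := fun X => Matrix.of fun α β => Δ α β q X
    have hC : C.transpose = -C := by ext α β; exact symC_swap β α
    -- The symplectic condition in matrix form, MᵀC = -CM; it is moved through a product of two such
    -- matrices to transpose the commutator.
    have hM : ∀ X, (M X).transpose * C = -(C * M X) := fun X => by
      have : (C * M X).transpose = C * M X := by
        ext α β
        simpa only [Matrix.mul_apply, Matrix.transpose_apply, Matrix.of_apply, C, M] using h.symplectic q hq β α X
      rw [← this, Matrix.transpose_mul, hC, mul_neg, neg_neg]
    have hP : ∀ σ β, ∑ α, symC σ α * ∑ γ, wedge (Δ α γ q) (Δ γ β q) X Y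
        = (C * (M X * M Y - M Y * M X)) σ β := by
      intro σ β
      simp only [Matrix.mul_apply, Matrix.sub_apply, Matrix.of_apply, C, M, wedge,
        ← Finset.sum_sub_distrib]
    have hT : (C * (M X * M Y - M Y * M X)).transpose = C * (M X * M Y - M Y * M X) := by
      rw [Matrix.transpose_mul, Matrix.transpose_sub, Matrix.transpose_mul, Matrix.transpose_mul,
        hC, mul_neg, sub_mul, mul_assoc, mul_assoc, hM, hM, mul_neg, mul_neg, ← mul_assoc,
        ← mul_assoc, hM, hM]
      noncomm_ring
    rw [hP, hP, ← Matrix.transpose_apply (C * (M X * M Y - M Y * M X)), hT]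
  have h3 : ∀ σ β, ∑ α, symC σ α * ∑ A, ∑ B, ∑ γ, eps A B * symC β γ *
      wedge (U A α q) (U B γ q) X Y = ∑ A, ∑ B, eps A B *
        ((∑ α, symC σ α * U A α q X) * (∑ γ, symC β γ * U B γ q Y)
          - (∑ α, symC σ α * U A α q Y) * (∑ γ, symC β γ * U B γ q X)) := by
    intro σ β
    simp only [Fin.sum_univ_two, Finset.mul_sum, Finset.sum_mul, ← Finset.sum_add_distrib,
      ← Finset.sum_sub_distrib, wedge]
    rw [Finset.sum_comm]
    refine Finset.sum_congr rfl fun α _ => Finset.sum_congr rfl fun γ _ => ?_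
    ring
  have e : ∀ σ β, weylLow U Δ σ β q X Y = ∑ γ, symC σ γ * extD (Δ γ β) q X Y
      + ∑ α, symC σ α * ∑ γ, wedge (Δ α γ q) (Δ γ β q) X Y
      - lam * ∑ α, symC σ α * ∑ A, ∑ B, ∑ γ, eps A B * symC β γ *
          wedge (U A α q) (U B γ q) X Y := by
    intro σ β
    simp only [weylLow, weylPart, spCurv]
    rw [Finset.mul_sum _ _ lam, ← Finset.sum_add_distrib, ← Finset.sum_sub_distrib]
    exact Finset.sum_congr rfl fun γ _ => by ring
  rw [e, e, h1, h2, h3, h3]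
  congr 2
  simp [Fin.sum_univ_two, eps]
  ring

end SpCurvature

/-! ### The completely symmetric tensor in the Sp(2m)-curvature. -/

section WeylTensor

variable {E ι : Type*} [NormedAddCommGroup E] [NormedSpace ℝ E] [Fintype ι] [DecidableEq ι]
  {D : Set E} {U : Fin 2 → ι ⊕ ι → E → E →L[ℝ] ℂ} {om : Fin 3 → E → E →L[ℝ] ℝ}
  {Δ : ι ⊕ ι → ι ⊕ ι → E → E →L[ℝ] ℂ}

theorem weylLow_swap (σ β : ι ⊕ ι) (q X Y : E) :
    weylLow U Δ σ β q Y X = -weylLow U Δ σ β q X Y := by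
  simp only [weylLow, weylPart, spCurv, ← Finset.sum_neg_distrib, extD_swap _ q X Y,
    wedge_swap _ _ X Y]
  refine Finset.sum_congr rfl fun α _ => ?_
  simp only [mul_neg, Finset.sum_neg_distrib]
  ring

/-- For fixed second argument, `weylLow` is a real-linear map. -/
def weylLin (U : Fin 2 → ι ⊕ ι → E → E →L[ℝ] ℂ) (Δ : ι ⊕ ι → ι ⊕ ι → E → E →L[ℝ] ℂ)
    (σ β : ι ⊕ ι) (q Y : E) : E →ₗ[ℝ] ℂ where
  toFun X := weylLow U Δ σ β q X Y
  map_add' X X' := by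
    simp only [weylLow, weylPart, spCurv, wedge, extD_add_left, map_add, Fin.sum_univ_two,
      ← Finset.sum_add_distrib, Finset.mul_sum]
    refine Finset.sum_congr rfl fun α _ => ?_
    rw [← mul_add]
    congr 1
    simp only [add_mul, mul_add, Finset.sum_add_distrib, Finset.sum_sub_distrib, mul_sub]
    ring
  map_smul' c X := by
    simp only [weylLow, weylPart, spCurv, wedge, extD_smul_left, map_smul, Fin.sum_univ_two,
      Complex.real_smul, RingHom.id_apply, Finset.mul_sum]
    refine Finset.sum_congr rfl fun α _ => ?_
    rw [mul_left_comm]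
    congr 1
    simp only [← Finset.sum_add_distrib, Finset.mul_sum, mul_sub, mul_add]
    congr 1
    · congr 1
      exact Finset.sum_congr rfl fun γ _ => by ring
    · exact Finset.sum_congr rfl fun γ _ => by ring

/-- The value of a real bilinear map on complexified vectors `x a + i y a`. -/
def complexifiedValue {V k : Type*} (T : V → V → ℂ) (x y : k → V) (a b : k) : ℂ :=
  T (x a) (x b) + Complex.I * T (x a) (y b) + Complex.I * T (y a) (x b) - T (y a) (y b)

/-- The dual-frame expansion is applied in each argument in turn; antisymmetry reduces the second
argument to the first. -/
theorem weylLow_expand {x y : Fin 2 × (ι ⊕ ι) → E} {q : E}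
    (hexp : ∀ (f : E →ₗ[ℝ] ℂ) (X : E),
      f X = ∑ a, U a.1 a.2 q X * (f (x a) + Complex.I * f (y a))) (σ β : ι ⊕ ι) (X Y : E) :
    weylLow U Δ σ β q X Y = ∑ a, ∑ b, U a.1 a.2 q X * U b.1 b.2 q Y *
      complexifiedValue (weylLow U Δ σ β q) x y a b := by
  have h1 : ∀ X Y, weylLow U Δ σ β q X Y = ∑ a, U a.1 a.2 q X *
      (weylLow U Δ σ β q (x a) Y + Complex.I * weylLow U Δ σ β q (y a) Y) := fun X Y =>
    hexp (weylLin U Δ σ β q Y) X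
  have h2 : ∀ X Y, weylLow U Δ σ β q X Y = ∑ b, U b.1 b.2 q Y *
      (weylLow U Δ σ β q X (x b) + Complex.I * weylLow U Δ σ β q X (y b)) := fun X Y => by
    rw [weylLow_swap, h1 Y X, ← Finset.sum_neg_distrib]
    refine Finset.sum_congr rfl fun a _ => ?_
    rw [weylLow_swap _ _ _ _ (x a), weylLow_swap _ _ _ _ (y a)]
    ring
  rw [h1]
  refine Finset.sum_congr rfl fun a _ => ?_
  rw [h2 (x a) Y, h2 (y a) Y, Finset.mul_sum, ← Finset.sum_add_distrib, Finset.mul_sum]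
  refine Finset.sum_congr rfl fun b _ => ?_
  simp only [complexifiedValue]
  linear_combination (U a.1 a.2 q X * U b.1 b.2 q Y * weylLow U Δ σ β q (y a) (y b))
    * Complex.I_mul_I

/-- On complexified dual vectors each factor U^{Aβ} of the Bianchi identity becomes a Kronecker
delta, which leaves a three-term relation between components. -/
theorem bianchi_complexified (h : IsTorsionFree D U om Δ) {x y : Fin 2 × (ι ⊕ ι) → E} {q : E}
    (hq : q ∈ D) (hdual : ∀ a b : Fin 2 × (ι ⊕ ι),
      U b.1 b.2 q (x a) + Complex.I * U b.1 b.2 q (y a) = if b = a then 1 else 0)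
    (σ : ι ⊕ ι) (A : Fin 2) (a b d : Fin 2 × (ι ⊕ ι)) :
    (if A = d.1 then complexifiedValue (weylLow U Δ σ d.2 q) x y a b else 0)
      + (if A = a.1 then complexifiedValue (weylLow U Δ σ a.2 q) x y b d else 0)
      + (if A = b.1 then complexifiedValue (weylLow U Δ σ b.2 q) x y d a else 0) = 0 := by
  have hs : ∀ (d : Fin 2 × (ι ⊕ ι)) (c : ι ⊕ ι → ℂ), (if A = d.1 then c d.2 else 0)
      = ∑ β, c β * (U A β q (x d) + Complex.I * U A β q (y d)) := by
    rintro ⟨B, δ⟩ c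
    simp only [hdual _ (A, _), Prod.mk.injEq, ite_and]
    split_ifs <;> simp
  rw [hs d fun β => complexifiedValue (weylLow U Δ σ β q) x y a b,
    hs a fun β => complexifiedValue (weylLow U Δ σ β q) x y b d,
    hs b fun β => complexifiedValue (weylLow U Δ σ β q) x y d a]
  have g := bianchi_weylLow h hq A σ
  -- The value of a real trilinear expression on three vectors x + iy, expanded into the eight real
  -- evaluations. Each of these is a Bianchi sum and vanishes.
  have e : ∀ G : ι ⊕ ι → E → E → E → ℂ,
      (∀ X Y Z, ∑ β, G β X Y Z = 0) →
      ∑ β, (G β (x a) (x b) (x d) + Complex.I * (G β (y a) (x b) (x d) + G β (x a) (y b) (x d)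
        + G β (x a) (x b) (y d)) - (G β (y a) (y b) (x d) + G β (y a) (x b) (y d)
        + G β (x a) (y b) (y d)) - Complex.I * G β (y a) (y b) (y d)) = 0 := by
    intro G hG
    simp only [Finset.sum_add_distrib, Finset.sum_sub_distrib, ← Finset.mul_sum, hG]
    simp
  rw [← Finset.sum_add_distrib, ← Finset.sum_add_distrib, ← e _ g]
  refine Finset.sum_congr rfl fun β _ => ?_
  simp only [complexifiedValue]
  ring_nf
  simp only [Complex.I_sq]
  ring

theorem complexifiedValue_swap {V k : Type*} {T : V → V → ℂ} (hT : ∀ X Y, T Y X = -T X Y)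
    (x y : k → V) (a b : k) : complexifiedValue T x y b a = -complexifiedValue T x y a b := by
  simp only [complexifiedValue]
  rw [hT (x a) (x b), hT (y a) (x b), hT (x a) (y b), hT (y a) (y b)]
  ring

/-- In a torsion-free quaternionic geometry with the right `SU(2)`-curvature, the `Sp(2m)`-curvature
has the form required of a quaternionic Kähler manifold. -/
theorem exists_weylTensor [FiniteDimensional ℝ E] (h : IsTorsionFree D U om Δ) {q : E}
    (hq : q ∈ D) : ∃ Ω : ι ⊕ ι → ι ⊕ ι → ι ⊕ ι → ι ⊕ ι → ℂ,
      (∀ α β X Y, weylPart U Δ α β q X Y = ∑ A, ∑ B, ∑ γ, ∑ δ, ∑ ρ,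
        eps A B * symC α ρ * Ω ρ β γ δ * wedge (U A γ q) (U B δ q) X Y) ∧
      (∀ α β γ δ, Ω α β γ δ = Ω β α γ δ) ∧ (∀ α β γ δ, Ω α β γ δ = Ω α γ β δ) ∧
      (∀ α β γ δ, Ω α β γ δ = Ω α β δ γ) := by
  obtain ⟨x, y, hdual, hexp⟩ := exists_dual_frame (k := Fin 2 × (ι ⊕ ι)) (E := E)
    (by rw [h.finrank_eq]; simp; ring) (fun a => U a.1 a.2 q)
    (fun X hX => h.coframe q hq X fun A α => hX (A, α))
    (by
      intro X Y hXY a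
      simp only [h.reality q hq]
      rw [Finset.mul_sum, ← Finset.sum_add_distrib]
      refine Finset.sum_eq_zero fun B _ => ?_
      rw [Finset.mul_sum, ← Finset.sum_add_distrib]
      refine Finset.sum_eq_zero fun β _ => ?_
      linear_combination eps a.1 B * symC a.2 β * hXY (B, β))
  set T : ι ⊕ ι → ι ⊕ ι → Fin 2 × (ι ⊕ ι) → Fin 2 × (ι ⊕ ι) → ℂ := fun σ β =>
    complexifiedValue (weylLow U Δ σ β q) x y with hT
  have hsymm : ∀ σ β a b, T σ β a b = T β σ a b := fun σ β a b => by
    simp only [hT, complexifiedValue, weylLow_symm h hq σ β]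
  have hanti : ∀ σ β a b, T σ β b a = -T σ β a b := fun σ β a b =>
    complexifiedValue_swap (fun X Y => weylLow_swap σ β q X Y) x y a b
  have hB : ∀ σ A a b d, (if A = d.1 then T σ d.2 a b else 0)
      + (if A = a.1 then T σ a.2 b d else 0) + (if A = b.1 then T σ b.2 d a else 0) = 0 :=
    fun σ A a b d => bianchi_complexified h hq hdual σ A a b d
  -- With d carrying the SU(2)-index that a and b do not have, only one of the three terms survives.
  -- Hence W has no components with equal SU(2)-indices.
  have h11 : ∀ σ β γ δ, T σ β (1, γ) (1, δ) = 0 := fun σ β γ δ => by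
    simpa using hB σ 0 (1, γ) (1, δ) (0, β)
  have h00 : ∀ σ β γ δ, T σ β (0, γ) (0, δ) = 0 := fun σ β γ δ => by
    simpa using hB σ 1 (0, γ) (0, δ) (1, β)
  -- For mixed SU(2)-indices two of the three terms survive and give the exchange of β with γ; the
  -- other value of A gives the exchange of β with δ.
  have h23 : ∀ σ β γ δ, T σ β (0, γ) (1, δ) = T σ γ (0, β) (1, δ) := fun σ β γ δ => by
    have := hB σ 0 (0, γ) (1, δ) (0, β)
    simp only [if_true, if_false, zero_ne_one] at this
    rw [hanti σ γ (0, β) (1, δ)] at this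
    linear_combination this
  have h24 : ∀ σ β γ δ, T σ β (0, γ) (1, δ) = T σ δ (0, γ) (1, β) := fun σ β γ δ => by
    have := hB σ 1 (0, γ) (1, δ) (1, β)
    simp only [if_true, one_ne_zero, if_false] at this
    rw [hanti σ δ (0, γ) (1, β)] at this
    linear_combination this
  have h34 : ∀ σ β γ δ, T σ β (0, γ) (1, δ) = T σ β (0, δ) (1, γ) := fun σ β γ δ => by
    rw [h23 σ β γ δ, h24 σ γ β δ, h23 σ δ β γ]
  -- The factor 1/2 arises because (A, B) = (1, 2) and (2, 1) contribute equally by `h34`. The sign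
  -- arises because C squares to -1, so that raising the lowered index with C changes the sign.
  refine ⟨fun α β γ δ => -T α β (0, γ) (1, δ) / 2, ?_, ?_, ?_, ?_⟩
  · intro α β X Y
    have hW : weylPart U Δ α β q X Y = -∑ ρ, symC α ρ * weylLow U Δ ρ β q X Y := by
      have : ∑ ρ, symC α ρ * weylLow U Δ ρ β q X Y
          = ∑ σ, (∑ ρ, symC α ρ * symC ρ σ) * weylPart U Δ σ β q X Y := by
        simp only [weylLow, Finset.mul_sum, Finset.sum_mul]
        rw [Finset.sum_comm]
        exact Finset.sum_congr rfl fun ρ _ => Finset.sum_congr rfl fun σ _ => by ring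
      rw [this]
      simp only [symC_mul_symC]
      simp
    have hL : ∀ ρ, weylLow U Δ ρ β q X Y
        = ∑ γ, ∑ δ, T ρ β (0, γ) (1, δ) * wedge (U 0 γ q) (U 1 δ q) X Y := by
      intro ρ
      rw [weylLow_expand (U := U) (Δ := Δ) hexp ρ β X Y]
      change ∑ a, ∑ b, U a.1 a.2 q X * U b.1 b.2 q Y * T ρ β a b = _
      simp only [Fintype.sum_prod_type, Fin.sum_univ_two, h00, h11, mul_zero,
        Finset.sum_const_zero, zero_add, add_zero]
      rw [Finset.sum_comm (f := fun γ δ => U 1 γ q X * U 0 δ q Y * T ρ β (1, γ) (0, δ)),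
        ← Finset.sum_add_distrib]
      refine Finset.sum_congr rfl fun γ _ => ?_
      rw [← Finset.sum_add_distrib]
      refine Finset.sum_congr rfl fun δ _ => ?_
      rw [hanti ρ β (0, γ) (1, δ)]
      simp only [wedge]; ring
    have hS : ∀ ρ, ∑ γ, ∑ δ, T ρ β (0, γ) (1, δ) * wedge (U 1 γ q) (U 0 δ q) X Y
        = -∑ γ, ∑ δ, T ρ β (0, γ) (1, δ) * wedge (U 0 γ q) (U 1 δ q) X Y := by
      intro ρ
      rw [Finset.sum_comm, ← Finset.sum_neg_distrib]
      refine Finset.sum_congr rfl fun γ _ => ?_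
      rw [← Finset.sum_neg_distrib]
      refine Finset.sum_congr rfl fun δ _ => ?_
      rw [h34]; simp only [wedge]; ring
    have hR : ∑ A, ∑ B, ∑ γ, ∑ δ, ∑ ρ, eps A B * symC α ρ * (-T ρ β (0, γ) (1, δ) / 2)
          * wedge (U A γ q) (U B δ q) X Y
        = ∑ ρ, symC α ρ * (-1 / 2 * (
          ∑ γ, ∑ δ, T ρ β (0, γ) (1, δ) * wedge (U 0 γ q) (U 1 δ q) X Y
          - ∑ γ, ∑ δ, T ρ β (0, γ) (1, δ) * wedge (U 1 γ q) (U 0 δ q) X Y)) := by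
      simp only [Fin.sum_univ_two, ← Finset.sum_add_distrib, ← Finset.sum_sub_distrib,
        Finset.mul_sum]
      conv_rhs => rw [Finset.sum_comm]
      refine Finset.sum_congr rfl fun γ _ => ?_
      conv_rhs => rw [Finset.sum_comm]
      refine Finset.sum_congr rfl fun δ _ => Finset.sum_congr rfl fun ρ _ => ?_
      simp [eps]; ring
    rw [hR, hW, ← Finset.sum_neg_distrib]
    refine Finset.sum_congr rfl fun ρ _ => ?_
    rw [hS, hL]; ring
  · intro α β γ δ
    simp only [hsymm α β]
  · intro α β γ δ
    simp only [h23 α β γ δ]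
  · intro α β γ δ
    simp only [h34 α β γ δ]

/-- The tensor is chosen point by point, since no regularity of Ω in q is part of the structure.
Outside D, where no condition is imposed, it is set to zero. -/
theorem exists_isQuaternionic [FiniteDimensional ℝ E] (h : IsTorsionFree D U om Δ) :
    ∃ Ω : E → ι ⊕ ι → ι ⊕ ι → ι ⊕ ι → ι ⊕ ι → ℂ, IsQuaternionic D U om Δ Ω := by
  classical
  have := fun q : D => exists_weylTensor h q.2
  choose Ω h1 h2 h3 h4 using this
  refine ⟨fun q => if hq : q ∈ D then Ω ⟨q, hq⟩ else 0, h.isOpen, h.finrank_eq, h.smooth_U,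
    h.smooth_om, h.smooth_Δ, h.coframe, h.reality, h.symplectic, h.antihermitian, h.torsion,
    h.su2_curvature, ?_, ?_, ?_, ?_⟩
  · intro q hq α β X Y
    simp only [dif_pos hq]
    rw [← h1 ⟨q, hq⟩ α β X Y]
    simp only [weylPart, spCurv]
    ring
  all_goals
    intro q hq α β γ δ
    simp only [dif_pos hq]
  · exact h2 ⟨q, hq⟩ α β γ δ
  · exact h3 ⟨q, hq⟩ α β γ δ
  · exact h4 ⟨q, hq⟩ α β γ δ

end WeylTensor

/-! ### The structure equations in undotted components, and the components Ω_{İJ̇KL̇}. -/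

section Blocks

variable {E ι : Type*} [NormedAddCommGroup E] [NormedSpace ℝ E] [Fintype ι] [DecidableEq ι]
  {D : Set E} {θ₁ θ₂ : ι → E → E →L[ℝ] ℂ} {om : Fin 3 → E → E →L[ℝ] ℝ}

theorem conjForm_apply (θ : E → E →L[ℝ] ℂ) (q X : E) :
    conjForm θ q X = (starRingEnd ℂ) (θ q X) := rfl

theorem extD_conjForm {θ : E → E →L[ℝ] ℂ} {q : E} (h : DifferentiableAt ℝ θ q) (X Y : E) :
    extD (conjForm θ) q X Y = (starRingEnd ℂ) (extD θ q X Y) :=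
  extD_clm_comp (Complex.conjCLE : ℂ →L[ℝ] ℂ) h X Y

theorem contDiffOn_conjForm {θ : E → E →L[ℝ] ℂ} (h : ContDiffOn ℝ ∞ θ D) :
    ContDiffOn ℝ ∞ (conjForm θ) D :=
  contDiffOn_const.clm_comp h

theorem conj_wedge {T : Type*} (a b : T → ℂ) (X Y : T) : (starRingEnd ℂ) (wedge a b X Y)
    = wedge (fun Z => (starRingEnd ℂ) (a Z)) (fun Z => (starRingEnd ℂ) (b Z)) X Y := by
  simp [wedge]

theorem sum_symC_mul (F : ι ⊕ ι → ι ⊕ ι → ℂ) :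
    ∑ α, ∑ β, symC α β * F α β = ∑ I, (F (Sum.inl I) (Sum.inr I) - F (Sum.inr I) (Sum.inl I)) := by
  simp [Fintype.sum_sum_type, symC, sub_eq_add_neg, Finset.sum_add_distrib, add_comm]

theorem wedge_comm {T : Type*} (a b : T → ℂ) (X Y : T) : wedge a b X Y = -wedge b a X Y := by
  simp only [wedge]; ring

theorem hypMetric_vielbeinOf (q X Y : E) :
    hypMetric (vielbeinOf θ₁ θ₂) q X Y = 2 * ∑ I, (θ₁ I q X * (starRingEnd ℂ) (θ₁ I q Y)
      + θ₂ I q X * (starRingEnd ℂ) (θ₂ I q Y)).re := by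
  have : ∀ A B, ∑ α, ∑ β, eps A B * symC α β * vielbeinOf θ₁ θ₂ A α q X * vielbeinOf θ₁ θ₂ B β q Y
      = ∑ α, ∑ β, symC α β * (eps A B * vielbeinOf θ₁ θ₂ A α q X * vielbeinOf θ₁ θ₂ B β q Y) :=
    fun A B => Finset.sum_congr rfl fun α _ => Finset.sum_congr rfl fun β _ => by ring
  simp only [hypMetric, this, sum_symC_mul, Fin.sum_univ_two, ← Finset.sum_add_distrib]
  rw [Complex.re_sum, Finset.mul_sum]
  refine Finset.sum_congr rfl fun I _ => ?_
  simp [eps, vielbeinOf, conjForm_apply]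
  ring

theorem su2_rhs_zero (q X Y : E) :
    ∑ α, ∑ β, ∑ A, ∑ B, symC α β * pauliLow 0 A B *
        wedge (vielbeinOf θ₁ θ₂ A α q) (vielbeinOf θ₁ θ₂ B β q) X Y
      = -2 * ∑ I, (wedge (θ₁ I q) (conjForm (θ₂ I) q) X Y
        + wedge (θ₂ I q) (conjForm (θ₁ I) q) X Y) := by
  simp only [mul_assoc, ← Finset.mul_sum, sum_symC_mul]
  simp only [Finset.mul_sum]
  refine Finset.sum_congr rfl fun I _ => ?_
  simp [Fin.sum_univ_two, pauliLow, pauli, eps, vielbeinOf, wedge]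
  ring

theorem su2_rhs_one (q X Y : E) :
    ∑ α, ∑ β, ∑ A, ∑ B, symC α β * pauliLow 1 A B *
        wedge (vielbeinOf θ₁ θ₂ A α q) (vielbeinOf θ₁ θ₂ B β q) X Y
      = 2 * Complex.I * ∑ I, (wedge (θ₁ I q) (conjForm (θ₂ I) q) X Y
        - wedge (θ₂ I q) (conjForm (θ₁ I) q) X Y) := by
  simp only [mul_assoc, ← Finset.mul_sum, sum_symC_mul]
  simp only [Finset.mul_sum]
  refine Finset.sum_congr rfl fun I _ => ?_
  simp [Fin.sum_univ_two, pauliLow, pauli, eps, vielbeinOf, wedge]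
  ring

theorem su2_rhs_two (q X Y : E) :
    ∑ α, ∑ β, ∑ A, ∑ B, symC α β * pauliLow 2 A B *
        wedge (vielbeinOf θ₁ θ₂ A α q) (vielbeinOf θ₁ θ₂ B β q) X Y
      = -2 * ∑ I, (wedge (θ₁ I q) (conjForm (θ₁ I) q) X Y
        - wedge (θ₂ I q) (conjForm (θ₂ I) q) X Y) := by
  simp only [mul_assoc, ← Finset.mul_sum, sum_symC_mul]
  simp only [Finset.mul_sum]
  refine Finset.sum_congr rfl fun I _ => ?_
  simp [Fin.sum_univ_two, pauliLow, pauli, eps, vielbeinOf, wedge]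
  ring

/-- The `usp(2m)`-valued connection with blocks `Δ^I_J = A`, `Δ^I_{J̇} = B`. -/
def spConn (A B : ι → ι → E → E →L[ℝ] ℂ) : ι ⊕ ι → ι ⊕ ι → E → E →L[ℝ] ℂ
  | Sum.inl I, Sum.inl J => A I J
  | Sum.inl I, Sum.inr J => B I J
  | Sum.inr I, Sum.inl J => -conjForm (B I J)
  | Sum.inr I, Sum.inr J => conjForm (A I J)

/-- The form `ω¹ + i ω²`. -/
def omPlus (om : Fin 3 → E → E →L[ℝ] ℝ) (q : E) : E →L[ℝ] ℂ :=
  Complex.ofRealCLM.comp (om 0 q) + Complex.I • Complex.ofRealCLM.comp (om 1 q)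

theorem omPlus_apply (q X : E) : omPlus om q X = om 0 q X + Complex.I * om 1 q X := by
  simp [omPlus]

/-- By reality the dotted torsion equations are the complex conjugates of the undotted ones, and the
curvature equations of ω¹ and ω² are the real and imaginary parts of one equation for ω¹ + iω². What
remains is the minimal list to be checked in an example. -/
theorem isTorsionFree_of_blocks {A B : ι → ι → E → E →L[ℝ] ℂ} (isOpen : IsOpen D)
    (finrank_eq : Module.finrank ℝ E = 4 * Fintype.card ι)
    (h₁ : ∀ I, ContDiffOn ℝ ∞ (θ₁ I) D) (h₂ : ∀ I, ContDiffOn ℝ ∞ (θ₂ I) D)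
    (hom : ∀ x, ContDiffOn ℝ ∞ (om x) D)
    (hA : ∀ I J, ContDiffOn ℝ ∞ (A I J) D) (hB : ∀ I J, ContDiffOn ℝ ∞ (B I J) D)
    (coframe : ∀ q ∈ D, ∀ X, (∀ I, θ₁ I q X = 0) → (∀ I, θ₂ I q X = 0) → X = 0)
    (antiherm : ∀ q ∈ D, ∀ I J X, (starRingEnd ℂ) (A I J q X) = -A J I q X)
    (symm : ∀ q ∈ D, ∀ I J X, B I J q X = B J I q X)
    (tor₁ : ∀ q ∈ D, ∀ I X Y, extD (θ₁ I) q X Y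
      + Complex.I / 2 * wedge (fun Z => (om 2 q Z : ℂ)) (θ₁ I q) X Y
      + Complex.I / 2 * wedge (omPlus om q) (θ₂ I q) X Y
      + ∑ J, (wedge (A I J q) (θ₁ J q) X Y - wedge (B I J q) (conjForm (θ₂ J) q) X Y) = 0)
    (tor₂ : ∀ q ∈ D, ∀ I X Y, extD (θ₂ I) q X Y
      + Complex.I / 2 * wedge (conjForm (omPlus om) q) (θ₁ I q) X Y
      - Complex.I / 2 * wedge (fun Z => (om 2 q Z : ℂ)) (θ₂ I q) X Y
      + ∑ J, (wedge (A I J q) (θ₂ J q) X Y + wedge (B I J q) (conjForm (θ₁ J) q) X Y) = 0)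
    (curv₃ : ∀ q ∈ D, ∀ X Y, ((extD (om 2) q X Y : ℝ) : ℂ)
      + wedge (fun Z => (om 0 q Z : ℂ)) (fun Z => (om 1 q Z : ℂ)) X Y
      = 2 * Complex.I * ∑ I, (wedge (θ₁ I q) (conjForm (θ₁ I) q) X Y
        - wedge (θ₂ I q) (conjForm (θ₂ I) q) X Y))
    (curvP : ∀ q ∈ D, ∀ X Y, extD (omPlus om) q X Y
      + Complex.I * wedge (fun Z => (om 2 q Z : ℂ)) (omPlus om q) X Y
      = 4 * Complex.I * ∑ I, wedge (θ₁ I q) (conjForm (θ₂ I) q) X Y) :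
    IsTorsionFree D (vielbeinOf θ₁ θ₂) om (spConn A B) := by
  have d₁ : ∀ q ∈ D, ∀ I, DifferentiableAt ℝ (θ₁ I) q := fun q hq I =>
    ((h₁ I).contDiffAt (isOpen.mem_nhds hq)).differentiableAt (by simp)
  have d₂ : ∀ q ∈ D, ∀ I, DifferentiableAt ℝ (θ₂ I) q := fun q hq I =>
    ((h₂ I).contDiffAt (isOpen.mem_nhds hq)).differentiableAt (by simp)
  have dom : ∀ q ∈ D, ∀ x, DifferentiableAt ℝ (om x) q := fun q hq x =>
    ((hom x).contDiffAt (isOpen.mem_nhds hq)).differentiableAt (by simp)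
  have eom : ∀ q ∈ D, ∀ X Y, extD (omPlus om) q X Y
      = extD (om 0) q X Y + Complex.I * extD (om 1) q X Y := by
    intro q hq X Y
    have d0 := dom q hq 0
    have d1 := dom q hq 1
    unfold omPlus
    rw [extD_add (by fun_prop) (by fun_prop), extD_const_smul _ (by fun_prop),
      extD_clm_comp _ d0, extD_clm_comp _ d1]
    simp
  -- The complex conjugate of `curvP`; half the sum and half the difference of the two isolate ω¹
  -- and ω².
  have curvBar : ∀ q ∈ D, ∀ X Y, extD (om 0) q X Y - Complex.I * extD (om 1) q X Y
      - Complex.I * wedge (fun Z => (om 2 q Z : ℂ)) (conjForm (omPlus om) q) X Y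
      = 4 * Complex.I * ∑ I, wedge (θ₂ I q) (conjForm (θ₁ I) q) X Y := by
    intro q hq X Y
    have := congrArg (starRingEnd ℂ) (curvP q hq X Y)
    rw [eom q hq] at this
    have e : ∑ I, (starRingEnd ℂ) (wedge (θ₁ I q) (conjForm (θ₂ I) q) X Y)
        = -∑ I, wedge (θ₂ I q) (conjForm (θ₁ I) q) X Y := by
      rw [← Finset.sum_neg_distrib]
      refine Finset.sum_congr rfl fun I _ => ?_
      simp [wedge, conjForm_apply]; ring
    have e' : (starRingEnd ℂ) (wedge (fun Z => (om 2 q Z : ℂ)) (omPlus om q) X Y)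
        = wedge (fun Z => (om 2 q Z : ℂ)) (conjForm (omPlus om) q) X Y := by
      simp [wedge, conjForm_apply]
    simp only [map_add, map_mul, map_sum, Complex.conj_ofReal, Complex.conj_I, map_ofNat, e, e']
      at this
    linear_combination this
  refine ⟨isOpen, finrank_eq, ?_, hom, ?_, ?_, ?_, ?_, ?_, ?_, ?_⟩
  · intro C α
    fin_cases C <;> rcases α with I | I
    · exact h₁ I
    · exact (contDiffOn_conjForm (h₂ I)).neg
    · exact h₂ I
    · exact contDiffOn_conjForm (h₁ I)
  · intro α β
    rcases α with I | I <;> rcases β with J | J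
    · exact hA I J
    · exact hB I J
    · exact (contDiffOn_conjForm (hB I J)).neg
    · exact contDiffOn_conjForm (hA I J)
  · intro q hq X hX
    exact coframe q hq X (fun I => hX 0 (Sum.inl I)) (fun I => hX 1 (Sum.inl I))
  · intro q hq C α X
    fin_cases C <;> rcases α with I | I <;>
      simp [Fin.sum_univ_two, eps, symC, vielbeinOf, conjForm_apply]
  · intro q hq α β X
    rcases α with I | I <;> rcases β with J | J <;>
      simp [symC, spConn, conjForm_apply, antiherm q hq, symm q hq I J]
  · intro q hq α β X
    rcases α with I | I <;> rcases β with J | J <;>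
      simp [spConn, conjForm_apply, antiherm q hq, symm q hq I J]
  · intro q hq C α X Y
    have t1 := fun I => tor₁ q hq I X Y
    have t2 := fun I => tor₂ q hq I X Y
    have c1 := fun I => congrArg (starRingEnd ℂ) (t1 I)
    have c2 := fun I => congrArg (starRingEnd ℂ) (t2 I)
    simp only [map_add, map_sub, map_sum, map_mul, map_zero, map_div₀, Complex.conj_I, map_ofNat,
      conj_wedge, ← extD_conjForm (d₁ q hq _), ← extD_conjForm (d₂ q hq _)] at c1 c2
    simp only [Finset.sum_add_distrib, Finset.sum_sub_distrib] at t1 t2 c1 c2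
    fin_cases C <;> rcases α with I | I
    · rw [← t1 I]
      simp [Fin.sum_univ_three, Fin.sum_univ_two, pauliUp, pauli, eps, vielbeinOf, spConn, wedge,
        omPlus, conjForm_apply]
      ring
    · have := c2 I
      simp [Fin.sum_univ_three, Fin.sum_univ_two, pauliUp, pauli, eps, vielbeinOf, spConn, wedge,
        omPlus, conjForm_apply] at this ⊢
      rw [show (-conjForm (θ₂ I)) = fun p => -conjForm (θ₂ I) p from rfl, extD_neg]
      linear_combination (exp := 1) -this
    · rw [← t2 I]
      simp [Fin.sum_univ_three, Fin.sum_univ_two, pauliUp, pauli, eps, vielbeinOf, spConn, wedge,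
        omPlus, conjForm_apply]
      ring
    · have := c1 I
      simp [Fin.sum_univ_three, Fin.sum_univ_two, pauliUp, pauli, eps, vielbeinOf, spConn, wedge,
        omPlus, conjForm_apply] at this ⊢
      linear_combination (exp := 1) this
  · intro q hq x X Y
    have c1 := curvP q hq X Y
    have c2 := curvBar q hq X Y
    have c3 := curv₃ q hq X Y
    rw [eom q hq] at c1
    have hw₁ : wedge (fun Z => (om 2 q Z : ℂ)) (omPlus om q) X Y
        = wedge (fun Z => (om 2 q Z : ℂ)) (fun Z => (om 0 q Z : ℂ)) X Y
          + Complex.I * wedge (fun Z => (om 2 q Z : ℂ)) (fun Z => (om 1 q Z : ℂ)) X Y := by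
      simp only [wedge, omPlus_apply]; ring
    have hw₂ : wedge (fun Z => (om 2 q Z : ℂ)) (conjForm (omPlus om) q) X Y
        = wedge (fun Z => (om 2 q Z : ℂ)) (fun Z => (om 0 q Z : ℂ)) X Y
          - Complex.I * wedge (fun Z => (om 2 q Z : ℂ)) (fun Z => (om 1 q Z : ℂ)) X Y := by
      simp only [wedge, omPlus_apply, conjForm_apply, map_add, map_mul, Complex.conj_I,
        Complex.conj_ofReal]
      ring
    rw [hw₁] at c1
    rw [hw₂] at c2
    -- Only two of the nine terms are nonzero, and they are equal. The indices x + 1 and x + 2 are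
    -- taken modulo 3.
    have hlevi : ∀ x, ∑ y, ∑ z, levi x y z * wedge (fun Z => (om y q Z : ℂ))
        (fun Z => (om z q Z : ℂ)) X Y
        = 2 * wedge (fun Z => (om (x + 1) q Z : ℂ)) (fun Z => (om (x + 2) q Z : ℂ)) X Y := by
      intro x
      fin_cases x <;> simp [Fin.sum_univ_three, levi, wedge] <;> ring_nf
    rw [hlevi]
    fin_cases x
    · change ((extD (om 0) q X Y : ℝ) : ℂ) + 1 / 2 * (2 * wedge (fun Z => (om 1 q Z : ℂ)) (fun Z => (om 2 q Z : ℂ)) X Y)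
        = Complex.I * lam * ∑ α, ∑ β, ∑ A, ∑ B, symC α β * pauliLow 0 A B * _
      rw [su2_rhs_zero, Finset.sum_add_distrib, wedge_comm (fun Z => (om 1 q Z : ℂ))]
      simp only [lam]
      linear_combination (c1 + c2) / 2 - wedge (fun Z => (om 2 q Z : ℂ))
        (fun Z => (om 1 q Z : ℂ)) X Y * Complex.I_mul_I
    · change ((extD (om 1) q X Y : ℝ) : ℂ) + 1 / 2 * (2 * wedge (fun Z => (om 2 q Z : ℂ)) (fun Z => (om 0 q Z : ℂ)) X Y)
        = Complex.I * lam * ∑ α, ∑ β, ∑ A, ∑ B, symC α β * pauliLow 1 A B * _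
      rw [su2_rhs_one, Finset.sum_sub_distrib]
      -- The difference of `c1` and `c2` contains dω² with the coefficient 2i, which is cancelled
      -- here.
      refine mul_left_cancel₀ (mul_ne_zero two_ne_zero Complex.I_ne_zero) ?_
      simp only [lam]
      linear_combination c1 - c2 + 4 * Complex.I * (∑ I, wedge (θ₁ I q) (conjForm (θ₂ I) q) X Y
        - ∑ I, wedge (θ₂ I q) (conjForm (θ₁ I) q) X Y) * Complex.I_mul_I
    · change ((extD (om 2) q X Y : ℝ) : ℂ) + 1 / 2 * (2 * wedge (fun Z => (om 0 q Z : ℂ)) (fun Z => (om 1 q Z : ℂ)) X Y)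
        = Complex.I * lam * ∑ α, ∑ β, ∑ A, ∑ B, symC α β * pauliLow 2 A B * _
      rw [su2_rhs_two]
      simp only [lam]
      linear_combination c3

/-- If the components `R^I_{J̇}` of the curvature vanish on the plane `U^{2I} = 0`, then so do the
components `Ω_{İ J̇ K L̇}`. -/
theorem weylTensor_eq_zero [FiniteDimensional ℝ E] {Δ : ι ⊕ ι → ι ⊕ ι → E → E →L[ℝ] ℂ}
    {Ω : E → ι ⊕ ι → ι ⊕ ι → ι ⊕ ι → ι ⊕ ι → ℂ}
    (h : IsQuaternionic D (vielbeinOf θ₁ θ₂) om Δ Ω) {q : E} (hq : q ∈ D)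
    (hR : ∀ X Y, (∀ I, θ₂ I q X = 0) → (∀ I, θ₂ I q Y = 0) → ∀ I J,
      spCurv Δ (Sum.inl I) (Sum.inr J) q X Y = 0) (I J K L : ι) :
    Ω q (Sum.inr I) (Sum.inr J) (Sum.inl K) (Sum.inr L) = 0 := by
  -- The undotted vielbein identifies the real tangent space with ℂ^m × ℂ^m, so U^{1I} may take
  -- arbitrary values on the plane U^{2I} = 0.
  let Ψ : E →ₗ[ℝ] (ι → ℂ) × (ι → ℂ) :=
    { toFun := fun X => (fun I => θ₁ I q X, fun I => θ₂ I q X)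
      map_add' := by intro X Y; ext <;> simp
      map_smul' := by intro c X; ext <;> simp }
  have hinj : Function.Injective Ψ := by
    rw [← LinearMap.ker_eq_bot, LinearMap.ker_eq_bot']
    intro X hX
    have h1 : ∀ I, θ₁ I q X = 0 := fun I => congrFun (congrArg Prod.fst hX) I
    have h2 : ∀ I, θ₂ I q X = 0 := fun I => congrFun (congrArg Prod.snd hX) I
    refine h.coframe q hq X fun A α => ?_
    fin_cases A <;> rcases α with I | I <;> simp [vielbeinOf, conjForm_apply, h1, h2]
  have hsurj : Function.Surjective Ψ := by
    refine (LinearMap.injective_iff_surjective_of_finrank_eq_finrank ?_).1 hinj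
    rw [h.finrank_eq, Module.finrank_prod, Module.finrank_pi_fintype]
    simp [Complex.finrank_real_complex]; ring
  -- On this plane U^{1İ} also vanishes, hence so does the λ-term of R^I_{J̇}. In the Ω-term only
  -- the products of U^{1K} with U^{2L̇}, the conjugate of U^{1L}, survive.
  have key : ∀ a b : ι → ℂ, ∑ K, ∑ L, Ω q (Sum.inr I) (Sum.inr J) (Sum.inl K) (Sum.inr L) *
      (a K * (starRingEnd ℂ) (b L) - b K * (starRingEnd ℂ) (a L)) = 0 := by
    intro a b
    obtain ⟨X, hX⟩ := hsurj (a, 0)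
    obtain ⟨Y, hY⟩ := hsurj (b, 0)
    have hX1 : ∀ I, θ₁ I q X = a I := fun I => congrFun (congrArg Prod.fst hX) I
    have hX2 : ∀ I, θ₂ I q X = 0 := fun I => congrFun (congrArg Prod.snd hX) I
    have hY1 : ∀ I, θ₁ I q Y = b I := fun I => congrFun (congrArg Prod.fst hY) I
    have hY2 : ∀ I, θ₂ I q Y = 0 := fun I => congrFun (congrArg Prod.snd hY) I
    have hc := h.sp_curvature q hq (Sum.inl I) (Sum.inr J) X Y
    have h0 := hR X Y hX2 hY2 I J
    unfold spCurv at h0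
    rw [h0] at hc
    simp [Fin.sum_univ_two, eps, symC, vielbeinOf, wedge, conjForm_apply, hX1, hX2, hY1, hY2]
      at hc
    rw [Finset.sum_comm (f := fun x y => Ω q (Sum.inr I) (Sum.inr J) (Sum.inr x) (Sum.inl y) * _),
      ← Finset.sum_neg_distrib, ← Finset.sum_add_distrib] at hc
    have h2 : (0 : ℂ) = 2 * ∑ K, ∑ L, Ω q (Sum.inr I) (Sum.inr J) (Sum.inl K) (Sum.inr L) *
      (a K * (starRingEnd ℂ) (b L) - b K * (starRingEnd ℂ) (a L)) := by
      rw [hc, Finset.mul_sum]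
      refine Finset.sum_congr rfl fun K _ => ?_
      rw [← Finset.sum_neg_distrib, ← Finset.sum_add_distrib, Finset.mul_sum]
      refine Finset.sum_congr rfl fun L _ => ?_
      rw [h.symm₃₄ q hq _ _ (Sum.inr L) (Sum.inl K)]
      ring
    simpa using h2.symm
  -- Replacing b by ib separates the part antilinear in b from the part linear in b, so the single
  -- component Ω_{İJ̇KL̇} can be isolated.
  have k1 := key (Pi.single K 1) (Pi.single L 1)
  have k2 := key (Pi.single K 1) (Pi.single L Complex.I)
  simp only [mul_sub, Finset.sum_sub_distrib, Pi.single_apply, apply_ite (starRingEnd ℂ), map_one,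
    map_zero, Complex.conj_I, ite_mul, one_mul, zero_mul, mul_ite, mul_zero, mul_one,
    Finset.sum_ite_eq', Finset.mem_univ, if_true] at k1 k2
  linear_combination (k1 + Complex.I * k2) / 2 + (1 / 2) *
    (Ω q (Sum.inr I) (Sum.inr J) (Sum.inl K) (Sum.inr L)
      + Ω q (Sum.inr I) (Sum.inr J) (Sum.inl L) (Sum.inr K)) * Complex.I_mul_I

end Blocks

/-! ### Pull-backs and the Kähler-Hodge reduction. -/

section Pull

variable {E F G : Type*} [NormedAddCommGroup E] [NormedSpace ℝ E] [NormedAddCommGroup F]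
  [NormedSpace ℝ F] [NormedAddCommGroup G] [NormedSpace ℝ G] {D : Set E} {N : Set F} {j : F → E}

theorem pull_apply (θ : E → E →L[ℝ] G) (j : F → E) (y X : F) :
    pull θ j y X = θ (j y) (fderiv ℝ j y X) := rfl

theorem contDiffOn_pull {θ : E → E →L[ℝ] G} (hN : IsOpen N) (hθ : ContDiffOn ℝ ∞ θ D)
    (hj : ContDiffOn ℝ ∞ j N) (hm : Set.MapsTo j N D) : ContDiffOn ℝ ∞ (pull θ j) N :=
  (hθ.comp hj hm).clm_comp (hj.fderiv_of_isOpen hN (by simp))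

/-- Naturality of d: the terms with second derivatives of j cancel in the antisymmetrization. -/
theorem extD_pull {θ : E → E →L[ℝ] G} {y : F} (hθ : DifferentiableAt ℝ θ (j y))
    (hj : ContDiffAt ℝ ∞ j y) (X Y : F) :
    extD (pull θ j) y X Y = extD θ (j y) (fderiv ℝ j y X) (fderiv ℝ j y Y) := by
  have h1 : DifferentiableAt ℝ (fderiv ℝ j) y :=
    (hj.fderiv_right (m := ∞) (by simp)).differentiableAt (by simp)
  have h2 : HasFDerivAt (fun y => θ (j y)) ((fderiv ℝ θ (j y)).comp (fderiv ℝ j y)) y :=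
    hθ.hasFDerivAt.comp y (hj.differentiableAt (by simp)).hasFDerivAt
  have hs : IsSymmSndFDerivAt ℝ j y :=
    hj.isSymmSndFDerivAt (by simpa using WithTop.coe_le_coe.2 (le_top : (2 : ℕ∞) ≤ ⊤))
  have h3 := (h2.clm_comp h1.hasFDerivAt).fderiv
  simp only [extD]
  unfold pull
  rw [h3]
  simp [hs.eq X Y]

end Pull

section Reduction

variable {E F ι : Type*} [NormedAddCommGroup E] [NormedSpace ℝ E] [NormedAddCommGroup F]
  [NormedSpace ℝ F] [FiniteDimensional ℝ F] [Fintype ι] [DecidableEq ι]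
  {D : Set E} {θ₁ θ₂ : ι → E → E →L[ℝ] ℂ} {om : Fin 3 → E → E →L[ℝ] ℝ}
  {Δ : ι ⊕ ι → ι ⊕ ι → E → E →L[ℝ] ℂ} {N : Set F} {j : F → E}

/-- The forms `U^{2İ}` pulled back to the submanifold, as a map to `ℂ^m`. -/
def holFrame (θ₁ : ι → E → E →L[ℝ] ℂ) (j : F → E) (y : F) : F →L[ℝ] (ι → ℂ) :=
  ContinuousLinearMap.pi fun I => pull (conjForm (θ₁ I)) j y

/-- The complex structure for which the forms `U^{2İ}` are of type `(1,0)`. -/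
def holStructure (θ₁ : ι → E → E →L[ℝ] ℂ) (j : F → E) (y : F) : F →L[ℝ] F :=
  (holFrame θ₁ j y).inverse.comp
    ((Complex.I • ContinuousLinearMap.id ℝ (ι → ℂ)).comp (holFrame θ₁ j y))

/-- The Kähler property needs no separate verification. The torsion equation restricted to N gives
integrability, and the restricted curvature of ω³ exhibits the fundamental form as a multiple of an
exact form. -/
theorem isKahlerHodgeReduction_of_pull_eq_zero
    (h : IsTorsionFree D (vielbeinOf θ₁ θ₂) om Δ)
    (hN : IsOpen N) (half_dim : 2 * Module.finrank ℝ F = Module.finrank ℝ E)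
    (hj : ContDiffOn ℝ ∞ j N) (hm : Set.MapsTo j N D)
    (embedding : Topology.IsEmbedding (N.domRestrict j))
    (immersion : ∀ y ∈ N, Function.Injective (fderiv ℝ j y))
    (hU : ∀ y ∈ N, ∀ I, pull (θ₂ I) j y = 0)
    (hom₁ : ∀ y ∈ N, pull (om 0) j y = 0) (hom₂ : ∀ y ∈ N, pull (om 1) j y = 0)
    (hΔ : ∀ y ∈ N, ∀ I J, pull (Δ (Sum.inl I) (Sum.inr J)) j y = 0) :
    IsKahlerHodgeReduction D (vielbeinOf θ₁ θ₂) om Δ N j := by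
  have hUz : ∀ y ∈ N, ∀ I X, θ₂ I (j y) (fderiv ℝ j y X) = 0 := fun y hy I X => by
    rw [← pull_apply, hU y hy I]; rfl
  have hjy : ∀ y ∈ N, ContDiffAt ℝ ∞ j y := fun y hy => hj.contDiffAt (hN.mem_nhds hy)
  set η : ι → F → F →L[ℝ] ℂ := fun I => pull (conjForm (θ₁ I)) j with hη
  have ηs : ∀ I, ContDiffOn ℝ ∞ (η I) N := fun I =>
    contDiffOn_pull hN (h.smooth_U 1 (Sum.inr I)) hj hm
  have ηd : ∀ I, ∀ y ∈ N, DifferentiableAt ℝ (η I) y := fun I y hy =>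
    ((ηs I).contDiffAt (hN.mem_nhds hy)).differentiableAt (by simp)
  have θη : ∀ I y X, θ₁ I (j y) (fderiv ℝ j y X) = (starRingEnd ℂ) (η I y X) := fun I y X => by
    simp [hη, pull_apply, conjForm_apply]
  have ηinj : ∀ y ∈ N, ∀ X, (∀ I, η I y X = 0) → X = 0 := by
    intro y hy X hX
    apply immersion y hy
    rw [map_zero]
    refine h.coframe (j y) (hm hy) _ fun A α => ?_
    fin_cases A <;> rcases α with I | I <;>
      simp [vielbeinOf, conjForm_apply, hUz y hy, θη, hX]
  have hfin : Module.finrank ℝ F = Module.finrank ℝ (ι → ℂ) := by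
    have := h.finrank_eq
    rw [Module.finrank_pi_fintype]
    simp only [Complex.finrank_real_complex, Finset.sum_const, Finset.card_univ, smul_eq_mul]
    omega
  -- Since U^{2I} vanishes on N and N has half the dimension, the forms η alone identify each
  -- tangent space with ℂ^m; J is multiplication by i carried over.
  have hequiv : ∀ y ∈ N, ∃ e : F ≃L[ℝ] (ι → ℂ), (e : F →L[ℝ] (ι → ℂ)) = holFrame θ₁ j y := by
    intro y hy
    have hinj : Function.Injective (holFrame θ₁ j y : F →ₗ[ℝ] (ι → ℂ)) := by
      rw [← LinearMap.ker_eq_bot, LinearMap.ker_eq_bot']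
      intro X hX
      exact ηinj y hy X fun I => congrFun hX I
    refine ⟨(LinearEquiv.ofInjectiveOfFinrankEq _ hinj hfin).toContinuousLinearEquiv, ?_⟩
    ext X I
    rfl
  set J := holStructure θ₁ j with hJdef
  have hframe : ∀ y ∈ N, ∀ X, holFrame θ₁ j y (J y X) = Complex.I • holFrame θ₁ j y X := by
    intro y hy X
    obtain ⟨e, he⟩ := hequiv y hy
    simp only [hJdef, holStructure, ← he, ContinuousLinearMap.inverse_equiv]
    simp
  have hJ : ∀ y ∈ N, ∀ I X, η I y (J y X) = Complex.I * η I y X := fun y hy I X =>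
    congrFun (hframe y hy X) I
  have frameSmooth : ContDiffOn ℝ ∞ (holFrame θ₁ j) N := by
    unfold holFrame
    have : ∀ y, ContinuousLinearMap.pi (fun I => η I y)
        = ∑ I, (ContinuousLinearMap.single ℝ (fun _ : ι => ℂ) I).comp (η I y) := by
      intro y
      ext X I
      simp [Pi.single_apply]
    refine ContDiffOn.congr (f := fun y => ∑ I,
      (ContinuousLinearMap.single ℝ (fun _ : ι => ℂ) I).comp (η I y)) ?_ fun y _ => this y
    exact ContDiffOn.sum fun I _ => contDiffOn_const.clm_comp (ηs I)
  have Js : ContDiffOn ℝ ∞ J N := by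
    have hinv : ContDiffOn ℝ ∞ (fun y => (holFrame θ₁ j y).inverse) N := by
      intro y hy
      obtain ⟨e, he⟩ := hequiv y hy
      have h1 : ContDiffAt ℝ ∞ ContinuousLinearMap.inverse (holFrame θ₁ j y) := by
        rw [← he]
        exact contDiffAt_map_inverse e
      exact h1.comp_contDiffWithinAt y (frameSmooth y hy)
    exact hinv.clm_comp (contDiffOn_const.clm_comp frameSmooth)
  have Jd : ∀ y ∈ N, DifferentiableAt ℝ J y := fun y hy =>
    (Js.contDiffAt (hN.mem_nhds hy)).differentiableAt (by simp)
  have gη : ∀ y ∈ N, ∀ X Y, inducedMetric (vielbeinOf θ₁ θ₂) j y X Y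
      = 2 * ∑ I, (η I y X * (starRingEnd ℂ) (η I y Y)).re := by
    intro y hy X Y
    rw [inducedMetric, hypMetric_vielbeinOf]
    congr 1
    refine Finset.sum_congr rfl fun I _ => ?_
    simp [hUz y hy, θη]
  -- With ω¹ = ω² = 0 the quadratic term of the third curvature equation drops out, and its
  -- right-hand side is a multiple of the imaginary part of Σ η(X) times the conjugate of η(Y).
  have curv : ∀ y ∈ N, ∀ X Y, extD (pull (om 2) j) y X Y
      = -2 * inducedMetric (vielbeinOf θ₁ θ₂) j y (J y X) Y := by
    intro y hy X Y
    rw [extD_pull (((h.smooth_om 2).contDiffAt (h.isOpen.mem_nhds (hm hy))).differentiableAt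
      (by simp)) (hjy y hy)]
    have hs := h.su2_curvature (j y) (hm hy) 2 (fderiv ℝ j y X) (fderiv ℝ j y Y)
    have h0 : ∀ X, om 0 (j y) (fderiv ℝ j y X) = 0 := fun X => by
      rw [← pull_apply, hom₁ y hy]; rfl
    have h1 : ∀ X, om 1 (j y) (fderiv ℝ j y X) = 0 := fun X => by
      rw [← pull_apply, hom₂ y hy]; rfl
    rw [su2_rhs_two] at hs
    have hw : ∑ a, ∑ b, levi 2 a b * wedge (fun Z => (om a (j y) Z : ℂ))
        (fun Z => (om b (j y) Z : ℂ)) (fderiv ℝ j y X) (fderiv ℝ j y Y) = 0 := by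
      simp [Fin.sum_univ_three, levi, wedge, h0, h1]
    rw [hw] at hs
    have := congrArg Complex.re hs
    rw [gη y hy]
    simp [wedge, conjForm_apply, hUz y hy, θη, hJ y hy, lam, Finset.mul_sum] at this ⊢
    rw [this, ← Finset.sum_sub_distrib, Finset.mul_sum, neg_inj]
    refine Finset.sum_congr rfl fun I _ => ?_
    ring
  -- In the torsion equation for U^{2İ} the terms containing U^{1İ} or U^{2I} vanish on N. Hence dη
  -- is a combination of products in which one factor is some η.
  have dη : ∀ y ∈ N, ∀ I, ∃ a : ι → F → ℂ, ∀ X Y,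
      extD (η I) y X Y = ∑ K, (a K X * η K y Y - a K Y * η K y X) := by
    intro y hy I
    refine ⟨fun K X => -(Δ (Sum.inr I) (Sum.inr K) (j y) (fderiv ℝ j y X)) - if K = I then
      ∑ x, Complex.I / 2 * pauliUp x 1 1 * (om x (j y) (fderiv ℝ j y X) : ℂ) else 0,
      fun X Y => ?_⟩
    have ht := h.torsion (j y) (hm hy) 1 (Sum.inr I) (fderiv ℝ j y X) (fderiv ℝ j y Y)
    have e1 : extD (η I) y X Y
        = extD (conjForm (θ₁ I)) (j y) (fderiv ℝ j y X) (fderiv ℝ j y Y) :=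
      extD_pull (((h.smooth_U 1 (Sum.inr I)).contDiffAt
        (h.isOpen.mem_nhds (hm hy))).differentiableAt (by simp)) (hjy y hy) X Y
    rw [e1]
    have e2 : ∀ K X, conjForm (θ₁ K) (j y) (fderiv ℝ j y X) = η K y X := fun K X => rfl
    simp only [Fin.sum_univ_two, Fintype.sum_sum_type, vielbeinOf, wedge, neg_apply, Pi.neg_apply,
      hUz y hy, e2] at ht
    simp only [conjForm_apply, hUz y hy, map_zero, neg_zero, mul_zero, sub_zero, zero_add,
      Finset.sum_const_zero] at ht
    simp only [sub_mul, ite_mul, zero_mul, Finset.sum_sub_distrib, Finset.sum_ite_eq',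
      Finset.mem_univ, if_true, neg_mul, Finset.sum_neg_distrib]
    simp only [Finset.sum_mul]
    rw [eq_neg_of_add_eq_zero_left ((add_assoc _ _ _).symm.trans ht)]
    simp only [mul_sub, Finset.sum_sub_distrib, mul_assoc]
    ring
  refine ⟨hN, half_dim, hj, hm, embedding, immersion, hU, hom₁, hom₂, hΔ, J, hJ, ?_, curv⟩
  refine ⟨?_, Js, ?_, ?_, ?_, ?_, ?_, ?_, ?_⟩
  · intro X Y
    have hs : ContDiffOn ℝ ∞ (fun y => 2 * ∑ I, Complex.reCLM
        (η I y X * Complex.conjCLE (η I y Y))) N := by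
      refine contDiffOn_const.mul (ContDiffOn.sum fun I _ => ?_)
      refine Complex.reCLM.contDiff.comp_contDiffOn ?_
      exact ((ηs I).clm_apply contDiffOn_const).mul
        (Complex.conjCLE.contDiff.comp_contDiffOn ((ηs I).clm_apply contDiffOn_const))
    exact hs.congr fun y hy => gη y hy X Y
  · intro y _ Y
    constructor
    · intro X X'
      simp only [inducedMetric, hypMetric_vielbeinOf, map_add, add_mul, Complex.add_re,
        ← mul_add, ← Finset.sum_add_distrib]
      congr 1
      exact Finset.sum_congr rfl fun I _ => by ring
    · intro c X
      simp only [inducedMetric, hypMetric_vielbeinOf, map_smul, smul_eq_mul, Finset.mul_sum]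
      refine Finset.sum_congr rfl fun I _ => ?_
      simp
      ring
  · intro y _ X Y
    simp only [inducedMetric, hypMetric_vielbeinOf]
    congr 1
    refine Finset.sum_congr rfl fun I _ => ?_
    simp
    ring
  · intro y hy X hX
    rw [gη y hy]
    have hne : ∃ I, η I y X ≠ 0 := by
      by_contra! hc
      exact hX (ηinj y hy X hc)
    obtain ⟨I, hI⟩ := hne
    have : ∀ I, (η I y X * (starRingEnd ℂ) (η I y X)).re = Complex.normSq (η I y X) := fun I => by
      rw [Complex.mul_conj]; simp
    simp only [this]
    have : 0 < ∑ I, Complex.normSq (η I y X) :=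
      Finset.sum_pos' (fun I _ => Complex.normSq_nonneg _)
        ⟨I, Finset.mem_univ _, Complex.normSq_pos.2 hI⟩
    linarith
  · intro y hy X
    rw [← sub_eq_zero]
    refine ηinj y hy _ fun I => ?_
    rw [map_sub, hJ y hy, hJ y hy, map_neg]
    linear_combination (η I y X) * Complex.I_mul_I
  · intro y hy X Y
    rw [gη y hy, gη y hy]
    congr 1
    refine Finset.sum_congr rfl fun I _ => ?_
    rw [hJ y hy, hJ y hy]
    simp
  · intro y hy X Y
    refine ηinj y hy _ fun I => ?_
    -- The derivative of η(JX) = iη(X) expresses η applied to the derivative of J through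
    -- derivatives of η, and so brings the Nijenhuis tensor into terms of dη.
    have hd : ∀ Z X, fderiv ℝ (η I) y Z (J y X) + η I y (fderiv ℝ J y Z X)
        = Complex.I * fderiv ℝ (η I) y Z X := by
      intro Z X
      have e : (fun p => η I p (J p X)) =ᶠ[nhds y] fun p => Complex.I * η I p X := by
        filter_upwards [hN.mem_nhds hy] with p hp using hJ p hp I X
      have h1 := ((ηd I y hy).hasFDerivAt.clm_apply
        (hasFDerivAt_apply_const (Jd y hy) X)).fderiv
      have h2 := ((hasFDerivAt_apply_const (ηd I y hy) X).const_mul Complex.I).fderiv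
      have := DFunLike.congr_fun (e.fderiv_eq (𝕜 := ℝ)) Z
      rw [h1, h2] at this
      simp at this
      rw [← this]; ring
    obtain ⟨a, ha⟩ := dη y hy I
    -- This combination is, up to a factor, the (0,2)-part of dη. It vanishes because a product with
    -- a factor of type (1,0) has no (0,2)-part.
    have expand : extD (η I) y X Y - extD (η I) y (J y X) (J y Y)
        + Complex.I * (extD (η I) y (J y X) Y + extD (η I) y X (J y Y)) = 0 := by
      simp only [ha, hJ y hy, Finset.mul_sum, ← Finset.sum_add_distrib, ← Finset.sum_sub_distrib]
      refine Finset.sum_eq_zero fun K _ => ?_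
      ring_nf
      simp only [Complex.I_sq]
      ring
    rw [← expand]
    simp only [extD, map_sub, map_add, hJ y hy]
    have r := fun Z X => eq_sub_of_add_eq' (hd Z X)
    rw [r, r, r, r]
    ring_nf
    simp only [Complex.I_sq]
    ring
  · intro y hy X Y Z
    -- The fundamental form is -1/2 times dω³ on N, so its closedness is d² = 0.
    have e : ∀ Y Z, (fun p => inducedMetric (vielbeinOf θ₁ θ₂) j p (J p Y) Z)
        =ᶠ[nhds y] fun p => -(1 / 2) * extD (pull (om 2) j) p Y Z := by
      intro Y Z
      filter_upwards [hN.mem_nhds hy] with p hp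
      rw [curv p hp]; ring
    have hs : ContDiffAt ℝ ∞ (pull (om 2) j) y :=
      (contDiffOn_pull hN (h.smooth_om 2) hj hm).contDiffAt (hN.mem_nhds hy)
    have hdiff : ∀ Y Z, DifferentiableAt ℝ (fun p => extD (pull (om 2) j) p Y Z) y := by
      intro Y Z
      have : DifferentiableAt ℝ (fderiv ℝ (pull (om 2) j)) y :=
        (hs.fderiv_right (m := ∞) (by simp)).differentiableAt (by simp)
      have hap : ∀ Y Z, DifferentiableAt ℝ (fun p => fderiv ℝ (pull (om 2) j) p Y Z) y :=
        fun Y Z => (this.clm_apply (differentiableAt_const Y)).clm_apply (differentiableAt_const Z)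
      exact (hap Y Z).sub (hap Z Y)
    have hc := extD_extD hs X Y Z
    rw [(e Y Z).fderiv_eq, (e Z X).fderiv_eq, (e X Y).fderiv_eq, fderiv_const_mul (hdiff _ _),
      fderiv_const_mul (hdiff _ _), fderiv_const_mul (hdiff _ _)]
    simp only [smul_apply, smul_eq_mul]
    linear_combination -(1 / 2) * hc

end Reduction

/-! ### Holomorphic functions of several variables are smooth. -/

section Holomorphic

variable {n : ℕ}

/-- Cauchy's estimate in one variable on the complex line through w in the direction h. The disc of
radius ρ/‖h‖ is mapped into the closed ball of radius ρ, well inside the domain. -/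
theorem norm_fderiv_le_of_norm_le {f : (Fin n → ℂ) → ℂ} {w : Fin n → ℂ} {ρ C : ℝ} (hρ : 0 < ρ)
    (hf : DifferentiableOn ℂ f (Metric.ball w (2 * ρ)))
    (hC : ∀ z ∈ Metric.ball w (2 * ρ), ‖f z‖ ≤ C) : ‖fderiv ℂ f w‖ ≤ C / ρ := by
  have hC0 : 0 ≤ C := (norm_nonneg _).trans (hC w (Metric.mem_ball_self (by linarith)))
  refine ContinuousLinearMap.opNorm_le_bound _ (by positivity) fun h => ?_
  rcases eq_or_ne h 0 with rfl | hh
  · simp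
  have hn : 0 < ‖h‖ := norm_pos_iff.2 hh
  have hmem : ∀ t ∈ Metric.closedBall (0 : ℂ) (ρ / ‖h‖), w + t • h ∈ Metric.ball w (2 * ρ) := by
    intro t ht
    rw [mem_closedBall_zero_iff, le_div_iff₀ hn] at ht
    rw [mem_ball_iff_norm, add_sub_cancel_left, norm_smul]
    linarith
  have hd : ∀ t ∈ Metric.closedBall (0 : ℂ) (ρ / ‖h‖),
      HasDerivAt (fun t : ℂ => f (w + t • h)) (fderiv ℂ f (w + t • h) h) t := by
    intro t ht
    have h1 : HasFDerivAt f (fderiv ℂ f (w + t • h)) (w + t • h) :=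
      ((hf _ (hmem t ht)).differentiableAt (Metric.isOpen_ball.mem_nhds (hmem t ht))).hasFDerivAt
    have h2 : HasDerivAt (fun t : ℂ => w + t • h) h t := by
      simpa using ((hasDerivAt_id t).smul_const h).const_add w
    exact h1.comp_hasDerivAt t h2
  have hr : 0 < ρ / ‖h‖ := by positivity
  have hcl : DiffContOnCl ℂ (fun t : ℂ => f (w + t • h)) (Metric.ball 0 (ρ / ‖h‖)) :=
    DifferentiableOn.diffContOnCl fun t ht => by
      rw [closure_ball _ hr.ne'] at ht
      exact (hd t ht).differentiableAt.differentiableWithinAt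
  have := Complex.norm_deriv_le_of_forall_mem_sphere_norm_le hr hcl
    (fun t ht => hC _ (hmem t (Metric.sphere_subset_closedBall ht)))
  rw [(hd 0 (Metric.mem_closedBall_self hr.le)).deriv] at this
  simp only [zero_smul, add_zero] at this
  calc _ ≤ C / (ρ / ‖h‖) := this
    _ = _ := by field_simp

/-- Cauchy's formula on a small circle in the direction e writes the directional derivative as an
integral of f, which is then differentiated under the integral sign. The dominating bound is the
Cauchy estimate above. -/
theorem differentiableOn_fderiv_apply {f : (Fin n → ℂ) → ℂ} {M : Set (Fin n → ℂ)} (hM : IsOpen M)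
    (hf : DifferentiableOn ℂ f M) (e : Fin n → ℂ) :
    DifferentiableOn ℂ (fun z => fderiv ℂ f z e) M := by
  intro z₀ hz₀
  apply DifferentiableAt.differentiableWithinAt
  obtain ⟨ε, hε, hball⟩ := Metric.nhds_basis_closedBall.mem_iff.1 (hM.mem_nhds hz₀)
  obtain ⟨C, hC⟩ := ((ProperSpace.isCompact_closedBall z₀ ε).image_of_continuousOn
    (hf.continuousOn.mono hball)).isBounded.exists_norm_le
  have hC' : ∀ z ∈ Metric.closedBall z₀ ε, ‖f z‖ ≤ C := fun z hz => hC _ ⟨z, hz, rfl⟩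
  -- Moving z by ρ, then along e by at most ρ, then within a ball of radius 2ρ uses up exactly ε.
  -- The 1 added in the definition of r covers the case e = 0.
  set ρ := ε / 4 with hρ
  set r := ρ / (‖e‖ + 1) with hr
  have hρ0 : 0 < ρ := by positivity
  have hr0 : 0 < r := by positivity
  have hre : r * ‖e‖ ≤ ρ := by
    rw [hr, div_mul_eq_mul_div, div_le_iff₀ (by positivity)]
    nlinarith [norm_nonneg e]
  have hsub : ∀ z ∈ Metric.ball z₀ ρ, ∀ t : ℂ, ‖t‖ ≤ r →
      Metric.ball (z + t • e) (2 * ρ) ⊆ Metric.closedBall z₀ ε := by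
    intro z hz t ht w hw
    rw [mem_ball_iff_norm] at hz hw
    rw [mem_closedBall_iff_norm]
    have h1 : ‖t • e‖ ≤ ρ := by
      rw [norm_smul]; exact (mul_le_mul_of_nonneg_right ht (norm_nonneg e)).trans hre
    calc ‖w - z₀‖ = ‖(w - (z + t • e)) + (z - z₀) + t • e‖ := by congr 1; abel
      _ ≤ ‖w - (z + t • e)‖ + ‖z - z₀‖ + ‖t • e‖ := norm_add₃_le
      _ ≤ ε := by linarith
  have hmem : ∀ z ∈ Metric.ball z₀ ρ, ∀ t : ℂ, ‖t‖ ≤ r → z + t • e ∈ M := fun z hz t ht =>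
    hball (hsub z hz t ht (Metric.mem_ball_self (by positivity)))
  have hda : ∀ z ∈ M, HasFDerivAt f (fderiv ℂ f z) z := fun z hz =>
    ((hf z hz).differentiableAt (hM.mem_nhds hz)).hasFDerivAt
  have hcirc : ∀ θ : ℝ, ‖circleMap 0 r θ‖ ≤ r := fun θ => by
    simp [abs_of_pos hr0]
  have hcne : ∀ θ : ℝ, circleMap 0 r θ ≠ 0 := fun θ => circleMap_ne_center hr0.ne'
  set c : ℝ → ℂ := fun θ => deriv (circleMap 0 r) θ * (1 / circleMap 0 r θ ^ 2) with hc
  have hcc : Continuous c := by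
    rw [hc]
    refine Continuous.mul ?_ ?_
    · rw [show deriv (circleMap 0 r) = fun θ => circleMap 0 r θ * Complex.I from
        funext fun θ => deriv_circleMap 0 r θ]
      exact (continuous_circleMap 0 r).mul continuous_const
    · exact continuous_const.div ((continuous_circleMap 0 r).pow 2) fun θ => pow_ne_zero 2 (hcne θ)
  have hformula : ∀ z ∈ Metric.ball z₀ ρ, fderiv ℂ f z e
      = (2 * Real.pi * Complex.I : ℂ)⁻¹ • ∫ θ in (0)..(2 * Real.pi),
        c θ * f (z + circleMap 0 r θ • e) := by
    intro z hz
    have hd : ∀ t ∈ Metric.closedBall (0 : ℂ) r,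
        HasDerivAt (fun t : ℂ => f (z + t • e)) (fderiv ℂ f (z + t • e) e) t := by
      intro t ht
      have h2 : HasDerivAt (fun t : ℂ => z + t • e) e t := by
        simpa using ((hasDerivAt_id t).smul_const e).const_add z
      exact (hda _ (hmem z hz t (by simpa using ht))).comp_hasDerivAt t h2
    have h1 := Complex.differentiable_on_off_countable_deriv_eq_smul_circleIntegral
      (s := ∅) (c := 0) (f := fun t : ℂ => f (z + t • e)) hr0 Set.countable_empty
      (fun t ht => (hd t ht).continuousAt.continuousWithinAt)
      (fun t ht => (hd t (Metric.ball_subset_closedBall ht.1)).differentiableAt)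
    rw [(hd 0 (Metric.mem_closedBall_self hr0.le)).deriv] at h1
    simp only [zero_smul, add_zero] at h1
    rw [eq_inv_smul_iff₀ Complex.two_pi_I_ne_zero, ← h1, circleIntegral]
    simp [hc, mul_assoc]
  have hev : (fun z => fderiv ℂ f z e) =ᶠ[nhds z₀] fun z => (2 * Real.pi * Complex.I : ℂ)⁻¹ •
      ∫ θ in (0)..(2 * Real.pi), c θ * f (z + circleMap 0 r θ • e) := by
    filter_upwards [Metric.ball_mem_nhds z₀ hρ0] with z hz using hformula z hz
  refine DifferentiableAt.congr_of_eventuallyEq ?_ hev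
  refine DifferentiableAt.fun_const_smul (f := fun z => ∫ θ in (0)..(2 * Real.pi),
    c θ * f (z + circleMap 0 r θ • e)) ?_ _
  have hline : ∀ z, Continuous fun θ : ℝ => z + circleMap 0 r θ • e := fun z =>
    continuous_const.add ((continuous_circleMap 0 r).smul continuous_const)
  have hcont : ∀ z ∈ Metric.ball z₀ ρ, Continuous fun θ => c θ * f (z + circleMap 0 r θ • e) := by
    intro z hz
    refine hcc.mul (continuous_iff_continuousAt.2 fun θ => ?_)
    exact ContinuousAt.comp (f := fun θ => z + circleMap 0 r θ • e)
      (hda _ (hmem z hz _ (hcirc θ))).continuousAt (hline z).continuousAt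
  have hz₀b := Metric.mem_ball_self (x := z₀) hρ0
  -- The derivative of f is always measurable, so its continuity, not yet available, is not needed
  -- here.
  have hmeas : Measurable fun θ : ℝ => c θ • fderiv ℂ f (z₀ + circleMap 0 r θ • e) := by
    refine hcc.measurable.smul ((measurable_fderiv ℂ f).comp ?_)
    exact (hline z₀).measurable
  refine (intervalIntegral.hasFDerivAt_integral_of_dominated_of_fderiv_le
    (F' := fun z θ => c θ • fderiv ℂ f (z + circleMap 0 r θ • e))
    (bound := fun θ => ‖c θ‖ * (C / ρ)) (μ := MeasureTheory.volume)
    (Metric.ball_mem_nhds z₀ hρ0) ?_ ?_ ?_ ?_ ?_ ?_).differentiableAt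
  · filter_upwards [Metric.ball_mem_nhds z₀ hρ0] with z hz
    exact (hcont z hz).aestronglyMeasurable
  · exact (hcont z₀ hz₀b).intervalIntegrable _ _
  · exact hmeas.aestronglyMeasurable
  · refine Filter.Eventually.of_forall fun θ _ z hz => ?_
    rw [norm_smul]
    refine mul_le_mul_of_nonneg_left ?_ (norm_nonneg _)
    exact norm_fderiv_le_of_norm_le hρ0 (hf.mono ((hsub z hz _ (hcirc θ)).trans hball))
      fun w hw => hC' w (hsub z hz _ (hcirc θ) hw)
  · exact (hcc.norm.mul continuous_const).intervalIntegrable _ _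
  · refine Filter.Eventually.of_forall fun θ _ z hz => ?_
    have h1 : HasFDerivAt (fun z => f (z + circleMap 0 r θ • e))
        (fderiv ℂ f (z + circleMap 0 r θ • e)) z :=
      (hda _ (hmem z hz _ (hcirc θ))).comp z ((hasFDerivAt_id z).add_const _)
    exact h1.const_mul (c θ)

/-- Induction on k: by finite dimensionality the derivative is C^k once its value on each fixed
vector is, and these values are again holomorphic. -/
theorem contDiffOn_of_differentiableOn_pi {M : Set (Fin n → ℂ)} (hM : IsOpen M) (k : ℕ) :
    ∀ {f : (Fin n → ℂ) → ℂ}, DifferentiableOn ℂ f M → ContDiffOn ℂ k f M := by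
  induction k with
  | zero => exact fun hf => contDiffOn_zero.2 hf.continuousOn
  | succ k ih =>
    intro f hf
    push_cast
    rw [contDiffOn_succ_iff_fderiv_of_isOpen hM]
    exact ⟨hf, by simp, contDiffOn_clm_apply.2 fun e => ih (differentiableOn_fderiv_apply hM hf e)⟩

/-- A holomorphic function of several variables is smooth. -/
theorem contDiffOn_of_holomorphic {κ : Type*} [Fintype κ] {M : Set (Fin n → ℂ)} (hM : IsOpen M)
    {V : (Fin n → ℂ) → κ → ℂ} (hV : DifferentiableOn ℂ V M) : ContDiffOn ℂ ∞ V M := by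
  rw [contDiffOn_pi]
  intro s
  rw [contDiffOn_infty]
  exact fun k => contDiffOn_of_differentiableOn_pi hM k (differentiableOn_pi.1 hV s)

end Holomorphic

/-! ### Symplectic algebra and Wirtinger derivatives. -/

section Symplectic

variable {n : ℕ}

theorem sympl_swap (A B : SympVec n) : sympl B A = -sympl A B := by
  simp only [sympl, ← Finset.sum_neg_distrib]
  exact Finset.sum_congr rfl fun Λ _ => by ring

theorem sympl_self (A : SympVec n) : sympl A A = 0 := by
  have := sympl_swap A A
  linear_combination this / 2

theorem sympl_add_left (A B C : SympVec n) : sympl (A + B) C = sympl A C + sympl B C := by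
  simp only [sympl, ← Finset.sum_add_distrib, Pi.add_apply]
  exact Finset.sum_congr rfl fun Λ _ => by ring

theorem sympl_smul_left (c : ℂ) (A B : SympVec n) : sympl (c • A) B = c * sympl A B := by
  simp only [sympl, Finset.mul_sum, Pi.smul_apply, smul_eq_mul]
  exact Finset.sum_congr rfl fun Λ _ => by ring

theorem sympl_add_right (A B C : SympVec n) : sympl A (B + C) = sympl A B + sympl A C := by
  rw [sympl_swap, sympl_add_left, sympl_swap B, sympl_swap C]; ring

theorem sympl_smul_right (c : ℂ) (A B : SympVec n) : sympl A (c • B) = c * sympl A B := by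
  rw [sympl_swap, sympl_smul_left, sympl_swap B]; ring

theorem sympl_neg_left (A B : SympVec n) : sympl (-A) B = -sympl A B := by
  rw [← neg_one_smul ℂ, sympl_smul_left]; ring

theorem sympl_neg_right (A B : SympVec n) : sympl A (-B) = -sympl A B := by
  rw [← neg_one_smul ℂ, sympl_smul_right]; ring

theorem sympl_sub_left (A B C : SympVec n) : sympl (A - B) C = sympl A C - sympl B C := by
  rw [sub_eq_add_neg, sympl_add_left, sympl_neg_left]; ring

theorem sympl_sub_right (A B C : SympVec n) : sympl A (B - C) = sympl A B - sympl A C := by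
  rw [sub_eq_add_neg, sympl_add_right, sympl_neg_right]; ring

theorem sympl_zero_right (A : SympVec n) : sympl A 0 = 0 := by simp [sympl]

theorem sympl_sum_left {κ : Type*} (s : Finset κ) (A : κ → SympVec n) (B : SympVec n) :
    sympl (∑ k ∈ s, A k) B = ∑ k ∈ s, sympl (A k) B := by
  classical
  induction s using Finset.induction_on with
  | empty => simp [sympl]
  | insert k s hk ih => rw [Finset.sum_insert hk, Finset.sum_insert hk, sympl_add_left, ih]

theorem sympl_sum_right {κ : Type*} (s : Finset κ) (A : SympVec n) (B : κ → SympVec n) :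
    sympl A (∑ k ∈ s, B k) = ∑ k ∈ s, sympl A (B k) := by
  rw [sympl_swap, sympl_sum_left, ← Finset.sum_neg_distrib]
  exact Finset.sum_congr rfl fun k _ => (sympl_swap _ _).symm

/-- The symplectic product as a continuous real bilinear map. -/
def symplB (n : ℕ) : SympVec n →L[ℝ] SympVec n →L[ℝ] ℂ :=
  (LinearMap.mk₂ ℝ sympl sympl_add_left
    (fun c A B => by
      have := sympl_smul_left (c : ℂ) A B
      rw [Complex.real_smul, ← this]; congr 1)
    sympl_add_right
    (fun c A B => by
      have := sympl_smul_right (c : ℂ) A B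
      rw [Complex.real_smul, ← this]; congr 1)).toContinuousBilinearMap

theorem symplB_apply (A B : SympVec n) : symplB n A B = sympl A B := rfl

/-- Complex conjugation of symplectic vectors. -/
def conjVec (n : ℕ) : SympVec n →L[ℝ] SympVec n :=
  ContinuousLinearMap.pi fun s =>
    (Complex.conjCLE : ℂ →L[ℝ] ℂ).comp (ContinuousLinearMap.proj (R := ℝ) s)

theorem conjVec_apply (A : SympVec n) (s : Fin (n + 1) ⊕ Fin (n + 1)) :
    conjVec n A s = (starRingEnd ℂ) (A s) := rfl

theorem conjVec_conjVec (A : SympVec n) : conjVec n (conjVec n A) = A := by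
  ext s; simp [conjVec_apply]

theorem conjVec_smul (c : ℂ) (A : SympVec n) :
    conjVec n (c • A) = (starRingEnd ℂ) c • conjVec n A := by
  ext s; simp [conjVec_apply]

theorem sympl_conjVec (A B : SympVec n) :
    sympl (conjVec n A) (conjVec n B) = (starRingEnd ℂ) (sympl A B) := by
  simp [sympl, conjVec_apply]

theorem hasFDerivAt_sympl {H : Type*} [NormedAddCommGroup H] [NormedSpace ℝ H]
    {A B : H → SympVec n} {A' B' : H →L[ℝ] SympVec n} {z : H} (hA : HasFDerivAt A A' z)
    (hB : HasFDerivAt B B' z) : HasFDerivAt (fun w => sympl (A w) (B w))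
      ((symplB n (A z)).comp B' + ((symplB n).flip (B z)).comp A') z := by
  refine ((symplB n).hasFDerivAt_of_bilinear hA hB).congr_fderiv ?_
  ext h
  simp

theorem ContDiffOn.sympl {H : Type*} [NormedAddCommGroup H] [NormedSpace ℝ H]
    {A B : H → SympVec n} {s : Set H} (hA : ContDiffOn ℝ ∞ A s) (hB : ContDiffOn ℝ ∞ B s) :
    ContDiffOn ℝ ∞ (fun w => CMap.sympl (A w) (B w)) s :=
  ((symplB n).contDiff.comp_contDiffOn hA).clm_apply hB

end Symplectic

section Wirtinger

variable {n : ℕ}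

theorem single_I (i : Fin n) : (Pi.single i Complex.I : Fin n → ℂ) = Complex.I • Pi.single i 1 := by
  rw [← Pi.single_smul]; simp

/-- Wirtinger derivatives of a function whose differential is split into types. -/
theorem dHol_eq {f : (Fin n → ℂ) → ℂ} {f' : (Fin n → ℂ) →L[ℝ] ℂ} {z : Fin n → ℂ}
    (hf : HasFDerivAt f f' z) {a b : (Fin n → ℂ) → ℂ} (h : ∀ v, f' v = a v + b v)
    (ha : ∀ v, a (Complex.I • v) = Complex.I * a v)
    (hb : ∀ v, b (Complex.I • v) = -Complex.I * b v) (i : Fin n) :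
    dHol i f z = a (Pi.single i 1) := by
  rw [dHol, hf.fderiv, single_I, h, h, ha, hb]
  linear_combination (-a (Pi.single i 1) + b (Pi.single i 1)) / 2 * Complex.I_mul_I

theorem dBar_eq {f : (Fin n → ℂ) → ℂ} {f' : (Fin n → ℂ) →L[ℝ] ℂ} {z : Fin n → ℂ}
    (hf : HasFDerivAt f f' z) {a b : (Fin n → ℂ) → ℂ} (h : ∀ v, f' v = a v + b v)
    (ha : ∀ v, a (Complex.I • v) = Complex.I * a v)
    (hb : ∀ v, b (Complex.I • v) = -Complex.I * b v) (i : Fin n) :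
    dBar i f z = b (Pi.single i 1) := by
  rw [dBar, hf.fderiv, single_I, h, h, ha, hb]
  linear_combination (a (Pi.single i 1) - b (Pi.single i 1)) / 2 * Complex.I_mul_I

end Wirtinger

/-! ### Pairings of the section with its covariant derivatives. -/

section SpecialGeometry

variable {n : ℕ} {M : Set (Fin n → ℂ)} {V : (Fin n → ℂ) → SympVec n}
  {P : (Fin n → ℂ) → Matrix (Fin n) (Fin n) ℂ}

/-- The form `∂K = ∂_i K dz^i`. -/
def delK (V : (Fin n → ℂ) → SympVec n) (z : Fin n → ℂ) : (Fin n → ℂ) →L[ℝ] ℂ :=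
  (-Complex.I / expNegK V z) • (symplB n (conjVec n (V z))).comp (fderiv ℝ V z)

theorem delK_apply (z h : Fin n → ℂ) : delK V z h
    = -Complex.I / expNegK V z * sympl (conjVec n (V z)) (fderiv ℝ V z h) := rfl

/-- Conjugation exchanges the arguments of the antisymmetric pairing and changes the sign of i, so
i⟨V̄, V⟩ is real and no information is lost in the real part. -/
theorem ofReal_expNegK (V : (Fin n → ℂ) → SympVec n) (z : Fin n → ℂ) :
    (expNegK V z : ℂ) = Complex.I * sympl (conjVec n (V z)) (V z) := by
  have h : (starRingEnd ℂ) (Complex.I * sympl (conjVec n (V z)) (V z))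
      = Complex.I * sympl (conjVec n (V z)) (V z) := by
    rw [map_mul, ← sympl_conjVec, conjVec_conjVec, sympl_swap, Complex.conj_I]; ring
  exact Complex.conj_eq_iff_re.1 h

theorem sympl_conj_self (V : (Fin n → ℂ) → SympVec n) (z : Fin n → ℂ) :
    sympl (conjVec n (V z)) (V z) = -Complex.I * expNegK V z := by
  rw [ofReal_expNegK]; linear_combination sympl (conjVec n (V z)) (V z) * Complex.I_mul_I

namespace IsSpecialKahler

theorem smooth (hS : IsSpecialKahler M V) : ContDiffOn ℝ ∞ V M :=
  (contDiffOn_of_holomorphic hS.isOpen hS.holomorphic).restrict_scalars ℝ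

theorem contDiffAt (hS : IsSpecialKahler M V) {z : Fin n → ℂ} (hz : z ∈ M) : ContDiffAt ℝ ∞ V z :=
  hS.smooth.contDiffAt (hS.isOpen.mem_nhds hz)

theorem hasFDerivAt (hS : IsSpecialKahler M V) {z : Fin n → ℂ} (hz : z ∈ M) :
    HasFDerivAt V (fderiv ℝ V z) z :=
  ((hS.contDiffAt hz).differentiableAt (by simp)).hasFDerivAt

theorem fderiv_eq (hS : IsSpecialKahler M V) {z : Fin n → ℂ} (hz : z ∈ M) :
    fderiv ℝ V z = (fderiv ℂ V z).restrictScalars ℝ :=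
  ((hS.holomorphic z hz).differentiableAt (hS.isOpen.mem_nhds hz)).fderiv_restrictScalars ℝ

theorem fderiv_smul (hS : IsSpecialKahler M V) {z : Fin n → ℂ} (hz : z ∈ M) (c : ℂ)
    (h : Fin n → ℂ) : fderiv ℝ V z (c • h) = c • fderiv ℝ V z h := by
  simp [hS.fderiv_eq hz]

theorem fderiv_single (hS : IsSpecialKahler M V) {z : Fin n → ℂ} (hz : z ∈ M) (i : Fin n) :
    fderiv ℝ V z (Pi.single i 1) = dSection V i z := by
  simp [hS.fderiv_eq hz, dSection]

theorem fderiv_apply (hS : IsSpecialKahler M V) {z : Fin n → ℂ} (hz : z ∈ M) (h : Fin n → ℂ) :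
    fderiv ℝ V z h = ∑ i, h i • dSection V i z := by
  conv_lhs => rw [← Finset.univ_sum_single h]
  rw [map_sum]
  refine Finset.sum_congr rfl fun i _ => ?_
  rw [← hS.fderiv_single hz, ← hS.fderiv_smul hz, ← Pi.single_smul]; simp

theorem hasFDerivAt_expNegK (hS : IsSpecialKahler M V) {z : Fin n → ℂ} (hz : z ∈ M) :
    ∃ Y' : (Fin n → ℂ) →L[ℝ] ℝ, HasFDerivAt (expNegK V) Y' z ∧ ∀ h, (Y' h : ℂ)
      = -expNegK V z * (delK V z h + (starRingEnd ℂ) (delK V z h)) := by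
  have h1 := (hasFDerivAt_sympl ((conjVec n).hasFDerivAt.comp z (hS.hasFDerivAt hz))
    (hS.hasFDerivAt hz)).const_mul Complex.I
  have h2 := Complex.reCLM.hasFDerivAt.comp z h1
  have hY : (expNegK V z : ℂ) ≠ 0 := Complex.ofReal_ne_zero.2 (hS.pos z hz).ne'
  refine ⟨_, h2, fun h => ?_⟩
  have e : (starRingEnd ℂ) (delK V z h)
      = -Complex.I / expNegK V z * sympl (conjVec n (fderiv ℝ V z h)) (V z) := by
    rw [delK_apply, map_mul, ← sympl_conjVec, conjVec_conjVec, sympl_swap]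
    simp
    ring
  have e2 : -(expNegK V z : ℂ) * (delK V z h + (starRingEnd ℂ) (delK V z h))
      = Complex.I * (sympl (conjVec n (V z)) (fderiv ℝ V z h)
        + sympl (conjVec n (fderiv ℝ V z h)) (V z)) := by
    rw [e, delK_apply]; field_simp; ring
  rw [e2]
  have e3 : (starRingEnd ℂ) (Complex.I * (sympl (conjVec n (V z)) (fderiv ℝ V z h)
        + sympl (conjVec n (fderiv ℝ V z h)) (V z))) = Complex.I *
        (sympl (conjVec n (V z)) (fderiv ℝ V z h)
        + sympl (conjVec n (fderiv ℝ V z h)) (V z)) := by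
    rw [map_mul, map_add, ← sympl_conjVec, ← sympl_conjVec, conjVec_conjVec, conjVec_conjVec,
      sympl_swap _ (V z), sympl_swap _ (fderiv ℝ V z h), Complex.conj_I]
    ring
  exact Complex.conj_eq_iff_re.1 e3

theorem hasFDerivAt_kahlerPot (hS : IsSpecialKahler M V) {z : Fin n → ℂ} (hz : z ∈ M) :
    ∃ K' : (Fin n → ℂ) →L[ℝ] ℝ, HasFDerivAt (kahlerPot V) K' z ∧ ∀ h, (K' h : ℂ)
      = delK V z h + (starRingEnd ℂ) (delK V z h) := by
  obtain ⟨Y', hY', e⟩ := hS.hasFDerivAt_expNegK hz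
  have hY := hS.pos z hz
  have hYc : (expNegK V z : ℂ) ≠ 0 := Complex.ofReal_ne_zero.2 hY.ne'
  refine ⟨_, (hY'.log hY.ne').fun_neg, fun h => ?_⟩
  simp only [neg_apply, smul_apply, smul_eq_mul, Complex.ofReal_neg, Complex.ofReal_mul, e,
    Complex.ofReal_inv]
  field_simp

theorem delK_smul (hS : IsSpecialKahler M V) {z : Fin n → ℂ} (hz : z ∈ M) (c : ℂ)
    (h : Fin n → ℂ) : delK V z (c • h) = c * delK V z h := by
  rw [delK_apply, delK_apply, hS.fderiv_smul hz, sympl_smul_right]; ring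

theorem dHol_kahlerPot (hS : IsSpecialKahler M V) {z : Fin n → ℂ} (hz : z ∈ M) (i : Fin n) :
    dHol i (fun w => (kahlerPot V w : ℂ)) z = delK V z (Pi.single i 1) := by
  obtain ⟨K', hK', e⟩ := hS.hasFDerivAt_kahlerPot hz
  exact dHol_eq (Complex.ofRealCLM.hasFDerivAt.comp z hK') e
    (fun v => hS.delK_smul hz Complex.I v)
    (fun v => by rw [hS.delK_smul hz, map_mul, Complex.conj_I]) i

theorem dBar_kahlerPot (hS : IsSpecialKahler M V) {z : Fin n → ℂ} (hz : z ∈ M) (i : Fin n) :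
    dBar i (fun w => (kahlerPot V w : ℂ)) z = (starRingEnd ℂ) (delK V z (Pi.single i 1)) := by
  obtain ⟨K', hK', e⟩ := hS.hasFDerivAt_kahlerPot hz
  exact dBar_eq (b := fun h => (starRingEnd ℂ) (delK V z h))
    (Complex.ofRealCLM.hasFDerivAt.comp z hK') e
    (fun v => hS.delK_smul hz Complex.I v)
    (fun v => by rw [hS.delK_smul hz, map_mul, Complex.conj_I]) i

theorem covSection_eq (hS : IsSpecialKahler M V) {z : Fin n → ℂ} (hz : z ∈ M) (i : Fin n) :
    covSection V i z = fderiv ℝ V z (Pi.single i 1) + delK V z (Pi.single i 1) • V z := by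
  rw [covSection, hS.dHol_kahlerPot hz, hS.fderiv_single hz]

theorem sympl_fderiv (hS : IsSpecialKahler M V) {z : Fin n → ℂ} (hz : z ∈ M) (h : Fin n → ℂ) :
    sympl (V z) (fderiv ℝ V z h) = 0 := by
  rw [hS.fderiv_apply hz, sympl_sum_right]
  exact Finset.sum_eq_zero fun i _ => by
    rw [sympl_smul_right, hS.sympl_dSection z hz, mul_zero]

theorem differentiableAt_fderiv (hS : IsSpecialKahler M V) {z : Fin n → ℂ} (hz : z ∈ M) :
    DifferentiableAt ℝ (fderiv ℝ V) z :=
  ((hS.contDiffAt hz).fderiv_right (m := ∞) (by simp)).differentiableAt (by simp)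

theorem snd_fderiv_symm (hS : IsSpecialKahler M V) {z : Fin n → ℂ} (hz : z ∈ M)
    (h k : Fin n → ℂ) :
    fderiv ℝ (fderiv ℝ V) z h k = fderiv ℝ (fderiv ℝ V) z k h :=
  ((hS.contDiffAt hz).isSymmSndFDerivAt
    (by simpa using WithTop.coe_le_coe.2 (le_top : (2 : ℕ∞) ≤ ⊤))).eq h k

/-- Differentiating ⟨V, ∂_k V⟩ = 0 gives ⟨∂_h V, ∂_k V⟩ = -⟨V, ∂_h ∂_k V⟩, where the left side is
antisymmetric in h, k and the right side symmetric. -/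
theorem sympl_fderiv_fderiv (hS : IsSpecialKahler M V) {z : Fin n → ℂ} (hz : z ∈ M)
    (h k : Fin n → ℂ) : sympl (fderiv ℝ V z h) (fderiv ℝ V z k) = 0 := by
  have key : ∀ h k, sympl (fderiv ℝ V z h) (fderiv ℝ V z k)
      + sympl (V z) (fderiv ℝ (fderiv ℝ V) z h k) = 0 := by
    intro h k
    have h1 := hasFDerivAt_sympl (hS.hasFDerivAt hz)
      (hasFDerivAt_apply_const (hS.differentiableAt_fderiv hz) k)
    have h2 : (fun w => sympl (V w) (fderiv ℝ V w k)) =ᶠ[nhds z] fun _ => 0 := by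
      filter_upwards [hS.isOpen.mem_nhds hz] with w hw using hS.sympl_fderiv hw k
    have h3 := h1.fderiv.symm.trans (h2.fderiv_eq (𝕜 := ℝ))
    have := DFunLike.congr_fun h3 h
    simp [symplB_apply] at this
    linear_combination this
  have a := key h k
  have b := key k h
  rw [hS.snd_fderiv_symm hz k h, sympl_swap] at b
  linear_combination (a - b) / 2

/-- By symmetry of second derivatives the scalar can be moved into the inner derivative, which is
complex linear near z. -/
theorem snd_fderiv_smul (hS : IsSpecialKahler M V) {z : Fin n → ℂ} (hz : z ∈ M) (c : ℂ)
    (h k : Fin n → ℂ) :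
    fderiv ℝ (fderiv ℝ V) z (c • h) k = c • fderiv ℝ (fderiv ℝ V) z h k := by
  rw [hS.snd_fderiv_symm hz, hS.snd_fderiv_symm hz h]
  have e2 : (fun w => fderiv ℝ V w (c • h)) =ᶠ[nhds z] fun w => c • fderiv ℝ V w h := by
    filter_upwards [hS.isOpen.mem_nhds hz] with w hw using hS.fderiv_smul hw c h
  have h1 := fderiv_apply_const (hS.differentiableAt_fderiv hz) (c • h) k
  have h2 := fderiv_apply_const (hS.differentiableAt_fderiv hz) h k
  rw [← h1, e2.fderiv_eq, fderiv_fun_const_smul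
    (hasFDerivAt_apply_const (hS.differentiableAt_fderiv hz) h).differentiableAt, smul_apply, h2]

/-- The correction ∂_i K in D_i V is precisely the coefficient that makes D_i V orthogonal to V for
the hermitian form ⟨V̄, ·⟩. -/
theorem sympl_conj_covSection (hS : IsSpecialKahler M V) {z : Fin n → ℂ} (hz : z ∈ M)
    (i : Fin n) : sympl (conjVec n (V z)) (covSection V i z) = 0 := by
  have hY : (expNegK V z : ℂ) ≠ 0 := Complex.ofReal_ne_zero.2 (hS.pos z hz).ne'
  rw [hS.covSection_eq hz, sympl_add_right, sympl_smul_right, sympl_conj_self, delK_apply]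
  field_simp
  rw [Complex.I_sq]; ring

theorem sympl_covSection (hS : IsSpecialKahler M V) {z : Fin n → ℂ} (hz : z ∈ M)
    (i : Fin n) : sympl (V z) (covSection V i z) = 0 := by
  rw [hS.covSection_eq hz, sympl_add_right, sympl_smul_right, sympl_self, hS.sympl_fderiv hz]
  ring

theorem sympl_covSection_covSection (hS : IsSpecialKahler M V) {z : Fin n → ℂ} (hz : z ∈ M)
    (i j : Fin n) : sympl (covSection V i z) (covSection V j z) = 0 := by
  rw [hS.covSection_eq hz i, sympl_add_left, sympl_smul_left, hS.sympl_covSection hz,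
    hS.covSection_eq hz j, sympl_add_right, sympl_smul_right, hS.sympl_fderiv_fderiv hz,
    sympl_swap (V z), hS.sympl_fderiv hz]
  ring

/-- This relates the metric, defined by two derivatives of K, to the hermitian form on symplectic
vectors; the opposite sign to ⟨V̄, V⟩ reflects the signature (1, n). -/
theorem sympl_conj_covSection_covSection (hS : IsSpecialKahler M V) {z : Fin n → ℂ}
    (hz : z ∈ M) (i j : Fin n) : sympl (conjVec n (covSection V j z)) (covSection V i z)
      = Complex.I * expNegK V z * kahlerMetric V z i j := by
  have hY : (expNegK V z : ℂ) ≠ 0 := Complex.ofReal_ne_zero.2 (hS.pos z hz).ne'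
  have hg : kahlerMetric V z i j
      = (expNegK V z : ℂ)⁻¹ ^ 2 * (sympl (conjVec n (V z)) (fderiv ℝ V z (Pi.single i 1))
          * sympl (V z) (conjVec n (fderiv ℝ V z (Pi.single j 1))))
        + Complex.I * (expNegK V z : ℂ)⁻¹ * sympl (fderiv ℝ V z (Pi.single i 1))
          (conjVec n (fderiv ℝ V z (Pi.single j 1))) := by
    have e1 : dBar j (fun w => (kahlerPot V w : ℂ)) =ᶠ[nhds z] fun w =>
        ((expNegK V w)⁻¹ : ℝ) * (Complex.I *
          sympl (V w) (conjVec n (fderiv ℝ V w (Pi.single j 1)))) := by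
      filter_upwards [hS.isOpen.mem_nhds hz] with w hw
      rw [hS.dBar_kahlerPot hw, delK_apply, map_mul, ← sympl_conjVec, conjVec_conjVec]
      simp
      ring
    obtain ⟨Y', hY', e⟩ := hS.hasFDerivAt_expNegK hz
    have d1 := Complex.ofRealCLM.hasFDerivAt.comp z ((hasDerivAt_inv (hS.pos z hz).ne').comp_hasFDerivAt z hY')
    have d2 := (hasFDerivAt_sympl (hS.hasFDerivAt hz) ((conjVec n).hasFDerivAt.comp z
      (hasFDerivAt_apply_const (hS.differentiableAt_fderiv hz) (Pi.single j 1)))).const_mul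
        Complex.I
    have d3 := (d1.mul d2).congr_of_eventuallyEq e1
    have hI : (Complex.I : ℂ) ≠ 0 := Complex.I_ne_zero
    -- Here `a` collects the terms complex linear in h and `b` the antilinear ones; the
    -- (1,0)-derivative is `a`.
    refine (dHol_eq (a := fun h => (expNegK V z : ℂ)⁻¹ ^ 2 *
        (sympl (conjVec n (V z)) (fderiv ℝ V z h)
          * sympl (V z) (conjVec n (fderiv ℝ V z (Pi.single j 1))))
        + Complex.I * (expNegK V z : ℂ)⁻¹ * sympl (fderiv ℝ V z h)
          (conjVec n (fderiv ℝ V z (Pi.single j 1))))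
      (b := fun h => (expNegK V z : ℂ)⁻¹ * (starRingEnd ℂ) (delK V z h) * Complex.I
          * sympl (V z) (conjVec n (fderiv ℝ V z (Pi.single j 1)))
        + Complex.I * (expNegK V z : ℂ)⁻¹ * sympl (V z)
          (conjVec n (fderiv ℝ (fderiv ℝ V) z h (Pi.single j 1)))) d3 ?_ ?_ ?_ i)
    · intro h
      simp [symplB_apply, e]
      rw [delK_apply]
      field_simp
      ring_nf
      simp only [Complex.I_sq]
      ring
    · intro h
      simp only [hS.fderiv_smul hz, sympl_smul_left, sympl_smul_right]
      ring
    · intro h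
      simp only [hS.delK_smul hz, hS.snd_fderiv_smul hz, conjVec_smul, sympl_smul_right, map_mul,
        Complex.conj_I]
      ring
  rw [hg, hS.covSection_eq hz i, hS.covSection_eq hz j, map_add, conjVec_smul]
  simp only [sympl_add_left, sympl_add_right, sympl_smul_left, sympl_smul_right, sympl_conj_self,
    delK_apply]
  rw [sympl_swap (fderiv ℝ V z _) (conjVec n _), sympl_swap (V z) (conjVec n _)]
  field_simp
  ring_nf
  simp only [Complex.I_sq]
  ring

end IsSpecialKahler

end SpecialGeometry

/-! ### The symplectic basis formed by the section and a unitary frame. -/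

section SymplecticFrame

variable {n : ℕ}

/-- Expansion of a vector in a family with a dual family of functionals. -/
theorem eq_sum_of_dual {κ : Type*} [Fintype κ] [DecidableEq κ] {W : Type*} [AddCommGroup W]
    [Module ℂ W] [FiniteDimensional ℂ W] (hcard : Fintype.card κ = Module.finrank ℂ W)
    (w : κ → W) (l : κ → W →ₗ[ℂ] ℂ) (h : ∀ k k', l k (w k') = if k = k' then 1 else 0) (ξ : W) :
    ξ = ∑ k, l k ξ • w k := by
  have hs : Function.Surjective (LinearMap.pi l) := fun c =>
    ⟨∑ k, c k • w k, by ext k; simp [h]⟩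
  have hi := (LinearMap.injective_iff_surjective_of_finrank_eq_finrank
    (by rw [Module.finrank_fintype_fun_eq_card, hcard])).2 hs
  refine hi ?_
  ext k
  simp [h]

/-- The symplectic product with a fixed vector as a linear functional. -/
def symplL (A : SympVec n) : SympVec n →ₗ[ℂ] ℂ where
  toFun B := sympl A B
  map_add' B C := sympl_add_right A B C
  map_smul' c B := sympl_smul_right c A B

theorem symplL_apply (A B : SympVec n) : symplL A B = sympl A B := rfl

/-- Expansion of a symplectic vector in a frame `w₀, w_a` and its complex conjugate, when the
hermitian products of the frame vectors are `∓ i y`. -/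
theorem eq_sum_sympl (w₀ : SympVec n) (w : Fin n → SympVec n) {y : ℂ} (hy : y ≠ 0)
    (h₀ : sympl (conjVec n w₀) w₀ = -Complex.I * y)
    (h₁ : ∀ a, sympl (conjVec n w₀) (w a) = 0) (h₂ : ∀ a, sympl w₀ (w a) = 0)
    (h₃ : ∀ a b, sympl (w a) (w b) = 0)
    (h₄ : ∀ a b, sympl (conjVec n (w a)) (w b) = if a = b then Complex.I * y else 0)
    (ξ : SympVec n) :
    ξ = (Complex.I * y⁻¹ * sympl (conjVec n w₀) ξ) • w₀
      - ∑ a, (Complex.I * y⁻¹ * sympl (conjVec n (w a)) ξ) • w a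
      - (Complex.I * y⁻¹ * sympl w₀ ξ) • conjVec n w₀
      + ∑ a, (Complex.I * y⁻¹ * sympl (w a) ξ) • conjVec n (w a) := by
  have hI : Complex.I * Complex.I = -1 := Complex.I_mul_I
  have c₁ : ∀ a, sympl w₀ (conjVec n (w a)) = 0 := fun a => by
    rw [← conjVec_conjVec w₀, sympl_conjVec, h₁, map_zero]
  have c₂ : ∀ a, sympl (conjVec n w₀) (conjVec n (w a)) = 0 := fun a => by
    rw [sympl_conjVec, h₂, map_zero]
  have c₃ : ∀ a b, sympl (conjVec n (w a)) (conjVec n (w b)) = 0 := fun a b => by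
    rw [sympl_conjVec, h₃, map_zero]
  have s₁ : ∀ a, sympl (w a) w₀ = 0 := fun a => by rw [sympl_swap, h₂, neg_zero]
  have s₂ : ∀ a, sympl (conjVec n (w a)) w₀ = 0 := fun a => by rw [sympl_swap, c₁, neg_zero]
  have s₃ : ∀ a, sympl (w a) (conjVec n w₀) = 0 := fun a => by rw [sympl_swap, h₁, neg_zero]
  have s₄ : ∀ a, sympl (conjVec n (w a)) (conjVec n w₀) = 0 := fun a => by
    rw [sympl_swap, c₂, neg_zero]
  have s₅ : sympl w₀ (conjVec n w₀) = Complex.I * y := by rw [sympl_swap, h₀]; ring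
  have s₆ : ∀ a b, sympl (w a) (conjVec n (w b)) = if a = b then -(Complex.I * y) else 0 :=
    fun a b => by
      rw [sympl_swap, h₄]
      by_cases h : a = b <;> simp [h, eq_comm]
  -- The dual functionals are multiples of pairings with the conjugate basis vectors. The signs
  -- alternate because ⟨w̄₀, w₀⟩ and ⟨w̄_a, w_a⟩ have opposite signs and the pairing is
  -- antisymmetric.
  have key := eq_sum_of_dual (κ := Option (Fin n) ⊕ Option (Fin n))
    (by simp)
    (Sum.elim (fun I => I.elim w₀ w) (fun I => I.elim (conjVec n w₀) (fun a => conjVec n (w a))))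
    (Sum.elim (fun I => I.elim (symplL ((Complex.I * y⁻¹) • conjVec n w₀))
      (fun a => symplL ((-(Complex.I * y⁻¹)) • conjVec n (w a))))
      (fun I => I.elim (symplL ((-(Complex.I * y⁻¹)) • w₀))
      (fun a => symplL ((Complex.I * y⁻¹) • w a)))) ?_ ξ
  · conv_lhs => rw [key]
    simp only [Fintype.sum_sum_type, Fintype.sum_option, Sum.elim_inl, Sum.elim_inr,
      Option.elim_none, Option.elim_some, symplL_apply, sympl_smul_left, sympl_neg_left, neg_smul,
      Finset.sum_neg_distrib]
    abel
  · have e : Complex.I * y⁻¹ * (Complex.I * y) = -1 := by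
      field_simp; rw [Complex.I_sq]
    rintro ((_ | a) | (_ | a)) ((_ | b) | (_ | b)) <;>
    simp only [Sum.elim_inl, Sum.elim_inr, Option.elim_none, Option.elim_some, symplL_apply,
      sympl_smul_left, sympl_self, h₀, h₁, h₂, h₃, h₄, c₁, c₂, c₃, s₁, s₂, s₃, s₄, s₅, s₆,
      mul_zero, reduceCtorEq, if_false, if_true, Sum.inl.injEq, Sum.inr.injEq,
      Option.some.injEq, mul_ite, neg_mul, mul_neg, e, neg_neg]

end SymplecticFrame

section SpecialFrame

variable {n : ℕ} {M : Set (Fin n → ℂ)} {V : (Fin n → ℂ) → SympVec n}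
  {P : (Fin n → ℂ) → Matrix (Fin n) (Fin n) ℂ}

/-- The covariant derivatives of the section along the dual unitary frame. -/
def frameVec (V : (Fin n → ℂ) → SympVec n) (P : (Fin n → ℂ) → Matrix (Fin n) (Fin n) ℂ)
    (a : Fin n) (z : Fin n → ℂ) : SympVec n :=
  ∑ i, (P z)⁻¹ i a • covSection V i z

/-- The unitary coframe `e^a`. -/
def frameForm (P : (Fin n → ℂ) → Matrix (Fin n) (Fin n) ℂ) (a : Fin n) (z : Fin n → ℂ) :
    (Fin n → ℂ) →L[ℝ] ℂ :=
  ∑ i, P z a i • ContinuousLinearMap.proj (R := ℝ) (φ := fun _ : Fin n => ℂ) i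

theorem frameForm_apply (a : Fin n) (z h : Fin n → ℂ) :
    frameForm P a z h = ∑ i, P z a i * h i := by
  simp [frameForm]

namespace IsUnitaryFrame

/-- The metric factors as PᵀP̄ and is positive definite, so det P cannot vanish. -/
theorem isUnit_det (hS : IsSpecialKahler M V) (hP : IsUnitaryFrame M V P) {z : Fin n → ℂ}
    (hz : z ∈ M) : IsUnit (P z).det := by
  have h : kahlerMetric V z = (P z).transpose * ((P z).map (starRingEnd ℂ)) := by
    ext i j
    simp [hP.metric_eq z hz, Matrix.mul_apply]
  have hd := (hS.metric_pos z hz).det_pos.ne'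
  rw [h, Matrix.det_mul, Matrix.det_transpose] at hd
  exact isUnit_iff_ne_zero.2 (left_ne_zero_of_mul hd)

theorem frameForm_inv (hS : IsSpecialKahler M V) (hP : IsUnitaryFrame M V P) {z : Fin n → ℂ}
    (hz : z ∈ M) (a b : Fin n) :
    frameForm P a z (fun i => (P z)⁻¹ i b) = if a = b then 1 else 0 := by
  rw [frameForm_apply, ← Matrix.mul_apply, Matrix.mul_nonsing_inv _ (hP.isUnit_det hS hz),
    Matrix.one_apply]

theorem sum_frameForm_smul (hS : IsSpecialKahler M V) (hP : IsUnitaryFrame M V P)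
    {z : Fin n → ℂ} (hz : z ∈ M) (h : Fin n → ℂ) :
    ∑ a, frameForm P a z h • (fun i => (P z)⁻¹ i a) = h := by
  have h1 : (P z)⁻¹.mulVec ((P z).mulVec h) = h := by
    rw [Matrix.mulVec_mulVec, Matrix.nonsing_inv_mul _ (hP.isUnit_det hS hz), Matrix.one_mulVec]
  conv_rhs => rw [← h1]
  ext i
  simp only [Finset.sum_apply, Pi.smul_apply, smul_eq_mul, frameForm_apply, Matrix.mulVec,
    dotProduct]
  exact Finset.sum_congr rfl fun a _ => mul_comm _ _

theorem frameVec_eq (hS : IsSpecialKahler M V) {z : Fin n → ℂ} (hz : z ∈ M) (a : Fin n) :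
    frameVec V P a z = fderiv ℝ V z (fun i => (P z)⁻¹ i a)
      + delK V z (fun i => (P z)⁻¹ i a) • V z := by
  have h : (fun i => (P z)⁻¹ i a) = ∑ i, (P z)⁻¹ i a • (Pi.single i 1 : Fin n → ℂ) := by
    ext i; simp [Finset.sum_apply, Pi.single_apply]
  rw [h, map_sum, map_sum, Finset.sum_smul, ← Finset.sum_add_distrib, frameVec]
  refine Finset.sum_congr rfl fun i _ => ?_
  rw [hS.covSection_eq hz, hS.fderiv_smul hz, hS.delK_smul hz, smul_add, smul_smul]

/-- The first structure equation, dV = e^a U_a - (∂K) V, where U_a denotes D_a V in the unitary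
frame. It is the definition of U_a, solved for dV. -/
theorem fderiv_section (hS : IsSpecialKahler M V) (hP : IsUnitaryFrame M V P) {z : Fin n → ℂ}
    (hz : z ∈ M) (h : Fin n → ℂ) :
    fderiv ℝ V z h = ∑ a, frameForm P a z h • frameVec V P a z - delK V z h • V z := by
  have h1 : ∀ a, frameForm P a z h • frameVec V P a z
      = fderiv ℝ V z (frameForm P a z h • (fun i => (P z)⁻¹ i a))
        + delK V z (frameForm P a z h • (fun i => (P z)⁻¹ i a)) • V z := fun a => by
    rw [frameVec_eq hS hz, hS.fderiv_smul hz, hS.delK_smul hz, smul_add, smul_smul]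
  simp only [h1, Finset.sum_add_distrib, ← Finset.sum_smul, ← map_sum]
  rw [hP.sum_frameForm_smul hS hz, add_sub_cancel_right]

theorem sympl_conj_frameVec (hS : IsSpecialKahler M V) {z : Fin n → ℂ} (hz : z ∈ M)
    (a : Fin n) : sympl (conjVec n (V z)) (frameVec V P a z) = 0 := by
  rw [frameVec, sympl_sum_right]
  exact Finset.sum_eq_zero fun i _ => by
    rw [sympl_smul_right, hS.sympl_conj_covSection hz, mul_zero]

theorem sympl_frameVec (hS : IsSpecialKahler M V) {z : Fin n → ℂ} (hz : z ∈ M)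
    (a : Fin n) : sympl (V z) (frameVec V P a z) = 0 := by
  rw [frameVec, sympl_sum_right]
  exact Finset.sum_eq_zero fun i _ => by
    rw [sympl_smul_right, hS.sympl_covSection hz, mul_zero]

theorem sympl_frameVec_frameVec (hS : IsSpecialKahler M V) {z : Fin n → ℂ} (hz : z ∈ M)
    (a b : Fin n) : sympl (frameVec V P a z) (frameVec V P b z) = 0 := by
  rw [frameVec, sympl_sum_left]
  refine Finset.sum_eq_zero fun i _ => ?_
  rw [frameVec, sympl_smul_left, sympl_sum_right, Finset.sum_eq_zero fun j _ => ?_, mul_zero]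
  rw [sympl_smul_right, hS.sympl_covSection_covSection hz, mul_zero]

theorem sympl_conj_frameVec_frameVec (hS : IsSpecialKahler M V) (hP : IsUnitaryFrame M V P)
    {z : Fin n → ℂ} (hz : z ∈ M) (a b : Fin n) :
    sympl (conjVec n (frameVec V P a z)) (frameVec V P b z)
      = if a = b then Complex.I * (expNegK V z : ℂ) else 0 := by
  have e : ∀ i j, kahlerMetric V z i j = ∑ c, P z c i * (starRingEnd ℂ) (P z c j) :=
    hP.metric_eq z hz
  have o : ∀ c b, ∑ i, P z c i * (P z)⁻¹ i b = if c = b then 1 else 0 := fun c b => by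
    rw [← frameForm_apply, hP.frameForm_inv hS hz]
  have o' : ∀ c, ∑ j, (starRingEnd ℂ) ((P z)⁻¹ j a) * (starRingEnd ℂ) (P z c j)
      = if c = a then 1 else 0 := fun c => by
    have := congrArg (starRingEnd ℂ) (o c a)
    rw [map_sum] at this
    simp only [map_mul] at this
    simp only [mul_comm ((starRingEnd ℂ) ((P z)⁻¹ _ a)), this]
    split_ifs <;> simp
  calc sympl (conjVec n (frameVec V P a z)) (frameVec V P b z)
      = ∑ j, ∑ i, (starRingEnd ℂ) ((P z)⁻¹ j a) * ((P z)⁻¹ i b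
          * (Complex.I * expNegK V z * ∑ c, P z c i * (starRingEnd ℂ) (P z c j))) := by
        simp only [frameVec, map_sum, conjVec_smul, sympl_sum_left, sympl_sum_right,
          sympl_smul_left, sympl_smul_right, hS.sympl_conj_covSection_covSection hz, e,
          Finset.mul_sum]
        rw [Finset.sum_comm]
        refine Finset.sum_congr rfl fun j _ => Finset.sum_congr rfl fun i _ =>
          Finset.sum_congr rfl fun c _ => ?_
        ring
    _ = Complex.I * expNegK V z * ∑ c, (∑ i, P z c i * (P z)⁻¹ i b) *
          ∑ j, (starRingEnd ℂ) ((P z)⁻¹ j a) * (starRingEnd ℂ) (P z c j) := by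
        simp only [Finset.mul_sum, Finset.sum_mul]
        rw [Finset.sum_comm' (t' := Finset.univ) (s' := fun _ => Finset.univ) (by simp)]
        rw [Finset.sum_comm]
        conv_rhs => rw [Finset.sum_comm]
        refine Finset.sum_congr rfl fun j _ => ?_
        rw [Finset.sum_comm]
        refine Finset.sum_congr rfl fun c _ => Finset.sum_congr rfl fun i _ => ?_
        ring
    _ = _ := by
        simp only [o, o']
        simp [eq_comm]

/-- V, U_a and their conjugates form a basis of ℂ^{2n+2} whose dual basis is given by symplectic
products. Every later structure equation results from expanding some vector in it. -/
theorem expansion (hS : IsSpecialKahler M V) (hP : IsUnitaryFrame M V P) {z : Fin n → ℂ}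
    (hz : z ∈ M) (ξ : SympVec n) :
    ξ = (Complex.I * (expNegK V z : ℂ)⁻¹ * sympl (conjVec n (V z)) ξ) • V z
      - ∑ a, (Complex.I * (expNegK V z : ℂ)⁻¹ * sympl (conjVec n (frameVec V P a z)) ξ) •
          frameVec V P a z
      - (Complex.I * (expNegK V z : ℂ)⁻¹ * sympl (V z) ξ) • conjVec n (V z)
      + ∑ a, (Complex.I * (expNegK V z : ℂ)⁻¹ * sympl (frameVec V P a z) ξ) •
          conjVec n (frameVec V P a z) :=
  eq_sum_sympl (V z) (fun a => frameVec V P a z) (Complex.ofReal_ne_zero.2 (hS.pos z hz).ne')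
    (sympl_conj_self V z) (fun a => sympl_conj_frameVec hS hz a)
    (fun a => sympl_frameVec hS hz a) (fun a b => sympl_frameVec_frameVec hS hz a b)
    (fun a b => hP.sympl_conj_frameVec_frameVec hS hz a b) ξ

end IsUnitaryFrame

end SpecialFrame

/-! ### Smoothness of the inverse matrix. -/

section MatrixSmooth

variable {H ν : Type*} [NormedAddCommGroup H] [NormedSpace ℝ H] [Fintype ν] [DecidableEq ν]
  {s : Set H}

theorem contDiffOn_det {A : H → Matrix ν ν ℂ} (hA : ∀ i j, ContDiffOn ℝ ∞ (fun z => A z i j) s) :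
    ContDiffOn ℝ ∞ (fun z => (A z).det) s := by
  simp only [Matrix.det_apply]
  exact ContDiffOn.sum fun σ _ => ContDiffOn.const_smul _ (contDiffOn_prod fun i _ => hA _ _)

/-- By Cramer's rule the entries of the inverse are quotients of determinants. -/
theorem contDiffOn_matrix_inv {A : H → Matrix ν ν ℂ}
    (hA : ∀ i j, ContDiffOn ℝ ∞ (fun z => A z i j) s) (hd : ∀ z ∈ s, IsUnit (A z).det) (i j : ν) :
    ContDiffOn ℝ ∞ (fun z => (A z)⁻¹ i j) s := by
  have h : ContDiffOn ℝ ∞ (fun z => ((A z).det)⁻¹ * ((A z).updateRow j (Pi.single i 1)).det) s := by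
    refine ((contDiffOn_det hA).inv fun z hz => (hd z hz).ne_zero).mul (contDiffOn_det fun k l => ?_)
    by_cases hk : k = j
    · subst hk; simpa using contDiffOn_const
    · simpa [Matrix.updateRow_ne hk] using hA k l
  refine h.congr fun z hz => ?_
  rw [Matrix.inv_def, Ring.inverse_eq_inv', Matrix.smul_apply, smul_eq_mul, Matrix.adjugate_apply]

end MatrixSmooth

/-! ### Structure equations of special Kähler geometry. -/

section SpecialStructure

variable {n : ℕ} {M : Set (Fin n → ℂ)} {V : (Fin n → ℂ) → SympVec n}
  {P : (Fin n → ℂ) → Matrix (Fin n) (Fin n) ℂ}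

/-- The device behind the structure equations: a pairing of basis vectors known near z is
differentiated by the product rule, which constrains the components of their differentials. -/
theorem sympl_fderiv_of_eq {H : Type*} [NormedAddCommGroup H] [NormedSpace ℝ H]
    {A B : H → SympVec n} {g : H → ℂ} {g' : H →L[ℝ] ℂ} {z : H} (hA : DifferentiableAt ℝ A z)
    (hB : DifferentiableAt ℝ B z) (hg : HasFDerivAt g g' z)
    (h : (fun w => sympl (A w) (B w)) =ᶠ[nhds z] g) (k : H) :
    sympl (fderiv ℝ A z k) (B z) + sympl (A z) (fderiv ℝ B z k) = g' k := by
  have h1 := (hasFDerivAt_sympl hA.hasFDerivAt hB.hasFDerivAt).unique (hg.congr_of_eventuallyEq h)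
  rw [← h1, add_comm]
  rfl

theorem hasFDerivAt_conjVec {H : Type*} [NormedAddCommGroup H] [NormedSpace ℝ H]
    {A : H → SympVec n} {z : H} (hA : DifferentiableAt ℝ A z) :
    HasFDerivAt (fun w => conjVec n (A w)) ((conjVec n).comp (fderiv ℝ A z)) z :=
  (conjVec n).hasFDerivAt.comp z hA.hasFDerivAt

namespace IsSpecialKahler

theorem contDiffOn_fderiv (hS : IsSpecialKahler M V) : ContDiffOn ℝ ∞ (fderiv ℝ V) M :=
  hS.smooth.fderiv_of_isOpen hS.isOpen (by simp)

theorem contDiffOn_expNegK (hS : IsSpecialKahler M V) : ContDiffOn ℝ ∞ (expNegK V) M :=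
  Complex.reCLM.contDiff.comp_contDiffOn
    (contDiffOn_const.mul (ContDiffOn.sympl ((conjVec n).contDiff.comp_contDiffOn hS.smooth)
      hS.smooth))

theorem contDiffOn_kahlerPot (hS : IsSpecialKahler M V) : ContDiffOn ℝ ∞ (kahlerPot V) M :=
  (hS.contDiffOn_expNegK.log fun z hz => (hS.pos z hz).ne').neg

theorem contDiffOn_inv_expNegK (hS : IsSpecialKahler M V) :
    ContDiffOn ℝ ∞ (fun z => (expNegK V z : ℂ)⁻¹) M :=
  (Complex.ofRealCLM.contDiff.comp_contDiffOn hS.contDiffOn_expNegK).inv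
    fun z hz => Complex.ofReal_ne_zero.2 (hS.pos z hz).ne'

theorem contDiffOn_delK (hS : IsSpecialKahler M V) : ContDiffOn ℝ ∞ (delK V) M := by
  have h : ContDiffOn ℝ ∞ (fun z => -Complex.I / (expNegK V z : ℂ)) M := by
    simpa only [div_eq_mul_inv] using contDiffOn_const.mul hS.contDiffOn_inv_expNegK
  exact h.smul (((symplB n).contDiff.comp_contDiffOn
    ((conjVec n).contDiff.comp_contDiffOn hS.smooth)).clm_comp hS.contDiffOn_fderiv)

theorem hasFDerivAt_ofReal_expNegK (hS : IsSpecialKahler M V) {z : Fin n → ℂ} (hz : z ∈ M) :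
    ∃ Y' : (Fin n → ℂ) →L[ℝ] ℂ, HasFDerivAt (fun w => (expNegK V w : ℂ)) Y' z ∧ ∀ h, Y' h
      = -expNegK V z * (delK V z h + (starRingEnd ℂ) (delK V z h)) := by
  obtain ⟨Y', hY', e⟩ := hS.hasFDerivAt_expNegK hz
  exact ⟨_, Complex.ofRealCLM.hasFDerivAt.comp z hY', e⟩

end IsSpecialKahler

/-- The matrix of connection forms of the special Kähler manifold in the unitary frame, twisted by
the Kähler connection. -/
def connForm (V : (Fin n → ℂ) → SympVec n) (P : (Fin n → ℂ) → Matrix (Fin n) (Fin n) ℂ)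
    (b a : Fin n) (z : Fin n → ℂ) : (Fin n → ℂ) →L[ℝ] ℂ :=
  (-Complex.I * (expNegK V z : ℂ)⁻¹) •
      (symplB n (conjVec n (frameVec V P b z))).comp (fderiv ℝ (frameVec V P a) z)
    + (if b = a then (1 / 2 : ℂ) else 0) • (delK V z + conjForm (delK V) z)

/-- The second fundamental form of the special Kähler manifold. -/
def secForm (V : (Fin n → ℂ) → SympVec n) (P : (Fin n → ℂ) → Matrix (Fin n) (Fin n) ℂ)
    (b a : Fin n) (z : Fin n → ℂ) : (Fin n → ℂ) →L[ℝ] ℂ :=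
  (Complex.I * (expNegK V z : ℂ)⁻¹) •
      (symplB n (frameVec V P b z)).comp (fderiv ℝ (frameVec V P a) z)

/-- The holomorphic cubic form of the special Kähler manifold in the unitary frame. -/
def cubicForm (V : (Fin n → ℂ) → SympVec n) (P : (Fin n → ℂ) → Matrix (Fin n) (Fin n) ℂ)
    (a b c : Fin n) (z : Fin n → ℂ) : ℂ :=
  secForm V P a b z (fun i => (P z)⁻¹ i c)

/-- The `U(1)` connection `(∂K - ∂̄K) / 2`. -/
def kahlerConn (V : (Fin n → ℂ) → SympVec n) (z : Fin n → ℂ) : (Fin n → ℂ) →L[ℝ] ℂ :=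
  (1 / 2 : ℂ) • (delK V z - conjForm (delK V) z)

theorem kahlerConn_apply (z h : Fin n → ℂ) :
    kahlerConn V z h = (delK V z h - (starRingEnd ℂ) (delK V z h)) / 2 := by
  simp [kahlerConn, conjForm_apply]; ring

namespace IsUnitaryFrame

theorem contDiffOn_inv (hS : IsSpecialKahler M V) (hP : IsUnitaryFrame M V P) (i a : Fin n) :
    ContDiffOn ℝ ∞ (fun z => (P z)⁻¹ i a) M :=
  contDiffOn_matrix_inv hP.smooth (fun _ hz => hP.isUnit_det hS hz) i a

theorem contDiffOn_frameVec (hS : IsSpecialKahler M V) (hP : IsUnitaryFrame M V P) (a : Fin n) :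
    ContDiffOn ℝ ∞ (frameVec V P a) M := by
  have h : ContDiffOn ℝ ∞ (fun z => fderiv ℝ V z (fun i => (P z)⁻¹ i a)
      + delK V z (fun i => (P z)⁻¹ i a) • V z) M := by
    have := contDiffOn_pi.2 fun i => hP.contDiffOn_inv hS i a
    exact (hS.contDiffOn_fderiv.clm_apply this).add ((hS.contDiffOn_delK.clm_apply this).smul
      hS.smooth)
  exact h.congr fun z hz => frameVec_eq hS hz a

theorem contDiffOn_frameForm (hP : IsUnitaryFrame M V P) (a : Fin n) :
    ContDiffOn ℝ ∞ (frameForm P a) M :=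
  ContDiffOn.sum fun i _ => (hP.smooth a i).smul contDiffOn_const

theorem contDiffOn_connForm (hS : IsSpecialKahler M V) (hP : IsUnitaryFrame M V P)
    (b a : Fin n) : ContDiffOn ℝ ∞ (connForm V P b a) M := by
  refine ContDiffOn.add (ContDiffOn.smul (contDiffOn_const.mul hS.contDiffOn_inv_expNegK)
    (((symplB n).contDiff.comp_contDiffOn
      ((conjVec n).contDiff.comp_contDiffOn (hP.contDiffOn_frameVec hS b))).clm_comp
      ((hP.contDiffOn_frameVec hS a).fderiv_of_isOpen hS.isOpen (by simp)))) ?_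
  exact ContDiffOn.const_smul _ (hS.contDiffOn_delK.add (contDiffOn_conjForm hS.contDiffOn_delK))

theorem contDiffOn_secForm (hS : IsSpecialKahler M V) (hP : IsUnitaryFrame M V P)
    (b a : Fin n) : ContDiffOn ℝ ∞ (secForm V P b a) M :=
  ContDiffOn.smul (contDiffOn_const.mul hS.contDiffOn_inv_expNegK)
    (((symplB n).contDiff.comp_contDiffOn (hP.contDiffOn_frameVec hS b)).clm_comp
      ((hP.contDiffOn_frameVec hS a).fderiv_of_isOpen hS.isOpen (by simp)))

theorem contDiffOn_cubicForm (hS : IsSpecialKahler M V) (hP : IsUnitaryFrame M V P)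
    (a b c : Fin n) : ContDiffOn ℝ ∞ (cubicForm V P a b c) M :=
  (hP.contDiffOn_secForm hS a b).clm_apply (contDiffOn_pi.2 fun i => hP.contDiffOn_inv hS i c)

theorem differentiableAt_frameVec (hS : IsSpecialKahler M V) (hP : IsUnitaryFrame M V P)
    {z : Fin n → ℂ} (hz : z ∈ M) (a : Fin n) : DifferentiableAt ℝ (frameVec V P a) z :=
  ((hP.contDiffOn_frameVec hS a).contDiffAt (hS.isOpen.mem_nhds hz)).differentiableAt (by simp)

theorem sympl_fderiv_frameVec (hS : IsSpecialKahler M V) (hP : IsUnitaryFrame M V P)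
    {z : Fin n → ℂ} (hz : z ∈ M) (a : Fin n) (h : Fin n → ℂ) :
    sympl (V z) (fderiv ℝ (frameVec V P a) z h) = 0 := by
  have := sympl_fderiv_of_eq (hS.hasFDerivAt hz).differentiableAt
    (hP.differentiableAt_frameVec hS hz a) (hasFDerivAt_const (0 : ℂ) z)
    (by filter_upwards [hS.isOpen.mem_nhds hz] with w hw using sympl_frameVec hS hw a) h
  rw [hP.fderiv_section hS hz, sympl_sub_left, sympl_smul_left, sympl_frameVec hS hz,
    sympl_sum_left, Finset.sum_eq_zero fun b _ => by
      rw [sympl_smul_left, sympl_frameVec_frameVec hS hz, mul_zero]] at this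
  simpa using this

/-- Since ⟨V̄, U_a⟩ = 0, the component of dU_a along V is determined by the component of dV along
U_a. This produces the term ē^a V of `fderiv_frameVec`. -/
theorem sympl_conj_fderiv_frameVec (hS : IsSpecialKahler M V) (hP : IsUnitaryFrame M V P)
    {z : Fin n → ℂ} (hz : z ∈ M) (a : Fin n) (h : Fin n → ℂ) :
    sympl (conjVec n (V z)) (fderiv ℝ (frameVec V P a) z h)
      = -(Complex.I * expNegK V z * (starRingEnd ℂ) (frameForm P a z h)) := by
  have := sympl_fderiv_of_eq
    (hasFDerivAt_conjVec (hS.hasFDerivAt hz).differentiableAt).differentiableAt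
    (hP.differentiableAt_frameVec hS hz a) (hasFDerivAt_const (0 : ℂ) z)
    (by filter_upwards [hS.isOpen.mem_nhds hz] with w hw using sympl_conj_frameVec hS hw a) h
  rw [(hasFDerivAt_conjVec (hS.hasFDerivAt hz).differentiableAt).fderiv,
    ContinuousLinearMap.comp_apply, hP.fderiv_section hS hz, map_sub, conjVec_smul,
    sympl_sub_left, sympl_smul_left, sympl_conj_frameVec hS hz, map_sum, sympl_sum_left] at this
  simp only [conjVec_smul, sympl_smul_left, hP.sympl_conj_frameVec_frameVec hS hz] at this
  simp at this
  linear_combination this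

theorem sympl_frameVec_fderiv (z : Fin n → ℂ) (a b : Fin n) (h : Fin n → ℂ) (hY : 0 < expNegK V z) :
    sympl (frameVec V P b z) (fderiv ℝ (frameVec V P a) z h)
      = -(Complex.I * expNegK V z * secForm V P b a z h) := by
  have : (expNegK V z : ℂ) ≠ 0 := Complex.ofReal_ne_zero.2 hY.ne'
  simp only [secForm, smul_apply, ContinuousLinearMap.comp_apply, symplB_apply, smul_eq_mul]
  field_simp
  rw [Complex.I_sq]; ring

theorem sympl_conj_frameVec_fderiv (z : Fin n → ℂ) (a b : Fin n) (h : Fin n → ℂ)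
    (hY : 0 < expNegK V z) :
    sympl (conjVec n (frameVec V P b z)) (fderiv ℝ (frameVec V P a) z h)
      = Complex.I * expNegK V z * (connForm V P b a z h
        - (if b = a then (1 / 2 : ℂ) else 0) * (delK V z h + (starRingEnd ℂ) (delK V z h))) := by
  have : (expNegK V z : ℂ) ≠ 0 := Complex.ofReal_ne_zero.2 hY.ne'
  simp only [connForm, smul_apply, add_apply, ContinuousLinearMap.comp_apply, symplB_apply,
    smul_eq_mul, conjForm_apply, add_sub_cancel_right]
  field_simp
  rw [Complex.I_sq]; ring

/-- Differential of the frame of the special Kähler manifold. -/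
theorem fderiv_frameVec (hS : IsSpecialKahler M V) (hP : IsUnitaryFrame M V P)
    {z : Fin n → ℂ} (hz : z ∈ M) (a : Fin n) (h : Fin n → ℂ) :
    fderiv ℝ (frameVec V P a) z h = (starRingEnd ℂ) (frameForm P a z h) • V z
      + ∑ b, connForm V P b a z h • frameVec V P b z
      - ((delK V z h + (starRingEnd ℂ) (delK V z h)) / 2) • frameVec V P a z
      + ∑ b, secForm V P b a z h • conjVec n (frameVec V P b z) := by
  have hY : (expNegK V z : ℂ) ≠ 0 := Complex.ofReal_ne_zero.2 (hS.pos z hz).ne'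
  have hI : Complex.I * (expNegK V z : ℂ)⁻¹ * (Complex.I * expNegK V z) = -1 := by
    field_simp; rw [Complex.I_sq]
  have e1 : (Complex.I * (expNegK V z : ℂ)⁻¹) * sympl (conjVec n (V z))
      (fderiv ℝ (frameVec V P a) z h) = (starRingEnd ℂ) (frameForm P a z h) := by
    rw [hP.sympl_conj_fderiv_frameVec hS hz]
    linear_combination -(starRingEnd ℂ) (frameForm P a z h) * hI
  have e2 : ∀ b, (Complex.I * (expNegK V z : ℂ)⁻¹) * sympl (conjVec n (frameVec V P b z))
      (fderiv ℝ (frameVec V P a) z h) = -(connForm V P b a z h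
        - (if b = a then (1 / 2 : ℂ) else 0) * (delK V z h + (starRingEnd ℂ) (delK V z h))) :=
    fun b => by
      rw [sympl_conj_frameVec_fderiv z a b h (hS.pos z hz)]
      linear_combination (connForm V P b a z h
        - (if b = a then (1 / 2 : ℂ) else 0) * (delK V z h + (starRingEnd ℂ) (delK V z h))) * hI
  have e3 : ∀ b, (Complex.I * (expNegK V z : ℂ)⁻¹) * sympl (frameVec V P b z)
      (fderiv ℝ (frameVec V P a) z h) = secForm V P b a z h :=
    fun b => by
      rw [sympl_frameVec_fderiv z a b h (hS.pos z hz)]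
      linear_combination -(secForm V P b a z h) * hI
  conv_lhs => rw [hP.expansion hS hz (fderiv ℝ (frameVec V P a) z h)]
  simp only [e1, e2, e3, hP.sympl_fderiv_frameVec hS hz, mul_zero, zero_smul, sub_zero, neg_smul,
    sub_smul, Finset.sum_neg_distrib, Finset.sum_sub_distrib, ite_mul, zero_mul, ite_smul,
    Finset.sum_ite_eq', Finset.mem_univ, if_true]
  rw [show (1 / 2 : ℂ) * (delK V z h + (starRingEnd ℂ) (delK V z h))
    = (delK V z h + (starRingEnd ℂ) (delK V z h)) / 2 by ring]
  abel

/-- Differentiating ⟨Ū_b, U_a⟩ = iYδ_{ab}, with Y = exp(-K), would leave a trace from dY = -Y(∂K +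
∂̄K). The multiple of ∂K + ∂̄K built into `connForm` removes it. -/
theorem connForm_antiherm (hS : IsSpecialKahler M V) (hP : IsUnitaryFrame M V P)
    {z : Fin n → ℂ} (hz : z ∈ M) (a b : Fin n) (h : Fin n → ℂ) :
    (starRingEnd ℂ) (connForm V P a b z h) = -connForm V P b a z h := by
  have hY : (expNegK V z : ℂ) ≠ 0 := Complex.ofReal_ne_zero.2 (hS.pos z hz).ne'
  obtain ⟨Y', hY', e⟩ := hS.hasFDerivAt_ofReal_expNegK hz
  have := sympl_fderiv_of_eq
    (hasFDerivAt_conjVec (hP.differentiableAt_frameVec hS hz b)).differentiableAt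
    (hP.differentiableAt_frameVec hS hz a)
    (g := fun w => if b = a then Complex.I * (expNegK V w : ℂ) else 0)
    (g' := if b = a then Complex.I • Y' else 0)
    (by
      split_ifs
      · exact hY'.const_mul Complex.I
      · exact hasFDerivAt_const 0 z)
    (by filter_upwards [hS.isOpen.mem_nhds hz] with w hw
          using hP.sympl_conj_frameVec_frameVec hS hw b a) h
  rw [(hasFDerivAt_conjVec (hP.differentiableAt_frameVec hS hz b)).fderiv,
    ContinuousLinearMap.comp_apply, sympl_conj_frameVec_fderiv z a b h (hS.pos z hz),
    ← conjVec_conjVec (frameVec V P a z), sympl_conjVec, sympl_swap,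
    sympl_conj_frameVec_fderiv z b a h (hS.pos z hz)] at this
  by_cases hab : b = a
  · subst hab
    simp [e] at this
    rw [show (starRingEnd ℂ) (2 : ℂ) = 2 from map_ofNat _ 2] at this
    refine mul_left_cancel₀ (mul_ne_zero Complex.I_ne_zero hY) ?_
    linear_combination this
  · simp [hab, Ne.symm hab] at this
    refine mul_left_cancel₀ (mul_ne_zero Complex.I_ne_zero hY) ?_
    linear_combination this

/-- The pairings ⟨U_a, U_b⟩ vanish near z, and their derivative is the antisymmetric part of the
second fundamental form. -/
theorem secForm_symm (hS : IsSpecialKahler M V) (hP : IsUnitaryFrame M V P)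
    {z : Fin n → ℂ} (hz : z ∈ M) (a b : Fin n) (h : Fin n → ℂ) :
    secForm V P a b z h = secForm V P b a z h := by
  have := sympl_fderiv_of_eq (hP.differentiableAt_frameVec hS hz a)
    (hP.differentiableAt_frameVec hS hz b) (hasFDerivAt_const (0 : ℂ) z)
    (by filter_upwards [hS.isOpen.mem_nhds hz] with w hw
          using sympl_frameVec_frameVec hS hw a b) h
  rw [sympl_swap] at this
  simp only [secForm, smul_apply, ContinuousLinearMap.comp_apply, symplB_apply, smul_eq_mul]
  simp at this
  linear_combination (Complex.I * (expNegK V z : ℂ)⁻¹) * this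

/-- The integrability condition of the differential of the section. -/
theorem alternating_fderiv_section (hS : IsSpecialKahler M V) (hP : IsUnitaryFrame M V P)
    {z : Fin n → ℂ} (hz : z ∈ M) (X Y : Fin n → ℂ) :
    ∑ a, extD (frameForm P a) z X Y • frameVec V P a z
      + ∑ a, (frameForm P a z Y • fderiv ℝ (frameVec V P a) z X
        - frameForm P a z X • fderiv ℝ (frameVec V P a) z Y)
      - extD (delK V) z X Y • V z
      - (delK V z Y • fderiv ℝ V z X - delK V z X • fderiv ℝ V z Y) = 0 := by
  have hn := hS.isOpen.mem_nhds hz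
  have de : ∀ a, DifferentiableAt ℝ (frameForm P a) z := fun a =>
    ((hP.contDiffOn_frameForm a).contDiffAt hn).differentiableAt (by simp)
  have dk : DifferentiableAt ℝ (delK V) z :=
    (hS.contDiffOn_delK.contDiffAt hn).differentiableAt (by simp)
  have key : ∀ X Y, fderiv ℝ (fderiv ℝ V) z X Y
      = ∑ a, (frameForm P a z Y • fderiv ℝ (frameVec V P a) z X
          + fderiv ℝ (frameForm P a) z X Y • frameVec V P a z)
        - (delK V z Y • fderiv ℝ V z X + fderiv ℝ (delK V) z X Y • V z) := by
    intro X Y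
    have h1 : HasFDerivAt (fun w => ∑ a, frameForm P a w Y • frameVec V P a w - delK V w Y • V w)
        _ z := (HasFDerivAt.fun_sum fun a _ => (hasFDerivAt_apply_const (de a) Y).smul
        (hP.differentiableAt_frameVec hS hz a).hasFDerivAt).sub
        ((hasFDerivAt_apply_const dk Y).smul (hS.hasFDerivAt hz))
    have h2 : (fun w => fderiv ℝ V w Y) =ᶠ[nhds z]
        fun w => ∑ a, frameForm P a w Y • frameVec V P a w - delK V w Y • V w := by
      filter_upwards [hn] with w hw using hP.fderiv_section hS hw Y
    have h3 := (hasFDerivAt_apply_const (hS.differentiableAt_fderiv hz) Y).unique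
      (h1.congr_of_eventuallyEq h2)
    have := DFunLike.congr_fun h3 X
    simpa using this
  have h := (key X Y).symm.trans ((hS.snd_fderiv_symm hz X Y).trans (key Y X))
  rw [← sub_eq_zero] at h
  rw [← h]
  simp only [extD, sub_smul, Finset.sum_add_distrib, Finset.sum_sub_distrib]
  abel

/-- The component of d² V = 0 along the conjugate basis vectors, extracted by pairing with U_c. -/
theorem sum_wedge_secForm (hS : IsSpecialKahler M V) (hP : IsUnitaryFrame M V P)
    {z : Fin n → ℂ} (hz : z ∈ M) (c : Fin n) (X Y : Fin n → ℂ) :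
    ∑ a, wedge (secForm V P c a z) (frameForm P a z) X Y = 0 := by
  have hY : (expNegK V z : ℂ) ≠ 0 := Complex.ofReal_ne_zero.2 (hS.pos z hz).ne'
  have h := congrArg (sympl (frameVec V P c z)) (hP.alternating_fderiv_section hS hz X Y)
  have hV : sympl (frameVec V P c z) (V z) = 0 := by
    rw [sympl_swap, sympl_frameVec hS hz, neg_zero]
  have hV' : ∀ X, sympl (frameVec V P c z) (fderiv ℝ V z X) = 0 := fun X => by
    rw [hP.fderiv_section hS hz, sympl_sub_right, sympl_smul_right, hV, sympl_sum_right,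
      Finset.sum_eq_zero fun b _ => by
        rw [sympl_smul_right, sympl_frameVec_frameVec hS hz, mul_zero]]
    ring
  simp only [sympl_sub_right, sympl_add_right, sympl_sum_right, sympl_smul_right, hV, hV',
    sympl_frameVec_frameVec hS hz, sympl_frameVec_fderiv z _ c _ (hS.pos z hz),
    sympl_zero_right, mul_zero, Finset.sum_const_zero, sub_zero, zero_add] at h
  refine mul_left_cancel₀ (mul_ne_zero Complex.I_ne_zero hY) ?_
  rw [mul_zero, ← neg_eq_zero, ← h, Finset.mul_sum, ← Finset.sum_neg_distrib]
  exact Finset.sum_congr rfl fun a _ => by simp only [wedge]; ring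

/-- Cartan's lemma: forms whose wedge products with the coframe e^a sum to zero are combinations of
the e^a, with coefficients symmetric in the last two indices. In particular they are of type (1,0).
-/
theorem secForm_eq (hS : IsSpecialKahler M V) (hP : IsUnitaryFrame M V P)
    {z : Fin n → ℂ} (hz : z ∈ M) (a b : Fin n) (X : Fin n → ℂ) :
    secForm V P a b z X = ∑ c, cubicForm V P a b c z * frameForm P c z X := by
  have h := hP.sum_wedge_secForm hS hz a X (fun i => (P z)⁻¹ i b)
  simp only [wedge, hP.frameForm_inv hS hz, Finset.sum_sub_distrib, mul_ite, mul_one, mul_zero,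
    Finset.sum_ite_eq', Finset.mem_univ, if_true] at h
  rw [sub_eq_zero.1 h]
  refine Finset.sum_congr rfl fun c _ => ?_
  have h' := hP.sum_wedge_secForm hS hz a (fun i => (P z)⁻¹ i c) (fun i => (P z)⁻¹ i b)
  simp only [wedge, hP.frameForm_inv hS hz, Finset.sum_sub_distrib, mul_ite, mul_one, mul_zero,
    Finset.sum_ite_eq', Finset.mem_univ, if_true] at h'
  rw [cubicForm, sub_eq_zero.1 h']

theorem cubicForm_symm_left (hS : IsSpecialKahler M V) (hP : IsUnitaryFrame M V P)
    {z : Fin n → ℂ} (hz : z ∈ M) (a b c : Fin n) :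
    cubicForm V P a b c z = cubicForm V P b a c z :=
  hP.secForm_symm hS hz a b _

theorem cubicForm_symm_right (hS : IsSpecialKahler M V) (hP : IsUnitaryFrame M V P)
    {z : Fin n → ℂ} (hz : z ∈ M) (a b c : Fin n) :
    cubicForm V P a b c z = cubicForm V P a c b z := by
  have h' := hP.sum_wedge_secForm hS hz a (fun i => (P z)⁻¹ i c) (fun i => (P z)⁻¹ i b)
  simp only [wedge, hP.frameForm_inv hS hz, Finset.sum_sub_distrib, mul_ite, mul_one, mul_zero,
    Finset.sum_ite_eq', Finset.mem_univ, if_true] at h'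
  exact sub_eq_zero.1 h'

/-- The component of d² V = 0 along U_c. The trace term of `connForm` and the ∂K of dV combine into
the U(1) connection (∂K - ∂̄K)/2. -/
theorem extD_frameForm (hS : IsSpecialKahler M V) (hP : IsUnitaryFrame M V P)
    {z : Fin n → ℂ} (hz : z ∈ M) (c : Fin n) (X Y : Fin n → ℂ) :
    extD (frameForm P c) z X Y = -∑ a, wedge (connForm V P c a z) (frameForm P a z) X Y
      - wedge (kahlerConn V z) (frameForm P c z) X Y := by
  have hY : (expNegK V z : ℂ) ≠ 0 := Complex.ofReal_ne_zero.2 (hS.pos z hz).ne'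
  have h := congrArg (sympl (conjVec n (frameVec V P c z)))
    (hP.alternating_fderiv_section hS hz X Y)
  have hV : sympl (conjVec n (frameVec V P c z)) (V z) = 0 := by
    rw [sympl_swap, ← conjVec_conjVec (V z), sympl_conjVec, sympl_conj_frameVec hS hz]; simp
  have hV' : ∀ X, sympl (conjVec n (frameVec V P c z)) (fderiv ℝ V z X)
      = Complex.I * expNegK V z * frameForm P c z X := fun X => by
    rw [hP.fderiv_section hS hz, sympl_sub_right, sympl_smul_right, hV, sympl_sum_right]
    simp only [sympl_smul_right, hP.sympl_conj_frameVec_frameVec hS hz]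
    simp
    ring
  simp only [sympl_sub_right, sympl_add_right, sympl_sum_right, sympl_smul_right, hV, hV',
    hP.sympl_conj_frameVec_frameVec hS hz, sympl_conj_frameVec_fderiv z _ c _ (hS.pos z hz),
    sympl_zero_right, mul_zero, sub_zero, mul_ite, Finset.sum_ite_eq, Finset.mem_univ,
    if_true] at h
  refine mul_left_cancel₀ (mul_ne_zero Complex.I_ne_zero hY) ?_
  have e : ∑ a, (frameForm P a z Y * (Complex.I * expNegK V z * (connForm V P c a z X
        - (if c = a then (1 / 2 : ℂ) else 0) * (delK V z X + (starRingEnd ℂ) (delK V z X))))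
      - frameForm P a z X * (Complex.I * expNegK V z * (connForm V P c a z Y
        - (if c = a then (1 / 2 : ℂ) else 0) * (delK V z Y + (starRingEnd ℂ) (delK V z Y)))))
      = Complex.I * expNegK V z * (∑ a, wedge (connForm V P c a z) (frameForm P a z) X Y
        - 1 / 2 * ((delK V z X + (starRingEnd ℂ) (delK V z X)) * frameForm P c z Y
          - (delK V z Y + (starRingEnd ℂ) (delK V z Y)) * frameForm P c z X)) := by
    have : ∀ a, frameForm P a z Y * (Complex.I * expNegK V z * (connForm V P c a z X
        - (if c = a then (1 / 2 : ℂ) else 0) * (delK V z X + (starRingEnd ℂ) (delK V z X))))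
      - frameForm P a z X * (Complex.I * expNegK V z * (connForm V P c a z Y
        - (if c = a then (1 / 2 : ℂ) else 0) * (delK V z Y + (starRingEnd ℂ) (delK V z Y))))
      = Complex.I * expNegK V z * wedge (connForm V P c a z) (frameForm P a z) X Y
        - if c = a then Complex.I * expNegK V z * (1 / 2 *
          ((delK V z X + (starRingEnd ℂ) (delK V z X)) * frameForm P a z Y
          - (delK V z Y + (starRingEnd ℂ) (delK V z Y)) * frameForm P a z X)) else 0 := fun a => by
      split_ifs <;> simp only [wedge] <;> ring
    simp only [this, Finset.sum_sub_distrib, ← Finset.mul_sum, Finset.sum_ite_eq, Finset.mem_univ,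
      if_true]
    ring
  rw [e] at h
  simp only [wedge, kahlerConn_apply] at h ⊢
  linear_combination h

/-- The component of d² V = 0 along V. -/
theorem extD_delK (hS : IsSpecialKahler M V) (hP : IsUnitaryFrame M V P)
    {z : Fin n → ℂ} (hz : z ∈ M) (X Y : Fin n → ℂ) :
    extD (delK V) z X Y = -∑ a, wedge (frameForm P a z) (conjForm (frameForm P a) z) X Y := by
  have hY : (expNegK V z : ℂ) ≠ 0 := Complex.ofReal_ne_zero.2 (hS.pos z hz).ne'
  have h := congrArg (sympl (conjVec n (V z))) (hP.alternating_fderiv_section hS hz X Y)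
  have hV' : ∀ X, sympl (conjVec n (V z)) (fderiv ℝ V z X)
      = Complex.I * expNegK V z * delK V z X := fun X => by
    rw [delK_apply]; field_simp; rw [Complex.I_sq]; ring
  simp only [sympl_sub_right, sympl_add_right, sympl_sum_right, sympl_smul_right, hV',
    sympl_conj_self, sympl_conj_frameVec hS hz, hP.sympl_conj_fderiv_frameVec hS hz,
    sympl_zero_right, mul_zero, Finset.sum_const_zero, zero_add] at h
  refine mul_left_cancel₀ (mul_ne_zero Complex.I_ne_zero hY) ?_
  have e : ∑ a, (frameForm P a z Y * -(Complex.I * expNegK V z *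
        (starRingEnd ℂ) (frameForm P a z X)) - frameForm P a z X * -(Complex.I * expNegK V z *
        (starRingEnd ℂ) (frameForm P a z Y))) = Complex.I * expNegK V z *
        ∑ a, wedge (frameForm P a z) (conjForm (frameForm P a) z) X Y := by
    rw [Finset.mul_sum]
    exact Finset.sum_congr rfl fun a _ => by simp only [wedge, conjForm_apply]; ring
  rw [e] at h
  linear_combination h

/-- The form d∂K equals minus its own conjugate, so antisymmetrizing under conjugation with weight
1/2 leaves it unchanged. -/
theorem extD_kahlerConn (hS : IsSpecialKahler M V) (hP : IsUnitaryFrame M V P)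
    {z : Fin n → ℂ} (hz : z ∈ M) (X Y : Fin n → ℂ) :
    extD (kahlerConn V) z X Y = -∑ a, wedge (frameForm P a z) (conjForm (frameForm P a) z) X Y := by
  have dk : DifferentiableAt ℝ (delK V) z :=
    (hS.contDiffOn_delK.contDiffAt (hS.isOpen.mem_nhds hz)).differentiableAt (by simp)
  have dk' : DifferentiableAt ℝ (conjForm (delK V)) z :=
    ((contDiffOn_conjForm hS.contDiffOn_delK).contDiffAt
      (hS.isOpen.mem_nhds hz)).differentiableAt (by simp)
  have h : extD (kahlerConn V) z X Y
      = 1 / 2 * (extD (delK V) z X Y - (starRingEnd ℂ) (extD (delK V) z X Y)) := by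
    rw [← extD_conjForm dk]
    simp only [extD]
    rw [show kahlerConn V = fun z => (1 / 2 : ℂ) • (delK V z - conjForm (delK V) z) from rfl,
      fderiv_fun_const_smul (dk.fun_sub dk'), fderiv_fun_sub dk dk']
    simp only [smul_apply, sub_apply, smul_eq_mul]
    ring
  have e : (starRingEnd ℂ) (∑ a, wedge (frameForm P a z) (conjForm (frameForm P a) z) X Y)
      = -∑ a, wedge (frameForm P a z) (conjForm (frameForm P a) z) X Y := by
    rw [map_sum, ← Finset.sum_neg_distrib]
    refine Finset.sum_congr rfl fun a _ => ?_
    simp only [wedge, conjForm_apply, map_sub, map_mul, Complex.conj_conj]; ring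
  rw [h, hP.extD_delK hS hz, map_neg, e]
  ring

theorem contDiffOn_kahlerConn (hS : IsSpecialKahler M V) : ContDiffOn ℝ ∞ (kahlerConn V) M :=
  ContDiffOn.const_smul _ (hS.contDiffOn_delK.sub (contDiffOn_conjForm hS.contDiffOn_delK))

end IsUnitaryFrame

end SpecialStructure

/-! ### Exterior derivatives of the c-map forms. -/

section CMapForms

variable {n : ℕ} {M : Set (Fin n → ℂ)} {V : (Fin n → ℂ) → SympVec n}
  {P : (Fin n → ℂ) → Matrix (Fin n) (Fin n) ℂ}

/-- Pull-back of a form along the projection of the c-map space to the special Kähler space. -/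
def pullFst {G : Type*} [NormedAddCommGroup G] [NormedSpace ℝ G]
    (θ : (Fin n → ℂ) → (Fin n → ℂ) →L[ℝ] G) (q : CMapSpace n) : CMapSpace n →L[ℝ] G :=
  (θ q.1).comp (ContinuousLinearMap.fst ℝ _ _)

theorem pullFst_apply {G : Type*} [NormedAddCommGroup G] [NormedSpace ℝ G]
    (θ : (Fin n → ℂ) → (Fin n → ℂ) →L[ℝ] G) (q X : CMapSpace n) : pullFst θ q X = θ q.1 X.1 := rfl

theorem pullFst_eq_pull {G : Type*} [NormedAddCommGroup G] [NormedSpace ℝ G]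
    (θ : (Fin n → ℂ) → (Fin n → ℂ) →L[ℝ] G) : pullFst θ = pull θ Prod.fst := by
  ext1 q
  rw [pullFst, pull, fderiv_fst]

theorem extD_pullFst {G : Type*} [NormedAddCommGroup G] [NormedSpace ℝ G]
    {θ : (Fin n → ℂ) → (Fin n → ℂ) →L[ℝ] G} (hM : IsOpen M) (hθ : ContDiffOn ℝ ∞ θ M)
    {q : CMapSpace n} (hq : q ∈ cmapDomain M) (X Y : CMapSpace n) :
    extD (pullFst θ) q X Y = extD θ q.1 X.1 Y.1 := by
  rw [pullFst_eq_pull, extD_pull ((hθ.contDiffAt (hM.mem_nhds hq)).differentiableAt (by simp))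
    contDiff_fst.contDiffAt, fderiv_fst]
  rfl

theorem isOpen_cmapDomain (hM : IsOpen M) : IsOpen (cmapDomain M) := hM.preimage continuous_fst

theorem contDiffOn_comp_fst {G : Type*} [NormedAddCommGroup G] [NormedSpace ℝ G]
    {f : (Fin n → ℂ) → G} (hf : ContDiffOn ℝ ∞ f M) :
    ContDiffOn ℝ ∞ (fun q : CMapSpace n => f q.1) (cmapDomain M) :=
  hf.comp contDiff_fst.contDiffOn fun _ hq => hq

theorem contDiffOn_pullFst {G : Type*} [NormedAddCommGroup G] [NormedSpace ℝ G]
    {θ : (Fin n → ℂ) → (Fin n → ℂ) →L[ℝ] G} (hθ : ContDiffOn ℝ ∞ θ M) :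
    ContDiffOn ℝ ∞ (pullFst θ) (cmapDomain M) :=
  (contDiffOn_comp_fst hθ).clm_comp contDiffOn_const

theorem eForm_eq (a : Fin n) : eForm P a = pullFst (frameForm P a) := by
  refine funext fun q => ContinuousLinearMap.ext fun X => ?_
  simp [eForm, pullFst, frameForm, dz]

/-- The `ζ`-component of a tangent vector, as a complex symplectic vector. -/
def zetaVec (n : ℕ) : CMapSpace n →L[ℝ] SympVec n :=
  ContinuousLinearMap.pi dζ

theorem zetaVec_apply (X : CMapSpace n) (s : Fin (n + 1) ⊕ Fin (n + 1)) :
    zetaVec n X s = (X.2.2.2 s : ℂ) := rfl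

theorem conjVec_zetaVec (X : CMapSpace n) : conjVec n (zetaVec n X) = zetaVec n X := by
  ext s; simp [conjVec_apply, zetaVec_apply]

theorem symplDζ_eq (A : SympVec n) : symplDζ A = (symplB n A).comp (zetaVec n) := by
  refine ContinuousLinearMap.ext fun X => ?_
  simp [symplDζ, symplB_apply, sympl, zetaVec]

theorem symplDζ_apply (A : SympVec n) (X : CMapSpace n) :
    symplDζ A X = sympl A (zetaVec n X) := by
  rw [symplDζ_eq]; rfl

theorem conj_symplDζ (A : SympVec n) (X : CMapSpace n) :
    (starRingEnd ℂ) (symplDζ A X) = sympl (conjVec n A) (zetaVec n X) := by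
  rw [symplDζ_apply, ← sympl_conjVec, conjVec_zetaVec]

theorem symplDζ_smul (c : ℂ) (A : SympVec n) : symplDζ (c • A) = c • symplDζ A := by
  refine ContinuousLinearMap.ext fun X => ?_
  simp [symplDζ_apply, sympl_smul_left]

theorem contDiffOn_symplDζ {W : CMapSpace n → SympVec n} {s : Set (CMapSpace n)}
    (hW : ContDiffOn ℝ ∞ W s) : ContDiffOn ℝ ∞ (fun q => symplDζ (W q)) s := by
  simp only [symplDζ_eq]
  exact ((symplB n).contDiff.comp_contDiffOn hW).clm_comp contDiffOn_const

/-- The forms dζ are constant, so only the coefficient vector W is differentiated. -/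
theorem extD_symplDζ {W : CMapSpace n → SympVec n} {W' : CMapSpace n →L[ℝ] SympVec n}
    {q : CMapSpace n} (hW : HasFDerivAt W W' q) (X Y : CMapSpace n) :
    extD (fun q => symplDζ (W q)) q X Y = symplDζ (W' X) Y - symplDζ (W' Y) X := by
  have h := ((symplB n).hasFDerivAt.comp q hW).clm_comp (hasFDerivAt_const (zetaVec n) q)
  simp only [symplDζ_eq, extD]
  rw [show (fun q => (symplB n (W q)).comp (zetaVec n))
    = fun q => ((⇑(symplB n) ∘ W) q).comp (zetaVec n) from rfl, h.fderiv]
  simp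

/-- The scale factor `i exp(K/2 + φ)`. -/
def scaleFac (V : (Fin n → ℂ) → SympVec n) (q : CMapSpace n) : ℂ :=
  Complex.I * Real.exp (kahlerPot V q.1 / 2 + q.2.1)

theorem contDiffOn_scaleFac (hS : IsSpecialKahler M V) :
    ContDiffOn ℝ ∞ (scaleFac V) (cmapDomain M) := by
  refine contDiffOn_const.mul (Complex.ofRealCLM.contDiff.comp_contDiffOn
    (Real.contDiff_exp.comp_contDiffOn (((contDiffOn_comp_fst hS.contDiffOn_kahlerPot).div_const
      2).add ?_)))
  exact (contDiff_fst.comp contDiff_snd).contDiffOn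

theorem hasFDerivAt_scaleFac (hS : IsSpecialKahler M V) {q : CMapSpace n}
    (hq : q ∈ cmapDomain M) : ∃ s' : CMapSpace n →L[ℝ] ℂ, HasFDerivAt (scaleFac V) s' q ∧
      ∀ X, s' X = scaleFac V q *
        ((delK V q.1 X.1 + (starRingEnd ℂ) (delK V q.1 X.1)) / 2 + dφ X) := by
  obtain ⟨K', hK, e⟩ := hS.hasFDerivAt_kahlerPot (show q.1 ∈ M from hq)
  have h1 : HasFDerivAt (fun q : CMapSpace n => kahlerPot V q.1)
      (K'.comp (ContinuousLinearMap.fst ℝ _ _)) q := hK.comp q hasFDerivAt_fst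
  have h2 : HasFDerivAt (fun q : CMapSpace n => q.2.1)
      ((ContinuousLinearMap.fst ℝ _ _).comp (ContinuousLinearMap.snd ℝ _ _)) q :=
    hasFDerivAt_fst.comp q hasFDerivAt_snd
  have h3 := (Complex.ofRealCLM.hasFDerivAt.comp q ((h1.mul_const (2⁻¹ : ℝ)).add h2).exp).const_mul
    Complex.I
  refine ⟨_, h3, fun X => ?_⟩
  simp [scaleFac, ← e, dφ, div_eq_mul_inv]
  ring

theorem conj_scaleFac (q : CMapSpace n) : (starRingEnd ℂ) (scaleFac V q) = -scaleFac V q := by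
  rw [scaleFac, map_mul, Complex.conj_I, Complex.conj_ofReal, neg_mul]

theorem hasFDerivAt_scaleFac_smul (hS : IsSpecialKahler M V) {q : CMapSpace n}
    (hq : q ∈ cmapDomain M) {A : (Fin n → ℂ) → SympVec n} (hA : DifferentiableAt ℝ A q.1) :
    ∃ W' : CMapSpace n →L[ℝ] SympVec n, HasFDerivAt (fun q : CMapSpace n => scaleFac V q • A q.1)
      W' q ∧ ∀ X, W' X = scaleFac V q • (fderiv ℝ A q.1 X.1
        + ((delK V q.1 X.1 + (starRingEnd ℂ) (delK V q.1 X.1)) / 2 + dφ X) • A q.1) := by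
  obtain ⟨s', hs, e⟩ := hasFDerivAt_scaleFac hS hq
  have h1 : HasFDerivAt (fun q : CMapSpace n => A q.1)
      ((fderiv ℝ A q.1).comp (ContinuousLinearMap.fst ℝ _ _)) q :=
    hA.hasFDerivAt.comp q hasFDerivAt_fst
  refine ⟨_, hs.smul h1, fun X => ?_⟩
  simp [e, smul_smul]

theorem uForm_eq (q : CMapSpace n) : uForm V q = symplDζ (scaleFac V q • V q.1) := by
  rw [symplDζ_smul]; rfl

theorem EbarForm_eq (a : Fin n) (q : CMapSpace n) :
    EbarForm V P a q = symplDζ (scaleFac V q • frameVec V P a q.1) := by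
  rw [symplDζ_smul]; rfl

theorem conj_contactForm (q X : CMapSpace n) :
    (starRingEnd ℂ) (contactForm q X) = contactForm q X := by
  simp [contactForm, da, dζ]

theorem conj_dφ (X : CMapSpace n) : (starRingEnd ℂ) (dφ X) = dφ X := by simp [dφ]

theorem vForm_apply (q X : CMapSpace n) :
    vForm q X = -dφ X - Complex.I / 2 * Real.exp (2 * q.2.1) * contactForm q X := rfl

theorem conj_vForm (q X : CMapSpace n) : (starRingEnd ℂ) (vForm q X)
    = -dφ X + Complex.I / 2 * Real.exp (2 * q.2.1) * contactForm q X := by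
  have h3 : (starRingEnd ℂ) (2 : ℂ) = 2 := map_ofNat _ 2
  simp only [vForm_apply, map_sub, map_neg, map_mul, map_div₀, conj_contactForm, conj_dφ, h3,
    Complex.conj_I, Complex.conj_ofReal]
  ring

/-- The factor exp(K/2 + φ) contributes dφ + (∂K + ∂̄K)/2 and dV contributes -∂K; together they give
dφ minus the U(1) connection. -/
theorem extD_uForm (hS : IsSpecialKahler M V) (hP : IsUnitaryFrame M V P) {q : CMapSpace n}
    (hq : q ∈ cmapDomain M) (X Y : CMapSpace n) :
    extD (uForm V) q X Y = wedge (dφ (n := n)) (uForm V q) X Y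
      - wedge (pullFst (kahlerConn V) q) (uForm V q) X Y
      + ∑ a, wedge (eForm P a q) (EbarForm V P a q) X Y := by
  obtain ⟨W', hW, e⟩ := hasFDerivAt_scaleFac_smul hS hq (hS.hasFDerivAt hq).differentiableAt
  have h1 : extD (uForm V) q X Y = extD (fun q => symplDζ (scaleFac V q • V q.1)) q X Y := by
    rw [← funext (uForm_eq (V := V))]
  have key : ∀ X Y, symplDζ (W' X) Y = (dφ X - kahlerConn V q.1 X.1) * uForm V q Y
      + ∑ a, eForm P a q X * EbarForm V P a q Y := by
    intro X Y
    rw [e, hP.fderiv_section hS hq]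
    simp only [uForm_eq, EbarForm_eq, symplDζ_apply, sympl_smul_left, sympl_add_left,
      sympl_sub_left, sympl_sum_left, eForm_eq, pullFst_apply, kahlerConn_apply]
    rw [show ∑ a, frameForm P a q.1 X.1 * (scaleFac V q
      * sympl (frameVec V P a q.1) (zetaVec n Y)) = scaleFac V q * ∑ a, frameForm P a q.1 X.1 *
      sympl (frameVec V P a q.1) (zetaVec n Y) by
        rw [Finset.mul_sum]; exact Finset.sum_congr rfl fun a _ => by ring]
    ring
  rw [h1, extD_symplDζ hW, key, key]
  simp only [wedge, pullFst_apply, Finset.sum_sub_distrib]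
  ring

/-- The term -(∂K + ∂̄K)/2 of dU_a cancels the derivative of exp(K/2), so only dφ remains. The
conjugate basis vectors contribute the conjugates of Ē^b with the cubic form as coefficient. -/
theorem extD_EbarForm (hS : IsSpecialKahler M V) (hP : IsUnitaryFrame M V P) {q : CMapSpace n}
    (hq : q ∈ cmapDomain M) (a : Fin n) (X Y : CMapSpace n) :
    extD (EbarForm V P a) q X Y = wedge (dφ (n := n)) (EbarForm V P a q) X Y
      + wedge (conjForm (eForm P a) q) (uForm V q) X Y
      + ∑ b, wedge (pullFst (connForm V P b a) q) (EbarForm V P b q) X Y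
      - ∑ b, ∑ c, cubicForm V P a b c q.1 *
          wedge (eForm P c q) (conjForm (EbarForm V P b) q) X Y := by
  have hq' : q.1 ∈ M := hq
  obtain ⟨W', hW, e⟩ := hasFDerivAt_scaleFac_smul hS hq (hP.differentiableAt_frameVec hS hq' a)
  have h1 : extD (EbarForm V P a) q X Y
      = extD (fun q => symplDζ (scaleFac V q • frameVec V P a q.1)) q X Y := by
    rw [← funext (EbarForm_eq (V := V) (P := P) a)]
  -- The minus sign comes from the scale factor, which is purely imaginary.
  have hc : ∀ b Y, sympl (scaleFac V q • conjVec n (frameVec V P b q.1)) (zetaVec n Y)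
      = -conjForm (EbarForm V P b) q Y := by
    intro b Y
    rw [conjForm_apply, EbarForm_eq, conj_symplDζ, conjVec_smul, conj_scaleFac, neg_smul,
      sympl_neg_left, neg_neg]
  have key : ∀ X Y, symplDζ (W' X) Y = dφ X * EbarForm V P a q Y
      + (starRingEnd ℂ) (eForm P a q X) * uForm V q Y
      + ∑ b, connForm V P b a q.1 X.1 * EbarForm V P b q Y
      - ∑ b, ∑ c, cubicForm V P a b c q.1 * (eForm P c q X * conjForm (EbarForm V P b) q Y) := by
    intro X Y
    have e1 : ∀ b, ∑ c, cubicForm V P a b c q.1 * (eForm P c q X * conjForm (EbarForm V P b) q Y)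
        = -(scaleFac V q * (secForm V P b a q.1 X.1 *
            sympl (conjVec n (frameVec V P b q.1)) (zetaVec n Y))) := fun b => by
      have := hc b Y
      rw [sympl_smul_left] at this
      rw [hP.secForm_symm hS hq', hP.secForm_eq hS hq', mul_left_comm, this, mul_neg, neg_neg,
        Finset.sum_mul]
      exact Finset.sum_congr rfl fun c _ => by rw [eForm_eq, pullFst_apply]; ring
    have e2 : ∀ b, connForm V P b a q.1 X.1 * EbarForm V P b q Y = scaleFac V q *
        (connForm V P b a q.1 X.1 * sympl (frameVec V P b q.1) (zetaVec n Y)) := fun b => by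
      rw [EbarForm_eq, symplDζ_apply, sympl_smul_left]; ring
    rw [e, hP.fderiv_frameVec hS hq']
    simp only [e1, e2, Finset.sum_neg_distrib, ← Finset.mul_sum]
    simp only [uForm_eq, EbarForm_eq, symplDζ_apply, sympl_smul_left, sympl_add_left,
      sympl_sub_left, sympl_sum_left, eForm_eq, pullFst_apply]
    ring
  rw [h1, extD_symplDζ hW, key, key]
  simp only [wedge, pullFst_apply, conjForm_apply, Finset.sum_sub_distrib, mul_sub]
  ring

theorem hasFDerivAt_contactForm (q : CMapSpace n) :
    ∃ c' : CMapSpace n →L[ℝ] CMapSpace n →L[ℝ] ℂ, HasFDerivAt (contactForm (n := n)) c' q ∧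
      ∀ X Y, c' X Y = -sympl (zetaVec n X) (zetaVec n Y) := by
  have hs : ∀ s, HasFDerivAt (fun q : CMapSpace n => (q.2.2.2 s : ℂ)) (dζ s) q := fun s =>
    (dζ s).hasFDerivAt
  have h : HasFDerivAt (contactForm (n := n)) _ q :=
    (HasFDerivAt.fun_sum fun (Λ : Fin (n + 1)) (_ : Λ ∈ Finset.univ) =>
      ((hs (Sum.inr Λ)).smul_const (dζ (Sum.inl Λ))).sub
        ((hs (Sum.inl Λ)).smul_const (dζ (Sum.inr Λ)))).const_add da
  refine ⟨_, h, fun X Y => ?_⟩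
  simp [sympl, zetaVec]

theorem contDiff_contactForm : ContDiff ℝ ∞ (contactForm (n := n)) := by
  have hs : ∀ s, ContDiff ℝ ∞ (fun q : CMapSpace n => (q.2.2.2 s : ℂ)) := fun s =>
    (dζ s).contDiff
  exact contDiff_const.add (ContDiff.sum fun Λ _ =>
    ((hs _).smul contDiff_const).sub ((hs _).smul contDiff_const))

theorem contDiff_vForm : ContDiff ℝ ∞ (vForm (n := n)) := by
  refine contDiff_const.sub (ContDiff.smul (contDiff_const.mul (Complex.ofRealCLM.contDiff.comp
    (Real.contDiff_exp.comp (contDiff_const.mul ?_)))) contDiff_contactForm)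
  exact contDiff_fst.comp contDiff_snd

/-- Differentiating exp(2φ) gives v ∧ v̄, since dφ and the contact form are real and imaginary parts
of v up to factors. The differential of the contact form gives the symplectic form in dζ. -/
theorem extD_vForm_eq (q X Y : CMapSpace n) :
    extD (vForm (n := n)) q X Y = wedge (vForm q) (conjForm vForm q) X Y
      + Complex.I * Real.exp (2 * q.2.1) * sympl (zetaVec n X) (zetaVec n Y) := by
  obtain ⟨c', hc, e⟩ := hasFDerivAt_contactForm q
  have h2 : HasFDerivAt (fun q : CMapSpace n => q.2.1)
      ((ContinuousLinearMap.fst ℝ _ _).comp (ContinuousLinearMap.snd ℝ _ _)) q :=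
    hasFDerivAt_fst.comp q hasFDerivAt_snd
  have h3 := (Complex.ofRealCLM.hasFDerivAt.comp q (h2.const_mul (2 : ℝ)).exp).const_mul
    (Complex.I / 2)
  have h4 : HasFDerivAt (vForm (n := n)) _ q := (h3.smul hc).const_sub (-dφ)
  have h5 : ∀ X Y, fderiv ℝ (vForm (n := n)) q X Y = -Complex.I * Real.exp (2 * q.2.1) * dφ X
      * contactForm q Y + Complex.I / 2 * Real.exp (2 * q.2.1) *
        sympl (zetaVec n X) (zetaVec n Y) := by
    intro X Y
    rw [h4.fderiv]
    simp only [neg_apply, add_apply, smul_apply, ContinuousLinearMap.smulRight_apply,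
      ContinuousLinearMap.comp_apply, smul_eq_mul, e]
    simp [dφ]
    left
    ring
  rw [extD, h5, h5, sympl_swap (zetaVec n X) (zetaVec n Y)]
  simp only [wedge, conjForm_apply, conj_vForm]
  simp only [vForm_apply]
  ring

end CMapForms

/-! ### The SU(2)- and Sp(2m)-connections of the c-map. -/

section CMapStructure

variable {n : ℕ} {M : Set (Fin n → ℂ)} {V : (Fin n → ℂ) → SympVec n}
  {P : (Fin n → ℂ) → Matrix (Fin n) (Fin n) ℂ}

theorem exp_kahlerPot (hS : IsSpecialKahler M V) {z : Fin n → ℂ} (hz : z ∈ M) :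
    Real.exp (kahlerPot V z) = (expNegK V z)⁻¹ := by
  rw [kahlerPot, Real.exp_neg, Real.exp_log (hS.pos z hz)]

theorem scaleFac_sq (hS : IsSpecialKahler M V) {q : CMapSpace n} (hq : q ∈ cmapDomain M) :
    scaleFac V q ^ 2 = -(Real.exp (2 * q.2.1) * (expNegK V q.1 : ℂ)⁻¹) := by
  rw [scaleFac, mul_pow, Complex.I_sq, ← Complex.ofReal_pow, ← Real.exp_nat_mul, neg_one_mul,
    ← Complex.ofReal_inv, ← exp_kahlerPot hS hq, ← Complex.ofReal_mul, ← Real.exp_add]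
  congr 3
  push_cast
  ring

theorem scaleFac_ne_zero (q : CMapSpace n) : scaleFac V q ≠ 0 :=
  mul_ne_zero Complex.I_ne_zero (Complex.ofReal_ne_zero.2 (Real.exp_pos _).ne')

theorem uForm_apply (q X : CMapSpace n) :
    uForm V q X = scaleFac V q * sympl (V q.1) (zetaVec n X) := by
  rw [uForm_eq, symplDζ_apply, sympl_smul_left]

theorem EbarForm_apply (a : Fin n) (q X : CMapSpace n) :
    EbarForm V P a q X = scaleFac V q * sympl (frameVec V P a q.1) (zetaVec n X) := by
  rw [EbarForm_eq, symplDζ_apply, sympl_smul_left]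

theorem conj_uForm (q X : CMapSpace n) : (starRingEnd ℂ) (uForm V q X)
    = -(scaleFac V q * sympl (conjVec n (V q.1)) (zetaVec n X)) := by
  rw [uForm_apply, map_mul, conj_scaleFac, ← sympl_conjVec, conjVec_zetaVec, neg_mul]

/-- Expanding dζ(Y) in the symplectic basis turns the symplectic form into u and Ē, because exp(2φ)
exp(K) is minus the square of the scale factor. The relative sign is that of the signature (1, n).
-/
theorem sympl_zetaVec (hS : IsSpecialKahler M V) (hP : IsUnitaryFrame M V P) {q : CMapSpace n}
    (hq : q ∈ cmapDomain M) (X Y : CMapSpace n) :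
    Complex.I * Real.exp (2 * q.2.1) * sympl (zetaVec n X) (zetaVec n Y)
      = wedge (uForm V q) (conjForm (uForm V) q) X Y
        - ∑ a, wedge (EbarForm V P a q) (conjForm (EbarForm V P a) q) X Y := by
  have hs := scaleFac_sq hS hq
  have e := congrArg (sympl (zetaVec n X)) (hP.expansion hS hq (zetaVec n Y))
  have s1 : ∀ A, sympl (zetaVec n X) A = -sympl A (zetaVec n X) := fun A => sympl_swap _ _
  simp only [sympl_add_right, sympl_sub_right, sympl_sum_right, sympl_smul_right,
    s1 (V _), s1 (conjVec n _), s1 (frameVec _ _ _ _)] at e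
  rw [e]
  have h : ∑ a, wedge (EbarForm V P a q) (conjForm (EbarForm V P a) q) X Y
      = -scaleFac V q ^ 2 *
        (∑ a, sympl (conjVec n (frameVec V P a q.1)) (zetaVec n Y) *
            sympl (frameVec V P a q.1) (zetaVec n X)
        - ∑ a, sympl (frameVec V P a q.1) (zetaVec n Y) *
            sympl (conjVec n (frameVec V P a q.1)) (zetaVec n X)) := by
    rw [← Finset.sum_sub_distrib, Finset.mul_sum]
    refine Finset.sum_congr rfl fun a _ => ?_
    simp only [wedge, conjForm_apply, EbarForm_apply, map_mul, conj_scaleFac, ← sympl_conjVec,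
      conjVec_zetaVec]
    ring
  rw [h, hs]
  simp only [wedge, conjForm_apply, conj_uForm]
  simp only [uForm_apply, mul_assoc, mul_neg, Finset.sum_neg_distrib, ← Finset.mul_sum]
  linear_combination (sympl (V q.1) (zetaVec n X) * sympl (conjVec n (V q.1)) (zetaVec n Y)
    - sympl (V q.1) (zetaVec n Y) * sympl (conjVec n (V q.1)) (zetaVec n X)) * hs
    + Real.exp (2 * q.2.1) * (expNegK V q.1 : ℂ)⁻¹ *
      (-sympl (V q.1) (zetaVec n X) * sympl (conjVec n (V q.1)) (zetaVec n Y)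
      + sympl (V q.1) (zetaVec n Y) * sympl (conjVec n (V q.1)) (zetaVec n X)
      + ∑ a, sympl (conjVec n (frameVec V P a q.1)) (zetaVec n Y) *
            sympl (frameVec V P a q.1) (zetaVec n X)
      - ∑ a, sympl (frameVec V P a q.1) (zetaVec n Y) *
            sympl (conjVec n (frameVec V P a q.1)) (zetaVec n X)) * Complex.I_mul_I

/-- The vector dζ(X) is real, so the vanishing of its pairings with V and U_a entails that of the
pairings with their conjugates, and all basis coefficients vanish. -/
theorem zetaVec_eq_zero (hS : IsSpecialKahler M V) (hP : IsUnitaryFrame M V P) {q : CMapSpace n}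
    (hq : q ∈ cmapDomain M) {X : CMapSpace n} (hu : uForm V q X = 0)
    (hE : ∀ a, EbarForm V P a q X = 0) : X.2.2.2 = 0 := by
  have h1 : sympl (V q.1) (zetaVec n X) = 0 :=
    (mul_eq_zero.1 ((uForm_apply q X).symm.trans hu)).resolve_left (scaleFac_ne_zero q)
  have h2 : ∀ a, sympl (frameVec V P a q.1) (zetaVec n X) = 0 := fun a =>
    (mul_eq_zero.1 ((EbarForm_apply a q X).symm.trans (hE a))).resolve_left (scaleFac_ne_zero q)
  have h3 : sympl (conjVec n (V q.1)) (zetaVec n X) = 0 := by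
    rw [← conjVec_zetaVec, sympl_conjVec, h1, map_zero]
  have h4 : ∀ a, sympl (conjVec n (frameVec V P a q.1)) (zetaVec n X) = 0 := fun a => by
    rw [← conjVec_zetaVec, sympl_conjVec, h2, map_zero]
  have e := hP.expansion hS hq (zetaVec n X)
  simp only [h1, h2, h3, h4, mul_zero, zero_smul, Finset.sum_const_zero, sub_zero, add_zero] at e
  ext s
  exact Complex.ofReal_eq_zero.1 (congrFun e s)

theorem extD_vForm (hS : IsSpecialKahler M V) (hP : IsUnitaryFrame M V P) {q : CMapSpace n}
    (hq : q ∈ cmapDomain M) (X Y : CMapSpace n) :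
    extD (vForm (n := n)) q X Y = wedge (vForm q) (conjForm vForm q) X Y
      + wedge (uForm V q) (conjForm (uForm V) q) X Y
      - ∑ a, wedge (EbarForm V P a q) (conjForm (EbarForm V P a) q) X Y := by
  rw [extD_vForm_eq, sympl_zetaVec hS hP hq]; ring

theorem contDiffOn_uForm (hS : IsSpecialKahler M V) :
    ContDiffOn ℝ ∞ (uForm V) (cmapDomain M) := by
  rw [funext (uForm_eq (V := V))]
  exact contDiffOn_symplDζ ((contDiffOn_scaleFac hS).smul (contDiffOn_comp_fst hS.smooth))

theorem contDiffOn_EbarForm (hS : IsSpecialKahler M V) (hP : IsUnitaryFrame M V P) (a : Fin n) :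
    ContDiffOn ℝ ∞ (EbarForm V P a) (cmapDomain M) := by
  rw [funext (EbarForm_eq (V := V) (P := P) a)]
  exact contDiffOn_symplDζ ((contDiffOn_scaleFac hS).smul
    (contDiffOn_comp_fst (hP.contDiffOn_frameVec hS a)))

/-- The `SU(2)`-connection of the c-map. -/
def cmapOm (V : (Fin n → ℂ) → SympVec n) : Fin 3 → CMapSpace n → CMapSpace n →L[ℝ] ℝ
  | 0 => fun q => (2 : ℝ) • Complex.imCLM.comp (uForm V q)
  | 1 => fun q => (2 : ℝ) • Complex.reCLM.comp (uForm V q)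
  | 2 => fun q => -Complex.imCLM.comp (vForm q) - Complex.imCLM.comp (pullFst (kahlerConn V) q)

/-- The block `Δ^I_J` of the `Sp(2m)`-connection of the c-map. -/
def cmapA (V : (Fin n → ℂ) → SympVec n) (P : (Fin n → ℂ) → Matrix (Fin n) (Fin n) ℂ) :
    Option (Fin n) → Option (Fin n) → CMapSpace n → CMapSpace n →L[ℝ] ℂ
  | none, none => fun q => (-3 / 4 : ℂ) • (vForm q - conjForm vForm q)
      + (1 / 2 : ℂ) • pullFst (kahlerConn V) q
  | none, some _ => 0
  | some _, none => 0
  | some a, some b => fun q => conjForm (pullFst (connForm V P a b)) q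
      + (if a = b then 1 else 0 : ℂ) • ((1 / 4 : ℂ) • (vForm q - conjForm vForm q)
        - (1 / 2 : ℂ) • pullFst (kahlerConn V) q)

/-- The block `Δ^I_J̇` of the `Sp(2m)`-connection of the c-map. -/
def cmapB (V : (Fin n → ℂ) → SympVec n) (P : (Fin n → ℂ) → Matrix (Fin n) (Fin n) ℂ) :
    Option (Fin n) → Option (Fin n) → CMapSpace n → CMapSpace n →L[ℝ] ℂ
  | none, none => 0
  | none, some a => EbarForm V P a
  | some a, none => EbarForm V P a
  | some a, some b => fun q => -∑ c, cubicForm V P a b c q.1 • conjForm (EbarForm V P c) q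

theorem contDiffOn_cmapOm (hS : IsSpecialKahler M V) (x : Fin 3) :
    ContDiffOn ℝ ∞ (cmapOm V x) (cmapDomain M) := by
  fin_cases x
  · exact ContDiffOn.const_smul _ (contDiffOn_const.clm_comp (contDiffOn_uForm hS))
  · exact ContDiffOn.const_smul _ (contDiffOn_const.clm_comp (contDiffOn_uForm hS))
  · exact (contDiffOn_const.clm_comp contDiff_vForm.contDiffOn).neg.sub
      (contDiffOn_const.clm_comp
        (contDiffOn_pullFst (IsUnitaryFrame.contDiffOn_kahlerConn hS)))

theorem contDiffOn_vForm_sub : ContDiffOn ℝ ∞ (fun q : CMapSpace n => vForm q - conjForm vForm q)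
    (cmapDomain M) :=
  contDiff_vForm.contDiffOn.sub (contDiffOn_conjForm contDiff_vForm.contDiffOn)

theorem contDiffOn_cmapA (hS : IsSpecialKahler M V) (hP : IsUnitaryFrame M V P)
    (I J : Option (Fin n)) : ContDiffOn ℝ ∞ (cmapA V P I J) (cmapDomain M) := by
  have hκ := contDiffOn_pullFst (IsUnitaryFrame.contDiffOn_kahlerConn hS)
  rcases I with _ | a <;> rcases J with _ | b
  · exact (contDiffOn_vForm_sub.const_smul _).add (hκ.const_smul _)
  · exact contDiffOn_const
  · exact contDiffOn_const
  · exact (contDiffOn_conjForm (contDiffOn_pullFst (hP.contDiffOn_connForm hS a b))).add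
      (((contDiffOn_vForm_sub.const_smul _).sub (hκ.const_smul _)).const_smul _)

theorem contDiffOn_cmapB (hS : IsSpecialKahler M V) (hP : IsUnitaryFrame M V P)
    (I J : Option (Fin n)) : ContDiffOn ℝ ∞ (cmapB V P I J) (cmapDomain M) := by
  rcases I with _ | a <;> rcases J with _ | b
  · exact contDiffOn_const
  · exact contDiffOn_EbarForm hS hP b
  · exact contDiffOn_EbarForm hS hP a
  · exact (ContDiffOn.sum fun c _ => (contDiffOn_comp_fst (hP.contDiffOn_cubicForm hS a b c)).smul
      (contDiffOn_conjForm (contDiffOn_EbarForm hS hP c))).neg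

theorem contDiffOn_cmapTheta₁ (hP : IsUnitaryFrame M V P) (I : Option (Fin n)) :
    ContDiffOn ℝ ∞ (cmapTheta₁ P I) (cmapDomain M) := by
  rcases I with _ | a
  · exact contDiff_vForm.contDiffOn.const_smul _
  · refine ContDiffOn.const_smul _ (contDiffOn_conjForm ?_)
    rw [eForm_eq]
    exact contDiffOn_pullFst (hP.contDiffOn_frameForm a)

theorem contDiffOn_cmapTheta₂ (hS : IsSpecialKahler M V) (hP : IsUnitaryFrame M V P)
    (I : Option (Fin n)) : ContDiffOn ℝ ∞ (cmapTheta₂ V P I) (cmapDomain M) := by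
  rcases I with _ | a
  · exact (contDiffOn_uForm hS).const_smul _
  · exact (contDiffOn_EbarForm hS hP a).const_smul _

theorem kahlerConn_conj (z h : Fin n → ℂ) :
    (starRingEnd ℂ) (kahlerConn V z h) = -kahlerConn V z h := by
  have h3 : (starRingEnd ℂ) (2 : ℂ) = 2 := map_ofNat _ 2
  rw [kahlerConn_apply, map_div₀, map_sub, Complex.conj_conj, h3]; ring

theorem cmapOm_two (q X : CMapSpace n) : (cmapOm V 2 q X : ℂ)
    = Complex.I / 2 * (vForm q X - (starRingEnd ℂ) (vForm q X))
      + Complex.I * kahlerConn V q.1 X.1 := by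
  have h1 : ∀ w : ℂ, (w.im : ℂ) = -(Complex.I / 2) * (w - (starRingEnd ℂ) w) := fun w => by
    apply Complex.ext <;> simp
    ring
  have : (cmapOm V 2 q X : ℂ) = -((vForm q X).im : ℂ) - ((kahlerConn V q.1 X.1).im : ℂ) := by
    simp [cmapOm, pullFst_apply]
  rw [this, h1, h1, kahlerConn_conj]; ring

theorem omPlus_cmapOm : omPlus (cmapOm V) = fun q => (2 * Complex.I) • conjForm (uForm V) q := by
  refine funext fun q => ContinuousLinearMap.ext fun X => ?_
  rw [omPlus_apply]
  simp only [cmapOm, smul_apply, conjForm_apply, ContinuousLinearMap.comp_apply]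
  apply Complex.ext <;> simp

end CMapStructure

theorem extD_real_smul {E : Type*} [NormedAddCommGroup E] [NormedSpace ℝ E] (c : ℝ)
    {θ : E → E →L[ℝ] ℂ} {q : E} (h : DifferentiableAt ℝ θ q) (X Y : E) :
    extD (fun p => c • θ p) q X Y = c * extD θ q X Y := by
  simp only [extD, fderiv_fun_const_smul h, smul_apply, Complex.real_smul]
  ring

/-! ### Torsion equations of the c-map. -/

section CMapTorsion

variable {n : ℕ} {M : Set (Fin n → ℂ)} {V : (Fin n → ℂ) → SympVec n}
  {P : (Fin n → ℂ) → Matrix (Fin n) (Fin n) ℂ}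

/-- The normalization factor `1 / √2` of the c-map vielbein. -/
def invSqrtTwo : ℂ := ((1 / Real.sqrt 2 : ℝ) : ℂ)

theorem invSqrtTwo_sq : invSqrtTwo * invSqrtTwo = 1 / 2 := by
  rw [invSqrtTwo, ← Complex.ofReal_mul, div_mul_div_comm, Real.mul_self_sqrt (by norm_num)]
  norm_num

theorem invSqrtTwo_ne_zero : invSqrtTwo ≠ 0 := fun h => by
  have := invSqrtTwo_sq
  rw [h] at this
  norm_num at this

theorem conj_invSqrtTwo : (starRingEnd ℂ) invSqrtTwo = invSqrtTwo := Complex.conj_ofReal _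

theorem cmapTheta₁_none (q X : CMapSpace n) :
    cmapTheta₁ P none q X = -invSqrtTwo * vForm q X := by
  simp [cmapTheta₁, invSqrtTwo]

theorem cmapTheta₁_some (a : Fin n) (q X : CMapSpace n) :
    cmapTheta₁ P (some a) q X = invSqrtTwo * (starRingEnd ℂ) (eForm P a q X) := by
  simp [cmapTheta₁, invSqrtTwo, conjForm_apply]

theorem cmapTheta₂_none (q X : CMapSpace n) :
    cmapTheta₂ V P none q X = invSqrtTwo * uForm V q X := by
  simp [cmapTheta₂, invSqrtTwo]

theorem cmapTheta₂_some (a : Fin n) (q X : CMapSpace n) :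
    cmapTheta₂ V P (some a) q X = invSqrtTwo * EbarForm V P a q X := by
  simp [cmapTheta₂, invSqrtTwo]

theorem differentiableAt_of_contDiffOn {G : Type*} [NormedAddCommGroup G] [NormedSpace ℝ G]
    (hM : IsOpen M) {θ : CMapSpace n → G} (h : ContDiffOn ℝ ∞ θ (cmapDomain M)) {q : CMapSpace n}
    (hq : q ∈ cmapDomain M) : DifferentiableAt ℝ θ q :=
  (h.contDiffAt ((isOpen_cmapDomain hM).mem_nhds hq)).differentiableAt (by simp)

theorem extD_cmapTheta₁_none (q X Y : CMapSpace n) :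
    extD (cmapTheta₁ P none) q X Y = -invSqrtTwo * extD (vForm (n := n)) q X Y := by
  have := extD_real_smul (-(1 / Real.sqrt 2)) (contDiff_vForm.differentiable (by simp) q) X Y
  rw [invSqrtTwo, ← Complex.ofReal_neg]
  exact this

theorem extD_eForm (hS : IsSpecialKahler M V) (hP : IsUnitaryFrame M V P) {q : CMapSpace n}
    (hq : q ∈ cmapDomain M) (a : Fin n) (X Y : CMapSpace n) :
    extD (eForm P a) q X Y = -∑ b, wedge (pullFst (connForm V P a b) q) (eForm P b q) X Y
      - wedge (pullFst (kahlerConn V) q) (eForm P a q) X Y := by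
  rw [eForm_eq, extD_pullFst hS.isOpen (hP.contDiffOn_frameForm a) hq,
    hP.extD_frameForm hS hq]
  simp only [eForm_eq]
  rfl

theorem contDiffOn_eForm (hP : IsUnitaryFrame M V P) (a : Fin n) :
    ContDiffOn ℝ ∞ (eForm P a) (cmapDomain M) := by
  rw [eForm_eq]
  exact contDiffOn_pullFst (hP.contDiffOn_frameForm a)

theorem extD_cmapTheta₁_some (hS : IsSpecialKahler M V) (hP : IsUnitaryFrame M V P)
    {q : CMapSpace n} (hq : q ∈ cmapDomain M) (a : Fin n) (X Y : CMapSpace n) :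
    extD (cmapTheta₁ P (some a)) q X Y
      = invSqrtTwo * (starRingEnd ℂ) (extD (eForm P a) q X Y) := by
  rw [← extD_conjForm (differentiableAt_of_contDiffOn hS.isOpen (contDiffOn_eForm hP a) hq)]
  exact extD_real_smul _ (differentiableAt_of_contDiffOn hS.isOpen
    (contDiffOn_conjForm (contDiffOn_eForm hP a)) hq) X Y

theorem extD_cmapTheta₂_none (hS : IsSpecialKahler M V)
    {q : CMapSpace n} (hq : q ∈ cmapDomain M) (X Y : CMapSpace n) :
    extD (cmapTheta₂ V P none) q X Y = invSqrtTwo * extD (uForm V) q X Y :=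
  extD_real_smul _ (differentiableAt_of_contDiffOn hS.isOpen (contDiffOn_uForm hS) hq) X Y

theorem extD_cmapTheta₂_some (hS : IsSpecialKahler M V) (hP : IsUnitaryFrame M V P)
    {q : CMapSpace n} (hq : q ∈ cmapDomain M) (a : Fin n) (X Y : CMapSpace n) :
    extD (cmapTheta₂ V P (some a)) q X Y = invSqrtTwo * extD (EbarForm V P a) q X Y :=
  extD_real_smul _ (differentiableAt_of_contDiffOn hS.isOpen (contDiffOn_EbarForm hS hP a) hq) X Y

theorem cmapA_none (q X : CMapSpace n) : cmapA V P none none q X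
    = -3 / 4 * (vForm q X - (starRingEnd ℂ) (vForm q X)) + kahlerConn V q.1 X.1 / 2 := by
  simp [cmapA, pullFst_apply, conjForm_apply]; ring

theorem cmapA_some (a b : Fin n) (q X : CMapSpace n) : cmapA V P (some a) (some b) q X
    = (starRingEnd ℂ) (connForm V P a b q.1 X.1) + if a = b then
      (vForm q X - (starRingEnd ℂ) (vForm q X)) / 4 - kahlerConn V q.1 X.1 / 2 else 0 := by
  by_cases h : a = b <;> simp [cmapA, pullFst_apply, conjForm_apply, h]; ring

theorem cmapB_some (a b : Fin n) (q X : CMapSpace n) : cmapB V P (some a) (some b) q X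
    = -∑ c, cubicForm V P a b c q.1 * (starRingEnd ℂ) (EbarForm V P c q X) := by
  simp [cmapB, conjForm_apply]

/-- The product of Ē and its conjugate in dv is absorbed by the block B^0_a = Ē^a, and u ∧ ū by ω¹ +
iω². The products of v and v̄ and the U(1) terms explain the coefficients -3/4 and 1/2 in `cmapA`.
-/
theorem cmap_torsion₁_none (hS : IsSpecialKahler M V) (hP : IsUnitaryFrame M V P)
    {q : CMapSpace n} (hq : q ∈ cmapDomain M) (X Y : CMapSpace n) :
    extD (cmapTheta₁ P none) q X Y
      + Complex.I / 2 * wedge (fun Z => (cmapOm V 2 q Z : ℂ)) (cmapTheta₁ P none q) X Y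
      + Complex.I / 2 * wedge (omPlus (cmapOm V) q) (cmapTheta₂ V P none q) X Y
      + ∑ J, (wedge (cmapA V P none J q) (cmapTheta₁ P J q) X Y
        - wedge (cmapB V P none J q) (conjForm (cmapTheta₂ V P J) q) X Y) = 0 := by
  have hs : ∑ a, (wedge (cmapA V P none (some a) q) (cmapTheta₁ P (some a) q) X Y
        - wedge (cmapB V P none (some a) q) (conjForm (cmapTheta₂ V P (some a)) q) X Y)
      = -invSqrtTwo * ∑ a, wedge (EbarForm V P a q) (conjForm (EbarForm V P a) q) X Y := by
    rw [Finset.mul_sum]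
    refine Finset.sum_congr rfl fun a _ => ?_
    simp only [wedge, conjForm_apply, cmapTheta₂_some, map_mul, conj_invSqrtTwo]
    simp only [cmapA, cmapB, Pi.zero_apply, zero_apply]
    ring
  rw [Fintype.sum_option, hs, extD_cmapTheta₁_none, extD_vForm hS hP hq, omPlus_cmapOm]
  simp only [wedge, conjForm_apply, cmapOm_two, cmapTheta₁_none, cmapTheta₂_none, cmapA_none,
    map_mul, conj_invSqrtTwo, smul_apply, smul_eq_mul]
  simp only [cmapB, Pi.zero_apply, zero_apply]
  linear_combination (invSqrtTwo * ((kahlerConn V q.1 Y.1 / 2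
      + (vForm q Y - (starRingEnd ℂ) (vForm q Y)) / 4) * vForm q X
      - (kahlerConn V q.1 X.1 / 2
      + (vForm q X - (starRingEnd ℂ) (vForm q X)) / 4) * vForm q Y
      + (starRingEnd ℂ) (uForm V q X) * uForm V q Y
      - (starRingEnd ℂ) (uForm V q Y) * uForm V q X)) * Complex.I_mul_I

theorem cmap_torsion₁_some (hS : IsSpecialKahler M V) (hP : IsUnitaryFrame M V P)
    {q : CMapSpace n} (hq : q ∈ cmapDomain M) (a : Fin n) (X Y : CMapSpace n) :
    extD (cmapTheta₁ P (some a)) q X Y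
      + Complex.I / 2 * wedge (fun Z => (cmapOm V 2 q Z : ℂ)) (cmapTheta₁ P (some a) q) X Y
      + Complex.I / 2 * wedge (omPlus (cmapOm V) q) (cmapTheta₂ V P (some a) q) X Y
      + ∑ J, (wedge (cmapA V P (some a) J q) (cmapTheta₁ P J q) X Y
        - wedge (cmapB V P (some a) J q) (conjForm (cmapTheta₂ V P J) q) X Y) = 0 := by
  have hA : ∑ b, wedge (cmapA V P (some a) (some b) q) (cmapTheta₁ P (some b) q) X Y
      = invSqrtTwo * (∑ b, (starRingEnd ℂ)
          (wedge (pullFst (connForm V P a b) q) (eForm P b q) X Y)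
        + wedge (fun X => (vForm q X - (starRingEnd ℂ) (vForm q X)) / 4
          - kahlerConn V q.1 X.1 / 2) (conjForm (eForm P a) q) X Y) := by
    have : wedge (fun X => (vForm q X - (starRingEnd ℂ) (vForm q X)) / 4
          - kahlerConn V q.1 X.1 / 2) (conjForm (eForm P a) q) X Y
        = ∑ b, if a = b then wedge (fun X => (vForm q X - (starRingEnd ℂ) (vForm q X)) / 4
          - kahlerConn V q.1 X.1 / 2) (conjForm (eForm P b) q) X Y else 0 := by simp
    rw [this, ← Finset.sum_add_distrib, Finset.mul_sum]
    refine Finset.sum_congr rfl fun b _ => ?_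
    simp only [wedge, cmapA_some, cmapTheta₁_some, conjForm_apply, map_sub, map_mul, pullFst_apply]
    split_ifs <;> ring
  -- A symmetric coefficient, the cubic form, is contracted with an antisymmetric product.
  have hB : ∑ b, wedge (cmapB V P (some a) (some b) q) (conjForm (cmapTheta₂ V P (some b)) q) X Y
      = 0 := by
    have h0 : ∑ b, ∑ c, cubicForm V P a b c q.1 * ((starRingEnd ℂ) (EbarForm V P c q X) *
          (starRingEnd ℂ) (EbarForm V P b q Y)) = ∑ b, ∑ c, cubicForm V P a b c q.1 *
          ((starRingEnd ℂ) (EbarForm V P c q Y) * (starRingEnd ℂ) (EbarForm V P b q X)) := by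
      rw [Finset.sum_comm]
      refine Finset.sum_congr rfl fun b _ => Finset.sum_congr rfl fun c _ => ?_
      rw [hP.cubicForm_symm_right hS hq]
      ring
    have h1 : ∀ b, wedge (cmapB V P (some a) (some b) q)
        (conjForm (cmapTheta₂ V P (some b)) q) X Y = -invSqrtTwo *
          (∑ c, cubicForm V P a b c q.1 * ((starRingEnd ℂ) (EbarForm V P c q X) *
          (starRingEnd ℂ) (EbarForm V P b q Y)) - ∑ c, cubicForm V P a b c q.1 *
          ((starRingEnd ℂ) (EbarForm V P c q Y) * (starRingEnd ℂ) (EbarForm V P b q X))) := by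
      intro b
      simp only [wedge, cmapB_some, cmapTheta₂_some, conjForm_apply, map_mul, conj_invSqrtTwo,
        ← mul_assoc, ← Finset.sum_mul]
      ring
    simp only [h1, ← Finset.mul_sum, Finset.sum_sub_distrib, h0, sub_self, mul_zero]
  rw [Fintype.sum_option, Finset.sum_sub_distrib, hA, hB, extD_cmapTheta₁_some hS hP hq,
    extD_eForm hS hP hq, omPlus_cmapOm, map_sub, map_neg, map_sum]
  simp only [wedge, conjForm_apply, cmapOm_two, cmapTheta₁_some, cmapTheta₁_none, cmapTheta₂_none,
    cmapTheta₂_some, map_mul, map_sub, conj_invSqrtTwo, smul_apply, smul_eq_mul, pullFst_apply,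
    kahlerConn_conj]
  simp only [cmapA, cmapB, Pi.zero_apply, zero_apply]
  linear_combination (invSqrtTwo * (((vForm q X - (starRingEnd ℂ) (vForm q X)) / 4
      + kahlerConn V q.1 X.1 / 2) * (starRingEnd ℂ) (eForm P a q Y)
      - ((vForm q Y - (starRingEnd ℂ) (vForm q Y)) / 4
      + kahlerConn V q.1 Y.1 / 2) * (starRingEnd ℂ) (eForm P a q X)
      + (starRingEnd ℂ) (uForm V q X) * EbarForm V P a q Y
      - (starRingEnd ℂ) (uForm V q Y) * EbarForm V P a q X)) * Complex.I_mul_I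

theorem cmap_torsion₂_none (hS : IsSpecialKahler M V) (hP : IsUnitaryFrame M V P)
    {q : CMapSpace n} (hq : q ∈ cmapDomain M) (X Y : CMapSpace n) :
    extD (cmapTheta₂ V P none) q X Y
      + Complex.I / 2 * wedge (conjForm (omPlus (cmapOm V)) q) (cmapTheta₁ P none q) X Y
      - Complex.I / 2 * wedge (fun Z => (cmapOm V 2 q Z : ℂ)) (cmapTheta₂ V P none q) X Y
      + ∑ J, (wedge (cmapA V P none J q) (cmapTheta₂ V P J q) X Y
        + wedge (cmapB V P none J q) (conjForm (cmapTheta₁ P J) q) X Y) = 0 := by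
  have hs : ∑ a, (wedge (cmapA V P none (some a) q) (cmapTheta₂ V P (some a) q) X Y
        + wedge (cmapB V P none (some a) q) (conjForm (cmapTheta₁ P (some a)) q) X Y)
      = -invSqrtTwo * ∑ a, wedge (eForm P a q) (EbarForm V P a q) X Y := by
    rw [Finset.mul_sum]
    refine Finset.sum_congr rfl fun a _ => ?_
    simp only [wedge, conjForm_apply, cmapTheta₁_some, map_mul, conj_invSqrtTwo,
      Complex.conj_conj]
    simp only [cmapA, cmapB, Pi.zero_apply, zero_apply]
    ring
  have hφ : ∀ X : CMapSpace n, dφ X = -(vForm q X + (starRingEnd ℂ) (vForm q X)) / 2 := fun X => by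
    rw [conj_vForm, vForm_apply]; ring
  have h3 : (starRingEnd ℂ) (2 : ℂ) = 2 := map_ofNat _ 2
  rw [Fintype.sum_option, hs, extD_cmapTheta₂_none hS hq, extD_uForm hS hP hq, omPlus_cmapOm]
  simp only [wedge, conjForm_apply, cmapOm_two, cmapTheta₁_none, cmapTheta₂_none, cmapA_none,
    map_mul, smul_apply, smul_eq_mul, Complex.conj_conj, Complex.conj_I,
    pullFst_apply, h3, hφ]
  simp only [cmapB, Pi.zero_apply, zero_apply]
  linear_combination (invSqrtTwo * (uForm V q X * vForm q Y - uForm V q Y * vForm q X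
      - ((vForm q X - (starRingEnd ℂ) (vForm q X)) / 4
      + kahlerConn V q.1 X.1 / 2) * uForm V q Y
      + ((vForm q Y - (starRingEnd ℂ) (vForm q Y)) / 4
      + kahlerConn V q.1 Y.1 / 2) * uForm V q X)) * Complex.I_mul_I

/-- The term of dĒ^a with the cubic form must be cancelled by B^a_b wedged with e^b; this dictates
the last case of `cmapB`. -/
theorem cmap_torsion₂_some (hS : IsSpecialKahler M V) (hP : IsUnitaryFrame M V P)
    {q : CMapSpace n} (hq : q ∈ cmapDomain M) (a : Fin n) (X Y : CMapSpace n) :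
    extD (cmapTheta₂ V P (some a)) q X Y
      + Complex.I / 2 * wedge (conjForm (omPlus (cmapOm V)) q) (cmapTheta₁ P (some a) q) X Y
      - Complex.I / 2 * wedge (fun Z => (cmapOm V 2 q Z : ℂ)) (cmapTheta₂ V P (some a) q) X Y
      + ∑ J, (wedge (cmapA V P (some a) J q) (cmapTheta₂ V P J q) X Y
        + wedge (cmapB V P (some a) J q) (conjForm (cmapTheta₁ P J) q) X Y) = 0 := by
  have hA : ∑ b, wedge (cmapA V P (some a) (some b) q) (cmapTheta₂ V P (some b) q) X Y
      = invSqrtTwo * (-∑ b, wedge (pullFst (connForm V P b a) q) (EbarForm V P b q) X Y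
        + wedge (fun X => (vForm q X - (starRingEnd ℂ) (vForm q X)) / 4
          - kahlerConn V q.1 X.1 / 2) (EbarForm V P a q) X Y) := by
    have : wedge (fun X => (vForm q X - (starRingEnd ℂ) (vForm q X)) / 4
          - kahlerConn V q.1 X.1 / 2) (EbarForm V P a q) X Y
        = ∑ b, if a = b then wedge (fun X => (vForm q X - (starRingEnd ℂ) (vForm q X)) / 4
          - kahlerConn V q.1 X.1 / 2) (EbarForm V P b q) X Y else 0 := by simp
    rw [this, ← Finset.sum_neg_distrib, ← Finset.sum_add_distrib, Finset.mul_sum]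
    refine Finset.sum_congr rfl fun b _ => ?_
    simp only [wedge, cmapA_some, cmapTheta₂_some, pullFst_apply, hP.connForm_antiherm hS hq]
    split_ifs <;> ring
  have hB : ∑ b, wedge (cmapB V P (some a) (some b) q) (conjForm (cmapTheta₁ P (some b)) q) X Y
      = invSqrtTwo * ∑ b, ∑ c, cubicForm V P a b c q.1 *
          wedge (eForm P c q) (conjForm (EbarForm V P b) q) X Y := by
    have h1 : ∀ b, wedge (cmapB V P (some a) (some b) q)
        (conjForm (cmapTheta₁ P (some b)) q) X Y = ∑ c, invSqrtTwo * (cubicForm V P a b c q.1 *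
          wedge (eForm P b q) (conjForm (EbarForm V P c) q) X Y) := by
      intro b
      simp only [wedge, cmapB_some, cmapTheta₁_some, conjForm_apply, map_mul, conj_invSqrtTwo,
        Complex.conj_conj, neg_mul, Finset.sum_mul, ← Finset.sum_neg_distrib,
        ← Finset.sum_sub_distrib]
      exact Finset.sum_congr rfl fun c _ => by ring
    simp only [h1, Finset.mul_sum]
    rw [Finset.sum_comm]
    refine Finset.sum_congr rfl fun b _ => Finset.sum_congr rfl fun c _ => ?_
    rw [hP.cubicForm_symm_right hS hq]
  have hφ : ∀ X : CMapSpace n, dφ X = -(vForm q X + (starRingEnd ℂ) (vForm q X)) / 2 := fun X => by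
    rw [conj_vForm, vForm_apply]; ring
  have h3 : (starRingEnd ℂ) (2 : ℂ) = 2 := map_ofNat _ 2
  rw [Fintype.sum_option, Finset.sum_add_distrib, hA, hB, extD_cmapTheta₂_some hS hP hq,
    extD_EbarForm hS hP hq, omPlus_cmapOm]
  simp only [wedge, conjForm_apply, cmapOm_two, cmapTheta₁_some, cmapTheta₁_none, cmapTheta₂_none,
    cmapTheta₂_some, map_mul, map_neg, conj_invSqrtTwo, smul_apply, smul_eq_mul, pullFst_apply,
    Complex.conj_conj, Complex.conj_I, h3, hφ]
  simp only [cmapA, cmapB, Pi.zero_apply, zero_apply]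
  linear_combination (invSqrtTwo * (-uForm V q X * (starRingEnd ℂ) (eForm P a q Y)
      + uForm V q Y * (starRingEnd ℂ) (eForm P a q X)
      - ((vForm q X - (starRingEnd ℂ) (vForm q X)) / 4
      + kahlerConn V q.1 X.1 / 2) * EbarForm V P a q Y
      + ((vForm q Y - (starRingEnd ℂ) (vForm q Y)) / 4
      + kahlerConn V q.1 Y.1 / 2) * EbarForm V P a q X)) * Complex.I_mul_I

end CMapTorsion

/-! ### Vanishing of the mixed curvature, and the c-map reduction. -/

section SpCurvPull

variable {E F ι : Type*} [NormedAddCommGroup E] [NormedSpace ℝ E]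
  [NormedAddCommGroup F] [NormedSpace ℝ F] [Fintype ι] {D : Set E} {N : Set F} {j : F → E}

/-- The mixed curvature of a connection which is block-diagonal on a submanifold vanishes on it. -/
theorem spCurv_eq_zero_of_pull {Δ : ι ⊕ ι → ι ⊕ ι → E → E →L[ℝ] ℂ} (hD : IsOpen D)
    (hN : IsOpen N) (hΔ : ∀ α β, ContDiffOn ℝ ∞ (Δ α β) D) (hj : ContDiffOn ℝ ∞ j N)
    (hm : Set.MapsTo j N D)
    (hp : ∀ y ∈ N, ∀ I J, pull (Δ (Sum.inl I) (Sum.inr J)) j y = 0) {y : F} (hy : y ∈ N)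
    (X Y : F) (I J : ι) :
    spCurv Δ (Sum.inl I) (Sum.inr J) (j y) (fderiv ℝ j y X) (fderiv ℝ j y Y) = 0 := by
  -- By naturality this is d of a pulled-back form that vanishes identically near y. Each quadratic
  -- term of the mixed curvature also contains a mixed block or its conjugate index position.
  have h1 : extD (Δ (Sum.inl I) (Sum.inr J)) (j y) (fderiv ℝ j y X) (fderiv ℝ j y Y) = 0 := by
    rw [← extD_pull (((hΔ _ _).contDiffAt (hD.mem_nhds (hm hy))).differentiableAt (by simp))
      (hj.contDiffAt (hN.mem_nhds hy)), extD_congr (η := fun _ => 0) (by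
        filter_upwards [hN.mem_nhds hy] with w hw using hp w hw I J), extD_const]
  have h2 : ∀ I J Z, Δ (Sum.inl I) (Sum.inr J) (j y) (fderiv ℝ j y Z) = 0 := fun I J Z => by
    rw [← pull_apply, hp y hy]; rfl
  simp [spCurv, h1, Fintype.sum_sum_type, wedge, h2]

end SpCurvPull

section CMapMain

variable {n : ℕ} {M : Set (Fin n → ℂ)} {V : (Fin n → ℂ) → SympVec n}
  {P : (Fin n → ℂ) → Matrix (Fin n) (Fin n) ℂ}

/-- Of the two summands of ω³, Im v supplies the v, u and E terms and the U(1) connection supplies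
the e terms. The product ω¹ ∧ ω² reverses the sign of u ∧ ū. -/
theorem cmap_curvature₃ (hS : IsSpecialKahler M V) (hP : IsUnitaryFrame M V P)
    {q : CMapSpace n} (hq : q ∈ cmapDomain M) (X Y : CMapSpace n) :
    ((extD (cmapOm V 2) q X Y : ℝ) : ℂ)
      + wedge (fun Z => (cmapOm V 0 q Z : ℂ)) (fun Z => (cmapOm V 1 q Z : ℂ)) X Y
      = 2 * Complex.I * ∑ I, (wedge (cmapTheta₁ P I q) (conjForm (cmapTheta₁ P I) q) X Y
        - wedge (cmapTheta₂ V P I q) (conjForm (cmapTheta₂ V P I) q) X Y) := by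
  have d0 := differentiableAt_of_contDiffOn hS.isOpen (contDiffOn_cmapOm hS 2) hq
  have dv : DifferentiableAt ℝ (vForm (n := n)) q := contDiff_vForm.differentiable (by simp) q
  have dvc : DifferentiableAt ℝ (conjForm (vForm (n := n))) q :=
    differentiableAt_of_contDiffOn hS.isOpen (contDiffOn_conjForm contDiff_vForm.contDiffOn) hq
  have hκ := IsUnitaryFrame.contDiffOn_kahlerConn hS
  have dκ := differentiableAt_of_contDiffOn hS.isOpen (contDiffOn_pullFst hκ) hq
  have e0 : ((extD (cmapOm V 2) q X Y : ℝ) : ℂ) = Complex.I / 2 * (extD (vForm (n := n)) q X Y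
      - (starRingEnd ℂ) (extD (vForm (n := n)) q X Y))
      + Complex.I * extD (pullFst (kahlerConn V)) q X Y := by
    rw [← Complex.ofRealCLM_apply, ← extD_clm_comp Complex.ofRealCLM d0]
    have : (fun q => Complex.ofRealCLM.comp (cmapOm V 2 q)) = fun q =>
        ((Complex.I / 2) • vForm q + (-(Complex.I / 2)) • conjForm vForm q)
          + Complex.I • pullFst (kahlerConn V) q := by
      refine funext fun q => ContinuousLinearMap.ext fun X => ?_
      simp only [ContinuousLinearMap.comp_apply, Complex.ofRealCLM_apply, cmapOm_two, add_apply,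
        smul_apply, smul_eq_mul, conjForm_apply, pullFst_apply]
      ring
    rw [this, extD_add ((dv.fun_const_smul _).fun_add (dvc.fun_const_smul _)) (dκ.fun_const_smul _),
      extD_add (dv.fun_const_smul _) (dvc.fun_const_smul _), extD_const_smul _ dv, extD_const_smul _ dvc,
      extD_const_smul _ dκ, extD_conjForm dv]
    ring
  have hw : ∀ (a : CMapSpace n → CMapSpace n →L[ℝ] ℂ),
      (starRingEnd ℂ) (wedge (a q) (conjForm a q) X Y) = -wedge (a q) (conjForm a q) X Y := by
    intro a
    simp only [wedge, conjForm_apply, map_sub, map_mul, Complex.conj_conj]; ring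
  have eu : wedge (fun Z => (cmapOm V 0 q Z : ℂ)) (fun Z => (cmapOm V 1 q Z : ℂ)) X Y
      = -2 * Complex.I * wedge (uForm V q) (conjForm (uForm V) q) X Y := by
    have h : ∀ Z, uForm V q Z = (cmapOm V 1 q Z : ℂ) / 2 + Complex.I * (cmapOm V 0 q Z : ℂ) / 2 :=
      fun Z => by
        simp only [cmapOm, smul_apply, ContinuousLinearMap.comp_apply]
        apply Complex.ext <;> simp
    have h' : ∀ Z, (starRingEnd ℂ) (uForm V q Z)
        = (cmapOm V 1 q Z : ℂ) / 2 - Complex.I * (cmapOm V 0 q Z : ℂ) / 2 := fun Z => by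
      rw [h, map_add, map_div₀, map_div₀, map_mul, Complex.conj_I, Complex.conj_ofReal,
        Complex.conj_ofReal, map_ofNat]
      ring
    simp only [wedge, conjForm_apply, h']
    simp only [h]
    linear_combination ((cmapOm V 0 q X : ℂ) * cmapOm V 1 q Y
      - (cmapOm V 0 q Y : ℂ) * cmapOm V 1 q X) * Complex.I_mul_I
  have es : ∑ a, (wedge (cmapTheta₁ P (some a) q) (conjForm (cmapTheta₁ P (some a)) q) X Y
        - wedge (cmapTheta₂ V P (some a) q) (conjForm (cmapTheta₂ V P (some a)) q) X Y)
      = 1 / 2 * (-∑ a, wedge (eForm P a q) (conjForm (eForm P a) q) X Y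
        - ∑ a, wedge (EbarForm V P a q) (conjForm (EbarForm V P a) q) X Y) := by
    rw [← Finset.sum_neg_distrib, ← Finset.sum_sub_distrib, Finset.mul_sum]
    refine Finset.sum_congr rfl fun a _ => ?_
    rw [← invSqrtTwo_sq]
    simp only [wedge, conjForm_apply, cmapTheta₁_some, cmapTheta₂_some, map_mul, conj_invSqrtTwo,
      Complex.conj_conj]
    ring
  have eκ : extD (pullFst (kahlerConn V)) q X Y
      = -∑ a, wedge (eForm P a q) (conjForm (eForm P a) q) X Y := by
    rw [extD_pullFst hS.isOpen hκ hq, hP.extD_kahlerConn hS hq]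
    simp only [eForm_eq]
    rfl
  have en : wedge (cmapTheta₁ P none q) (conjForm (cmapTheta₁ P none) q) X Y
        - wedge (cmapTheta₂ V P none q) (conjForm (cmapTheta₂ V P none) q) X Y
      = 1 / 2 * (wedge (vForm q) (conjForm vForm q) X Y
        - wedge (uForm V q) (conjForm (uForm V) q) X Y) := by
    rw [← invSqrtTwo_sq]
    simp only [wedge, conjForm_apply, cmapTheta₁_none, cmapTheta₂_none, map_mul, map_neg,
      conj_invSqrtTwo]
    ring
  rw [Fintype.sum_option, es, en, e0, eu, eκ, extD_vForm hS hP hq]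
  simp only [map_sub, map_add, map_sum, hw, Finset.sum_neg_distrib]
  ring

theorem cmap_curvature_plus (hS : IsSpecialKahler M V) (hP : IsUnitaryFrame M V P)
    {q : CMapSpace n} (hq : q ∈ cmapDomain M) (X Y : CMapSpace n) :
    extD (omPlus (cmapOm V)) q X Y
      + Complex.I * wedge (fun Z => (cmapOm V 2 q Z : ℂ)) (omPlus (cmapOm V) q) X Y
      = 4 * Complex.I * ∑ I, wedge (cmapTheta₁ P I q) (conjForm (cmapTheta₂ V P I) q) X Y := by
  have hu := contDiffOn_uForm hS
  have es : ∑ a, wedge (cmapTheta₁ P (some a) q) (conjForm (cmapTheta₂ V P (some a)) q) X Y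
      = 1 / 2 * ∑ a, (starRingEnd ℂ) (wedge (eForm P a q) (EbarForm V P a q) X Y) := by
    rw [Finset.mul_sum]
    refine Finset.sum_congr rfl fun a _ => ?_
    rw [← invSqrtTwo_sq]
    simp only [wedge, conjForm_apply, cmapTheta₁_some, cmapTheta₂_some, map_mul, map_sub,
      conj_invSqrtTwo]
    ring
  have hφ : ∀ X : CMapSpace n, dφ X = -(vForm q X + (starRingEnd ℂ) (vForm q X)) / 2 := fun X => by
    rw [conj_vForm, vForm_apply]; ring
  have en : wedge (cmapTheta₁ P none q) (conjForm (cmapTheta₂ V P none) q) X Y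
      = -(1 / 2) * wedge (vForm q) (conjForm (uForm V) q) X Y := by
    rw [← invSqrtTwo_sq]
    simp only [wedge, conjForm_apply, cmapTheta₁_none, cmapTheta₂_none, map_mul,
      conj_invSqrtTwo]
    ring
  rw [Fintype.sum_option, es, en, omPlus_cmapOm, extD_const_smul _
    (differentiableAt_of_contDiffOn hS.isOpen (contDiffOn_conjForm hu) hq),
    extD_conjForm (differentiableAt_of_contDiffOn hS.isOpen hu hq), extD_uForm hS hP hq, map_add,
    map_sum]
  simp only [wedge, conjForm_apply, cmapOm_two, map_sub, map_mul, conj_dφ, kahlerConn_conj,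
    pullFst_apply, smul_apply, smul_eq_mul]
  simp only [hφ]
  linear_combination (2 * Complex.I * (((vForm q X - (starRingEnd ℂ) (vForm q X)) / 2
      + kahlerConn V q.1 X.1) * (starRingEnd ℂ) (uForm V q Y)
      - ((vForm q Y - (starRingEnd ℂ) (vForm q Y)) / 2
      + kahlerConn V q.1 Y.1) * (starRingEnd ℂ) (uForm V q X))) * Complex.I_mul_I

/-- The forms u, Ē detect dζ and the e^a detect dz. From v and v̄ one obtains dφ and the contact
form, which reduces to da once dζ = 0. -/
theorem cmap_coframe (hS : IsSpecialKahler M V) (hP : IsUnitaryFrame M V P)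
    {q : CMapSpace n} (hq : q ∈ cmapDomain M) {X : CMapSpace n}
    (h₁ : ∀ I, cmapTheta₁ P I q X = 0) (h₂ : ∀ I, cmapTheta₂ V P I q X = 0) : X = 0 := by
  have hr := invSqrtTwo_ne_zero
  have hv : vForm q X = 0 := by
    have := h₁ none
    rw [cmapTheta₁_none] at this
    simpa [hr] using this
  have he : ∀ a, frameForm P a q.1 X.1 = 0 := fun a => by
    have := h₁ (some a)
    rw [cmapTheta₁_some, eForm_eq, pullFst_apply] at this
    simpa [hr] using this
  have hu : uForm V q X = 0 := by
    have := h₂ none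
    rw [cmapTheta₂_none] at this
    simpa [hr] using this
  have hE : ∀ a, EbarForm V P a q X = 0 := fun a => by
    have := h₂ (some a)
    rw [cmapTheta₂_some] at this
    simpa [hr] using this
  have hζ := zetaVec_eq_zero hS hP hq hu hE
  have hz : X.1 = 0 := by
    rw [← hP.sum_frameForm_smul hS hq X.1]
    simp [he]
  have hv' : (starRingEnd ℂ) (vForm q X) = 0 := by rw [hv, map_zero]
  have hφ : dφ X = 0 := by
    rw [conj_vForm] at hv'
    rw [vForm_apply] at hv
    linear_combination -(hv + hv') / 2
  have hc : contactForm q X = 0 := by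
    have : (Real.exp (2 * q.2.1) : ℂ) ≠ 0 := Complex.ofReal_ne_zero.2 (Real.exp_pos _).ne'
    rw [vForm_apply, hφ] at hv
    simpa [this, Complex.exp_ne_zero] using hv
  have ha : da X = 0 := by
    simpa [contactForm, dζ, hζ] using hc
  refine Prod.ext hz (Prod.ext ?_ (Prod.ext ?_ hζ))
  · simpa [dφ] using hφ
  · simpa [da] using ha

theorem finrank_cMapSpace :
    Module.finrank ℝ (CMapSpace n) = 4 * Fintype.card (Option (Fin n)) := by
  simp [CMapSpace, Module.finrank_pi_fintype]
  ring

theorem cmap_isTorsionFree (hS : IsSpecialKahler M V) (hP : IsUnitaryFrame M V P) :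
    IsTorsionFree (cmapDomain M) (cmapVielbein V P) (cmapOm V)
      (spConn (cmapA V P) (cmapB V P)) := by
  refine isTorsionFree_of_blocks (isOpen_cmapDomain hS.isOpen) finrank_cMapSpace
    (contDiffOn_cmapTheta₁ hP) (contDiffOn_cmapTheta₂ hS hP) (contDiffOn_cmapOm hS)
    (contDiffOn_cmapA hS hP) (contDiffOn_cmapB hS hP)
    (fun q hq X h₁ h₂ => cmap_coframe hS hP hq h₁ h₂) ?_ ?_ ?_ ?_
    (fun q hq X Y => cmap_curvature₃ hS hP hq X Y)
    (fun q hq X Y => cmap_curvature_plus hS hP hq X Y)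
  · have h2 : (starRingEnd ℂ) (2 : ℂ) = 2 := map_ofNat _ 2
    have h3 : (starRingEnd ℂ) (3 : ℂ) = 3 := map_ofNat _ 3
    have h4 : (starRingEnd ℂ) (4 : ℂ) = 4 := map_ofNat _ 4
    rintro q hq (_ | a) (_ | b) X
    · simp only [cmapA_none, map_add, map_mul, map_sub, map_div₀, map_neg, kahlerConn_conj, h2, h3,
        h4, Complex.conj_conj]
      ring
    · simp [cmapA]
    · simp [cmapA]
    · simp only [cmapA_some, map_add, Complex.conj_conj, apply_ite (starRingEnd ℂ), map_sub,
        map_div₀, kahlerConn_conj, h2, h4, map_zero, eq_comm (a := b)]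
      rw [hP.connForm_antiherm hS hq b a]
      split_ifs <;> ring
  · rintro q hq (_ | a) (_ | b) X
    · rfl
    · rfl
    · rfl
    · rw [cmapB_some, cmapB_some]
      simp only [hP.cubicForm_symm_left hS hq a b]
  · rintro q hq (_ | a) X Y
    · exact cmap_torsion₁_none hS hP hq X Y
    · exact cmap_torsion₁_some hS hP hq a X Y
  · rintro q hq (_ | a) X Y
    · exact cmap_torsion₂_none hS hP hq X Y
    · exact cmap_torsion₂_some hS hP hq a X Y

/-- The differential of the slices `ζ = ζ₀`. -/
def sliceDeriv (n : ℕ) : ((Fin n → ℂ) × ℝ × ℝ) →L[ℝ] CMapSpace n :=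
  (ContinuousLinearMap.fst ℝ _ _).prod (((ContinuousLinearMap.fst ℝ _ _).comp
    (ContinuousLinearMap.snd ℝ _ _)).prod (((ContinuousLinearMap.snd ℝ _ _).comp
    (ContinuousLinearMap.snd ℝ _ _)).prod 0))

theorem cmapSlice_eq (ζ₀ : Fin (n + 1) ⊕ Fin (n + 1) → ℝ) :
    cmapSlice ζ₀ = fun y => sliceDeriv n y + (0, 0, 0, ζ₀) := by
  ext1 y
  simp [cmapSlice, sliceDeriv]

theorem fderiv_cmapSlice (ζ₀ : Fin (n + 1) ⊕ Fin (n + 1) → ℝ) (y : (Fin n → ℂ) × ℝ × ℝ) :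
    fderiv ℝ (cmapSlice ζ₀) y = sliceDeriv n := by
  rw [cmapSlice_eq]
  exact ((sliceDeriv n).hasFDerivAt.add_const _).fderiv

theorem contDiff_cmapSlice (ζ₀ : Fin (n + 1) ⊕ Fin (n + 1) → ℝ) :
    ContDiff ℝ ∞ (cmapSlice (n := n) ζ₀) := by
  rw [cmapSlice_eq]
  exact (sliceDeriv n).contDiff.add contDiff_const

theorem zetaVec_sliceDeriv (X : (Fin n → ℂ) × ℝ × ℝ) : zetaVec n (sliceDeriv n X) = 0 := by
  ext s; simp [zetaVec_apply, sliceDeriv]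

theorem uForm_sliceDeriv (q : CMapSpace n) (X : (Fin n → ℂ) × ℝ × ℝ) :
    uForm V q (sliceDeriv n X) = 0 := by
  rw [uForm_apply, zetaVec_sliceDeriv, sympl_zero_right, mul_zero]

theorem EbarForm_sliceDeriv (a : Fin n) (q : CMapSpace n) (X : (Fin n → ℂ) × ℝ × ℝ) :
    EbarForm V P a q (sliceDeriv n X) = 0 := by
  rw [EbarForm_apply, zetaVec_sliceDeriv, sympl_zero_right, mul_zero]

theorem pull_cmapB (ζ₀ : Fin (n + 1) ⊕ Fin (n + 1) → ℝ) (y : (Fin n → ℂ) × ℝ × ℝ)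
    (I J : Option (Fin n)) : pull (cmapB V P I J) (cmapSlice ζ₀) y = 0 := by
  refine ContinuousLinearMap.ext fun X => ?_
  rw [pull_apply, fderiv_cmapSlice]
  rcases I with _ | a <;> rcases J with _ | b
  · rfl
  · exact EbarForm_sliceDeriv b _ X
  · exact EbarForm_sliceDeriv a _ X
  · rw [cmapB_some]
    simp [EbarForm_sliceDeriv]

theorem isOpen_sliceDomain (hM : IsOpen M) : IsOpen {y : (Fin n → ℂ) × ℝ × ℝ | y.1 ∈ M} :=
  hM.preimage continuous_fst

theorem cmap_isKahlerHodgeReduction (hS : IsSpecialKahler M V) (hP : IsUnitaryFrame M V P)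
    (ζ₀ : Fin (n + 1) ⊕ Fin (n + 1) → ℝ) :
    IsKahlerHodgeReduction (cmapDomain M) (cmapVielbein V P) (cmapOm V)
      (spConn (cmapA V P) (cmapB V P)) {y : (Fin n → ℂ) × ℝ × ℝ | y.1 ∈ M} (cmapSlice ζ₀) := by
  refine isKahlerHodgeReduction_of_pull_eq_zero (cmap_isTorsionFree hS hP)
    (isOpen_sliceDomain hS.isOpen) ?_ (contDiff_cmapSlice ζ₀).contDiffOn (fun y hy => hy) ?_ ?_
    ?_ ?_ ?_ (fun y _ I J => pull_cmapB ζ₀ y I J)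
  · rw [finrank_cMapSpace]
    simp [Module.finrank_pi_fintype]
    ring
  · have h : Topology.IsEmbedding (cmapSlice (n := n) ζ₀) :=
      Function.LeftInverse.isEmbedding (f := fun q : CMapSpace n => (q.1, q.2.1, q.2.2.1))
        (fun _ => rfl) (by fun_prop) (contDiff_cmapSlice ζ₀).continuous
    exact h.comp Topology.IsEmbedding.subtypeVal
  · intro y _ X Y h
    rw [fderiv_cmapSlice] at h
    simpa [sliceDeriv, Prod.ext_iff] using h
  · rintro y _ (_ | a)
    · refine ContinuousLinearMap.ext fun X => ?_
      rw [pull_apply, fderiv_cmapSlice, cmapTheta₂_none, uForm_sliceDeriv, mul_zero]; rfl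
    · refine ContinuousLinearMap.ext fun X => ?_
      rw [pull_apply, fderiv_cmapSlice, cmapTheta₂_some, EbarForm_sliceDeriv, mul_zero]; rfl
  · intro y _
    refine ContinuousLinearMap.ext fun X => ?_
    rw [pull_apply, fderiv_cmapSlice]
    simp [cmapOm, uForm_sliceDeriv]
  · intro y _
    refine ContinuousLinearMap.ext fun X => ?_
    rw [pull_apply, fderiv_cmapSlice]
    simp [cmapOm, uForm_sliceDeriv]

/-- Vectors killed by u and all Ē^a have no ζ-component, so they are tangent to the slice through q,
on which the mixed block vanishes identically. -/
theorem cmap_spCurv_eq_zero (hS : IsSpecialKahler M V) (hP : IsUnitaryFrame M V P)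
    {q : CMapSpace n} (hq : q ∈ cmapDomain M) {X Y : CMapSpace n}
    (hX : ∀ I, cmapTheta₂ V P I q X = 0) (hY : ∀ I, cmapTheta₂ V P I q Y = 0)
    (I J : Option (Fin n)) :
    spCurv (spConn (cmapA V P) (cmapB V P)) (Sum.inl I) (Sum.inr J) q X Y = 0 := by
  have hz : ∀ X : CMapSpace n, (∀ I, cmapTheta₂ V P I q X = 0) →
      sliceDeriv n (X.1, X.2.1, X.2.2.1) = X := fun X h => by
    have hu : uForm V q X = 0 := by
      have := h none
      rw [cmapTheta₂_none] at this
      simpa [invSqrtTwo_ne_zero] using this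
    have hE : ∀ a, EbarForm V P a q X = 0 := fun a => by
      have := h (some a)
      rw [cmapTheta₂_some] at this
      simpa [invSqrtTwo_ne_zero] using this
    have h0 := zetaVec_eq_zero hS hP hq hu hE
    exact Prod.ext rfl (Prod.ext rfl (Prod.ext rfl h0.symm))
  have := spCurv_eq_zero_of_pull (isOpen_cmapDomain hS.isOpen) (isOpen_sliceDomain hS.isOpen)
    (cmap_isTorsionFree hS hP).smooth_Δ (contDiff_cmapSlice q.2.2.2).contDiffOn
    (fun y hy => hy) (fun y _ I J => pull_cmapB q.2.2.2 y I J) (y := (q.1, q.2.1, q.2.2.1)) hq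
    (X.1, X.2.1, X.2.2.1) (Y.1, Y.2.1, Y.2.2.1) I J
  rw [fderiv_cmapSlice, hz X hX, hz Y hY] at this
  exact this

theorem inv_kahlerMetric (hS : IsSpecialKahler M V) (hP : IsUnitaryFrame M V P) {z : Fin n → ℂ}
    (hz : z ∈ M) (i j : Fin n) : (kahlerMetric V z)⁻¹ j i
      = ∑ a, (starRingEnd ℂ) ((P z)⁻¹ j a) * (P z)⁻¹ i a := by
  have hd := hP.isUnit_det hS hz
  have h : kahlerMetric V z = (P z).transpose * ((P z).map (starRingEnd ℂ)) := by
    ext i j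
    simp [hP.metric_eq z hz, Matrix.mul_apply]
  have h' : (kahlerMetric V z)⁻¹ = (P z)⁻¹.map (starRingEnd ℂ) * (P z)⁻¹.transpose := by
    refine Matrix.inv_eq_left_inv ?_
    rw [h, Matrix.mul_assoc, ← Matrix.mul_assoc (P z)⁻¹.transpose, ← Matrix.transpose_mul,
      Matrix.mul_nonsing_inv _ hd, Matrix.transpose_one, Matrix.one_mul, ← Matrix.map_mul,
      Matrix.nonsing_inv_mul _ hd, Matrix.map_one _ (map_zero _) (map_one _)]
  rw [h', Matrix.mul_apply]
  rfl

theorem sum_quadratic {ν κ : Type*} [Fintype ν] [Fintype κ] (f g : κ → ν → ℂ) (x y : ν → ℂ) :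
    ∑ i, ∑ j, (∑ a, f a i * g a j) * x i * y j
      = ∑ a, (∑ i, f a i * x i) * ∑ j, g a j * y j := by
  simp only [Finset.sum_mul_sum]
  rw [Finset.sum_comm]
  conv_rhs => rw [Finset.sum_comm]
  rw [Finset.sum_comm]
  refine Finset.sum_congr rfl fun i _ => ?_
  rw [Finset.sum_comm]
  refine Finset.sum_congr rfl fun j _ => ?_
  rw [Finset.sum_mul, Finset.sum_mul]
  exact Finset.sum_congr rfl fun a _ => by ring

theorem re_eq_of_add_conj {z w : ℂ} (h : z + (starRingEnd ℂ) z = w + (starRingEnd ℂ) w) :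
    z.re = w.re := by
  rw [Complex.add_conj, Complex.add_conj, Complex.ofReal_inj] at h
  linarith

/-- Unitarity of P turns the sums over frame indices into contractions with g and its inverse, which
removes the frame. -/
theorem cmap_metric_eq (hS : IsSpecialKahler M V) (hP : IsUnitaryFrame M V P)
    {q : CMapSpace n} (hq : q ∈ cmapDomain M) (X Y : CMapSpace n) :
    hypMetric (cmapVielbein V P) q X Y = cmapMetric V q X Y := by
  have e1 : ∑ i, ∑ j, kahlerMetric V q.1 i j * dz i X * (starRingEnd ℂ) (dz j Y)
      = ∑ a, eForm P a q X * (starRingEnd ℂ) (eForm P a q Y) := by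
    have : ∀ a, ∀ X, eForm P a q X = ∑ i, P q.1 a i * dz i X := fun a X => by simp [eForm]
    simp only [this, hP.metric_eq q.1 hq, map_sum, map_mul]
    exact sum_quadratic (P q.1) (fun a j => (starRingEnd ℂ) (P q.1 a j)) _ _
  have e2 : ∑ i, ∑ j, (kahlerMetric V q.1)⁻¹ j i * symplDζ (covSection V i q.1) X *
            (starRingEnd ℂ) (symplDζ (covSection V j q.1) Y)
      = ∑ a, sympl (frameVec V P a q.1) (zetaVec n X) *
          (starRingEnd ℂ) (sympl (frameVec V P a q.1) (zetaVec n Y)) := by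
    simp only [frameVec, sympl_sum_left, sympl_smul_left, inv_kahlerMetric hS hP hq, map_sum,
      map_mul, symplDζ_apply, mul_comm ((starRingEnd ℂ) ((P q.1)⁻¹ _ _)) ((P q.1)⁻¹ _ _)]
    exact sum_quadratic (fun a i => (P q.1)⁻¹ i a)
      (fun a j => (starRingEnd ℂ) ((P q.1)⁻¹ j a)) _ _
  have hs : scaleFac V q * scaleFac V q = -(Real.exp (kahlerPot V q.1 + 2 * q.2.1) : ℂ) := by
    rw [← sq, scaleFac_sq hS hq, Real.exp_add, exp_kahlerPot hS hq]
    push_cast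
    ring
  have h4 : (Real.exp (4 * q.2.1) : ℂ) = Real.exp (2 * q.2.1) * Real.exp (2 * q.2.1) := by
    rw [← Complex.ofReal_mul, ← Real.exp_add]
    congr 2
    ring
  have e3 : ∑ a, EbarForm V P a q X * (starRingEnd ℂ) (EbarForm V P a q Y)
      = Real.exp (kahlerPot V q.1 + 2 * q.2.1) * ∑ a, sympl (frameVec V P a q.1) (zetaVec n X) *
          (starRingEnd ℂ) (sympl (frameVec V P a q.1) (zetaVec n Y)) := by
    rw [Finset.mul_sum]
    refine Finset.sum_congr rfl fun a _ => ?_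
    rw [EbarForm_apply, EbarForm_apply, map_mul, conj_scaleFac]
    linear_combination (-sympl (frameVec V P a q.1) (zetaVec n X) *
          (starRingEnd ℂ) (sympl (frameVec V P a q.1) (zetaVec n Y))) * hs
  have e4 : uForm V q X * (starRingEnd ℂ) (uForm V q Y)
      = Real.exp (kahlerPot V q.1 + 2 * q.2.1) * (symplDζ (V q.1) X *
        (starRingEnd ℂ) (symplDζ (V q.1) Y)) := by
    rw [uForm_apply, uForm_apply, map_mul, conj_scaleFac, symplDζ_apply, symplDζ_apply]
    linear_combination (-sympl (V q.1) (zetaVec n X) *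
          (starRingEnd ℂ) (sympl (V q.1) (zetaVec n Y))) * hs
  have e5 : (∑ a, (starRingEnd ℂ) (eForm P a q X) * eForm P a q Y)
      = (starRingEnd ℂ) (∑ a, eForm P a q X * (starRingEnd ℂ) (eForm P a q Y)) := by
    simp [map_sum]
  have l : hypMetric (cmapVielbein V P) q X Y = (vForm q X * (starRingEnd ℂ) (vForm q Y)
      + uForm V q X * (starRingEnd ℂ) (uForm V q Y)
      + ∑ a, (starRingEnd ℂ) (eForm P a q X) * eForm P a q Y
      + ∑ a, EbarForm V P a q X * (starRingEnd ℂ) (EbarForm V P a q Y)).re := by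
    rw [cmapVielbein, hypMetric_vielbeinOf, ← Complex.re_sum, ← Complex.re_ofReal_mul]
    congr 1
    rw [Fintype.sum_option, add_assoc (_ + _), ← Finset.sum_add_distrib, mul_add, Finset.mul_sum]
    have h2 := invSqrtTwo_sq
    congr 1
    · simp only [cmapTheta₁_none, cmapTheta₂_none, map_mul, map_neg, conj_invSqrtTwo]
      push_cast
      linear_combination 2 * (vForm q X * (starRingEnd ℂ) (vForm q Y)
        + uForm V q X * (starRingEnd ℂ) (uForm V q Y)) * h2
    · refine Finset.sum_congr rfl fun a _ => ?_
      simp only [cmapTheta₁_some, cmapTheta₂_some, map_mul, conj_invSqrtTwo, Complex.conj_conj]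
      push_cast
      linear_combination 2 * ((starRingEnd ℂ) (eForm P a q X) * eForm P a q Y
        + EbarForm V P a q X * (starRingEnd ℂ) (EbarForm V P a q Y)) * h2
  rw [l, cmapMetric, e1, e2]
  -- The two complex expressions differ: e^a enters the vielbein conjugated, and v(X) v̄(Y) has
  -- imaginary cross terms. Only the real parts agree.
  refine re_eq_of_add_conj ?_
  rw [e3, e4, e5, mul_add, conj_vForm, vForm_apply]
  have h2 : (starRingEnd ℂ) (2 : ℂ) = 2 := map_ofNat _ 2
  have h4' : (starRingEnd ℂ) (4 : ℂ) = 4 := map_ofNat _ 4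
  simp only [map_add, map_mul, map_sub, map_neg, map_div₀, Complex.conj_conj, Complex.conj_ofReal,
    conj_dφ, conj_contactForm, Complex.conj_I, h2, h4', map_one, h4]
  linear_combination (-1 / 2 * Real.exp (2 * q.2.1) * Real.exp (2 * q.2.1) * contactForm q X
    * contactForm q Y) * Complex.I_mul_I

end CMapMain

/-! ### Differentiating the matrix exponential. -/

section MatrixExp

attribute [local instance] Matrix.linftyOpNormedAddCommGroup Matrix.linftyOpNormedSpace
  Matrix.linftyOpNormedRing Matrix.linftyOpNormedAlgebra

variable {μ : Type*} [Fintype μ] [DecidableEq μ]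

/-- A matrix entry as a continuous linear functional. -/
def entryL (i j : μ) : Matrix μ μ ℝ →L[ℝ] ℝ :=
  LinearMap.toContinuousLinearMap (Matrix.entryLinearMap ℝ ℝ i j)

theorem contDiff_matrix_exp {H : Type*} [NormedAddCommGroup H] [NormedSpace ℝ H]
    [FiniteDimensional ℝ H] (f : H →ₗ[ℝ] Matrix μ μ ℝ) (i j : μ) :
    ContDiff ℝ ∞ (fun x => NormedSpace.exp (f x) i j) := by
  have h1 : ContDiff ℝ ∞ (NormedSpace.exp : Matrix μ μ ℝ → Matrix μ μ ℝ) :=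
    contDiff_iff_contDiffAt.2 fun A => (NormedSpace.exp_analytic (𝕂 := ℝ) A).contDiffAt
  have h2 : ContDiff ℝ ∞ (fun x => f x) := (LinearMap.toContinuousLinearMap f).contDiff
  exact (entryL i j).contDiff.comp (h1.comp h2)

theorem hasDerivAt_exp_smul_entry (H : Matrix μ μ ℝ) (i j : μ) :
    HasDerivAt (fun s : ℝ => NormedSpace.exp (s • H) i j) (H i j) 0 := by
  have h := (entryL i j).hasFDerivAt.comp_hasDerivAt (0 : ℝ)
    (hasDerivAt_exp_smul_const (𝕂 := ℝ) H (0 : ℝ))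
  simp only [zero_smul, NormedSpace.exp_zero, one_mul] at h
  exact h

end MatrixExp

section MatrixExpSymm

variable {μ : Type*} [Fintype μ] [DecidableEq μ]

/-- A matrix commuting with the exponential of a real symmetric matrix commutes with the matrix. -/
theorem commute_of_commute_exp {T H : Matrix μ μ ℝ} (hT : T.IsHermitian)
    (h : H * NormedSpace.exp T = NormedSpace.exp T * H) : H * T = T * H := by
  set U : Matrix μ μ ℝ := (hT.eigenvectorUnitary : Matrix μ μ ℝ) with hU
  have hUU : star U * U = 1 := Unitary.coe_star_mul_self _
  have hUU' : U * star U = 1 := Unitary.coe_mul_star_self _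
  have hinv : U⁻¹ = star U := Matrix.inv_eq_left_inv hUU
  have hunit : IsUnit U := IsUnit.of_mul_eq_one _ hUU'
  have hspec : T = U * Matrix.diagonal hT.eigenvalues * star U := by
    have := hT.spectral_theorem
    rw [Unitary.conjStarAlgAut_apply] at this
    exact this
  set lam := hT.eigenvalues
  have hexp : NormedSpace.exp T = U * Matrix.diagonal (fun i => Real.exp (lam i)) * star U := by
    conv_lhs => rw [hspec, ← hinv, Matrix.exp_conj _ _ hunit, Matrix.exp_diagonal, hinv]
    congr 3
    ext i
    rw [Pi.coe_exp, Real.exp_eq_exp_ℝ]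
  set K := star U * H * U with hK
  have hH : H = U * K * star U := by
    rw [hK]
    simp only [← mul_assoc, hUU', one_mul]
    rw [mul_assoc, hUU', mul_one]
  have key : ∀ d : μ → ℝ, H * (U * Matrix.diagonal d * star U)
      = U * (K * Matrix.diagonal d) * star U := fun d => by
    rw [hH]
    simp only [mul_assoc]
    rw [← mul_assoc (star U) U, hUU, one_mul]
  have key' : ∀ d : μ → ℝ, (U * Matrix.diagonal d * star U) * H
      = U * (Matrix.diagonal d * K) * star U := fun d => by
    rw [hH]
    simp only [mul_assoc]
    rw [← mul_assoc (star U) U, hUU, one_mul]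
  rw [hexp, key, key'] at h
  have h1 : K * Matrix.diagonal (fun i => Real.exp (lam i))
      = Matrix.diagonal (fun i => Real.exp (lam i)) * K := by
    have := congrArg (fun A => star U * A * U) h
    simpa only [mul_assoc, hUU, mul_one, ← mul_assoc (star U) U, one_mul] using this
  -- In the eigenbasis, commuting with exp T means K_{ij}(exp λ_j - exp λ_i) = 0. Injectivity of the
  -- real exponential leaves only entries with λ_i = λ_j.
  have h2 : K * Matrix.diagonal lam = Matrix.diagonal lam * K := by
    ext i j
    have := congrFun (congrFun h1 i) j
    rw [Matrix.mul_diagonal, Matrix.diagonal_mul] at this ⊢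
    rcases eq_or_ne (lam i) (lam j) with e | e
    · rw [e, mul_comm]
    · have hne : Real.exp (lam j) - Real.exp (lam i) ≠ 0 :=
        sub_ne_zero.2 fun h => e (Real.exp_injective h).symm
      have : K i j = 0 := by
        refine (mul_eq_zero.1 (?_ : K i j * (Real.exp (lam j) - Real.exp (lam i)) = 0)).resolve_right
          hne
        linear_combination this
      rw [this, zero_mul, mul_zero]
  rw [hspec, key, key', h2]

/-- The differential of the exponential is injective at real symmetric matrices. -/
theorem eq_zero_of_hasDerivAt_exp {T H : Matrix μ μ ℝ} (hT : T.IsHermitian)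
    (h : ∀ i j, HasDerivAt (fun s : ℝ => NormedSpace.exp (T + s • H) i j) 0 0) : H = 0 := by
  have hlin : ∀ i j, HasDerivAt (fun s : ℝ => (T + s • H) i j) (H i j) 0 := fun i j => by
    have := ((hasDerivAt_id (0 : ℝ)).mul_const (H i j)).const_add (T i j)
    simpa using this
  -- A matrix commutes with its exponential. Differentiating this at s = 0, where the derivative of
  -- exp vanishes by hypothesis, shows that H commutes with exp T.
  have hcomm : ∀ s : ℝ, NormedSpace.exp (T + s • H) * (T + s • H)
      = (T + s • H) * NormedSpace.exp (T + s • H) := fun s =>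
    ((Commute.refl (T + s • H)).exp_left).eq
  have e0 : T + (0 : ℝ) • H = T := by simp
  have h1 : H * NormedSpace.exp T = NormedSpace.exp T * H := by
    ext i j
    have a : HasDerivAt (fun s : ℝ => (NormedSpace.exp (T + s • H) * (T + s • H)) i j)
        (∑ k, (0 * (T + (0 : ℝ) • H) k j + NormedSpace.exp (T + (0 : ℝ) • H) i k * H k j)) 0 := by
      simp only [Matrix.mul_apply]
      exact HasDerivAt.fun_sum fun k _ => (h i k).mul (hlin k j)
    have b : HasDerivAt (fun s : ℝ => ((T + s • H) * NormedSpace.exp (T + s • H)) i j)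
        (∑ k, (H i k * NormedSpace.exp (T + (0 : ℝ) • H) k j + (T + (0 : ℝ) • H) i k * 0)) 0 := by
      simp only [Matrix.mul_apply]
      exact HasDerivAt.fun_sum fun k _ => (hlin i k).mul (h k j)
    simp only [hcomm] at a
    have := a.unique b
    simp only [e0, zero_mul, zero_add, mul_zero, add_zero] at this
    rw [Matrix.mul_apply, Matrix.mul_apply, this]
  have h2 := commute_of_commute_exp hT h1
  -- Once H commutes with T, the curve exp(sH) is a constant matrix times exp(T + sH). Its
  -- derivative at 0 is H on one side and 0 on the other.
  have h3 : ∀ s : ℝ, NormedSpace.exp (s • H)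
      = NormedSpace.exp (-T) * NormedSpace.exp (T + s • H) := fun s => by
    have hc : Commute (-T) (T + s • H) :=
      ((Commute.refl T).add_right ((show Commute T H from h2.symm).smul_right s)).neg_left
    rw [← Matrix.exp_add_of_commute _ _ hc, neg_add_cancel_left]
  ext i j
  have a := hasDerivAt_exp_smul_entry H i j
  have b : HasDerivAt (fun s : ℝ => NormedSpace.exp (s • H) i j) (∑ k, NormedSpace.exp (-T) i k * 0)
      0 := by
    simp only [h3, Matrix.mul_apply]
    exact HasDerivAt.fun_sum fun k _ => (h k j).const_mul _
  simpa using a.unique b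

end MatrixExpSymm

/-! ### Maurer-Cartan forms of the coset representative. -/

section CosetGeometry

variable {π κ : Type*} [Fintype π] [DecidableEq π] [Fintype κ] [DecidableEq κ]

/-- The symmetric matrix `[[0, xᵀ], [x, 0]]`. -/
def cosetGen : (κ → π → ℝ) →ₗ[ℝ] Matrix (π ⊕ κ) (π ⊕ κ) ℝ where
  toFun x := Matrix.fromBlocks 0 (Matrix.transpose (Matrix.of x)) (Matrix.of x) 0
  map_add' x y := by ext (i | i) (j | j) <;> simp
  map_smul' c x := by ext (i | i) (j | j) <;> simp

theorem cosetRep_eq (x : κ → π → ℝ) : cosetRep x = NormedSpace.exp (cosetGen x) := rfl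

theorem isHermitian_cosetGen (x : κ → π → ℝ) : (cosetGen x).IsHermitian := by
  ext (i | i) (j | j) <;> simp [cosetGen]

theorem cosetRep_symm (x : κ → π → ℝ) (s t : π ⊕ κ) : cosetRep x s t = cosetRep x t s := by
  have h : (cosetGen x).IsSymm := by
    ext (i | i) (j | j) <;> simp [cosetGen]
  exact congrFun (congrFun (Matrix.IsSymm.exp h) t) s

/-- The signs of the quadratic form of signature `(p, q)`. -/
def sgn : π ⊕ κ → ℝ := Sum.elim (fun _ => 1) (fun _ => -1)

theorem sgn_mul_self (s : π ⊕ κ) : sgn s * sgn s = 1 := by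
  rcases s with s | s <;> simp [sgn]

theorem inv_cosetRep (x : κ → π → ℝ) : (cosetRep x)⁻¹ = cosetRep (-x) := by
  rw [cosetRep_eq, cosetRep_eq, map_neg, Matrix.exp_neg]

/-- Conjugation by the signature matrix changes the sign of the off-diagonal generator and hence
inverts its exponential. Inverse entries are thus smooth and easy to differentiate. -/
theorem inv_cosetRep_apply (x : κ → π → ℝ) (s t : π ⊕ κ) :
    (cosetRep x)⁻¹ s t = sgn s * sgn t * cosetRep x s t := by
  have hd : Matrix.diagonal sgn * Matrix.diagonal sgn = (1 : Matrix (π ⊕ κ) (π ⊕ κ) ℝ) := by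
    rw [Matrix.diagonal_mul_diagonal, ← Matrix.diagonal_one]
    exact congrArg _ (funext sgn_mul_self)
  have hu : IsUnit (Matrix.diagonal sgn : Matrix (π ⊕ κ) (π ⊕ κ) ℝ) :=
    IsUnit.of_mul_eq_one _ hd
  have hi : (Matrix.diagonal sgn : Matrix (π ⊕ κ) (π ⊕ κ) ℝ)⁻¹ = Matrix.diagonal sgn :=
    Matrix.inv_eq_left_inv hd
  have h : cosetGen (-x) = Matrix.diagonal sgn * cosetGen x
      * (Matrix.diagonal sgn : Matrix (π ⊕ κ) (π ⊕ κ) ℝ)⁻¹ := by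
    rw [hi]
    ext (i | i) (j | j) <;> simp [cosetGen, sgn]
  rw [inv_cosetRep, cosetRep_eq, h, Matrix.exp_conj _ _ hu, hi, Matrix.mul_diagonal,
    Matrix.diagonal_mul, ← cosetRep_eq]
  ring

theorem contDiff_cosetRep (s t : π ⊕ κ) :
    ContDiff ℝ ∞ (fun x : κ → π → ℝ => cosetRep x s t) :=
  contDiff_matrix_exp cosetGen s t

theorem contDiff_inv_cosetRep (s t : π ⊕ κ) :
    ContDiff ℝ ∞ (fun x : κ → π → ℝ => (cosetRep x)⁻¹ s t) := by
  simp only [inv_cosetRep_apply]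
  exact contDiff_const.mul (contDiff_cosetRep s t)

theorem inv_mul_cosetRep (x : κ → π → ℝ) : (cosetRep x)⁻¹ * cosetRep x = 1 :=
  Matrix.nonsing_inv_mul _ ((Matrix.isUnit_iff_isUnit_det _).1 (Matrix.isUnit_exp _))

theorem cosetRep_mul_inv (x : κ → π → ℝ) : cosetRep x * (cosetRep x)⁻¹ = 1 :=
  Matrix.mul_nonsing_inv _ ((Matrix.isUnit_iff_isUnit_det _).1 (Matrix.isUnit_exp _))

/-- The differential of the coset representative. -/
def dCosetRep (x X : κ → π → ℝ) : Matrix (π ⊕ κ) (π ⊕ κ) ℝ :=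
  Matrix.of fun s t => fderiv ℝ (fun y => cosetRep y s t) x X

/-- The left-invariant form `L⁻¹ dL`. -/
def mcForm (s t : π ⊕ κ) (x : κ → π → ℝ) : (κ → π → ℝ) →L[ℝ] ℝ :=
  ∑ r, (cosetRep x)⁻¹ s r • fderiv ℝ (fun y => cosetRep y r t) x

theorem cosetForm_eq (i : κ) (a : π) :
    cosetForm i a = mcForm (π := π) (Sum.inr i) (Sum.inl a) := rfl

theorem mcForm_apply (s t : π ⊕ κ) (x X : κ → π → ℝ) :
    mcForm s t x X = ((cosetRep x)⁻¹ * dCosetRep x X) s t := by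
  simp [mcForm, Matrix.mul_apply, dCosetRep]

theorem contDiff_mcForm (s t : π ⊕ κ) : ContDiff ℝ ∞ (mcForm (π := π) (κ := κ) s t) :=
  ContDiff.sum fun r _ => (contDiff_inv_cosetRep s r).smul
    ((contDiff_cosetRep r t).fderiv_right (by simp))

theorem cosetRep_mul_mcForm (s t : π ⊕ κ) (x X : κ → π → ℝ) :
    ∑ r, cosetRep x s r * mcForm r t x X = dCosetRep x X s t := by
  have : ∑ r, cosetRep x s r * mcForm r t x X
      = (cosetRep x * ((cosetRep x)⁻¹ * dCosetRep x X)) s t := by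
    rw [Matrix.mul_apply]
    exact Finset.sum_congr rfl fun r _ => by rw [mcForm_apply]
  rw [this, ← Matrix.mul_assoc, cosetRep_mul_inv, Matrix.one_mul]

theorem hasFDerivAt_cosetRep (s t : π ⊕ κ) (x : κ → π → ℝ) :
    HasFDerivAt (fun y => cosetRep y s t) (fderiv ℝ (fun y => cosetRep y s t) x) x :=
  ((contDiff_cosetRep s t).differentiable (by simp) x).hasFDerivAt

theorem hasFDerivAt_inv_cosetRep (s t : π ⊕ κ) (x : κ → π → ℝ) :
    HasFDerivAt (fun y => (cosetRep y)⁻¹ s t)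
      ((sgn s * sgn t) • fderiv ℝ (fun y => cosetRep y s t) x) x := by
  simp only [inv_cosetRep_apply]
  exact (hasFDerivAt_cosetRep s t x).const_mul _

theorem sum_fderiv_inv_mul (s t : π ⊕ κ) (x X : κ → π → ℝ) :
    ∑ r, fderiv ℝ (fun y => (cosetRep y)⁻¹ s r) x X * cosetRep x r t = -mcForm s t x X := by
  have h : HasFDerivAt (fun y => ∑ r, (cosetRep y)⁻¹ s r * cosetRep y r t) _ x :=
    HasFDerivAt.fun_sum fun r _ => (hasFDerivAt_inv_cosetRep s r x).mul (hasFDerivAt_cosetRep r t x)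
  have h0 : (fun y : κ → π → ℝ => ∑ r, (cosetRep y)⁻¹ s r * cosetRep y r t)
      = fun _ => (1 : Matrix (π ⊕ κ) (π ⊕ κ) ℝ) s t := by
    ext1 y
    rw [← Matrix.mul_apply, inv_mul_cosetRep]
  rw [h0] at h
  have e := DFunLike.congr_fun (h.unique (hasFDerivAt_const _ _)) X
  simp only [sum_apply, add_apply, smul_apply, smul_eq_mul, zero_apply, Finset.sum_add_distrib] at e
  have h1 : ∑ r, (cosetRep x)⁻¹ s r * fderiv ℝ (fun y => cosetRep y r t) x X = mcForm s t x X := by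
    simp [mcForm]
  have h2 : ∑ r, fderiv ℝ (fun y => (cosetRep y)⁻¹ s r) x X * cosetRep x r t
      = ∑ r, cosetRep x r t * (sgn s * sgn r * fderiv ℝ (fun y => cosetRep y s r) x X) :=
    Finset.sum_congr rfl fun r _ => by
      rw [(hasFDerivAt_inv_cosetRep s r x).fderiv, smul_apply, smul_eq_mul, mul_comm]
  rw [h2]
  linear_combination e - h1

/-- `L⁻¹ dL` takes values in the Lie algebra of `SO(p, q)`. -/
theorem sgn_mul_mcForm (s t : π ⊕ κ) (x X : κ → π → ℝ) :
    sgn s * mcForm s t x X = -(sgn t * mcForm t s x X) := by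
  have e := sum_fderiv_inv_mul s t x X
  have h2 : ∑ r, fderiv ℝ (fun y => (cosetRep y)⁻¹ s r) x X * cosetRep x r t
      = sgn s * sgn t * mcForm t s x X := by
    have hf : ∀ r, fderiv ℝ (fun y => (cosetRep y)⁻¹ s r) x X
        = sgn s * sgn r * fderiv ℝ (fun y => cosetRep y s r) x X := fun r => by
      rw [(hasFDerivAt_inv_cosetRep s r x).fderiv, smul_apply, smul_eq_mul]
    simp only [hf]
    simp only [mcForm, sum_apply, smul_apply, smul_eq_mul, Finset.mul_sum, inv_cosetRep_apply]
    refine Finset.sum_congr rfl fun r _ => ?_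
    rw [show (fun y : κ → π → ℝ => cosetRep y r s) = fun y => cosetRep y s r from
      funext fun y => cosetRep_symm y r s, cosetRep_symm x t r]
    linear_combination -(sgn s * sgn r * cosetRep x r t *
      fderiv ℝ (fun y => cosetRep y s r) x X) * sgn_mul_self t
  rw [h2] at e
  linear_combination sgn s * e - sgn t * mcForm t s x X * sgn_mul_self s

/-- The Maurer-Cartan equation. -/
theorem extD_mcForm (s t : π ⊕ κ) (x X Y : κ → π → ℝ) :
    extD (mcForm s t) x X Y = -∑ r, (mcForm s r x X * mcForm r t x Y
      - mcForm s r x Y * mcForm r t x X) := by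
  have hd : ∀ r, DifferentiableAt ℝ (fderiv ℝ (fun y : κ → π → ℝ => cosetRep y r t)) x := fun r =>
    ((contDiff_cosetRep r t).fderiv_right (m := ∞) (by simp)).differentiable (by simp) x
  have hi : ∀ r, HasFDerivAt (fun y : κ → π → ℝ => (cosetRep y)⁻¹ s r)
      (fderiv ℝ (fun y => (cosetRep y)⁻¹ s r) x) x := fun r =>
    ((contDiff_inv_cosetRep s r).differentiable (by simp) x).hasFDerivAt
  have h : HasFDerivAt (mcForm s t) _ x :=
    HasFDerivAt.fun_sum fun r (_ : r ∈ Finset.univ) => (hi r).smul (hd r).hasFDerivAt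
  have hs : ∀ r, IsSymmSndFDerivAt ℝ (fun y : κ → π → ℝ => cosetRep y r t) x := fun r =>
    (contDiff_cosetRep r t).contDiffAt.isSymmSndFDerivAt
      (by simpa using WithTop.coe_le_coe.2 (le_top : (2 : ℕ∞) ≤ ⊤))
  -- Writing dL = L(L⁻¹dL) and d(L⁻¹)L = -L⁻¹dL gives the quadratic term; second derivatives of L
  -- cancel by symmetry.
  have key : ∀ X Y, ∑ r, fderiv ℝ (fun y => (cosetRep y)⁻¹ s r) x X
      * fderiv ℝ (fun y => cosetRep y r t) x Y = -∑ k, mcForm s k x X * mcForm k t x Y := by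
    intro X Y
    have h1 : ∀ r, fderiv ℝ (fun y => cosetRep y r t) x Y
        = ∑ k, cosetRep x r k * mcForm k t x Y := fun r => (cosetRep_mul_mcForm r t x Y).symm
    simp only [h1, Finset.mul_sum]
    rw [Finset.sum_comm, ← Finset.sum_neg_distrib]
    refine Finset.sum_congr rfl fun k _ => ?_
    simp only [← mul_assoc, ← Finset.sum_mul, sum_fderiv_inv_mul]
    ring
  simp only [extD]
  rw [h.fderiv]
  simp only [sum_apply, add_apply, smul_apply, ContinuousLinearMap.smulRight_apply, smul_eq_mul,
    Finset.sum_add_distrib, key, Finset.sum_sub_distrib]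
  simp only [(hs _).eq X Y]
  ring

/-- If the coset part of L⁻¹dL(X) vanishes, the rest is antisymmetric, so the derivative of LLᵀ
along X is zero. As L is symmetric, LLᵀ = L² is the exponential of twice the generator, and
injectivity of d exp gives X = 0. -/
theorem eq_zero_of_cosetForm {x X : κ → π → ℝ} (h : ∀ i a, cosetForm i a x X = 0) : X = 0 := by
  have hanti : ∀ s t : π ⊕ κ, mcForm s t x X = -mcForm t s x X := by
    rintro (a | i) (b | j)
    · have := sgn_mul_mcForm (Sum.inl a : π ⊕ κ) (Sum.inl b) x X
      simpa [sgn] using this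
    · have := sgn_mul_mcForm (Sum.inl a : π ⊕ κ) (Sum.inr j) x X
      have h0 := h j a
      rw [cosetForm_eq] at h0
      simpa [sgn, h0] using this
    · have := sgn_mul_mcForm (Sum.inl b : π ⊕ κ) (Sum.inr i) x X
      have h0 := h i b
      rw [cosetForm_eq] at h0
      simp [sgn, h0] at this
      simp [this, h0]
    · have := sgn_mul_mcForm (Sum.inr i : π ⊕ κ) (Sum.inr j) x X
      simp [sgn] at this
      linarith
  have hsym : ∀ s t, dCosetRep x X s t = dCosetRep (π := π) x X t s := fun s t => by
    simp only [dCosetRep, Matrix.of_apply]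
    rw [show (fun y : κ → π → ℝ => cosetRep y s t) = fun y => cosetRep y t s from
      funext fun y => cosetRep_symm y s t]
  -- The derivative of L²; one factor dL is written as L·θ and the other, using symmetry, as -θ·L,
  -- with θ = L⁻¹dL(X).
  have hsq : ∀ i j : π ⊕ κ, ∑ k, (dCosetRep x X i k * cosetRep x k j
      + cosetRep x i k * dCosetRep x X k j) = 0 := by
    intro i j
    have e1 : ∀ k, dCosetRep x X i k = ∑ r, cosetRep x i r * mcForm r k x X := fun k =>
      (cosetRep_mul_mcForm i k x X).symm
    have e2 : ∀ k, dCosetRep x X k j = -∑ r, mcForm k r x X * cosetRep x r j := fun k => by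
      rw [hsym, ← cosetRep_mul_mcForm, ← Finset.sum_neg_distrib]
      refine Finset.sum_congr rfl fun r _ => ?_
      rw [hanti r k, cosetRep_symm x j r]; ring
    simp only [e1, e2, Finset.sum_mul, Finset.mul_sum, mul_neg, Finset.sum_add_distrib,
      Finset.sum_neg_distrib]
    rw [Finset.sum_comm, ← sub_eq_add_neg, sub_eq_zero]
    exact Finset.sum_congr rfl fun r _ => Finset.sum_congr rfl fun k _ => by ring
  have hz := eq_zero_of_hasDerivAt_exp (T := (2 : ℝ) • cosetGen x) (H := (2 : ℝ) • cosetGen X)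
    (by
      have := isHermitian_cosetGen x
      rw [Matrix.IsHermitian, Matrix.conjTranspose_smul, this.eq, star_trivial]) (fun i j => by
      have e : (fun s : ℝ => NormedSpace.exp
          ((2 : ℝ) • cosetGen x + s • ((2 : ℝ) • cosetGen X)) i j)
          = fun s : ℝ => ∑ k, cosetRep (x + s • X) i k * cosetRep (x + s • X) k j := by
        ext1 s
        rw [smul_comm s, ← smul_add, ← map_smul, ← map_add, two_smul,
          Matrix.exp_add_of_commute _ _ (Commute.refl _), Matrix.mul_apply]
        rfl
      rw [e]
      have hl : HasDerivAt (fun s : ℝ => x + s • X) X 0 := by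
        simpa using ((hasDerivAt_id (0 : ℝ)).smul_const X).const_add x
      have hL : ∀ s t, HasDerivAt (fun r : ℝ => cosetRep (x + r • X) s t) (dCosetRep x X s t) 0 :=
        fun s t => by
          have h0 : x + (0 : ℝ) • X = x := by simp
          have := hasFDerivAt_cosetRep s t (x + (0 : ℝ) • X)
          have := this.comp_hasDerivAt (0 : ℝ) hl
          rw [h0] at this
          exact this
      have hm : ∀ k, HasDerivAt (fun s : ℝ => cosetRep (x + s • X) i k * cosetRep (x + s • X) k j)
          (dCosetRep x X i k * cosetRep x k j + cosetRep x i k * dCosetRep x X k j) 0 := fun k => by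
        have := (hL i k).fun_mul (hL k j)
        simpa only [zero_smul, add_zero] using this
      exact (HasDerivAt.fun_sum fun k _ => hm k).congr_deriv (hsq i j))
  ext i a
  have := congrFun (congrFun hz (Sum.inr i)) (Sum.inl a)
  simpa [cosetGen] using this

/-- The left-invariant form, with complex values. -/
def cForm (s t : π ⊕ κ) (x : κ → π → ℝ) : (κ → π → ℝ) →L[ℝ] ℂ :=
  Complex.ofRealCLM.comp (mcForm s t x)

theorem cForm_apply (s t : π ⊕ κ) (x X : κ → π → ℝ) :
    cForm s t x X = (mcForm s t x X : ℂ) := rfl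

theorem conj_cForm (s t : π ⊕ κ) (x X : κ → π → ℝ) :
    (starRingEnd ℂ) (cForm s t x X) = cForm s t x X := Complex.conj_ofReal _

theorem contDiff_cForm (s t : π ⊕ κ) : ContDiff ℝ ∞ (cForm (π := π) (κ := κ) s t) :=
  contDiff_const.clm_comp (contDiff_mcForm s t)

theorem extD_cForm (s t : π ⊕ κ) (x X Y : κ → π → ℝ) :
    extD (cForm s t) x X Y = -∑ r, wedge (cForm s r x) (cForm r t x) X Y := by
  have := extD_clm_comp Complex.ofRealCLM ((contDiff_mcForm s t).differentiable (by simp) x) X Y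
  refine this.trans ?_
  rw [Complex.ofRealCLM_apply, extD_mcForm]
  simp [wedge, cForm_apply]

theorem cForm_inl_inl (a b : π) (x X : κ → π → ℝ) :
    cForm (Sum.inl a) (Sum.inl b) x X = -cForm (Sum.inl b) (Sum.inl a) x X := by
  have := sgn_mul_mcForm (Sum.inl a : π ⊕ κ) (Sum.inl b) x X
  simp only [sgn, Sum.elim_inl, one_mul] at this
  rw [cForm_apply, cForm_apply, this, Complex.ofReal_neg]

theorem cForm_inr_inr (i j : κ) (x X : κ → π → ℝ) :
    cForm (Sum.inr i) (Sum.inr j) x X = -cForm (Sum.inr j) (Sum.inr i) x X := by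
  have := sgn_mul_mcForm (Sum.inr i : π ⊕ κ) (Sum.inr j) x X
  simp only [sgn, Sum.elim_inr] at this
  rw [cForm_apply, cForm_apply, ← Complex.ofReal_neg]
  congr 1
  linarith

theorem cForm_inl_inr (a : π) (i : κ) (x X : κ → π → ℝ) :
    cForm (Sum.inl a) (Sum.inr i) x X = cForm (Sum.inr i) (Sum.inl a) x X := by
  have := sgn_mul_mcForm (Sum.inl a : π ⊕ κ) (Sum.inr i) x X
  simp only [sgn, Sum.elim_inr, Sum.elim_inl] at this
  rw [cForm_apply, cForm_apply]
  congr 1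
  linarith

end CosetGeometry

/-! ### Structure equations of SO(4, n)/SO(4) × SO(n). -/

section Grassmannian

variable {n₁ n₂ : ℕ}

/-- The `SO(4)`-connection of the Grassmannian. -/
def grConn (a b : Fin 2 ⊕ Fin 2) : GrSpace n₁ n₂ → GrSpace n₁ n₂ →L[ℝ] ℂ :=
  cForm (Sum.inl a) (Sum.inl b)

/-- The `SO(n)`-connection of the Grassmannian. -/
def grRot (i j : Fin n₁ ⊕ Fin n₂) : GrSpace n₁ n₂ → GrSpace n₁ n₂ →L[ℝ] ℂ :=
  cForm (Sum.inr i) (Sum.inr j)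

/-- The coset vielbein, with complex values. -/
def grViel (i : Fin n₁ ⊕ Fin n₂) (a : Fin 2 ⊕ Fin 2) : GrSpace n₁ n₂ → GrSpace n₁ n₂ →L[ℝ] ℂ :=
  cForm (Sum.inr i) (Sum.inl a)

theorem grConn_swap (a b : Fin 2 ⊕ Fin 2) (x X : GrSpace n₁ n₂) :
    grConn b a x X = -grConn a b x X := cForm_inl_inl b a x X

theorem grConn_self (a : Fin 2 ⊕ Fin 2) (x X : GrSpace n₁ n₂) : grConn a a x X = 0 := by
  have := grConn_swap a a x X
  linear_combination this / 2

theorem grRot_swap (i j : Fin n₁ ⊕ Fin n₂) (x X : GrSpace n₁ n₂) :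
    grRot j i x X = -grRot i j x X := cForm_inr_inr j i x X

theorem conj_grConn (a b : Fin 2 ⊕ Fin 2) (x X : GrSpace n₁ n₂) :
    (starRingEnd ℂ) (grConn a b x X) = grConn a b x X := conj_cForm _ _ x X

theorem conj_grRot (i j : Fin n₁ ⊕ Fin n₂) (x X : GrSpace n₁ n₂) :
    (starRingEnd ℂ) (grRot i j x X) = grRot i j x X := conj_cForm _ _ x X

theorem conj_grViel (i : Fin n₁ ⊕ Fin n₂) (a : Fin 2 ⊕ Fin 2) (x X : GrSpace n₁ n₂) :
    (starRingEnd ℂ) (grViel i a x X) = grViel i a x X := conj_cForm _ _ x X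

theorem extD_grViel (i : Fin n₁ ⊕ Fin n₂) (a : Fin 2 ⊕ Fin 2) (x X Y : GrSpace n₁ n₂) :
    extD (grViel i a) x X Y = -∑ b, wedge (grViel i b x) (grConn b a x) X Y
      - ∑ j, wedge (grRot i j x) (grViel j a x) X Y := by
  rw [grViel, extD_cForm, Fintype.sum_sum_type, neg_add, sub_eq_add_neg]
  rfl

theorem extD_grConn (a b : Fin 2 ⊕ Fin 2) (x X Y : GrSpace n₁ n₂) :
    extD (grConn a b) x X Y = -∑ c, wedge (grConn a c x) (grConn c b x) X Y
      - ∑ i, wedge (grViel i a x) (grViel i b x) X Y := by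
  rw [grConn, extD_cForm, Fintype.sum_sum_type, neg_add, sub_eq_add_neg]
  simp only [wedge, cForm_inl_inr]
  rfl

theorem extD_grRot (i j : Fin n₁ ⊕ Fin n₂) (x X Y : GrSpace n₁ n₂) :
    extD (grRot i j) x X Y = -∑ a, wedge (grViel i a x) (grViel j a x) X Y
      - ∑ k, wedge (grRot i k x) (grRot k j x) X Y := by
  rw [grRot, extD_cForm, Fintype.sum_sum_type, neg_add, sub_eq_add_neg]
  simp only [wedge, cForm_inl_inr]
  rfl

theorem contDiff_grConn (a b : Fin 2 ⊕ Fin 2) : ContDiff ℝ ∞ (grConn (n₁ := n₁) (n₂ := n₂) a b) :=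
  contDiff_cForm _ _

theorem contDiff_grRot (i j : Fin n₁ ⊕ Fin n₂) : ContDiff ℝ ∞ (grRot i j) :=
  contDiff_cForm _ _

theorem contDiff_grViel (i : Fin n₁ ⊕ Fin n₂) (a : Fin 2 ⊕ Fin 2) :
    ContDiff ℝ ∞ (grViel i a) := contDiff_cForm _ _

theorem grZ₁_eq (i : Fin n₁ ⊕ Fin n₂) : grZ₁ i = fun x =>
    (1 / 2 : ℂ) • (grViel i (Sum.inl 0) x + Complex.I • grViel i (Sum.inl 1) x) := rfl

theorem grZ₂_eq (i : Fin n₁ ⊕ Fin n₂) : grZ₂ i = fun x =>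
    (1 / 2 : ℂ) • (grViel i (Sum.inr 0) x + Complex.I • grViel i (Sum.inr 1) x) := rfl

theorem grZ₁_apply (i : Fin n₁ ⊕ Fin n₂) (x X : GrSpace n₁ n₂) : grZ₁ i x X
    = (grViel i (Sum.inl 0) x X + Complex.I * grViel i (Sum.inl 1) x X) / 2 := by
  simp [grZ₁_eq]; ring

theorem grZ₂_apply (i : Fin n₁ ⊕ Fin n₂) (x X : GrSpace n₁ n₂) : grZ₂ i x X
    = (grViel i (Sum.inr 0) x X + Complex.I * grViel i (Sum.inr 1) x X) / 2 := by
  simp [grZ₂_eq]; ring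

theorem contDiff_grZ₁ (i : Fin n₁ ⊕ Fin n₂) : ContDiff ℝ ∞ (grZ₁ i) :=
  ((contDiff_grViel i _).add ((contDiff_grViel i _).const_smul _)).const_smul _

theorem contDiff_grZ₂ (i : Fin n₁ ⊕ Fin n₂) : ContDiff ℝ ∞ (grZ₂ i) :=
  ((contDiff_grViel i _).add ((contDiff_grViel i _).const_smul _)).const_smul _

theorem extD_half_add (a b : GrSpace n₁ n₂ → GrSpace n₁ n₂ →L[ℝ] ℂ) (x X Y : GrSpace n₁ n₂)
    (ha : ContDiff ℝ ∞ a) (hb : ContDiff ℝ ∞ b) :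
    extD (fun x => (1 / 2 : ℂ) • (a x + Complex.I • b x)) x X Y
      = (extD a x X Y + Complex.I * extD b x X Y) / 2 := by
  have da := ha.differentiable (by simp) x
  have db := hb.differentiable (by simp) x
  rw [extD_const_smul _ (da.fun_add (db.fun_const_smul _)), extD_add da (db.fun_const_smul _),
    extD_const_smul _ db]
  ring

/-- The `SU(2)`-connection of the Grassmannian. -/
def grOm : Fin 3 → GrSpace n₁ n₂ → GrSpace n₁ n₂ →L[ℝ] ℝ
  | 0 => fun x => mcForm (Sum.inl (Sum.inl 1)) (Sum.inl (Sum.inr 0)) x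
      - mcForm (Sum.inl (Sum.inl 0)) (Sum.inl (Sum.inr 1)) x
  | 1 => fun x => -(mcForm (Sum.inl (Sum.inl 0)) (Sum.inl (Sum.inr 0)) x
      + mcForm (Sum.inl (Sum.inl 1)) (Sum.inl (Sum.inr 1)) x)
  | 2 => fun x => mcForm (Sum.inl (Sum.inr 0)) (Sum.inl (Sum.inr 1)) x
      - mcForm (Sum.inl (Sum.inl 0)) (Sum.inl (Sum.inl 1)) x

theorem grOm_zero (x X : GrSpace n₁ n₂) : (grOm 0 x X : ℂ)
    = grConn (Sum.inl 1) (Sum.inr 0) x X - grConn (Sum.inl 0) (Sum.inr 1) x X := by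
  simp [grOm, grConn, cForm_apply]

theorem grOm_one (x X : GrSpace n₁ n₂) : (grOm 1 x X : ℂ)
    = -(grConn (Sum.inl 0) (Sum.inr 0) x X + grConn (Sum.inl 1) (Sum.inr 1) x X) := by
  simp [grOm, grConn, cForm_apply]

theorem grOm_two (x X : GrSpace n₁ n₂) : (grOm 2 x X : ℂ)
    = grConn (Sum.inr 0) (Sum.inr 1) x X - grConn (Sum.inl 0) (Sum.inl 1) x X := by
  simp [grOm, grConn, cForm_apply]

/-- The generator `a₁₂ + a₃₄` of the commuting `SU(2)`. -/
def grAlpha (x : GrSpace n₁ n₂) : GrSpace n₁ n₂ →L[ℝ] ℂ :=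
  grConn (Sum.inl 0) (Sum.inl 1) x + grConn (Sum.inr 0) (Sum.inr 1) x

/-- The form `a₁₃ - a₂₄ + i (a₂₃ + a₁₄)` of the commuting `SU(2)`. -/
def grBeta (x : GrSpace n₁ n₂) : GrSpace n₁ n₂ →L[ℝ] ℂ :=
  grConn (Sum.inl 0) (Sum.inr 0) x - grConn (Sum.inl 1) (Sum.inr 1) x
    + Complex.I • (grConn (Sum.inl 1) (Sum.inr 0) x + grConn (Sum.inl 0) (Sum.inr 1) x)

theorem grAlpha_apply (x X : GrSpace n₁ n₂) : grAlpha x X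
    = grConn (Sum.inl 0) (Sum.inl 1) x X + grConn (Sum.inr 0) (Sum.inr 1) x X := rfl

theorem grBeta_apply (x X : GrSpace n₁ n₂) : grBeta x X
    = grConn (Sum.inl 0) (Sum.inr 0) x X - grConn (Sum.inl 1) (Sum.inr 1) x X
    + Complex.I * (grConn (Sum.inl 1) (Sum.inr 0) x X + grConn (Sum.inl 0) (Sum.inr 1) x X) := rfl

theorem conj_grAlpha (x X : GrSpace n₁ n₂) : (starRingEnd ℂ) (grAlpha x X) = grAlpha x X := by
  simp only [grAlpha_apply, map_add, conj_grConn]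

theorem omPlus_grOm (x X : GrSpace n₁ n₂) : omPlus grOm x X
    = grConn (Sum.inl 1) (Sum.inr 0) x X - grConn (Sum.inl 0) (Sum.inr 1) x X
      - Complex.I * (grConn (Sum.inl 0) (Sum.inr 0) x X + grConn (Sum.inl 1) (Sum.inr 1) x X) := by
  rw [omPlus_apply, grOm_zero, grOm_one]; ring

theorem conj_omPlus_grOm (x X : GrSpace n₁ n₂) : (starRingEnd ℂ) (omPlus grOm x X)
    = grConn (Sum.inl 1) (Sum.inr 0) x X - grConn (Sum.inl 0) (Sum.inr 1) x X
      + Complex.I * (grConn (Sum.inl 0) (Sum.inr 0) x X + grConn (Sum.inl 1) (Sum.inr 1) x X) := by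
  simp only [omPlus_grOm, map_add, map_sub, map_mul, conj_grConn, Complex.conj_I]; ring

/-- The vector representation of SO(4) is a product of two doublets. One su(2), namely ω, mixes Z₁
with Z₂, and the commuting one, namely α and β, mixes Z₁ with the conjugate of Z₂. -/
theorem extD_grZ₁ (i : Fin n₁ ⊕ Fin n₂) (x X Y : GrSpace n₁ n₂) :
    extD (grZ₁ i) x X Y = -(Complex.I / 2) * wedge (fun Z => (grOm 2 x Z : ℂ)) (grZ₁ i x) X Y
      - Complex.I / 2 * wedge (omPlus grOm x) (grZ₂ i x) X Y
      - ∑ j, wedge (grRot i j x) (grZ₁ j x) X Y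
      + Complex.I / 2 * wedge (grAlpha x) (grZ₁ i x) X Y
      - 1 / 2 * wedge (grBeta x) (conjForm (grZ₂ i) x) X Y := by
  have hs : ∑ j, wedge (grRot i j x) (grZ₁ j x) X Y
      = (∑ j, wedge (grRot i j x) (grViel j (Sum.inl 0) x) X Y
        + Complex.I * ∑ j, wedge (grRot i j x) (grViel j (Sum.inl 1) x) X Y) / 2 := by
    rw [Finset.mul_sum, ← Finset.sum_add_distrib, Finset.sum_div]
    exact Finset.sum_congr rfl fun j _ => by simp only [wedge, grZ₁_apply]; ring
  have h2 : (starRingEnd ℂ) (2 : ℂ) = 2 := map_ofNat _ 2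
  have hd : extD (grZ₁ i) x X Y = (extD (grViel i (Sum.inl 0)) x X Y
      + Complex.I * extD (grViel i (Sum.inl 1)) x X Y) / 2 :=
    extD_half_add _ _ _ _ _ (contDiff_grViel _ _) (contDiff_grViel _ _)
  rw [hs, hd, extD_grViel, extD_grViel]
  generalize ∑ j, wedge (grRot i j x) (grViel j (Sum.inl 0) x) X Y = S₀
  generalize ∑ j, wedge (grRot i j x) (grViel j (Sum.inl 1) x) X Y = S₁
  simp only [Fintype.sum_sum_type (α₁ := Fin 2), Fin.sum_univ_two, wedge, conjForm_apply, grZ₁_apply, grZ₂_apply, map_add, map_mul, map_div₀, h2, conj_grViel,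
    Complex.conj_I, omPlus_grOm, grOm_two, grAlpha_apply, grBeta_apply, grConn_self,
    grConn_swap (Sum.inl 0) (Sum.inl 1), grConn_swap (Sum.inl 0) (Sum.inr 0),
    grConn_swap (Sum.inl 0) (Sum.inr 1), grConn_swap (Sum.inl 1) (Sum.inr 0),
    grConn_swap (Sum.inl 1) (Sum.inr 1)]
  ring_nf
  simp only [Complex.I_sq, Complex.I_pow_three]
  ring

theorem extD_grZ₂ (i : Fin n₁ ⊕ Fin n₂) (x X Y : GrSpace n₁ n₂) :
    extD (grZ₂ i) x X Y = Complex.I / 2 * wedge (fun Z => (grOm 2 x Z : ℂ)) (grZ₂ i x) X Y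
      - Complex.I / 2 * wedge (conjForm (omPlus grOm) x) (grZ₁ i x) X Y
      - ∑ j, wedge (grRot i j x) (grZ₂ j x) X Y
      + Complex.I / 2 * wedge (grAlpha x) (grZ₂ i x) X Y
      + 1 / 2 * wedge (grBeta x) (conjForm (grZ₁ i) x) X Y := by
  have hs : ∑ j, wedge (grRot i j x) (grZ₂ j x) X Y
      = (∑ j, wedge (grRot i j x) (grViel j (Sum.inr 0) x) X Y
        + Complex.I * ∑ j, wedge (grRot i j x) (grViel j (Sum.inr 1) x) X Y) / 2 := by
    rw [Finset.mul_sum, ← Finset.sum_add_distrib, Finset.sum_div]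
    exact Finset.sum_congr rfl fun j _ => by simp only [wedge, grZ₂_apply]; ring
  have h2 : (starRingEnd ℂ) (2 : ℂ) = 2 := map_ofNat _ 2
  have hd : extD (grZ₂ i) x X Y = (extD (grViel i (Sum.inr 0)) x X Y
      + Complex.I * extD (grViel i (Sum.inr 1)) x X Y) / 2 :=
    extD_half_add _ _ _ _ _ (contDiff_grViel _ _) (contDiff_grViel _ _)
  rw [hs, hd, extD_grViel, extD_grViel]
  generalize ∑ j, wedge (grRot i j x) (grViel j (Sum.inr 0) x) X Y = S₀
  generalize ∑ j, wedge (grRot i j x) (grViel j (Sum.inr 1) x) X Y = S₁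
  simp only [Fintype.sum_sum_type (α₁ := Fin 2), Fin.sum_univ_two, wedge, conjForm_apply, grZ₁_apply, grZ₂_apply, map_add, map_mul, map_div₀, h2, conj_grViel,
    Complex.conj_I, conj_omPlus_grOm, grOm_two, grAlpha_apply, grBeta_apply, grConn_self,
    grConn_swap (Sum.inr 0) (Sum.inr 1)]
  ring_nf
  simp only [Complex.I_sq, Complex.I_pow_three]
  ring

end Grassmannian

/-! ### Torsion equations of the Grassmannian. -/

section GrassmannianTorsion

variable {n₁ n₂ : ℕ}

/-- The diagonal blocks of the `Sp(2n)`-connection of the Grassmannian. -/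
def grA : Fin n₁ ⊕ Fin n₂ → Fin n₁ ⊕ Fin n₂ → GrSpace n₁ n₂ → GrSpace n₁ n₂ →L[ℝ] ℂ
  | Sum.inl i, Sum.inl j => fun x =>
      grRot (Sum.inl i) (Sum.inl j) x - (if i = j then Complex.I / 2 else 0) • grAlpha x
  | Sum.inr i, Sum.inr j => fun x =>
      grRot (Sum.inr i) (Sum.inr j) x + (if i = j then Complex.I / 2 else 0) • grAlpha x
  | _, _ => 0

/-- The off-diagonal blocks of the `Sp(2n)`-connection of the Grassmannian. -/
def grB : Fin n₁ ⊕ Fin n₂ → Fin n₁ ⊕ Fin n₂ → GrSpace n₁ n₂ → GrSpace n₁ n₂ →L[ℝ] ℂ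
  | Sum.inl i, Sum.inl j => fun x => (if i = j then -1 / 2 else 0 : ℂ) • grBeta x
  | Sum.inl i, Sum.inr j => fun x => -grRot (Sum.inl i) (Sum.inr j) x
  | Sum.inr i, Sum.inl j => fun x => grRot (Sum.inr i) (Sum.inl j) x
  | Sum.inr i, Sum.inr j => fun x => (if i = j then -1 / 2 else 0 : ℂ) • conjForm grBeta x

theorem grA_inl_inl (i j : Fin n₁) (x X : GrSpace n₁ n₂) : grA (Sum.inl i) (Sum.inl j) x X
    = grRot (Sum.inl i) (Sum.inl j) x X - (if i = j then Complex.I / 2 else 0) * grAlpha x X := rfl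

theorem grA_inr_inr (i j : Fin n₂) (x X : GrSpace n₁ n₂) : grA (Sum.inr i) (Sum.inr j) x X
    = grRot (Sum.inr i) (Sum.inr j) x X + (if i = j then Complex.I / 2 else 0) * grAlpha x X := rfl

theorem grA_inl_inr (i : Fin n₁) (j : Fin n₂) (x X : GrSpace n₁ n₂) :
    grA (Sum.inl i) (Sum.inr j) x X = 0 := rfl

theorem grA_inr_inl (i : Fin n₂) (j : Fin n₁) (x X : GrSpace n₁ n₂) :
    grA (Sum.inr i) (Sum.inl j) x X = 0 := rfl

theorem grB_inl_inl (i j : Fin n₁) (x X : GrSpace n₁ n₂) : grB (Sum.inl i) (Sum.inl j) x X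
    = (if i = j then -1 / 2 else 0) * grBeta x X := rfl

theorem grB_inr_inr (i j : Fin n₂) (x X : GrSpace n₁ n₂) : grB (Sum.inr i) (Sum.inr j) x X
    = (if i = j then -1 / 2 else 0) * (starRingEnd ℂ) (grBeta x X) := rfl

theorem grB_inl_inr (i : Fin n₁) (j : Fin n₂) (x X : GrSpace n₁ n₂) :
    grB (Sum.inl i) (Sum.inr j) x X = -grRot (Sum.inl i) (Sum.inr j) x X := rfl

theorem grB_inr_inl (i : Fin n₂) (j : Fin n₁) (x X : GrSpace n₁ n₂) :
    grB (Sum.inr i) (Sum.inl j) x X = grRot (Sum.inr i) (Sum.inl j) x X := rfl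

theorem grTheta₁_inl (i : Fin n₁) (x X : GrSpace n₁ n₂) :
    grTheta₁ (Sum.inl i) x X = grZ₁ (Sum.inl i) x X := rfl

theorem grTheta₁_inr (i : Fin n₂) (x X : GrSpace n₁ n₂) :
    grTheta₁ (Sum.inr i) x X = -(starRingEnd ℂ) (grZ₂ (Sum.inr i) x X) := rfl

theorem grTheta₂_inl (i : Fin n₁) (x X : GrSpace n₁ n₂) :
    grTheta₂ (Sum.inl i) x X = grZ₂ (Sum.inl i) x X := rfl

theorem grTheta₂_inr (i : Fin n₂) (x X : GrSpace n₁ n₂) :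
    grTheta₂ (Sum.inr i) x X = (starRingEnd ℂ) (grZ₁ (Sum.inr i) x X) := rfl

theorem contDiff_grAlpha : ContDiff ℝ ∞ (grAlpha (n₁ := n₁) (n₂ := n₂)) :=
  (contDiff_grConn _ _).add (contDiff_grConn _ _)

theorem contDiff_grBeta : ContDiff ℝ ∞ (grBeta (n₁ := n₁) (n₂ := n₂)) :=
  ((contDiff_grConn _ _).sub (contDiff_grConn _ _)).add
    (((contDiff_grConn _ _).add (contDiff_grConn _ _)).const_smul _)

theorem contDiff_conjForm {E : Type*} [NormedAddCommGroup E] [NormedSpace ℝ E]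
    {θ : E → E →L[ℝ] ℂ} (h : ContDiff ℝ ∞ θ) : ContDiff ℝ ∞ (conjForm θ) :=
  contDiff_const.clm_comp h

theorem contDiff_grA (I J : Fin n₁ ⊕ Fin n₂) : ContDiff ℝ ∞ (grA I J) := by
  rcases I with i | i <;> rcases J with j | j
  · exact (contDiff_grRot _ _).sub (contDiff_grAlpha.const_smul _)
  · exact contDiff_const
  · exact contDiff_const
  · exact (contDiff_grRot _ _).add (contDiff_grAlpha.const_smul _)

theorem contDiff_grB (I J : Fin n₁ ⊕ Fin n₂) : ContDiff ℝ ∞ (grB I J) := by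
  rcases I with i | i <;> rcases J with j | j
  · exact contDiff_grBeta.const_smul _
  · exact (contDiff_grRot _ _).neg
  · exact contDiff_grRot _ _
  · exact (contDiff_conjForm contDiff_grBeta).const_smul _

theorem contDiff_grTheta₁ (I : Fin n₁ ⊕ Fin n₂) : ContDiff ℝ ∞ (grTheta₁ I) := by
  rcases I with i | i
  · exact contDiff_grZ₁ _
  · exact (contDiff_conjForm (contDiff_grZ₂ _)).neg

theorem contDiff_grTheta₂ (I : Fin n₁ ⊕ Fin n₂) : ContDiff ℝ ∞ (grTheta₂ I) := by
  rcases I with i | i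
  · exact contDiff_grZ₂ _
  · exact contDiff_conjForm (contDiff_grZ₁ _)

theorem contDiff_grOm (k : Fin 3) : ContDiff ℝ ∞ (grOm (n₁ := n₁) (n₂ := n₂) k) := by
  have h := contDiff_mcForm (π := Fin 2 ⊕ Fin 2) (κ := Fin n₁ ⊕ Fin n₂)
  fin_cases k
  · exact (h _ _).sub (h _ _)
  · exact ((h _ _).add (h _ _)).neg
  · exact (h _ _).sub (h _ _)

theorem extD_grTheta₁_inr (i : Fin n₂) (x X Y : GrSpace n₁ n₂) :
    extD (grTheta₁ (Sum.inr i)) x X Y = -(starRingEnd ℂ) (extD (grZ₂ (Sum.inr i)) x X Y) := by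
  rw [← extD_conjForm ((contDiff_grZ₂ _).differentiable (by simp) x)]
  simp only [extD]
  rw [show grTheta₁ (Sum.inr i) = -conjForm (grZ₂ (n₁ := n₁) (Sum.inr i)) from rfl, fderiv_neg]
  simp only [neg_apply]
  ring

theorem extD_grTheta₂_inr (i : Fin n₂) (x X Y : GrSpace n₁ n₂) :
    extD (grTheta₂ (Sum.inr i)) x X Y = (starRingEnd ℂ) (extD (grZ₁ (Sum.inr i)) x X Y) :=
  extD_conjForm ((contDiff_grZ₁ _).differentiable (by simp) x) X Y

/-- For I ≤ n₁ this is the structure equation of Z₁, and for I > n₁ it is minus the conjugate of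
that of Z₂. -/
theorem gr_torsion₁ (I : Fin n₁ ⊕ Fin n₂) (x X Y : GrSpace n₁ n₂) :
    extD (grTheta₁ I) x X Y
      + Complex.I / 2 * wedge (fun Z => (grOm 2 x Z : ℂ)) (grTheta₁ I x) X Y
      + Complex.I / 2 * wedge (omPlus grOm x) (grTheta₂ I x) X Y
      + ∑ J, (wedge (grA I J x) (grTheta₁ J x) X Y
        - wedge (grB I J x) (conjForm (grTheta₂ J) x) X Y) = 0 := by
  rcases I with i | i
  · have hl : ∀ j, wedge (grA (Sum.inl i) (Sum.inl j) x) (grTheta₁ (Sum.inl j) x) X Y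
        - wedge (grB (Sum.inl i) (Sum.inl j) x) (conjForm (grTheta₂ (Sum.inl j)) x) X Y
        = wedge (grRot (Sum.inl i) (Sum.inl j) x) (grZ₁ (Sum.inl j) x) X Y
          + if i = j then -(Complex.I / 2) * wedge (grAlpha x) (grZ₁ (Sum.inl j) x) X Y
            + 1 / 2 * wedge (grBeta x) (conjForm (grZ₂ (Sum.inl j)) x) X Y else 0 := fun j => by
      simp only [wedge, conjForm_apply, grA_inl_inl, grB_inl_inl, grTheta₁_inl, grTheta₂_inl]
      split_ifs <;> ring
    -- A rotation from I ≤ n₁ to J > n₁ must reach Z₁, which is the conjugate of U^{2J}. It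
    -- therefore sits in the off-diagonal block, not in `grA`.
    have hr : ∀ j, wedge (grA (Sum.inl i) (Sum.inr j) x) (grTheta₁ (Sum.inr j) x) X Y
        - wedge (grB (Sum.inl i) (Sum.inr j) x) (conjForm (grTheta₂ (Sum.inr j)) x) X Y
        = wedge (grRot (Sum.inl i) (Sum.inr j) x) (grZ₁ (Sum.inr j) x) X Y := fun j => by
      simp only [wedge, conjForm_apply, grA_inl_inr, grB_inl_inr, grTheta₂_inr, Complex.conj_conj]
      ring
    rw [Fintype.sum_sum_type]
    simp only [hl, hr, Finset.sum_add_distrib, Finset.sum_ite_eq, Finset.mem_univ, if_true]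
    rw [show grTheta₁ (Sum.inl i) = grZ₁ (n₂ := n₂) (Sum.inl i) from rfl, extD_grZ₁,
      Fintype.sum_sum_type]
    simp only [wedge, grTheta₂_inl]
    ring
  · have hr : ∀ j, wedge (grA (Sum.inr i) (Sum.inr j) x) (grTheta₁ (Sum.inr j) x) X Y
        - wedge (grB (Sum.inr i) (Sum.inr j) x) (conjForm (grTheta₂ (Sum.inr j)) x) X Y
        = -(starRingEnd ℂ) (wedge (grRot (Sum.inr i) (Sum.inr j) x) (grZ₂ (Sum.inr j) x) X Y)
          + if i = j then -(Complex.I / 2) * wedge (grAlpha x) (conjForm (grZ₂ (Sum.inr j)) x) X Y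
            + 1 / 2 * wedge (conjForm grBeta x) (grZ₁ (Sum.inr j) x) X Y else 0 := fun j => by
      simp only [wedge, conjForm_apply, grA_inr_inr, grB_inr_inr, grTheta₁_inr, grTheta₂_inr,
        Complex.conj_conj, map_sub, map_mul, conj_grRot]
      split_ifs <;> ring
    have hl : ∀ j, wedge (grA (Sum.inr i) (Sum.inl j) x) (grTheta₁ (Sum.inl j) x) X Y
        - wedge (grB (Sum.inr i) (Sum.inl j) x) (conjForm (grTheta₂ (Sum.inl j)) x) X Y
        = -(starRingEnd ℂ) (wedge (grRot (Sum.inr i) (Sum.inl j) x) (grZ₂ (Sum.inl j) x) X Y) :=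
      fun j => by
      simp only [wedge, conjForm_apply, grA_inr_inl, grB_inr_inl, grTheta₂_inl, map_sub, map_mul,
        conj_grRot]
      ring
    have h2 : (starRingEnd ℂ) (2 : ℂ) = 2 := map_ofNat _ 2
    rw [Fintype.sum_sum_type]
    simp only [hl, hr, Finset.sum_add_distrib, Finset.sum_ite_eq, Finset.mem_univ, if_true,
      Finset.sum_neg_distrib]
    rw [extD_grTheta₁_inr, extD_grZ₂, Fintype.sum_sum_type]
    simp only [map_add, map_sub, map_sum, map_mul, map_div₀, conj_wedge, conjForm_apply,
      Complex.conj_conj, Complex.conj_ofReal, Complex.conj_I, h2, map_one]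
    simp only [wedge, grTheta₁_inr, grTheta₂_inr, conjForm_apply, conj_grAlpha]
    ring

theorem gr_torsion₂ (I : Fin n₁ ⊕ Fin n₂) (x X Y : GrSpace n₁ n₂) :
    extD (grTheta₂ I) x X Y
      + Complex.I / 2 * wedge (conjForm (omPlus grOm) x) (grTheta₁ I x) X Y
      - Complex.I / 2 * wedge (fun Z => (grOm 2 x Z : ℂ)) (grTheta₂ I x) X Y
      + ∑ J, (wedge (grA I J x) (grTheta₂ J x) X Y
        + wedge (grB I J x) (conjForm (grTheta₁ J) x) X Y) = 0 := by
  rcases I with i | i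
  · have hl : ∀ j, wedge (grA (Sum.inl i) (Sum.inl j) x) (grTheta₂ (Sum.inl j) x) X Y
        + wedge (grB (Sum.inl i) (Sum.inl j) x) (conjForm (grTheta₁ (Sum.inl j)) x) X Y
        = wedge (grRot (Sum.inl i) (Sum.inl j) x) (grZ₂ (Sum.inl j) x) X Y
          + if i = j then -(Complex.I / 2) * wedge (grAlpha x) (grZ₂ (Sum.inl j) x) X Y
            - 1 / 2 * wedge (grBeta x) (conjForm (grZ₁ (Sum.inl j)) x) X Y else 0 := fun j => by
      simp only [wedge, conjForm_apply, grA_inl_inl, grB_inl_inl, grTheta₁_inl, grTheta₂_inl]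
      split_ifs <;> ring
    have hr : ∀ j, wedge (grA (Sum.inl i) (Sum.inr j) x) (grTheta₂ (Sum.inr j) x) X Y
        + wedge (grB (Sum.inl i) (Sum.inr j) x) (conjForm (grTheta₁ (Sum.inr j)) x) X Y
        = wedge (grRot (Sum.inl i) (Sum.inr j) x) (grZ₂ (Sum.inr j) x) X Y := fun j => by
      simp only [wedge, conjForm_apply, grA_inl_inr, grB_inl_inr, grTheta₁_inr, map_neg,
        Complex.conj_conj]
      ring
    rw [Fintype.sum_sum_type]
    simp only [hl, hr, Finset.sum_add_distrib, Finset.sum_ite_eq, Finset.mem_univ, if_true]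
    rw [show grTheta₂ (Sum.inl i) = grZ₂ (n₂ := n₂) (Sum.inl i) from rfl, extD_grZ₂,
      Fintype.sum_sum_type]
    simp only [wedge, grTheta₁_inl]
    ring
  · have hr : ∀ j, wedge (grA (Sum.inr i) (Sum.inr j) x) (grTheta₂ (Sum.inr j) x) X Y
        + wedge (grB (Sum.inr i) (Sum.inr j) x) (conjForm (grTheta₁ (Sum.inr j)) x) X Y
        = (starRingEnd ℂ) (wedge (grRot (Sum.inr i) (Sum.inr j) x) (grZ₁ (Sum.inr j) x) X Y)
          + if i = j then Complex.I / 2 * wedge (grAlpha x) (conjForm (grZ₁ (Sum.inr j)) x) X Y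
            + 1 / 2 * wedge (conjForm grBeta x) (grZ₂ (Sum.inr j) x) X Y else 0 := fun j => by
      simp only [wedge, conjForm_apply, grA_inr_inr, grB_inr_inr, grTheta₁_inr, grTheta₂_inr,
        Complex.conj_conj, map_sub, map_mul, map_neg, conj_grRot]
      split_ifs <;> ring
    have hl : ∀ j, wedge (grA (Sum.inr i) (Sum.inl j) x) (grTheta₂ (Sum.inl j) x) X Y
        + wedge (grB (Sum.inr i) (Sum.inl j) x) (conjForm (grTheta₁ (Sum.inl j)) x) X Y
        = (starRingEnd ℂ) (wedge (grRot (Sum.inr i) (Sum.inl j) x) (grZ₁ (Sum.inl j) x) X Y) :=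
      fun j => by
      simp only [wedge, conjForm_apply, grA_inr_inl, grB_inr_inl, grTheta₁_inl, map_sub, map_mul,
        conj_grRot]
      ring
    have h2 : (starRingEnd ℂ) (2 : ℂ) = 2 := map_ofNat _ 2
    rw [Fintype.sum_sum_type]
    simp only [hl, hr, Finset.sum_add_distrib, Finset.sum_ite_eq, Finset.mem_univ, if_true]
    rw [extD_grTheta₂_inr, extD_grZ₁, Fintype.sum_sum_type]
    simp only [map_add, map_sub, map_sum, map_mul, map_div₀, map_neg, conj_wedge, conjForm_apply,
      Complex.conj_conj, Complex.conj_ofReal, Complex.conj_I, h2, map_one]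
    simp only [wedge, grTheta₁_inr, grTheta₂_inr, conjForm_apply, conj_grAlpha]
    ring

end GrassmannianTorsion

theorem extD_sub {E G : Type*} [NormedAddCommGroup E] [NormedSpace ℝ E] [NormedAddCommGroup G]
    [NormedSpace ℝ G] {θ η : E → E →L[ℝ] G} {q : E} (hθ : DifferentiableAt ℝ θ q)
    (hη : DifferentiableAt ℝ η q) (X Y : E) :
    extD (fun p => θ p - η p) q X Y = extD θ q X Y - extD η q X Y := by
  simp only [extD, fderiv_fun_sub hθ hη, sub_apply]
  abel

/-! ### SU(2)-curvature, metric and the commuting su(2). -/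

section GrassmannianCurvature

variable {n₁ n₂ : ℕ}

theorem wedge_grZ₁_grZ₁ (i : Fin n₁ ⊕ Fin n₂) (x X Y : GrSpace n₁ n₂) :
    wedge (grZ₁ i x) (conjForm (grZ₁ i) x) X Y
      = -(Complex.I / 2) * wedge (grViel i (Sum.inl 0) x) (grViel i (Sum.inl 1) x) X Y := by
  have h2 : (starRingEnd ℂ) (2 : ℂ) = 2 := map_ofNat _ 2
  simp only [wedge, conjForm_apply, grZ₁_apply, map_add, map_mul, map_div₀, h2, conj_grViel,
    Complex.conj_I]
  ring

theorem wedge_grZ₂_grZ₂ (i : Fin n₁ ⊕ Fin n₂) (x X Y : GrSpace n₁ n₂) :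
    wedge (grZ₂ i x) (conjForm (grZ₂ i) x) X Y
      = -(Complex.I / 2) * wedge (grViel i (Sum.inr 0) x) (grViel i (Sum.inr 1) x) X Y := by
  have h2 : (starRingEnd ℂ) (2 : ℂ) = 2 := map_ofNat _ 2
  simp only [wedge, conjForm_apply, grZ₂_apply, map_add, map_mul, map_div₀, h2, conj_grViel,
    Complex.conj_I]
  ring

theorem wedge_grZ₁_grZ₂ (i : Fin n₁ ⊕ Fin n₂) (x X Y : GrSpace n₁ n₂) :
    4 * Complex.I * wedge (grZ₁ i x) (conjForm (grZ₂ i) x) X Y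
      = Complex.I * (wedge (grViel i (Sum.inl 0) x) (grViel i (Sum.inr 0) x) X Y
          + wedge (grViel i (Sum.inl 1) x) (grViel i (Sum.inr 1) x) X Y)
        + (wedge (grViel i (Sum.inl 0) x) (grViel i (Sum.inr 1) x) X Y
          - wedge (grViel i (Sum.inl 1) x) (grViel i (Sum.inr 0) x) X Y) := by
  have h2 : (starRingEnd ℂ) (2 : ℂ) = 2 := map_ofNat _ 2
  simp only [wedge, conjForm_apply, grZ₁_apply, grZ₂_apply, map_add, map_mul, map_div₀, h2,
    conj_grViel, Complex.conj_I]
  ring_nf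
  simp only [Complex.I_sq, Complex.I_pow_three]
  ring

/-- The change from (Z₁, Z₂) to (-Z̄₂, Z̄₁) only exchanges dotted and undotted components, so the
SU(2)-triplet of two-forms is the same for every splitting of n. -/
theorem wedge_grTheta₁_grTheta₂ (I : Fin n₁ ⊕ Fin n₂) (x X Y : GrSpace n₁ n₂) :
    wedge (grTheta₁ I x) (conjForm (grTheta₂ I) x) X Y
      = wedge (grZ₁ I x) (conjForm (grZ₂ I) x) X Y := by
  rcases I with i | i
  · rfl
  · simp only [wedge, conjForm_apply, grTheta₁_inr, grTheta₂_inr, Complex.conj_conj]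
    ring

theorem wedge_grTheta_sub (I : Fin n₁ ⊕ Fin n₂) (x X Y : GrSpace n₁ n₂) :
    wedge (grTheta₁ I x) (conjForm (grTheta₁ I) x) X Y
        - wedge (grTheta₂ I x) (conjForm (grTheta₂ I) x) X Y
      = wedge (grZ₁ I x) (conjForm (grZ₁ I) x) X Y
        - wedge (grZ₂ I x) (conjForm (grZ₂ I) x) X Y := by
  rcases I with i | i
  · rfl
  · simp only [wedge, conjForm_apply, grTheta₁_inr, grTheta₂_inr, map_neg, Complex.conj_conj]
    ring

theorem gr_curvature₃ (x X Y : GrSpace n₁ n₂) :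
    ((extD (grOm 2) x X Y : ℝ) : ℂ)
      + wedge (fun Z => (grOm 0 x Z : ℂ)) (fun Z => (grOm 1 x Z : ℂ)) X Y
      = 2 * Complex.I * ∑ I, (wedge (grTheta₁ I x) (conjForm (grTheta₁ I) x) X Y
        - wedge (grTheta₂ I x) (conjForm (grTheta₂ I) x) X Y) := by
  have hd : ∀ a b, DifferentiableAt ℝ (grConn a b) x := fun a b =>
    (contDiff_grConn a b).differentiable (by simp) x
  have e0 : ((extD (grOm 2) x X Y : ℝ) : ℂ)
      = extD (grConn (Sum.inr 0) (Sum.inr 1)) x X Y - extD (grConn (Sum.inl 0) (Sum.inl 1)) x X Y := by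
    rw [← Complex.ofRealCLM_apply, ← extD_clm_comp Complex.ofRealCLM
      ((contDiff_grOm 2).differentiable (by simp) x), ← extD_sub (hd _ _) (hd _ _)]
    congr 1
    refine funext fun q => ContinuousLinearMap.ext fun X => ?_
    exact grOm_two q X
  have es : 2 * Complex.I * ∑ I, (wedge (grTheta₁ I x) (conjForm (grTheta₁ I) x) X Y
        - wedge (grTheta₂ I x) (conjForm (grTheta₂ I) x) X Y)
      = ∑ i, wedge (grViel i (Sum.inl 0) x) (grViel i (Sum.inl 1) x) X Y
        - ∑ i, wedge (grViel i (Sum.inr 0) x) (grViel i (Sum.inr 1) x) X Y := by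
    rw [Finset.mul_sum, ← Finset.sum_sub_distrib]
    refine Finset.sum_congr rfl fun i _ => ?_
    rw [wedge_grTheta_sub, wedge_grZ₁_grZ₁, wedge_grZ₂_grZ₂]
    ring_nf
    simp only [Complex.I_sq]
    ring
  rw [e0, es, extD_grConn, extD_grConn]
  generalize ∑ i, wedge (grViel i (Sum.inl 0) x) (grViel i (Sum.inl 1) x) X Y = S₀
  generalize ∑ i, wedge (grViel i (Sum.inr 0) x) (grViel i (Sum.inr 1) x) X Y = S₁
  simp only [Fintype.sum_sum_type, Fin.sum_univ_two, wedge, grOm_zero, grOm_one, grConn_self,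
    grConn_swap (Sum.inl 0) (Sum.inr 0),
    grConn_swap (Sum.inl 1) (Sum.inr 0),
    grConn_swap (Sum.inl 1) (Sum.inr 1)]
  ring

theorem gr_curvature_plus (x X Y : GrSpace n₁ n₂) :
    extD (omPlus grOm) x X Y
      + Complex.I * wedge (fun Z => (grOm 2 x Z : ℂ)) (omPlus grOm x) X Y
      = 4 * Complex.I * ∑ I, wedge (grTheta₁ I x) (conjForm (grTheta₂ I) x) X Y := by
  have hd : ∀ a b, DifferentiableAt ℝ (grConn a b) x := fun a b =>
    (contDiff_grConn a b).differentiable (by simp) x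
  have e0 : extD (omPlus (grOm (n₁ := n₁) (n₂ := n₂))) x X Y
      = extD (grConn (Sum.inl 1) (Sum.inr 0)) x X Y - extD (grConn (Sum.inl 0) (Sum.inr 1)) x X Y
        - Complex.I * (extD (grConn (Sum.inl 0) (Sum.inr 0)) x X Y
          + extD (grConn (Sum.inl 1) (Sum.inr 1)) x X Y) := by
    rw [← extD_add (hd _ _) (hd _ _), ← extD_sub (hd _ _) (hd _ _),
      ← extD_const_smul _ ((hd _ _).fun_add (hd _ _)),
      ← extD_sub ((hd _ _).fun_sub (hd _ _)) (((hd _ _).fun_add (hd _ _)).fun_const_smul _)]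
    congr 1
    refine funext fun q => ContinuousLinearMap.ext fun X => ?_
    exact omPlus_grOm q X
  simp only [wedge_grTheta₁_grTheta₂]
  rw [Finset.mul_sum]
  simp only [wedge_grZ₁_grZ₂, Finset.sum_add_distrib, Finset.sum_sub_distrib, ← Finset.mul_sum]
  rw [e0, extD_grConn, extD_grConn, extD_grConn, extD_grConn]
  generalize ∑ i, wedge (grViel i (Sum.inl 0) x) (grViel i (Sum.inr 0) x) X Y = S₀
  generalize ∑ i, wedge (grViel i (Sum.inl 0) x) (grViel i (Sum.inr 1) x) X Y = S₁
  generalize ∑ i, wedge (grViel i (Sum.inl 1) x) (grViel i (Sum.inr 0) x) X Y = S₂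
  generalize ∑ i, wedge (grViel i (Sum.inl 1) x) (grViel i (Sum.inr 1) x) X Y = S₃
  simp only [Fintype.sum_sum_type, Fin.sum_univ_two, wedge, grOm_two, omPlus_grOm, grConn_self,
    grConn_swap (Sum.inl 0) (Sum.inl 1), grConn_swap (Sum.inr 0) (Sum.inr 1)]
  ring_nf
  simp only [Complex.I_sq]
  ring

theorem grViel_eq_zero_of_grZ₁ {i : Fin n₁ ⊕ Fin n₂} {x X : GrSpace n₁ n₂} (h : grZ₁ i x X = 0)
    (a : Fin 2) : grViel i (Sum.inl a) x X = 0 := by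
  have h2 : (starRingEnd ℂ) (2 : ℂ) = 2 := map_ofNat _ 2
  have hc : (starRingEnd ℂ) (grZ₁ i x X) = 0 := by rw [h, map_zero]
  rw [grZ₁_apply] at h hc
  simp only [map_add, map_mul, map_div₀, h2, conj_grViel, Complex.conj_I] at hc
  fin_cases a
  · change grViel i (Sum.inl 0) x X = 0
    linear_combination h + hc
  · change grViel i (Sum.inl 1) x X = 0
    linear_combination -Complex.I * (h - hc)
      + grViel i (Sum.inl 1) x X * (Complex.I_mul_I)

theorem grViel_eq_zero_of_grZ₂ {i : Fin n₁ ⊕ Fin n₂} {x X : GrSpace n₁ n₂} (h : grZ₂ i x X = 0)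
    (a : Fin 2) : grViel i (Sum.inr a) x X = 0 := by
  have h2 : (starRingEnd ℂ) (2 : ℂ) = 2 := map_ofNat _ 2
  have hc : (starRingEnd ℂ) (grZ₂ i x X) = 0 := by rw [h, map_zero]
  rw [grZ₂_apply] at h hc
  simp only [map_add, map_mul, map_div₀, h2, conj_grViel, Complex.conj_I] at hc
  fin_cases a
  · change grViel i (Sum.inr 0) x X = 0
    linear_combination h + hc
  · change grViel i (Sum.inr 1) x X = 0
    linear_combination -Complex.I * (h - hc)
      + grViel i (Sum.inr 1) x X * (Complex.I_mul_I)

theorem gr_coframe {x X : GrSpace n₁ n₂} (h₁ : ∀ I, grTheta₁ I x X = 0)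
    (h₂ : ∀ I, grTheta₂ I x X = 0) : X = 0 := by
  have hZ₁ : ∀ I, grZ₁ I x X = 0 := by
    rintro (i | i)
    · exact h₁ (Sum.inl i)
    · simpa [grTheta₂_inr] using h₂ (Sum.inr i)
  have hZ₂ : ∀ I, grZ₂ I x X = 0 := by
    rintro (i | i)
    · exact h₂ (Sum.inl i)
    · simpa [grTheta₁_inr] using h₁ (Sum.inr i)
  refine eq_zero_of_cosetForm (x := x) fun i a => Complex.ofReal_eq_zero.1 ?_
  change grViel i a x X = 0
  rcases a with a | a
  · exact grViel_eq_zero_of_grZ₁ (hZ₁ i) a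
  · exact grViel_eq_zero_of_grZ₂ (hZ₂ i) a

theorem finrank_grSpace :
    Module.finrank ℝ (GrSpace n₁ n₂) = 4 * Fintype.card (Fin n₁ ⊕ Fin n₂) := by
  simp [GrSpace, Module.finrank_pi_fintype]
  ring

theorem gr_isTorsionFree : IsTorsionFree Set.univ (grVielbein n₁ n₂) grOm (spConn grA grB) := by
  refine isTorsionFree_of_blocks isOpen_univ finrank_grSpace
    (fun I => (contDiff_grTheta₁ I).contDiffOn) (fun I => (contDiff_grTheta₂ I).contDiffOn)
    (fun k => (contDiff_grOm k).contDiffOn) (fun I J => (contDiff_grA I J).contDiffOn)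
    (fun I J => (contDiff_grB I J).contDiffOn) (fun x _ X h₁ h₂ => gr_coframe h₁ h₂) ?_ ?_
    (fun x _ I X Y => gr_torsion₁ I x X Y) (fun x _ I X Y => gr_torsion₂ I x X Y)
    (fun x _ X Y => gr_curvature₃ x X Y) (fun x _ X Y => gr_curvature_plus x X Y)
  · have h2 : (starRingEnd ℂ) (2 : ℂ) = 2 := map_ofNat _ 2
    rintro x _ (i | i) (j | j) X
    · simp only [grA_inl_inl, map_sub, map_mul, apply_ite (starRingEnd ℂ), map_div₀, Complex.conj_I,
        h2, map_zero, conj_grRot, conj_grAlpha, eq_comm (a := j),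
        grRot_swap (Sum.inl i) (Sum.inl j)]
      split_ifs <;> ring
    · simp [grA_inl_inr, grA_inr_inl]
    · simp [grA_inl_inr, grA_inr_inl]
    · simp only [grA_inr_inr, map_add, map_mul, apply_ite (starRingEnd ℂ), map_div₀, Complex.conj_I,
        h2, map_zero, conj_grRot, conj_grAlpha, eq_comm (a := j),
        grRot_swap (Sum.inr i) (Sum.inr j)]
      split_ifs <;> ring
  · rintro x _ (i | i) (j | j) X
    · simp only [grB_inl_inl, eq_comm]
    · exact (grRot_swap _ _ x X).symm
    · exact grRot_swap _ _ x X
    · simp only [grB_inr_inr, eq_comm]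

theorem gr_metric_eq (x X Y : GrSpace n₁ n₂) : hypMetric (grVielbein n₁ n₂) x X Y
    = cosetMetric (Fin 2 ⊕ Fin 2) (Fin n₁ ⊕ Fin n₂) x X Y := by
  have h₁ : ∀ i, (grZ₁ i x X * (starRingEnd ℂ) (grZ₁ i x Y)).re
      = 1 / 4 * (cosetForm i (Sum.inl 0) x X * cosetForm i (Sum.inl 0) x Y
        + cosetForm i (Sum.inl 1) x X * cosetForm i (Sum.inl 1) x Y) := fun i => by
    simp [grZ₁]
    ring
  have h₂ : ∀ i, (grZ₂ i x X * (starRingEnd ℂ) (grZ₂ i x Y)).re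
      = 1 / 4 * (cosetForm i (Sum.inr 0) x X * cosetForm i (Sum.inr 0) x Y
        + cosetForm i (Sum.inr 1) x X * cosetForm i (Sum.inr 1) x Y) := fun i => by
    simp [grZ₂]
    ring
  have h : ∀ I, (grTheta₁ I x X * (starRingEnd ℂ) (grTheta₁ I x Y)
      + grTheta₂ I x X * (starRingEnd ℂ) (grTheta₂ I x Y)).re
      = (grZ₁ I x X * (starRingEnd ℂ) (grZ₁ I x Y)).re
        + (grZ₂ I x X * (starRingEnd ℂ) (grZ₂ I x Y)).re := by
    rintro (i | i)
    · rfl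
    · simp only [grTheta₁_inr, grTheta₂_inr, Complex.add_re, Complex.mul_re, map_neg,
        Complex.neg_re, Complex.neg_im, Complex.conj_re, Complex.conj_im]
      ring
  rw [grVielbein, hypMetric_vielbeinOf, cosetMetric, Finset.mul_sum, Finset.mul_sum]
  refine Finset.sum_congr rfl fun i _ => ?_
  rw [h, h₁, h₂, Fintype.sum_sum_type, Fin.sum_univ_two, Fin.sum_univ_two]
  ring

/-- The curvature of the off-diagonal generator of the commuting su(2). Its vielbein terms pair one
of the first two SO(4)-directions with one of the last two, which is what makes it vanish on U^{2I}
= 0. -/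
theorem extD_grBeta (x X Y : GrSpace n₁ n₂) : extD (grBeta (n₁ := n₁) (n₂ := n₂)) x X Y
    = Complex.I * wedge (grAlpha x) (grBeta x) X Y
      - (∑ i, wedge (grViel i (Sum.inl 0) x) (grViel i (Sum.inr 0) x) X Y
        - ∑ i, wedge (grViel i (Sum.inl 1) x) (grViel i (Sum.inr 1) x) X Y
        + Complex.I * (∑ i, wedge (grViel i (Sum.inl 1) x) (grViel i (Sum.inr 0) x) X Y
          + ∑ i, wedge (grViel i (Sum.inl 0) x) (grViel i (Sum.inr 1) x) X Y)) := by
  have hd : ∀ a b, DifferentiableAt ℝ (grConn a b) x := fun a b =>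
    (contDiff_grConn a b).differentiable (by simp) x
  have e0 : extD (grBeta (n₁ := n₁) (n₂ := n₂)) x X Y
      = extD (grConn (Sum.inl 0) (Sum.inr 0)) x X Y - extD (grConn (Sum.inl 1) (Sum.inr 1)) x X Y
        + Complex.I * (extD (grConn (Sum.inl 1) (Sum.inr 0)) x X Y
          + extD (grConn (Sum.inl 0) (Sum.inr 1)) x X Y) := by
    rw [← extD_add (hd _ _) (hd _ _), ← extD_sub (hd _ _) (hd _ _),
      ← extD_const_smul _ ((hd _ _).fun_add (hd _ _)),
      ← extD_add ((hd _ _).fun_sub (hd _ _)) (((hd _ _).fun_add (hd _ _)).fun_const_smul _)]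
    rfl
  rw [e0, extD_grConn, extD_grConn, extD_grConn, extD_grConn]
  generalize ∑ i, wedge (grViel i (Sum.inl 0) x) (grViel i (Sum.inr 0) x) X Y = S₀
  generalize ∑ i, wedge (grViel i (Sum.inl 0) x) (grViel i (Sum.inr 1) x) X Y = S₁
  generalize ∑ i, wedge (grViel i (Sum.inl 1) x) (grViel i (Sum.inr 0) x) X Y = S₂
  generalize ∑ i, wedge (grViel i (Sum.inl 1) x) (grViel i (Sum.inr 1) x) X Y = S₃
  simp only [Fintype.sum_sum_type, Fin.sum_univ_two, wedge, grAlpha_apply, grBeta_apply,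
    grConn_self,
    grConn_swap (Sum.inl 0) (Sum.inl 1), grConn_swap (Sum.inr 0) (Sum.inr 1)]
  ring_nf
  simp only [Complex.I_sq]
  ring

end GrassmannianCurvature

/-! ### Vanishing of the mixed Sp-curvature of the Grassmannian. -/

section GrassmannianWeyl

variable {n₁ n₂ : ℕ}

theorem gr_spCurv_eq (I J : Fin n₁ ⊕ Fin n₂) (x X Y : GrSpace n₁ n₂) :
    spCurv (spConn grA grB) (Sum.inl I) (Sum.inr J) x X Y = extD (grB I J) x X Y
      + (∑ K, wedge (grA I K x) (grB K J x) X Y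
        + ∑ K, wedge (grB I K x) (conjForm (grA K J) x) X Y) := by
  rw [spCurv, Fintype.sum_sum_type]
  rfl

/-- On the plane U^{2I} = 0 the vielbein is block-diagonal. In equal blocks the curvature is that of
β or its conjugate; in unequal blocks it is that of the mixed SO(n)-rotations. Both contain only
products with a vanishing factor. -/
theorem gr_spCurv_eq_zero {x X Y : GrSpace n₁ n₂} (hX : ∀ I, grTheta₂ I x X = 0)
    (hY : ∀ I, grTheta₂ I x Y = 0) (I J : Fin n₁ ⊕ Fin n₂) :
    spCurv (spConn grA grB) (Sum.inl I) (Sum.inr J) x X Y = 0 := by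
  have hl : ∀ Z, (∀ I, grTheta₂ I x Z = 0) → ∀ i a, grViel (Sum.inl i) (Sum.inr a) x Z = 0 :=
    fun Z hZ i a => grViel_eq_zero_of_grZ₂ (hZ (Sum.inl i)) a
  have hr : ∀ Z, (∀ I, grTheta₂ I x Z = 0) → ∀ i a, grViel (Sum.inr i) (Sum.inl a) x Z = 0 :=
    fun Z hZ i a => grViel_eq_zero_of_grZ₁ (by simpa [grTheta₂_inr] using hZ (Sum.inr i)) a
  have hw : ∀ i a b, wedge (grViel i (Sum.inl a) x) (grViel i (Sum.inr b) x) X Y = 0 := by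
    rintro (i | i) a b
    · simp [wedge, hl X hX, hl Y hY]
    · simp [wedge, hr X hX, hr Y hY]
  have hβ : extD (grBeta (n₁ := n₁) (n₂ := n₂)) x X Y
      = Complex.I * wedge (grAlpha x) (grBeta x) X Y := by
    rw [extD_grBeta]
    simp [hw]
  have dβ : DifferentiableAt ℝ (grBeta (n₁ := n₁) (n₂ := n₂)) x :=
    contDiff_grBeta.differentiable (by simp) x
  have h2 : (starRingEnd ℂ) (2 : ℂ) = 2 := map_ofNat _ 2
  rw [gr_spCurv_eq, Fintype.sum_sum_type, Fintype.sum_sum_type]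
  rcases I with i | i <;> rcases J with j | j
  · have e0 : extD (grB (Sum.inl i) (Sum.inl j)) x X Y
        = (if i = j then -1 / 2 else 0) * extD (grBeta (n₁ := n₁) (n₂ := n₂)) x X Y :=
      extD_const_smul _ dβ X Y
    have e1 : ∀ k, wedge (grA (Sum.inl i) (Sum.inl k) x) (grB (Sum.inl k) (Sum.inl j) x) X Y
        = (if k = j then -1 / 2 * wedge (grRot (Sum.inl i) (Sum.inl k) x) (grBeta x) X Y else 0)
          + if i = k then (if k = j then Complex.I / 4 * wedge (grAlpha x) (grBeta x) X Y else 0)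
            else 0 := fun k => by
      simp only [wedge, grA_inl_inl, grB_inl_inl]
      split_ifs <;> ring
    have e2 : ∀ k, wedge (grB (Sum.inl i) (Sum.inl k) x) (conjForm (grA (Sum.inl k) (Sum.inl j)) x)
        X Y = if i = k then -1 / 2 * wedge (grBeta x) (grRot (Sum.inl k) (Sum.inl j) x) X Y
          + (if k = j then Complex.I / 4 * wedge (grAlpha x) (grBeta x) X Y else 0)
            else 0 := fun k => by
      simp only [wedge, conjForm_apply, grA_inl_inl, grB_inl_inl, map_sub, map_mul, conj_grRot,
        conj_grAlpha, apply_ite (starRingEnd ℂ), map_div₀, Complex.conj_I, h2, map_zero]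
      split_ifs <;> ring
    have e3 : ∀ k, wedge (grA (Sum.inl i) (Sum.inr k) x) (grB (Sum.inr k) (Sum.inl j) x) X Y = 0 :=
      fun k => by simp [wedge, grA_inl_inr]
    have e4 : ∀ k, wedge (grB (Sum.inl i) (Sum.inr k) x) (conjForm (grA (Sum.inr k) (Sum.inl j)) x)
        X Y = 0 := fun k => by simp [wedge, conjForm_apply, grA_inr_inl]
    simp only [e0, hβ, e1, e2, e3, e4, Finset.sum_add_distrib, Finset.sum_ite_eq,
      Finset.sum_ite_eq', Finset.mem_univ, if_true, Finset.sum_const_zero]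
    simp only [wedge]
    split_ifs <;> ring
  · have e0 : extD (grB (Sum.inl i) (Sum.inr j)) x X Y
        = -extD (grRot (Sum.inl i) (Sum.inr j)) x X Y := by
      simp only [extD]
      rw [show grB (Sum.inl i) (Sum.inr j) = -grRot (Sum.inl i) (Sum.inr j) from rfl, fderiv_neg]
      simp only [neg_apply]
      ring
    have e1 : ∀ k, wedge (grA (Sum.inl i) (Sum.inl k) x) (grB (Sum.inl k) (Sum.inr j) x) X Y
        = -wedge (grRot (Sum.inl i) (Sum.inl k) x) (grRot (Sum.inl k) (Sum.inr j) x) X Y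
          + if i = k then Complex.I / 2 * wedge (grAlpha x) (grRot (Sum.inl k) (Sum.inr j) x) X Y
            else 0 := fun k => by
      simp only [wedge, grA_inl_inl, grB_inl_inr]
      split_ifs <;> ring
    have e2 : ∀ k, wedge (grB (Sum.inl i) (Sum.inr k) x) (conjForm (grA (Sum.inr k) (Sum.inr j)) x)
        X Y = -wedge (grRot (Sum.inl i) (Sum.inr k) x) (grRot (Sum.inr k) (Sum.inr j) x) X Y
          + if k = j then Complex.I / 2 * wedge (grRot (Sum.inl i) (Sum.inr k) x) (grAlpha x) X Y
            else 0 := fun k => by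
      simp only [wedge, conjForm_apply, grA_inr_inr, grB_inl_inr, map_add, map_mul, conj_grRot,
        conj_grAlpha, apply_ite (starRingEnd ℂ), map_div₀, Complex.conj_I, h2, map_zero]
      split_ifs <;> ring
    have e3 : ∀ k, wedge (grA (Sum.inl i) (Sum.inr k) x) (grB (Sum.inr k) (Sum.inr j) x) X Y = 0 :=
      fun k => by simp [wedge, grA_inl_inr]
    have e4 : ∀ k, wedge (grB (Sum.inl i) (Sum.inl k) x) (conjForm (grA (Sum.inl k) (Sum.inr j)) x)
        X Y = 0 := fun k => by simp [wedge, conjForm_apply, grA_inl_inr]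
    have e5 : ∑ a, wedge (grViel (Sum.inl i) a x) (grViel (Sum.inr j) a x) X Y = 0 := by
      rw [Fintype.sum_sum_type]
      simp [wedge, hl X hX, hl Y hY, hr X hX, hr Y hY]
    rw [e0, extD_grRot, e5, Fintype.sum_sum_type]
    simp only [e1, e2, e3, e4, Finset.sum_add_distrib, Finset.sum_ite_eq, Finset.sum_neg_distrib,
      Finset.sum_ite_eq', Finset.mem_univ, if_true, Finset.sum_const_zero]
    simp only [wedge]
    ring
  · have e1 : ∀ k, wedge (grA (Sum.inr i) (Sum.inr k) x) (grB (Sum.inr k) (Sum.inl j) x) X Y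
        = wedge (grRot (Sum.inr i) (Sum.inr k) x) (grRot (Sum.inr k) (Sum.inl j) x) X Y
          + if i = k then Complex.I / 2 * wedge (grAlpha x) (grRot (Sum.inr k) (Sum.inl j) x) X Y
            else 0 := fun k => by
      simp only [wedge, grA_inr_inr, grB_inr_inl]
      split_ifs <;> ring
    have e2 : ∀ k, wedge (grB (Sum.inr i) (Sum.inl k) x) (conjForm (grA (Sum.inl k) (Sum.inl j)) x)
        X Y = wedge (grRot (Sum.inr i) (Sum.inl k) x) (grRot (Sum.inl k) (Sum.inl j) x) X Y
          + if k = j then Complex.I / 2 * wedge (grRot (Sum.inr i) (Sum.inl k) x) (grAlpha x) X Y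
            else 0 := fun k => by
      simp only [wedge, conjForm_apply, grA_inl_inl, grB_inr_inl, map_sub, map_mul, conj_grRot,
        conj_grAlpha, apply_ite (starRingEnd ℂ), map_div₀, Complex.conj_I, h2, map_zero]
      split_ifs <;> ring
    have e3 : ∀ k, wedge (grA (Sum.inr i) (Sum.inl k) x) (grB (Sum.inl k) (Sum.inl j) x) X Y = 0 :=
      fun k => by simp [wedge, grA_inr_inl]
    have e4 : ∀ k, wedge (grB (Sum.inr i) (Sum.inr k) x) (conjForm (grA (Sum.inr k) (Sum.inl j)) x)
        X Y = 0 := fun k => by simp [wedge, conjForm_apply, grA_inr_inl]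
    have e5 : ∑ a, wedge (grViel (Sum.inr i) a x) (grViel (Sum.inl j) a x) X Y = 0 := by
      rw [Fintype.sum_sum_type]
      simp [wedge, hl X hX, hl Y hY, hr X hX, hr Y hY]
    rw [show grB (Sum.inr i) (Sum.inl j) = grRot (Sum.inr i) (Sum.inl j) from rfl, extD_grRot, e5,
      Fintype.sum_sum_type]
    simp only [e1, e2, e3, e4, Finset.sum_add_distrib, Finset.sum_ite_eq,
      Finset.sum_ite_eq', Finset.mem_univ, if_true, Finset.sum_const_zero]
    simp only [wedge]
    ring
  · have dc : DifferentiableAt ℝ (conjForm (grBeta (n₁ := n₁) (n₂ := n₂))) x :=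
      (contDiff_conjForm contDiff_grBeta).differentiable (by simp) x
    have e0 : extD (grB (Sum.inr i) (Sum.inr j)) x X Y = (if i = j then -1 / 2 else 0)
        * (starRingEnd ℂ) (extD (grBeta (n₁ := n₁) (n₂ := n₂)) x X Y) := by
      rw [← extD_conjForm dβ]
      exact extD_const_smul _ dc X Y
    have e1 : ∀ k, wedge (grA (Sum.inr i) (Sum.inr k) x) (grB (Sum.inr k) (Sum.inr j) x) X Y
        = (if k = j then -1 / 2 * wedge (grRot (Sum.inr i) (Sum.inr k) x) (conjForm grBeta x) X Y
            else 0)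
          + if i = k then (if k = j then -(Complex.I / 4) *
              wedge (grAlpha x) (conjForm grBeta x) X Y else 0) else 0 := fun k => by
      simp only [wedge, conjForm_apply, grA_inr_inr, grB_inr_inr]
      split_ifs <;> ring
    have e2 : ∀ k, wedge (grB (Sum.inr i) (Sum.inr k) x) (conjForm (grA (Sum.inr k) (Sum.inr j)) x)
        X Y = if i = k then -1 / 2 * wedge (conjForm grBeta x) (grRot (Sum.inr k) (Sum.inr j) x) X Y
          + (if k = j then -(Complex.I / 4) * wedge (grAlpha x) (conjForm grBeta x) X Y else 0)
            else 0 := fun k => by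
      simp only [wedge, conjForm_apply, grA_inr_inr, grB_inr_inr, map_add, map_mul, conj_grRot,
        conj_grAlpha, apply_ite (starRingEnd ℂ), map_div₀, Complex.conj_I, h2, map_zero]
      split_ifs <;> ring
    have e3 : ∀ k, wedge (grA (Sum.inr i) (Sum.inl k) x) (grB (Sum.inl k) (Sum.inr j) x) X Y = 0 :=
      fun k => by simp [wedge, grA_inr_inl]
    have e4 : ∀ k, wedge (grB (Sum.inr i) (Sum.inl k) x) (conjForm (grA (Sum.inl k) (Sum.inr j)) x)
        X Y = 0 := fun k => by simp [wedge, conjForm_apply, grA_inl_inr]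
    simp only [e0, hβ, e1, e2, e3, e4, Finset.sum_add_distrib, Finset.sum_ite_eq,
      Finset.sum_ite_eq', Finset.mem_univ, if_true, Finset.sum_const_zero]
    simp only [wedge, conjForm_apply, map_mul, map_sub, Complex.conj_I, conj_grAlpha]
    split_ifs <;> ring

end GrassmannianWeyl

/-! ### The block-diagonal submanifold. -/

section BlockExp

attribute [local instance] Matrix.linftyOpNormedAddCommGroup Matrix.linftyOpNormedSpace
  Matrix.linftyOpNormedRing Matrix.linftyOpNormedAlgebra

variable {μ ν ρ : Type*} [Fintype μ] [DecidableEq μ] [Fintype ν] [DecidableEq ν] [Fintype ρ]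
  [DecidableEq ρ]

/-- The inclusion of block-diagonal matrices, as a ring homomorphism. -/
def blockHom (e : μ ⊕ ν ≃ ρ) : Matrix μ μ ℝ × Matrix ν ν ℝ →+* Matrix ρ ρ ℝ where
  toFun p := (Matrix.fromBlocks p.1 0 0 p.2).submatrix e.symm e.symm
  map_one' := by simp
  map_mul' p q := by
    rw [Matrix.submatrix_mul_equiv, Matrix.fromBlocks_multiply]
    simp
  map_zero' := by simp
  map_add' p q := by
    ext i j
    rw [Matrix.add_apply, Matrix.submatrix_apply, Matrix.submatrix_apply, Matrix.submatrix_apply,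
      ← Matrix.add_apply, Matrix.fromBlocks_add, add_zero, add_zero]
    rfl

/-- A continuous ring homomorphism commutes with exp, and exp in a product ring is componentwise. -/
theorem exp_blockHom (e : μ ⊕ ν ≃ ρ) (A : Matrix μ μ ℝ) (B : Matrix ν ν ℝ) :
    NormedSpace.exp (blockHom e (A, B)) = blockHom e (NormedSpace.exp A, NormedSpace.exp B) := by
  have hc : Continuous (blockHom e) :=
    (Continuous.matrix_fromBlocks continuous_fst continuous_const continuous_const
      continuous_snd).matrix_submatrix _ _
  refine (NormedSpace.map_exp (blockHom e) hc (A, B)).symm.trans (congrArg _ ?_)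
  exact Prod.ext (Prod.fst_exp _) (Prod.snd_exp _)

end BlockExp

section GrassmannianSub

variable {n₁ n₂ : ℕ}

/-- The splitting of the indices of `SO(4, n)` into those of `SO(2, n₁)` and `SO(2, n₂)`. -/
def grIdx : (Fin 2 ⊕ Fin n₁) ⊕ (Fin 2 ⊕ Fin n₂) ≃ (Fin 2 ⊕ Fin 2) ⊕ (Fin n₁ ⊕ Fin n₂) :=
  Equiv.sumSumSumComm (Fin 2) (Fin n₁) (Fin 2) (Fin n₂)

theorem cosetGen_grSub (y : (Fin n₁ → Fin 2 → ℝ) × (Fin n₂ → Fin 2 → ℝ)) :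
    cosetGen (grSub y) = blockHom grIdx (cosetGen y.1, cosetGen y.2) := by
  ext ((i | i) | (i | i)) ((j | j) | (j | j)) <;> rfl

theorem cosetRep_grSub (y : (Fin n₁ → Fin 2 → ℝ) × (Fin n₂ → Fin 2 → ℝ)) :
    cosetRep (grSub y) = blockHom grIdx (cosetRep y.1, cosetRep y.2) := by
  rw [cosetRep_eq, cosetGen_grSub, exp_blockHom]
  rfl

theorem cosetRep_grSub_inl_inl (y : (Fin n₁ → Fin 2 → ℝ) × (Fin n₂ → Fin 2 → ℝ))
    (s t : Fin 2 ⊕ Fin n₁) :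
    cosetRep (grSub y) (grIdx (Sum.inl s)) (grIdx (Sum.inl t)) = cosetRep y.1 s t := by
  simp [cosetRep_grSub, blockHom]

theorem cosetRep_grSub_inr_inr (y : (Fin n₁ → Fin 2 → ℝ) × (Fin n₂ → Fin 2 → ℝ))
    (s t : Fin 2 ⊕ Fin n₂) :
    cosetRep (grSub y) (grIdx (Sum.inr s)) (grIdx (Sum.inr t)) = cosetRep y.2 s t := by
  simp [cosetRep_grSub, blockHom]

theorem cosetRep_grSub_inl_inr (y : (Fin n₁ → Fin 2 → ℝ) × (Fin n₂ → Fin 2 → ℝ))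
    (s : Fin 2 ⊕ Fin n₁) (t : Fin 2 ⊕ Fin n₂) :
    cosetRep (grSub y) (grIdx (Sum.inl s)) (grIdx (Sum.inr t)) = 0 := by
  simp [cosetRep_grSub, blockHom]

theorem cosetRep_grSub_inr_inl (y : (Fin n₁ → Fin 2 → ℝ) × (Fin n₂ → Fin 2 → ℝ))
    (s : Fin 2 ⊕ Fin n₂) (t : Fin 2 ⊕ Fin n₁) :
    cosetRep (grSub y) (grIdx (Sum.inr s)) (grIdx (Sum.inl t)) = 0 := by
  simp [cosetRep_grSub, blockHom]

theorem sgn_grIdx_inl (s : Fin 2 ⊕ Fin n₁) :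
    sgn (grIdx (n₂ := n₂) (Sum.inl s)) = sgn s := by
  rcases s with s | s <;> rfl

theorem sgn_grIdx_inr (s : Fin 2 ⊕ Fin n₂) :
    sgn (grIdx (n₁ := n₁) (Sum.inr s)) = sgn s := by
  rcases s with s | s <;> rfl

/-- The block-diagonal embedding as a continuous linear map. -/
def grSubL : ((Fin n₁ → Fin 2 → ℝ) × (Fin n₂ → Fin 2 → ℝ)) →L[ℝ] GrSpace n₁ n₂ :=
  LinearMap.toContinuousLinearMap
    { toFun := grSub
      map_add' := fun x y => by
        ext (i | i) (j | j)
        exacts [rfl, (add_zero (0 : ℝ)).symm, (add_zero (0 : ℝ)).symm, rfl]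
      map_smul' := fun c x => by
        ext (i | i) (j | j)
        exacts [rfl, (mul_zero c).symm, (mul_zero c).symm, rfl] }

theorem fderiv_grSub (y : (Fin n₁ → Fin 2 → ℝ) × (Fin n₂ → Fin 2 → ℝ)) :
    fderiv ℝ (grSub (n₁ := n₁) (n₂ := n₂)) y = grSubL :=
  grSubL.hasFDerivAt.fderiv

theorem contDiff_grSub : ContDiff ℝ ∞ (grSub (n₁ := n₁) (n₂ := n₂)) := grSubL.contDiff

theorem fderiv_cosetRep_grSub (s t : (Fin 2 ⊕ Fin 2) ⊕ (Fin n₁ ⊕ Fin n₂))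
    (y X : (Fin n₁ → Fin 2 → ℝ) × (Fin n₂ → Fin 2 → ℝ)) :
    fderiv ℝ (fun x => cosetRep x s t) (grSub y) (grSubL X)
      = fderiv ℝ (fun y => cosetRep (grSub y) s t) y X := by
  have h := (hasFDerivAt_cosetRep s t (grSub y)).comp y
    (grSubL (n₁ := n₁) (n₂ := n₂)).hasFDerivAt
  exact (DFunLike.congr_fun h.fderiv X).symm

theorem fderiv_cosetRep_fst (s t : Fin 2 ⊕ Fin n₁)
    (y X : (Fin n₁ → Fin 2 → ℝ) × (Fin n₂ → Fin 2 → ℝ)) :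
    fderiv ℝ (fun y : (Fin n₁ → Fin 2 → ℝ) × (Fin n₂ → Fin 2 → ℝ) => cosetRep y.1 s t) y X
      = fderiv ℝ (fun x => cosetRep x s t) y.1 X.1 := by
  have h := (hasFDerivAt_cosetRep s t y.1).comp y
    (hasFDerivAt_fst (𝕜 := ℝ) (E := Fin n₁ → Fin 2 → ℝ) (F := Fin n₂ → Fin 2 → ℝ) (p := y))
  exact DFunLike.congr_fun h.fderiv X

theorem fderiv_cosetRep_snd (s t : Fin 2 ⊕ Fin n₂)
    (y X : (Fin n₁ → Fin 2 → ℝ) × (Fin n₂ → Fin 2 → ℝ)) :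
    fderiv ℝ (fun y : (Fin n₁ → Fin 2 → ℝ) × (Fin n₂ → Fin 2 → ℝ) => cosetRep y.2 s t) y X
      = fderiv ℝ (fun x => cosetRep x s t) y.2 X.2 := by
  have h := (hasFDerivAt_cosetRep s t y.2).comp y
    (hasFDerivAt_snd (𝕜 := ℝ) (E := Fin n₁ → Fin 2 → ℝ) (F := Fin n₂ → Fin 2 → ℝ) (p := y))
  exact DFunLike.congr_fun h.fderiv X

/-- Splitting the summation index as in `grIdx` displays the two factors; the block structure of L
then eliminates one of the two sums. -/
theorem mcForm_grSub (s t : (Fin 2 ⊕ Fin 2) ⊕ (Fin n₁ ⊕ Fin n₂))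
    (y X : (Fin n₁ → Fin 2 → ℝ) × (Fin n₂ → Fin 2 → ℝ)) :
    mcForm s t (grSub y) (grSubL X)
      = ∑ r, sgn s * sgn (grIdx (n₂ := n₂) (Sum.inl r)) * cosetRep (grSub y) s (grIdx (Sum.inl r))
          * fderiv ℝ (fun y => cosetRep (grSub y) (grIdx (Sum.inl r)) t) y X
        + ∑ r, sgn s * sgn (grIdx (n₁ := n₁) (Sum.inr r)) * cosetRep (grSub y) s (grIdx (Sum.inr r))
          * fderiv ℝ (fun y => cosetRep (grSub y) (grIdx (Sum.inr r)) t) y X := by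
  simp only [mcForm, sum_apply, smul_apply, smul_eq_mul, inv_cosetRep_apply, fderiv_cosetRep_grSub]
  rw [← grIdx.sum_comp, Fintype.sum_sum_type]

theorem mcForm_grSub_inl_inl (s t : Fin 2 ⊕ Fin n₁)
    (y X : (Fin n₁ → Fin 2 → ℝ) × (Fin n₂ → Fin 2 → ℝ)) :
    mcForm (grIdx (Sum.inl s)) (grIdx (Sum.inl t)) (grSub y) (grSubL X) = mcForm s t y.1 X.1 := by
  rw [mcForm_grSub]
  simp only [cosetRep_grSub_inl_inl, cosetRep_grSub_inl_inr, sgn_grIdx_inl, fderiv_cosetRep_fst,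
    mul_zero, zero_mul, Finset.sum_const_zero, add_zero]
  simp only [mcForm, sum_apply, smul_apply, smul_eq_mul, inv_cosetRep_apply]

theorem mcForm_grSub_inr_inr (s t : Fin 2 ⊕ Fin n₂)
    (y X : (Fin n₁ → Fin 2 → ℝ) × (Fin n₂ → Fin 2 → ℝ)) :
    mcForm (grIdx (Sum.inr s)) (grIdx (Sum.inr t)) (grSub y) (grSubL X) = mcForm s t y.2 X.2 := by
  rw [mcForm_grSub]
  simp only [cosetRep_grSub_inr_inr, cosetRep_grSub_inr_inl, sgn_grIdx_inr, fderiv_cosetRep_snd,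
    mul_zero, zero_mul, Finset.sum_const_zero, zero_add]
  simp only [mcForm, sum_apply, smul_apply, smul_eq_mul, inv_cosetRep_apply]

theorem mcForm_grSub_inl_inr (s : Fin 2 ⊕ Fin n₁) (t : Fin 2 ⊕ Fin n₂)
    (y X : (Fin n₁ → Fin 2 → ℝ) × (Fin n₂ → Fin 2 → ℝ)) :
    mcForm (grIdx (Sum.inl s)) (grIdx (Sum.inr t)) (grSub y) (grSubL X) = 0 := by
  rw [mcForm_grSub]
  simp [cosetRep_grSub_inl_inr]

theorem mcForm_grSub_inr_inl (s : Fin 2 ⊕ Fin n₂) (t : Fin 2 ⊕ Fin n₁)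
    (y X : (Fin n₁ → Fin 2 → ℝ) × (Fin n₂ → Fin 2 → ℝ)) :
    mcForm (grIdx (Sum.inr s)) (grIdx (Sum.inl t)) (grSub y) (grSubL X) = 0 := by
  rw [mcForm_grSub]
  simp [cosetRep_grSub_inr_inl]

theorem cForm_grSub_inl_inr (s : Fin 2 ⊕ Fin n₁) (t : Fin 2 ⊕ Fin n₂)
    (y X : (Fin n₁ → Fin 2 → ℝ) × (Fin n₂ → Fin 2 → ℝ)) :
    cForm (grIdx (Sum.inl s)) (grIdx (Sum.inr t)) (grSub y) (grSubL X) = 0 := by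
  rw [cForm_apply, mcForm_grSub_inl_inr, Complex.ofReal_zero]

theorem cForm_grSub_inr_inl (s : Fin 2 ⊕ Fin n₂) (t : Fin 2 ⊕ Fin n₁)
    (y X : (Fin n₁ → Fin 2 → ℝ) × (Fin n₂ → Fin 2 → ℝ)) :
    cForm (grIdx (Sum.inr s)) (grIdx (Sum.inl t)) (grSub y) (grSubL X) = 0 := by
  rw [cForm_apply, mcForm_grSub_inr_inl, Complex.ofReal_zero]

theorem grConn_grSub (a b : Fin 2) (y X : (Fin n₁ → Fin 2 → ℝ) × (Fin n₂ → Fin 2 → ℝ)) :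
    grConn (Sum.inl a) (Sum.inr b) (grSub y) (grSubL X) = 0 :=
  cForm_grSub_inl_inr (Sum.inl a) (Sum.inl b) y X

theorem grRot_grSub_inl_inr (i : Fin n₁) (j : Fin n₂)
    (y X : (Fin n₁ → Fin 2 → ℝ) × (Fin n₂ → Fin 2 → ℝ)) :
    grRot (Sum.inl i) (Sum.inr j) (grSub y) (grSubL X) = 0 :=
  cForm_grSub_inl_inr (Sum.inr i) (Sum.inr j) y X

theorem grRot_grSub_inr_inl (i : Fin n₂) (j : Fin n₁)
    (y X : (Fin n₁ → Fin 2 → ℝ) × (Fin n₂ → Fin 2 → ℝ)) :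
    grRot (Sum.inr i) (Sum.inl j) (grSub y) (grSubL X) = 0 :=
  cForm_grSub_inr_inl (Sum.inr i) (Sum.inr j) y X

theorem grViel_grSub_inl_inr (i : Fin n₁) (a : Fin 2)
    (y X : (Fin n₁ → Fin 2 → ℝ) × (Fin n₂ → Fin 2 → ℝ)) :
    grViel (Sum.inl i) (Sum.inr a) (grSub y) (grSubL X) = 0 :=
  cForm_grSub_inl_inr (Sum.inr i) (Sum.inl a) y X

theorem grViel_grSub_inr_inl (i : Fin n₂) (a : Fin 2)
    (y X : (Fin n₁ → Fin 2 → ℝ) × (Fin n₂ → Fin 2 → ℝ)) :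
    grViel (Sum.inr i) (Sum.inl a) (grSub y) (grSubL X) = 0 :=
  cForm_grSub_inr_inl (Sum.inr i) (Sum.inl a) y X

theorem grBeta_grSub (y X : (Fin n₁ → Fin 2 → ℝ) × (Fin n₂ → Fin 2 → ℝ)) :
    grBeta (grSub y) (grSubL X) = 0 := by
  simp [grBeta_apply, grConn_grSub]

/-- All forms required to vanish are mixed components of L⁻¹dL, and L⁻¹dL is block-diagonal along
the embedding. -/
theorem gr_isKahlerHodgeReduction : IsKahlerHodgeReduction Set.univ (grVielbein n₁ n₂) grOm
    (spConn grA grB) Set.univ (grSub (n₁ := n₁) (n₂ := n₂)) := by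
  have hemb : Topology.IsEmbedding (grSub (n₁ := n₁) (n₂ := n₂)) :=
    Function.LeftInverse.isEmbedding (f := fun q : GrSpace n₁ n₂ =>
      ((fun i a => q (Sum.inl i) (Sum.inl a), fun i a => q (Sum.inr i) (Sum.inr a)) :
        (Fin n₁ → Fin 2 → ℝ) × (Fin n₂ → Fin 2 → ℝ)))
      (fun _ => rfl) (by fun_prop) contDiff_grSub.continuous
  refine isKahlerHodgeReduction_of_pull_eq_zero gr_isTorsionFree isOpen_univ ?_
    contDiff_grSub.contDiffOn (Set.mapsTo_univ _ _) (hemb.comp Topology.IsEmbedding.subtypeVal)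
    ?_ ?_ ?_ ?_ ?_
  · rw [finrank_grSpace]
    simp [Module.finrank_pi_fintype]
    ring
  · intro y _
    rw [fderiv_grSub]
    exact hemb.injective
  · rintro y _ (i | i) <;> refine ContinuousLinearMap.ext fun X => ?_ <;>
      rw [pull_apply, fderiv_grSub, zero_apply]
    · rw [grTheta₂_inl, grZ₂_apply]
      simp [grViel_grSub_inl_inr]
    · rw [grTheta₂_inr, grZ₁_apply]
      simp [grViel_grSub_inr_inl]
  · refine fun y _ => ContinuousLinearMap.ext fun X => Complex.ofReal_injective ?_
    rw [pull_apply, fderiv_grSub, grOm_zero]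
    simp [grConn_grSub]
  · refine fun y _ => ContinuousLinearMap.ext fun X => Complex.ofReal_injective ?_
    rw [pull_apply, fderiv_grSub, grOm_one]
    simp [grConn_grSub]
  · intro y _ I J
    refine ContinuousLinearMap.ext fun X => ?_
    rw [pull_apply, fderiv_grSub, zero_apply]
    change grB I J (grSub y) (grSubL X) = 0
    rcases I with i | i <;> rcases J with j | j
    · rw [grB_inl_inl, grBeta_grSub, mul_zero]
    · rw [grB_inl_inr, grRot_grSub_inl_inr, neg_zero]
    · rw [grB_inr_inl, grRot_grSub_inr_inl]
    · rw [grB_inr_inr, grBeta_grSub, map_zero, mul_zero]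

theorem gr_inducedMetric_eq (y X Y : (Fin n₁ → Fin 2 → ℝ) × (Fin n₂ → Fin 2 → ℝ)) :
    inducedMetric (grVielbein n₁ n₂) grSub y X Y
      = cosetMetric (Fin 2) (Fin n₁) y.1 X.1 Y.1 + cosetMetric (Fin 2) (Fin n₂) y.2 X.2 Y.2 := by
  have h₁ : ∀ i a X, cosetForm (Sum.inl i) (Sum.inl a) (grSub y) (grSubL X)
      = cosetForm i a y.1 X.1 := fun i a X => mcForm_grSub_inl_inl (Sum.inr i) (Sum.inl a) y X
  have h₂ : ∀ i a X, cosetForm (Sum.inr i) (Sum.inr a) (grSub y) (grSubL X)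
      = cosetForm i a y.2 X.2 := fun i a X => mcForm_grSub_inr_inr (Sum.inr i) (Sum.inl a) y X
  have h₃ : ∀ i a X, cosetForm (Sum.inl i) (Sum.inr a) (grSub y) (grSubL X) = 0 :=
    fun i a X => mcForm_grSub_inl_inr (Sum.inr i) (Sum.inl a) y X
  have h₄ : ∀ i a X, cosetForm (Sum.inr i) (Sum.inl a) (grSub y) (grSubL X) = 0 :=
    fun i a X => mcForm_grSub_inr_inl (Sum.inr i) (Sum.inl a) y X
  rw [inducedMetric, fderiv_grSub, gr_metric_eq, cosetMetric, cosetMetric, cosetMetric,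
    Fintype.sum_sum_type, ← mul_add]
  simp only [Fintype.sum_sum_type (α₁ := Fin 2), h₁, h₂, h₃, h₄, mul_zero, Finset.sum_const_zero,
    add_zero, zero_add]

end GrassmannianSub

end CMap

end

/-! ### The two families assembled. -/

theorem mainTheorem3 :
    (∀ (n : ℕ) (M : Set (Fin n → ℂ)) (V : (Fin n → ℂ) → CMap.SympVec n)
      (P : (Fin n → ℂ) → Matrix (Fin n) (Fin n) ℂ),
      CMap.IsSpecialKahler M V → CMap.IsUnitaryFrame M V P →
      (∀ q ∈ CMap.cmapDomain M, ∀ X Y : CMap.CMapSpace n,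
        CMap.hypMetric (CMap.cmapVielbein V P) q X Y = CMap.cmapMetric V q X Y) ∧
      ∃ (om : Fin 3 → CMap.CMapSpace n → CMap.CMapSpace n →L[ℝ] ℝ)
        (Δ : Option (Fin n) ⊕ Option (Fin n) → Option (Fin n) ⊕ Option (Fin n) →
          CMap.CMapSpace n → CMap.CMapSpace n →L[ℝ] ℂ)
        (Ω : CMap.CMapSpace n → Option (Fin n) ⊕ Option (Fin n) →
          Option (Fin n) ⊕ Option (Fin n) → Option (Fin n) ⊕ Option (Fin n) →
          Option (Fin n) ⊕ Option (Fin n) → ℂ),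
        CMap.IsQuaternionic (CMap.cmapDomain M) (CMap.cmapVielbein V P) om Δ Ω ∧
        (∀ q ∈ CMap.cmapDomain M, ∀ I J K L : Option (Fin n),
          Ω q (Sum.inr I) (Sum.inr J) (Sum.inl K) (Sum.inr L) = 0) ∧
        (∀ ζ₀ : Fin (n + 1) ⊕ Fin (n + 1) → ℝ,
          CMap.IsKahlerHodgeReduction (CMap.cmapDomain M) (CMap.cmapVielbein V P) om Δ
            {y : (Fin n → ℂ) × ℝ × ℝ | y.1 ∈ M} (CMap.cmapSlice ζ₀))) ∧
    (∀ n₁ n₂ : ℕ,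
      (∀ x X Y : CMap.GrSpace n₁ n₂,
        CMap.hypMetric (CMap.grVielbein n₁ n₂) x X Y
          = CMap.cosetMetric (Fin 2 ⊕ Fin 2) (Fin n₁ ⊕ Fin n₂) x X Y) ∧
      ∃ (om : Fin 3 → CMap.GrSpace n₁ n₂ → CMap.GrSpace n₁ n₂ →L[ℝ] ℝ)
        (Δ : (Fin n₁ ⊕ Fin n₂) ⊕ (Fin n₁ ⊕ Fin n₂) → (Fin n₁ ⊕ Fin n₂) ⊕ (Fin n₁ ⊕ Fin n₂) →
          CMap.GrSpace n₁ n₂ → CMap.GrSpace n₁ n₂ →L[ℝ] ℂ)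
        (Ω : CMap.GrSpace n₁ n₂ → (Fin n₁ ⊕ Fin n₂) ⊕ (Fin n₁ ⊕ Fin n₂) →
          (Fin n₁ ⊕ Fin n₂) ⊕ (Fin n₁ ⊕ Fin n₂) → (Fin n₁ ⊕ Fin n₂) ⊕ (Fin n₁ ⊕ Fin n₂) →
          (Fin n₁ ⊕ Fin n₂) ⊕ (Fin n₁ ⊕ Fin n₂) → ℂ),
        CMap.IsQuaternionic Set.univ (CMap.grVielbein n₁ n₂) om Δ Ω ∧
        (∀ x, ∀ I J K L : Fin n₁ ⊕ Fin n₂,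
          Ω x (Sum.inr I) (Sum.inr J) (Sum.inl K) (Sum.inr L) = 0) ∧
        CMap.IsKahlerHodgeReduction Set.univ (CMap.grVielbein n₁ n₂) om Δ Set.univ
          (CMap.grSub (n₁ := n₁) (n₂ := n₂)) ∧
        (∀ y X Y : (Fin n₁ → Fin 2 → ℝ) × (Fin n₂ → Fin 2 → ℝ),
          CMap.inducedMetric (CMap.grVielbein n₁ n₂) CMap.grSub y X Y
            = CMap.cosetMetric (Fin 2) (Fin n₁) y.1 X.1 Y.1
              + CMap.cosetMetric (Fin 2) (Fin n₂) y.2 X.2 Y.2)) := by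
  refine ⟨fun n M V P hS hP => ⟨fun q hq X Y => CMap.cmap_metric_eq hS hP hq X Y, ?_⟩, ?_⟩
  · obtain ⟨Ω, hΩ⟩ := CMap.exists_isQuaternionic (CMap.cmap_isTorsionFree hS hP)
    exact ⟨_, _, Ω, hΩ, fun q hq I J K L => CMap.weylTensor_eq_zero hΩ hq
      (fun X Y hX hY I J => CMap.cmap_spCurv_eq_zero hS hP hq hX hY I J) I J K L,
      fun ζ₀ => CMap.cmap_isKahlerHodgeReduction hS hP ζ₀⟩
  · intro n₁ n₂
    obtain ⟨Ω, hΩ⟩ := CMap.exists_isQuaternionic (CMap.gr_isTorsionFree (n₁ := n₁) (n₂ := n₂))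
    exact ⟨CMap.gr_metric_eq, _, _, Ω, hΩ, fun x I J K L => CMap.weylTensor_eq_zero hΩ
      (Set.mem_univ x) (fun X Y hX hY I J => CMap.gr_spCurv_eq_zero hX hY I J) I J K L,
      CMap.gr_isKahlerHodgeReduction, CMap.gr_inducedMetric_eq⟩
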